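/- **Setting.** Let $q_0>0$, $\epsilon\in\mathbb R$, and let $q(x,t)$ be a complex-valued function on $\mathbb R^2$ (in the application, a solution of the inhomogeneous fifth-order nonlinear Schrödinger equation with non-zero boundary conditions). Fix a time $t$ and suppose that $q(\cdot,t)$ is continuous, that $q(x,t)\to q_\pm$ as $x\to\pm\infty$ with $|q_\pm|=q_0$, and that $(1+|x|)(q(x,t)-q_+)\in L^1(0,\infty)$ and $(1+|x|)(q(x,t)-q_-)\in L^1(-\infty,0)$. For $z\neq 0$ put $$k=\tfrac12\Big(z-\frac{q_0^2}{z}\Big),\quad \lambda=\tfrac12\Big(z+\frac{q_0^2}{z}\Big),\quad \gamma=1+\frac{q_0^2}{z^2},\quad \theta=\lambda\big[x+(16k^4\epsilon-8k^2q_0^2\epsilon+2k+6q_0^4\epsilon+1)t\big].$$ Let $D^\pm=\{z:\pm(|z|^2-q_0^2)\,\mathrm{Im}\,z>0\}$ and $\Sigma=\mathbb R\cup\{|z|=q_0\}$, oriented so that $D^+$ lies on its left: the rays $(-\infty,-q_0)$ and $(q_0,\infty)$ run from left to right, the segment $(-q_0,q_0)$ from right to left, and the two half circles from $-q_0$ to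 $q_0$. Let $\phi_\pm=(\phi_{\pm,1},\phi_{\pm,2})$ be the Jost solutions of $$\phi_x=\begin{pmatrix}-ik&q\\-q^*&ik\end{pmatrix}\phi,\qquad \phi_\pm e^{i\theta\sigma_3}\to E_\pm=\begin{pmatrix}1&-iq_\pm/z\\-iq_\pm^*/z&1\end{pmatrix}\quad(x\to\pm\infty),$$ and let $S=(s_{ij})$ be defined on $\Sigma\setminus\{0,\pm iq_0\}$ by $\phi_+=\phi_-S$. Then $s_{11}=\mathrm{Wr}(\phi_{+,1},\phi_{-,2})/\gamma$ and $s_{22}=\mathrm{Wr}(\phi_{-,1},\phi_{+,2})/\gamma$, and these formulas define $s_{11}$ in $D^-$ and $s_{22}$ in $D^+$. Put $\rho=s_{21}/s_{11}$. Assume that there are no spectral singularities: $s_{11}\ne0$ on $\Sigma\setminus\{0,\pm iq_0\}$, and $|s_{11}|$ is bounded below by a positive constant near each of $\pm iq_0$ in $D^-\cup\Sigma$. Let $z_1,\dots,z_N$ ($N\ge 0$) be the distinct zeros of $s_{11}$ in $\{\mathrm{Im}\,z<0,\ |z|>q_0\}\subset D^-$. **Claim.** There is a determination of $\log[1+\rho(\zeta)\rho^*(\zeta^*)]$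 that is continuous on $\Sigma\setminus\{0,\pm iq_0\}$ and real on the real axis. With any such determination the following holds. The integrals $$\int_\Sigma\frac{\log[1+\rho(\zeta)\rho^*(\zeta^*)]}{\zeta-z}\,d\zeta\quad(z\in D^+\cup D^-),\qquad \int_\Sigma\frac{\log[1+\rho(\zeta)\rho^*(\zeta^*)]}{\zeta}\,d\zeta$$ converge absolutely, and the second one is real. Set $m=1$ if all the $z_n$ are simple zeros ($s_{11}'(z_n)\ne0$), and $m=2$ if all of them are double zeros ($s_{11}'(z_n)=0\neq s_{11}''(z_n)$). In each of the two cases $$s_{11}(z)=\exp\Big(\frac1{2\pi i}\int_\Sigma\frac{\log[1+\rho(\zeta)\rho^*(\zeta^*)]}{\zeta-z}d\zeta\Big)\prod_{n=1}^N\left(\frac{(z-z_n)(z+q_0^2/z_n^*)}{(z-z_n^*)(z+q_0^2/z_n)}\right)^{m},\quad z\in D^-,$$ $$s_{22}(z)=\exp\Big(-\frac1{2\pi i}\int_\Sigma\frac{\log[1+\rho(\zeta)\rho^*(\zeta^*)]}{\zeta-z}d\zeta\Big)\prod_{n=1}^N\left(\frac{(z-z_n^*)(z+q_0^2/z_n)}{(z-z_n)(z+q_0^2/z_n^*)}\right)^{m},\quad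 z\in D^+,$$ and $$\arg\frac{q_-}{q_+}\equiv-\frac1{2\pi}\int_\Sigma\frac{\log[1+\rho(\zeta)\rho^*(\zeta^*)]}{\zeta}\,d\zeta+4m\sum_{n=1}^N\arg z_n\pmod{2\pi}.$$ -/

import Mathlib

open scoped ComplexConjugate Topology
open Filter MeasureTheory

noncomputable section

namespace IfoNLS

/-! ### Uniformization variable -/

/-- `k(z) = (z - q₀²/z)/2`. -/
def kOf (q0 : ℝ) (z : ℂ) : ℂ := (z - (q0 : ℂ) ^ 2 / z) / 2

/-- `λ(z) = (z + q₀²/z)/2`. -/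
def lamOf (q0 : ℝ) (z : ℂ) : ℂ := (z + (q0 : ℂ) ^ 2 / z) / 2

/-- `θ(x,t;z) = λ [x + (16 k⁴ ε - 8 k² q₀² ε + 2 k + 6 q₀⁴ ε + 1) t]`. -/
def theta (ε q0 x t : ℝ) (z : ℂ) : ℂ :=
  lamOf q0 z * (x + (16 * kOf q0 z ^ 4 * ε - 8 * kOf q0 z ^ 2 * (q0 : ℂ) ^ 2 * ε
    + 2 * kOf q0 z + 6 * (q0 : ℂ) ^ 4 * ε + 1) * t)

/-- `γ(z) = det E_±(z) = 1 + q₀²/z²`. -/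
def gam (q0 : ℝ) (z : ℂ) : ℂ := 1 + (q0 : ℂ) ^ 2 / z ^ 2

/-- `D⁺ = {z : (|z|² - q₀²) Im z > 0}`. -/
def DPlus (q0 : ℝ) : Set ℂ := {z | 0 < (‖z‖ ^ 2 - q0 ^ 2) * z.im}

/-- `D⁻ = {z : (|z|² - q₀²) Im z < 0}`. -/
def DMinus (q0 : ℝ) : Set ℂ := {z | (‖z‖ ^ 2 - q0 ^ 2) * z.im < 0}

/-- The continuous spectrum `Σ = ℝ ∪ C₀`, with `C₀` the circle of radius `q₀`. -/
def SigmaSet (q0 : ℝ) : Set ℂ := {z | z.im = 0 ∨ ‖z‖ = q0}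

/-- `Σ` without the origin and without the branch points `± i q₀`. -/
def SigmaReg (q0 : ℝ) : Set ℂ :=
  SigmaSet q0 \ {0, Complex.I * (q0 : ℂ), -(Complex.I * (q0 : ℂ))}

/-! ### Jost functions and scattering coefficients -/

/-- The matrix `U = -i k σ₃ + U₀` of the scattering problem `φ_x = U φ`. -/
def laxU (k v : ℂ) : Matrix (Fin 2) (Fin 2) ℂ :=
  !![-(Complex.I * k), v; -conj v, Complex.I * k]

/-- `E_±(z) = 𝕀 - (i/z) σ₃ Q_±`, where `qa` is `q_±`. -/
def eigE (qa z : ℂ) : Matrix (Fin 2) (Fin 2) ℂ :=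
  !![1, -(Complex.I * qa / z); -(Complex.I * conj qa / z), 1]

/-- The diagonal entries `1, -1` of `σ₃`. -/
def sgn3 (j : Fin 2) : ℂ := if j = 0 then 1 else -1

/-- `φ` is the `j`-th column of a Jost solution at time `t`: it solves `φ_x = U φ`, and the
modified column `φ e^{± i θ}` tends to the `j`-th column of `E_±` as `x → ± ∞`.
The end is given by the filter `l` (`atTop` or `atBot`) and the boundary value `qa`. -/
def IsJostColumn (ε q0 : ℝ) (q : ℝ → ℝ → ℂ) (t : ℝ) (l : Filter ℝ) (qa z : ℂ) (j : Fin 2)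
    (φ : ℝ → Fin 2 → ℂ) : Prop :=
  (∀ x, HasDerivAt φ ((laxU (kOf q0 z) (q x t)).mulVec (φ x)) x) ∧
  Tendsto (fun x => Complex.exp (sgn3 j * Complex.I * theta ε q0 x t z) • φ x) l
    (𝓝 (fun i => eigE qa z i j))

open Classical in
/-- The Jost column: the solution characterized by `IsJostColumn`, whenever there is one. -/
def jost (ε q0 : ℝ) (q : ℝ → ℝ → ℂ) (t : ℝ) (l : Filter ℝ) (qa z : ℂ) (j : Fin 2) :
    ℝ → Fin 2 → ℂ :=
  if h : ∃ φ, IsJostColumn ε q0 q t l qa z j φ then h.choose else 0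

/-- The Wronskian determinant `Wr(u,v) = u₁ v₂ - u₂ v₁`. -/
def wr (u v : Fin 2 → ℂ) : ℂ := u 0 * v 1 - u 1 * v 0

/-- `s₁₁ γ = Wr(φ_{+,1}, φ_{-,2})`. The Wronskian of two solutions does not depend on `x`;
it is taken at `x = 0`. -/
def s11 (ε q0 : ℝ) (q : ℝ → ℝ → ℂ) (qp qm : ℂ) (t : ℝ) (z : ℂ) : ℂ :=
  wr (jost ε q0 q t atTop qp z 0 0) (jost ε q0 q t atBot qm z 1 0) / gam q0 z

/-- `s₂₂ γ = Wr(φ_{-,1}, φ_{+,2})`. -/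
def s22 (ε q0 : ℝ) (q : ℝ → ℝ → ℂ) (qp qm : ℂ) (t : ℝ) (z : ℂ) : ℂ :=
  wr (jost ε q0 q t atBot qm z 0 0) (jost ε q0 q t atTop qp z 1 0) / gam q0 z

/-- `s₁₂ γ = Wr(φ_{+,2}, φ_{-,2})`. -/
def s12 (ε q0 : ℝ) (q : ℝ → ℝ → ℂ) (qp qm : ℂ) (t : ℝ) (z : ℂ) : ℂ :=
  wr (jost ε q0 q t atTop qp z 1 0) (jost ε q0 q t atBot qm z 1 0) / gam q0 z

/-- `s₂₁ γ = Wr(φ_{-,1}, φ_{+,1})`. -/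
def s21 (ε q0 : ℝ) (q : ℝ → ℝ → ℂ) (qp qm : ℂ) (t : ℝ) (z : ℂ) : ℂ :=
  wr (jost ε q0 q t atBot qm z 0 0) (jost ε q0 q t atTop qp z 0 0) / gam q0 z

/-- The four coefficients are the entries of the scattering matrix: as soon as
`det φ_- = γ ≠ 0`, one has `φ_+ = φ_- S`. -/
theorem jost_plus_eq (ε q0 : ℝ) (q : ℝ → ℝ → ℂ) (qp qm : ℂ) (t : ℝ) (z : ℂ)
    (hγ : gam q0 z ≠ 0)
    (hdet : wr (jost ε q0 q t atBot qm z 0 0) (jost ε q0 q t atBot qm z 1 0) = gam q0 z) :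
    jost ε q0 q t atTop qp z 0 0 =
        s11 ε q0 q qp qm t z • jost ε q0 q t atBot qm z 0 0
          + s21 ε q0 q qp qm t z • jost ε q0 q t atBot qm z 1 0 ∧
      jost ε q0 q t atTop qp z 1 0 =
        s12 ε q0 q qp qm t z • jost ε q0 q t atBot qm z 0 0
          + s22 ε q0 q qp qm t z • jost ε q0 q t atBot qm z 1 0 := by
  constructor <;> funext i <;> fin_cases i <;>
    simp only [s11, s12, s21, s22, wr, Pi.add_apply, Pi.smul_apply, smul_eq_mul,
      Fin.zero_eta, Fin.mk_one] <;>
    unfold wr at hdet <;> field_simp <;> rw [← hdet] <;> ring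

/-- The reflection coefficient `ρ = s₂₁ / s₁₁`. -/
def rho (ε q0 : ℝ) (q : ℝ → ℝ → ℂ) (qp qm : ℂ) (t : ℝ) (z : ℂ) : ℂ :=
  s21 ε q0 q qp qm t z / s11 ε q0 q qp qm t z

/-- `1 + ρ(ζ) ρ*(ζ*)`. -/
def onePlusRho (ε q0 : ℝ) (q : ℝ → ℝ → ℂ) (qp qm : ℂ) (t : ℝ) (ζ : ℂ) : ℂ :=
  1 + rho ε q0 q qp qm t ζ * conj (rho ε q0 q qp qm t (conj ζ))

/-- `L` is the determination of `log r` on `Σ`: continuous off `0, ± i q₀`, real on the real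
axis. (On the circle `r` is complex valued and can cross the negative half-line.) -/
def IsLogOnSigma (q0 : ℝ) (r L : ℂ → ℂ) : Prop :=
  ContinuousOn L (SigmaReg q0) ∧ (∀ ζ ∈ SigmaReg q0, Complex.exp (L ζ) = r ζ) ∧
    ∀ ζ ∈ SigmaReg q0, ζ.im = 0 → (L ζ).im = 0

/-! ### Contour integrals over `Σ` -/

/-- The point `q₀ e^{i s}` of the circle. -/
def circPt (q0 s : ℝ) : ℂ := (q0 : ℂ) * Complex.exp (Complex.I * (s : ℂ))

/-- `∫_Σ f(ζ) dζ`, with `Σ` oriented so that `D⁺` lies on its left: the rays `(-∞,-q₀)` and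
`(q₀,∞)` from left to right, the segment `(-q₀,q₀)` from right to left, and both half circles
from `-q₀` to `q₀`. On the circle `dζ = i ζ ds`. -/
def sigmaIntegral (q0 : ℝ) (f : ℂ → ℂ) : ℂ :=
  (∫ x in Set.Iio (-q0), f (x : ℂ)) + (∫ x in Set.Ioi q0, f (x : ℂ))
    - (∫ x in Set.Ioo (-q0) q0, f (x : ℂ))
    - (∫ s in Set.Ioo 0 Real.pi, f (circPt q0 s) * (Complex.I * circPt q0 s))
    + (∫ s in Set.Ioo (-Real.pi) 0, f (circPt q0 s) * (Complex.I * circPt q0 s))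

/-- `f` is (absolutely) integrable along `Σ`. -/
def SigmaIntegrable (q0 : ℝ) (f : ℂ → ℂ) : Prop :=
  Integrable (fun x : ℝ => f (x : ℂ)) ∧
    IntegrableOn (fun s : ℝ => f (circPt q0 s)) (Set.Ioo (-Real.pi) Real.pi)

/-- The product `∏ (z - z_n)(z + q₀²/z_n*) / ((z - z_n*)(z + q₀²/z_n))`. -/
def blaschke (q0 : ℝ) {N : ℕ} (zn : Fin N → ℂ) (z : ℂ) : ℂ :=
  ∏ n, ((z - zn n) * (z + (q0 : ℂ) ^ 2 / conj (zn n))) /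
    ((z - conj (zn n)) * (z + (q0 : ℂ) ^ 2 / zn n))

end IfoNLS

end

/-!
The theorem is a trace formula. On the closure of `D⁻` the coefficient `s₁₁` is the product of a
Blaschke product, built from its zeros, and of `exp Ψ`; on `Σ` the Blaschke product drops out of
`1 + ρ ρ* = 1 / (s₁₁(ζ) s₁₁(ζ*)*)`, so that `L(ζ) = -Ψ(ζ) - Ψ(ζ*)*` is the determination of its
logarithm, and the Cauchy integral of `L` over `Σ` returns `2πi Ψ` in `D⁻`.

*The scattering coefficient.* The modified Jost columns solve Volterra equations, and the first
moment of `q - q_±` bounds the kernel uniformly on `{|z| ≥ q₀, Im z ≤ 0}` up to the branch point and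
to infinity (`norm_volK_apply_le`). The Neumann series gives existence, continuity, holomorphy and
the limit `1` of `s₁₁` at infinity. Along the negative imaginary axis `s₁₁ - 1 = O(1/Y)`. The
symmetries `z ↦ z*` and `z ↦ -q₀²/z*` of the spectral problem follow from the uniqueness of the Jost
columns; they give `s₂₂(z*) = s₁₁(z)*`, the relation `s₁₁(-q₀²/z*) = (q_- / q_+) s₁₁(z)*`
(`Potential.s11_hatConj`) between the two components of `D⁻`, the formula for `1 + ρ ρ*`, and
`|s₁₁| ≤ 1` on the real axis.

*The logarithm.* After the zeros have been split off (`OuterFn.exists_factorization`), the lower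
component of `D⁻` is mapped to the half-strip `Re w > 0`, `-π < Im w < 0` by `z = q₀ e^w`, where the
remaining factor has a logarithm `f` (`StripLog`). The upper component is covered by the symmetry
`z ↦ -q₀²/z*` (`glueLog`), and the additive constant `iκ` that makes the two pieces of `Ψ` agree at
`± q₀` satisfies `e^{iκ} = (q_- / q_+) ∏ (z_n*/z_n)^{2m}`: this is the theta condition.

*Convergence of the integrals.* Two estimates are not immediate, since nothing but the first moment
of the potential is at hand. Near the branch point only a bound of `Re f` by a small power of the
distance is known; as `∫ f² = 0` over a contour in the strip, it bounds the square integrals of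
`Im f` as well (`StripLog.sqBounded`), and the contour can be pushed to the boundary. On the real
axis `-Re f ≥ 0`, and its integral against the Poisson kernel at the point `-i q₀ e^S` is
`O(e^{-S})`, because `f` has this decay at that point; so `Re f` is integrable on the two rays
(`StripLog.integrableOn_re`).

*The Cauchy integrals.* In the coordinates `ζ = q₀ e^{±w}` the set `Σ` consists of two copies of the
boundary of the half-strip, and the integrals of `Ψ(ζ)/(ζ - z)` follow from the residue theorem
(`StripLog.sigT_cauchy`): they are `-2πi Ψ(z)` in `D⁻`, zero in `D⁺`, and `πκ` at `z = 0`. The other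
half of `L` is obtained by complex conjugation (`sigT_conj`).
-/


/-! ### Integrals over half-lines and integrals depending on a parameter -/

namespace IfoNLS

theorem integrableOn_Ioi_of_continuous {E : Type*} [NormedAddCommGroup E] {f : ℝ → E} {c : ℝ}
    (hf : Continuous f) (hi : IntegrableOn f (Set.Ioi c)) (x : ℝ) :
    IntegrableOn f (Set.Ioi x) := by
  have h1 : IntegrableOn f (Set.Icc x c) := hf.continuousOn.integrableOn_Icc
  refine (h1.union hi).mono_set ?_
  intro y hy
  by_cases h : y ≤ c
  · exact Or.inl ⟨le_of_lt hy, h⟩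
  · exact Or.inr (lt_of_not_ge h)

theorem hasDerivAt_integral_Ioi {E : Type*} [NormedAddCommGroup E] [NormedSpace ℝ E]
    [CompleteSpace E] {f : ℝ → E} {c : ℝ} (hf : Continuous f)
    (hi : IntegrableOn f (Set.Ioi c)) (x : ℝ) :
    HasDerivAt (fun x => ∫ y in Set.Ioi x, f y) (-f x) x := by
  have h : (fun x => ∫ y in Set.Ioi x, f y)
      = fun x => (∫ y in Set.Ioi c, f y) - ∫ y in c..x, f y := by
    funext x
    rw [← intervalIntegral.integral_interval_add_Ioi hi (integrableOn_Ioi_of_continuous hf hi x)]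
    abel
  rw [h]
  exact (intervalIntegral.integral_hasDerivAt_right (hf.intervalIntegrable _ _)
    (hf.stronglyMeasurableAtFilter _ _) hf.continuousAt).const_sub _

/-- A dominated integral of functions holomorphic in a parameter is holomorphic: Cauchy's estimate
dominates the derivatives. -/
theorem differentiableOn_integral_of_dominated {E : Type*} [NormedAddCommGroup E]
    [NormedSpace ℂ E] [CompleteSpace E] {μ : Measure ℝ} {U : Set ℂ} (hU : IsOpen U)
    {f : ℂ → ℝ → E} {g : ℝ → ℝ} (hg : Integrable g μ)
    (hm : ∀ z ∈ U, AEStronglyMeasurable (f z) μ)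
    (hb : ∀ᵐ y ∂μ, ∀ z ∈ U, ‖f z y‖ ≤ g y)
    (hd : ∀ᵐ y ∂μ, DifferentiableOn ℂ (fun z => f z y) U) :
    DifferentiableOn ℂ (fun z => ∫ y, f z y ∂μ) U := by
  intro z₀ hz₀
  obtain ⟨r, hr, hball⟩ := Metric.isOpen_iff.1 hU z₀ hz₀
  have hda : ∀ᵐ y ∂μ, ∀ z ∈ U, HasDerivAt (fun z => f z y) (deriv (fun z => f z y) z) z := by
    filter_upwards [hd] with y hy z hz
    exact ((hy z hz).differentiableAt (hU.mem_nhds hz)).hasDerivAt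
  -- the derivative is an a.e. limit of difference quotients, hence measurable
  have hF' : AEStronglyMeasurable (fun y => deriv (fun z => f z y) z₀) μ := by
    have hs : Tendsto (fun n : ℕ => ((r / 2 / (n + 1) : ℝ) : ℂ)) atTop (𝓝[≠] 0) := by
      refine tendsto_nhdsWithin_iff.2 ⟨?_, Eventually.of_forall fun n => ?_⟩
      · rw [show (0 : ℂ) = ((0 : ℝ) : ℂ) by simp]
        refine (Complex.continuous_ofReal.tendsto _).comp ?_
        have := (tendsto_one_div_add_atTop_nhds_zero_nat (𝕜 := ℝ)).const_mul (r / 2)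
        simpa [div_eq_mul_inv] using this
      · have : (r / 2 / (n + 1) : ℝ) ≠ 0 := by positivity
        exact Complex.ofReal_ne_zero.2 this
    refine aestronglyMeasurable_of_tendsto_ae atTop
      (f := fun n : ℕ => fun y => (((r / 2 / (n + 1) : ℝ) : ℂ))⁻¹ •
        (f (z₀ + ((r / 2 / (n + 1) : ℝ) : ℂ)) y - f z₀ y)) ?_ ?_
    · intro n
      refine ((hm _ (hball ?_)).sub (hm _ hz₀)).const_smul _
      have h1 : (r / 2 / (n + 1) : ℝ) ≤ r / 2 := by
        apply div_le_self (by positivity); have := n.cast_nonneg (α := ℝ); linarith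
      rw [Metric.mem_ball, dist_eq_norm, add_sub_cancel_left, Complex.norm_real, Real.norm_eq_abs,
        abs_of_nonneg (by positivity)]
      linarith
    · filter_upwards [hda] with y hy
      exact (hasDerivAt_iff_tendsto_slope_zero.1 (hy z₀ hz₀)).comp hs
  have key := hasDerivAt_integral_of_dominated_loc_of_deriv_le (μ := μ)
    (F := f) (F' := fun z y => deriv (fun z => f z y) z) (x₀ := z₀)
    (bound := fun y => g y / (r / 2)) (Metric.ball_mem_nhds z₀ (half_pos hr))
    (Filter.eventually_of_mem (hU.mem_nhds hz₀) fun z hz => hm z hz)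
    (hg.mono' (hm z₀ hz₀) (hb.mono fun y hy => hy z₀ hz₀)) hF' ?_ (hg.div_const _) ?_
  · exact key.2.differentiableAt.differentiableWithinAt
  · filter_upwards [hb, hd] with y hy hdy z hz
    have hsub : Metric.closedBall z (r / 2) ⊆ U := by
      intro w hw
      refine hball ?_
      have := dist_triangle w z z₀
      rw [Metric.mem_ball] at hz ⊢
      rw [Metric.mem_closedBall] at hw
      linarith
    refine Complex.norm_deriv_le_of_forall_mem_sphere_norm_le (half_pos hr) ?_ ?_
    · exact (hdy.mono hsub).diffContOnCl_ball subset_rfl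
    · exact fun w hw => hy w (hsub (Metric.sphere_subset_closedBall hw))
  · filter_upwards [hda] with y hy z hz
    refine hy z (hball ?_)
    exact Metric.ball_subset_ball (by linarith) hz

theorem norm_exp_sub_one_le_of_re_nonpos {w : ℂ} (hw : w.re ≤ 0) : ‖Complex.exp w - 1‖ ≤ ‖w‖ := by
  have hconv : Convex ℝ {w : ℂ | w.re ≤ 0} := convex_halfSpace_re_le 0
  have := hconv.norm_image_sub_le_of_norm_hasDerivWithin_le (f := Complex.exp) (f' := Complex.exp)
    (C := 1) (x := 0) (y := w) (fun x _ => (Complex.hasDerivAt_exp x).hasDerivWithinAt)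
    (fun x hx => by
      rw [Complex.norm_exp]
      exact Real.exp_le_one_iff.2 hx) (by simp) hw
  simpa using this

theorem norm_exp_two_I_mul_le {l : ℂ} (hl : l.im ≤ 0) {s : ℝ} (hs : s ≤ 0) :
    ‖Complex.exp (2 * Complex.I * l * s)‖ ≤ 1 := by
  rw [Complex.norm_exp]
  refine Real.exp_le_one_iff.2 ?_
  have : (2 * Complex.I * l * s).re = - (2 * l.im * s) := by simp
  rw [this]
  nlinarith

/-- The Riemann-Lebesgue lemma for the oscillatory kernel `exp (2 i l (x - y))` on `(x, ∞)`,
uniformly for frequencies `l` in the closed lower half-plane. -/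
theorem riemannLebesgue_Ioi {f : ℝ → ℂ} {x : ℝ} (hf : IntegrableOn f (Set.Ioi x)) :
    Tendsto (fun l : ℂ => ∫ y in Set.Ioi x, Complex.exp (2 * Complex.I * l * ((x - y : ℝ) : ℂ)) * f y)
      (Bornology.cobounded ℂ ⊓ 𝓟 {l | l.im ≤ 0}) (𝓝 0) := by
  have hmeas : ∀ l : ℂ, Continuous fun y : ℝ => Complex.exp (2 * Complex.I * l * ((x - y : ℝ) : ℂ)) :=
    fun l => by fun_prop
  rw [Metric.tendsto_nhds]
  intro ε hε
  obtain ⟨g, hgc, hgd, hge⟩ := (memLp_one_iff_integrable.2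
    ((integrable_indicator_iff measurableSet_Ioi).2 hf)).exist_eLpNorm_sub_le
      (by simp) le_rfl (half_pos (half_pos hε))
  have hgint : Integrable g := hgd.continuous.integrable_of_hasCompactSupport hgc
  have hg' : Continuous (deriv g) := hgd.continuous_deriv (by simp)
  have hg'int : Integrable (deriv g) :=
    hg'.integrable_of_hasCompactSupport hgc.deriv
  have hdiff : ∫ y in Set.Ioi x, ‖f y - g y‖ ≤ ε / 4 := by
    have h1 : eLpNorm ((Set.Ioi x).indicator f - g) 1 volume
        = ENNReal.ofReal (∫ y, ‖((Set.Ioi x).indicator f - g) y‖) := by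
      rw [eLpNorm_one_eq_lintegral_enorm, ofReal_integral_norm_eq_lintegral_enorm]
      exact ((integrable_indicator_iff measurableSet_Ioi).2 hf).sub hgint
    rw [h1, ENNReal.ofReal_le_ofReal_iff (by positivity)] at hge
    refine le_trans ?_ (hge.trans (by linarith))
    have h2 : ∫ y in Set.Ioi x, ‖f y - g y‖
        = ∫ y in Set.Ioi x, ‖((Set.Ioi x).indicator f - g) y‖ := by
      refine setIntegral_congr_fun measurableSet_Ioi fun y hy => ?_
      simp [Set.indicator_of_mem hy]
    rw [h2]
    exact setIntegral_le_integral
      (((integrable_indicator_iff measurableSet_Ioi).2 hf).sub hgint).norm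
      (Eventually.of_forall fun y => norm_nonneg _)
  set M : ℝ := ‖g x‖ + ∫ y in Set.Ioi x, ‖deriv g y‖ with hM
  have hM0 : 0 ≤ M := add_nonneg (norm_nonneg _) (integral_nonneg fun y => norm_nonneg _)
  have hcob : ∀ᶠ l : ℂ in Bornology.cobounded ℂ, 2 * (M + 1) / ε + 1 ≤ ‖l‖ :=
    tendsto_norm_cobounded_atTop.eventually_ge_atTop _
  filter_upwards [hcob.filter_mono inf_le_left,
    (mem_inf_of_right (mem_principal_self _) :
      {l : ℂ | l.im ≤ 0} ∈ Bornology.cobounded ℂ ⊓ 𝓟 {l | l.im ≤ 0})] with l hl1 hl2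
  have hl0 : 0 < ‖l‖ := lt_of_lt_of_le (by positivity) hl1
  have hlne : l ≠ 0 := norm_pos_iff.1 hl0
  set E : ℝ → ℂ := fun y => Complex.exp (2 * Complex.I * l * ((x - y : ℝ) : ℂ)) with hE
  have hEb : ∀ y ∈ Set.Ioi x, ‖E y‖ ≤ 1 := fun y hy =>
    norm_exp_two_I_mul_le hl2 (by have := Set.mem_Ioi.1 hy; linarith)
  have bint : ∀ {u : ℝ → ℂ}, IntegrableOn u (Set.Ioi x) →
      IntegrableOn (fun y => E y * u y) (Set.Ioi x) := by
    intro u hu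
    refine hu.norm.mono' ((hmeas l).aestronglyMeasurable.mul hu.aestronglyMeasurable) ?_
    filter_upwards [ae_restrict_mem measurableSet_Ioi] with y hy
    rw [norm_mul]
    exact mul_le_of_le_one_left (norm_nonneg _) (hEb y hy)
  have bnorm : ∀ {u : ℝ → ℂ}, IntegrableOn u (Set.Ioi x) →
      ‖∫ y in Set.Ioi x, E y * u y‖ ≤ ∫ y in Set.Ioi x, ‖u y‖ := by
    intro u hu
    refine (norm_integral_le_integral_norm _).trans ?_
    refine setIntegral_mono_on (bint hu).norm hu.norm measurableSet_Ioi fun y hy => ?_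
    rw [norm_mul]
    exact mul_le_of_le_one_left (norm_nonneg _) (hEb y hy)
  have hsplit : ∫ y in Set.Ioi x, E y * f y
      = (∫ y in Set.Ioi x, E y * (f y - g y)) + ∫ y in Set.Ioi x, E y * g y := by
    have hfg : IntegrableOn (fun y => f y - g y) (Set.Ioi x) := hf.sub hgint.integrableOn
    rw [← integral_add (bint hfg) (bint hgint.integrableOn)]
    congr 1; funext y; ring
  have hEd : ∀ y, HasDerivAt E (-(2 * Complex.I * l) * E y) y := by
    intro y
    have h1 : HasDerivAt (fun y : ℝ => 2 * Complex.I * l * ((x - y : ℝ) : ℂ))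
        (2 * Complex.I * l * ((-1 : ℝ) : ℂ)) y :=
      (((hasDerivAt_id y).const_sub x).ofReal_comp).const_mul _
    convert h1.cexp using 1
    simp only [hE]; push_cast; ring
  -- integration by parts
  have hparts : (2 * Complex.I * l) * ∫ y in Set.Ioi x, E y * g y
      = g x + ∫ y in Set.Ioi x, E y * deriv g y := by
    have hF : ∀ y ∈ Set.Ici x, HasDerivAt (fun y => E y * g y)
        (-(2 * Complex.I * l) * (E y * g y) + E y * deriv g y) y := by
      intro y _
      refine ((hEd y).fun_mul ((hgd.differentiable (by simp)) y).hasDerivAt).congr_deriv ?_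
      ring
    have hlim : Tendsto (fun y => E y * g y) atTop (𝓝 0) := by
      refine tendsto_nhds_of_eventually_eq ?_
      obtain ⟨R, hR⟩ := hgc.isCompact.isBounded.subset_closedBall 0
      filter_upwards [eventually_gt_atTop R] with y hy
      have : y ∉ tsupport g := fun h => by
        have h3 := hR h
        rw [Metric.mem_closedBall, dist_zero_right, Real.norm_eq_abs] at h3
        exact absurd (le_abs_self y) (by linarith)
      rw [image_eq_zero_of_notMem_tsupport this, mul_zero]
    have h3 := integral_Ioi_of_hasDerivAt_of_tendsto' hF
      (((bint hgint.integrableOn).const_mul _).add (bint hg'int.integrableOn)) hlim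
    rw [integral_add ((bint hgint.integrableOn).const_mul _) (bint hg'int.integrableOn),
      integral_const_mul] at h3
    have hEx : E x = 1 := by simp [hE]
    rw [hEx] at h3
    linear_combination -h3
  have hgl : ‖∫ y in Set.Ioi x, E y * g y‖ ≤ ε / 4 := by
    have h4 : 2 * ‖l‖ * ‖∫ y in Set.Ioi x, E y * g y‖ ≤ M := by
      have := congrArg norm hparts
      rw [norm_mul, norm_mul, norm_mul, Complex.norm_I, mul_one] at this
      simp only [Complex.norm_ofNat] at this
      rw [this]
      exact (norm_add_le _ _).trans (add_le_add le_rfl (bnorm hg'int.integrableOn))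
    have h5 : 2 * (M + 1) / ε ≤ ‖l‖ := by linarith
    rw [div_le_iff₀ hε] at h5
    by_contra hcon
    push Not at hcon
    nlinarith [norm_nonneg (∫ y in Set.Ioi x, E y * g y)]
  rw [dist_zero_right, hsplit]
  calc _ ≤ _ := norm_add_le _ _
    _ ≤ ε / 4 + ε / 4 := add_le_add ((bnorm (hf.sub hgint.integrableOn)).trans hdiff) hgl
    _ < ε := by linarith

end IfoNLS

/-! ### The Volterra equation of the modified Jost column -/

namespace IfoNLS

/-- The closed region `|z| ≥ q₀`, `Im z ≤ 0` without the branch point `-i q₀`. -/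
def outerLower (q0 : ℝ) : Set ℂ := {z | q0 ≤ ‖z‖ ∧ z.im ≤ 0 ∧ z ≠ -(Complex.I * (q0 : ℂ))}

/-- The interior `|z| > q₀`, `Im z < 0` of `outerLower`: the unbounded component of `D⁻`. -/
def outerLowerInt (q0 : ℝ) : Set ℂ := {z | q0 < ‖z‖ ∧ z.im < 0}

theorem isOpen_outerLowerInt (q0 : ℝ) : IsOpen (outerLowerInt q0) :=
  (isOpen_lt continuous_const continuous_norm).inter
    (isOpen_lt Complex.continuous_im continuous_const)

theorem outerLowerInt_subset {q0 : ℝ} (hq0 : 0 < q0) : outerLowerInt q0 ⊆ outerLower q0 := by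
  rintro z ⟨h1, h2⟩
  refine ⟨h1.le, h2.le, ?_⟩
  rintro rfl
  simp [abs_of_pos hq0] at h1

theorem ne_zero_of_le_norm {q0 : ℝ} (hq0 : 0 < q0) {z : ℂ} (hz : q0 ≤ ‖z‖) : z ≠ 0 := by
  rintro rfl
  simp at hz
  linarith

theorem lamOf_im (q0 : ℝ) (z : ℂ) :
    (lamOf q0 z).im = z.im * (1 - q0 ^ 2 / ‖z‖ ^ 2) / 2 := by
  have h : ((q0 : ℂ) ^ 2 / z).im = -(q0 ^ 2 * z.im / ‖z‖ ^ 2) := by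
    rw [← Complex.normSq_eq_norm_sq, Complex.div_im, ← Complex.ofReal_pow, Complex.ofReal_im,
      Complex.ofReal_re]
    ring
  have h2 : (lamOf q0 z).im = (z.im + ((q0 : ℂ) ^ 2 / z).im) / 2 := by
    unfold lamOf
    rw [show (2 : ℂ) = ((2 : ℝ) : ℂ) by simp, Complex.div_ofReal_im, Complex.add_im]
  rw [h2, h]
  ring

theorem lamOf_im_nonpos {q0 : ℝ} (hq0 : 0 < q0) {z : ℂ} (hz : q0 ≤ ‖z‖) (hi : z.im ≤ 0) :
    (lamOf q0 z).im ≤ 0 := by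
  rw [lamOf_im]
  have h1 : q0 ^ 2 / ‖z‖ ^ 2 ≤ 1 := by
    rw [div_le_one (by have := hq0.trans_le hz; positivity)]
    exact pow_le_pow_left₀ hq0.le hz 2
  nlinarith

theorem lamOf_ne_zero {q0 : ℝ} {z : ℂ} (hz : z ≠ 0) (h1 : z ≠ Complex.I * q0)
    (h2 : z ≠ -(Complex.I * q0)) : lamOf q0 z ≠ 0 := by
  unfold lamOf
  intro h
  have h3 : (z - Complex.I * q0) * (z + Complex.I * q0) = 0 := by
    field_simp at h
    linear_combination h - (q0 : ℂ) ^ 2 * Complex.I_sq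
  rcases mul_eq_zero.1 h3 with h4 | h4
  · exact h1 (sub_eq_zero.1 h4)
  · exact h2 (eq_neg_of_add_eq_zero_left h4)

theorem lamOf_ne_zero_of_mem {q0 : ℝ} (hq0 : 0 < q0) {z : ℂ} (hz : z ∈ outerLower q0) :
    lamOf q0 z ≠ 0 := by
  refine lamOf_ne_zero (ne_zero_of_le_norm hq0 hz.1) ?_ hz.2.2
  rintro rfl
  have := hz.2.1
  simp at this
  linarith

theorem continuousOn_lamOf (q0 : ℝ) : ContinuousOn (lamOf q0) {0}ᶜ := by
  intro z hz
  have : z ≠ 0 := hz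
  unfold lamOf
  exact ContinuousAt.continuousWithinAt (by fun_prop (disch := assumption))

theorem differentiableAt_lamOf (q0 : ℝ) {z : ℂ} (hz : z ≠ 0) :
    DifferentiableAt ℂ (lamOf q0) z := by
  unfold lamOf
  fun_prop (disch := assumption)

/-- The primitive `(e^{2 i l s} - 1) / (2 i l)` of `e^{2 i l s}`. -/
noncomputable def osc (l : ℂ) (s : ℝ) : ℂ :=
  (Complex.exp (2 * Complex.I * l * s) - 1) / (2 * Complex.I * l)

theorem norm_osc_le_abs {l : ℂ} (hl0 : l ≠ 0) (hl : l.im ≤ 0) {s : ℝ} (hs : s ≤ 0) :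
    ‖osc l s‖ ≤ |s| := by
  unfold osc
  have h0 : 0 < ‖2 * Complex.I * l‖ := by
    rw [norm_pos_iff]; simp [hl0]
  rw [norm_div, div_le_iff₀ h0]
  refine (norm_exp_sub_one_le_of_re_nonpos ?_).trans (le_of_eq ?_)
  · have : (2 * Complex.I * l * s).re = - (2 * l.im * s) := by simp
    rw [this]; nlinarith
  · rw [norm_mul, Complex.norm_real, Real.norm_eq_abs, mul_comm]

theorem norm_osc_le_inv {l : ℂ} (hl0 : l ≠ 0) (hl : l.im ≤ 0) {s : ℝ} (hs : s ≤ 0) :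
    ‖osc l s‖ ≤ 1 / ‖l‖ := by
  unfold osc
  have h0 : 0 < ‖l‖ := norm_pos_iff.2 hl0
  rw [norm_div, norm_mul, norm_mul, Complex.norm_I, Complex.norm_ofNat, mul_one,
    div_le_div_iff₀ (by positivity) h0]
  have h1 : ‖Complex.exp (2 * Complex.I * l * s) - 1‖ ≤ 2 := by
    refine (norm_sub_le _ _).trans ?_
    have := norm_exp_two_I_mul_le hl hs
    rw [norm_one]; linarith
  nlinarith

theorem continuous_osc {l : ℂ} : Continuous (osc l) := by
  unfold osc; fun_prop

/-- The constant matrix `U₊ + i λ` of the modified column at the background, acting on pairs. -/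
noncomputable def bgA (q0 : ℝ) (a z : ℂ) : (ℂ × ℂ) →L[ℂ] ℂ × ℂ :=
  ((Complex.I * (q0 : ℂ) ^ 2 / z) • ContinuousLinearMap.fst ℂ ℂ ℂ
      + a • ContinuousLinearMap.snd ℂ ℂ ℂ).prod
    (-conj a • ContinuousLinearMap.fst ℂ ℂ ℂ + (Complex.I * z) • ContinuousLinearMap.snd ℂ ℂ ℂ)

/-- The off-diagonal matrix with entries `d`, `-d*`, acting on pairs. -/
noncomputable def offG (d : ℂ) : (ℂ × ℂ) →L[ℂ] ℂ × ℂ :=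
  (d • ContinuousLinearMap.snd ℂ ℂ ℂ).prod (-conj d • ContinuousLinearMap.fst ℂ ℂ ℂ)

theorem bgA_apply (q0 : ℝ) (a z : ℂ) (u : ℂ × ℂ) :
    bgA q0 a z u = (Complex.I * (q0 : ℂ) ^ 2 / z * u.1 + a * u.2,
      -conj a * u.1 + Complex.I * z * u.2) := by
  simp [bgA]

theorem offG_apply (d : ℂ) (u : ℂ × ℂ) : offG d u = (d * u.2, -conj d * u.1) := by
  simp [offG]

theorem norm_offG_apply_le (d : ℂ) (u : ℂ × ℂ) : ‖offG d u‖ ≤ ‖d‖ * ‖u‖ := by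
  rw [offG_apply, Prod.norm_def]
  simp only [norm_mul, norm_neg, RCLike.norm_conj]
  exact max_le (mul_le_mul_of_nonneg_left (norm_snd_le u) (norm_nonneg _))
    (mul_le_mul_of_nonneg_left (norm_fst_le u) (norm_nonneg _))

theorem bgA_bgA {q0 : ℝ} {a z : ℂ} (ha : ‖a‖ = q0) (hz : z ≠ 0) (u : ℂ × ℂ) :
    bgA q0 a z (bgA q0 a z u) = (2 * Complex.I * lamOf q0 z) • bgA q0 a z u := by
  have h : a * conj a = (q0 : ℂ) ^ 2 := by rw [Complex.mul_conj, Complex.normSq_eq_norm_sq, ha]; simp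
  simp only [bgA_apply, lamOf, Prod.smul_mk, smul_eq_mul, Prod.mk.injEq]
  constructor
  · field_simp
    linear_combination (-u.1 * z ^ 2) * h - u.1 * z ^ 2 * (q0 : ℂ) ^ 2 * Complex.I_sq
  · field_simp
    linear_combination (-u.2 * z) * h - u.2 * z * (q0 : ℂ) ^ 2 * Complex.I_sq

/-- The first column `(1, -i a* / z)` of `E`. -/
noncomputable def colE (a z : ℂ) : ℂ × ℂ := (1, -(Complex.I * conj a / z))

theorem bgA_colE {q0 : ℝ} {a z : ℂ} (ha : ‖a‖ = q0) (hz : z ≠ 0) : bgA q0 a z (colE a z) = 0 := by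
  have h : a * conj a = (q0 : ℂ) ^ 2 := by rw [Complex.mul_conj, Complex.normSq_eq_norm_sq, ha]; simp
  simp only [bgA_apply, colE, Prod.mk_eq_zero]
  constructor
  · field_simp
    linear_combination -Complex.I * h
  · field_simp
    linear_combination -conj a * Complex.I_sq

theorem norm_colE_le {q0 : ℝ} (hq0 : 0 < q0) {a z : ℂ} (ha : ‖a‖ = q0) (hz : q0 ≤ ‖z‖) :
    ‖colE a z‖ ≤ 1 := by
  rw [colE, Prod.norm_def]
  refine max_le (by simp) ?_
  simp only [norm_neg, norm_div, norm_mul, Complex.norm_I, one_mul, RCLike.norm_conj, ha]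
  exact (div_le_one (hq0.trans_le hz)).2 hz

/-- The kernel `(1 + osc(s) A) ΔQ` of the Volterra equation; `1 + osc(s) A` is the exponential of
`s A`, because `A² = 2 i λ A`. -/
noncomputable def volK (q0 : ℝ) (a z : ℂ) (s : ℝ) (d : ℂ) : (ℂ × ℂ) →L[ℂ] ℂ × ℂ :=
  offG d + osc (lamOf q0 z) s • (bgA q0 a z).comp (offG d)

theorem volK_apply (q0 : ℝ) (a z : ℂ) (s : ℝ) (d : ℂ) (u : ℂ × ℂ) :
    volK q0 a z s d u = offG d u + osc (lamOf q0 z) s • bgA q0 a z (offG d u) := by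
  simp [volK]

theorem norm_osc_mul_le {q0 : ℝ} (hq0 : 0 < q0) {z : ℂ} (hz : z ∈ outerLower q0) {s : ℝ}
    (hs : s ≤ 0) : ‖osc (lamOf q0 z) s‖ * ‖z‖ ≤ 3 + 2 * q0 * |s| := by
  have hl0 := lamOf_ne_zero_of_mem hq0 hz
  have hl := lamOf_im_nonpos hq0 hz.1 hz.2.1
  have hzn : 0 < ‖z‖ := hq0.trans_le hz.1
  rcases le_total ‖z‖ (2 * q0) with h | h
  · have h1 := norm_osc_le_abs hl0 hl hs
    have := mul_le_mul h1 h (norm_nonneg _) (abs_nonneg s)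
    linarith
  · have h1 := norm_osc_le_inv hl0 hl hs
    have h2 : 3 / 8 * ‖z‖ ≤ ‖lamOf q0 z‖ := by
      unfold lamOf
      rw [norm_div, Complex.norm_ofNat, le_div_iff₀ (by norm_num)]
      have h3 : ‖(q0 : ℂ) ^ 2 / z‖ ≤ ‖z‖ / 4 := by
        rw [norm_div, norm_pow, Complex.norm_real, Real.norm_eq_abs, sq_abs, div_le_iff₀ hzn]
        nlinarith
      have h4 := norm_sub_le_norm_add z ((q0 : ℂ) ^ 2 / z)
      linarith
    have h5 : ‖osc (lamOf q0 z) s‖ * ‖z‖ ≤ 3 := by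
      have h6 : 0 < ‖lamOf q0 z‖ := norm_pos_iff.2 hl0
      calc _ ≤ 1 / ‖lamOf q0 z‖ * ‖z‖ := mul_le_mul_of_nonneg_right h1 hzn.le
        _ = ‖z‖ / ‖lamOf q0 z‖ := by ring
        _ ≤ 3 := by rw [div_le_iff₀ h6]; linarith
    have : 0 ≤ 2 * q0 * |s| := by positivity
    linarith

/-- The bound on the Volterra kernel that is uniform up to the branch point and to infinity. -/
theorem norm_volK_apply_le {q0 : ℝ} (hq0 : 0 < q0) {a z : ℂ} (ha : ‖a‖ = q0)
    (hz : z ∈ outerLower q0) {s : ℝ} (hs : s ≤ 0) (d : ℂ) (u : ℂ × ℂ) :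
    ‖volK q0 a z s d u‖ ≤ (4 + 3 * q0) * (1 + |s|) * ‖d‖ * ‖u‖ := by
  have hl0 := lamOf_ne_zero_of_mem hq0 hz
  have hl := lamOf_im_nonpos hq0 hz.1 hz.2.1
  have hzn : 0 < ‖z‖ := hq0.trans_le hz.1
  have h1 := norm_osc_le_abs hl0 hl hs
  have h2 := norm_osc_mul_le hq0 hz hs
  have hg := norm_offG_apply_le d u
  set g := offG d u with hgdef
  set e := osc (lamOf q0 z) s with hedef
  have hg1 := norm_fst_le g
  have hg2 := norm_snd_le g
  have hb : ‖Complex.I * (q0 : ℂ) ^ 2 / z‖ ≤ q0 := by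
    rw [norm_div, norm_mul, Complex.norm_I, one_mul, norm_pow, Complex.norm_real, Real.norm_eq_abs,
      sq_abs, div_le_iff₀ hzn]
    nlinarith [hz.1]
  have key : ‖volK q0 a z s d u‖ ≤ (4 + 3 * q0) * (1 + |s|) * ‖g‖ := by
    have hG := norm_nonneg g
    have hs0 := abs_nonneg s
    have e0 := norm_nonneg e
    have p1 : ‖e‖ * (q0 * ‖g‖) ≤ |s| * (q0 * ‖g‖) := mul_le_mul_of_nonneg_right h1 (by positivity)
    have p2 : 0 ≤ q0 * ‖g‖ := by positivity
    have p3 : 0 ≤ |s| * ‖g‖ := by positivity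
    rw [volK_apply, ← hgdef, ← hedef, bgA_apply, Prod.norm_def]
    refine max_le ?_ ?_
    · simp only [Prod.fst_add, Prod.smul_fst, smul_eq_mul]
      calc _ ≤ ‖g.1‖ + ‖e‖ * (‖Complex.I * (q0 : ℂ) ^ 2 / z‖ * ‖g.1‖ + ‖a‖ * ‖g.2‖) := by
            refine (norm_add_le _ _).trans (add_le_add le_rfl ?_)
            rw [norm_mul]
            refine mul_le_mul_of_nonneg_left ((norm_add_le _ _).trans ?_) e0
            rw [norm_mul, norm_mul]
        _ ≤ ‖g‖ + ‖e‖ * (q0 * ‖g‖ + q0 * ‖g‖) := by rw [ha]; gcongr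
        _ ≤ _ := by nlinarith
    · simp only [Prod.snd_add, Prod.smul_snd, smul_eq_mul]
      calc _ ≤ ‖g.2‖ + ‖e‖ * (‖a‖ * ‖g.1‖ + ‖z‖ * ‖g.2‖) := by
            refine (norm_add_le _ _).trans (add_le_add le_rfl ?_)
            rw [norm_mul]
            refine mul_le_mul_of_nonneg_left ((norm_add_le _ _).trans ?_) e0
            rw [norm_mul, norm_mul, norm_neg, RCLike.norm_conj, norm_mul, Complex.norm_I, one_mul]
        _ ≤ ‖g‖ + (‖e‖ * (q0 * ‖g‖) + (‖e‖ * ‖z‖) * ‖g‖) := by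
            rw [ha, mul_add, ← mul_assoc (‖e‖) (‖z‖)]; gcongr
        _ ≤ ‖g‖ + (|s| * (q0 * ‖g‖) + (3 + 2 * q0 * |s|) * ‖g‖) := by gcongr
        _ ≤ _ := by nlinarith
  calc _ ≤ _ := key
    _ ≤ (4 + 3 * q0) * (1 + |s|) * (‖d‖ * ‖u‖) := by gcongr
    _ = _ := by ring

/-- Differentiation of the Volterra integral: `T' = A T - g`. -/
theorem hasDerivAt_volterra {q0 : ℝ} {a z : ℂ} (ha : ‖a‖ = q0) (hz : z ≠ 0)
    (hl0 : lamOf q0 z ≠ 0) (hl : (lamOf q0 z).im ≤ 0) {g : ℝ → ℂ × ℂ} (hg : Continuous g)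
    (hgi : IntegrableOn (fun y => (1 + |y|) * ‖g y‖) (Set.Ioi 0)) (x : ℝ) :
    HasDerivAt (fun x => ∫ y in Set.Ioi x, (g y + osc (lamOf q0 z) (x - y) • bgA q0 a z (g y)))
      (bgA q0 a z (∫ y in Set.Ioi x, (g y + osc (lamOf q0 z) (x - y) • bgA q0 a z (g y))) - g x)
      x := by
  set l := lamOf q0 z with hldef
  set A := bgA q0 a z with hA
  set E : ℝ → ℂ := fun s => Complex.exp (2 * Complex.I * l * s) with hE
  have hEc : Continuous E := by fun_prop
  have h2l : 2 * Complex.I * l ≠ 0 := by simp [hl0]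
  have hosc : ∀ s, 2 * Complex.I * l * osc l s = E s - 1 := fun s => by
    simp only [osc, hE]; field_simp
  have hadd : ∀ x y : ℝ, osc l (x - y) = osc l (-y) + E (-y) * osc l x := by
    intro x y
    have : E (x - y) = E x * E (-y) := by
      simp only [hE]; rw [← Complex.exp_add]; congr 1; push_cast; ring
    have h3 : ∀ s, osc l s = (E s - 1) / (2 * Complex.I * l) := fun s => rfl
    rw [h3, h3, h3, this]; field_simp; ring
  have hoscd : ∀ x, HasDerivAt (osc l) (E x) x := by
    intro x
    have h1 : HasDerivAt E (E x * (2 * Complex.I * l)) x := by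
      have h2 : HasDerivAt (fun s : ℝ => 2 * Complex.I * l * (s : ℂ)) (2 * Complex.I * l * 1) x :=
        (Complex.ofRealCLM.hasDerivAt (x := x)).const_mul _
      rw [mul_one] at h2
      exact h2.cexp
    have h3 := (h1.sub_const 1).div_const (2 * Complex.I * l)
    rw [mul_div_cancel_right₀ _ h2l] at h3
    exact h3
  have dom : ∀ {c : ℝ → ℂ}, Continuous c → (∀ y, 0 < y → ‖c y‖ ≤ 1 + |y|) → ∀ x,
      IntegrableOn (fun y => c y • g y) (Set.Ioi x) := by
    intro c hc hcb x
    have hcg : Continuous fun y => c y • g y := hc.smul hg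
    refine integrableOn_Ioi_of_continuous (c := 0) hcg ?_ x
    refine hgi.mono' hcg.aestronglyMeasurable ?_
    filter_upwards [ae_restrict_mem measurableSet_Ioi] with y hy
    rw [norm_smul]
    exact mul_le_mul_of_nonneg_right (hcb y hy) (norm_nonneg _)
  have i0 : ∀ x, IntegrableOn g (Set.Ioi x) := by
    intro x
    have := dom (c := fun _ => 1) continuous_const (fun y hy => by
      rw [norm_one]; linarith [abs_nonneg y]) x
    simpa using this
  have c1 : Continuous fun y => osc l (-y) := continuous_osc.comp continuous_neg
  have c2 : Continuous fun y => E (-y) := hEc.comp continuous_neg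
  have i1 : ∀ x, IntegrableOn (fun y => osc l (-y) • g y) (Set.Ioi x) :=
    dom c1 fun y hy => by
      have := norm_osc_le_abs hl0 hl (s := -y) (by linarith)
      rw [abs_neg] at this; linarith
  have i2 : ∀ x, IntegrableOn (fun y => E (-y) • g y) (Set.Ioi x) :=
    dom c2 fun y hy => by
      have := norm_exp_two_I_mul_le hl (s := -y) (by linarith)
      exact this.trans (by linarith [abs_nonneg y])
  have hT : (fun x => ∫ y in Set.Ioi x, (g y + osc l (x - y) • A (g y)))
      = fun x => (∫ y in Set.Ioi x, g y) + A ((∫ y in Set.Ioi x, osc l (-y) • g y)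
        + osc l x • ∫ y in Set.Ioi x, E (-y) • g y) := by
    funext x
    have i3 : IntegrableOn (fun y => osc l x • (E (-y) • g y)) (Set.Ioi x) :=
      (i2 x).smul (osc l x)
    have i4 : IntegrableOn (fun y => osc l (-y) • g y + osc l x • (E (-y) • g y)) (Set.Ioi x) :=
      (i1 x).add i3
    have i5 : IntegrableOn (fun y => A (osc l (-y) • g y + osc l x • (E (-y) • g y)))
      (Set.Ioi x) := A.integrable_comp i4
    rw [← integral_smul, ← integral_add (i1 x) i3, ← ContinuousLinearMap.integral_comp_comm A i4,
      ← integral_add (i0 x) i5]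
    congr 1; funext y
    simp only [map_add, map_smul, hadd x y, add_smul, mul_smul]
    rw [smul_comm]
  rw [hT]
  have d0 := hasDerivAt_integral_Ioi hg (i0 0) x
  have d1 : HasDerivAt (fun x => ∫ y in Set.Ioi x, osc l (-y) • g y) (-(osc l (-x) • g x)) x :=
    hasDerivAt_integral_Ioi (c1.smul hg) (i1 0) x
  have d2 : HasDerivAt (fun x => ∫ y in Set.Ioi x, E (-y) • g y) (-(E (-x) • g x)) x :=
    hasDerivAt_integral_Ioi (c2.smul hg) (i2 0) x
  have d3 := d1.fun_add ((hoscd x).fun_smul d2)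
  have d4 : HasDerivAt (fun x => A ((∫ y in Set.Ioi x, osc l (-y) • g y)
      + osc l x • ∫ y in Set.Ioi x, E (-y) • g y)) _ x :=
    ((A.restrictScalars ℝ).hasFDerivAt (x := (∫ y in Set.Ioi x, osc l (-y) • g y)
      + osc l x • ∫ y in Set.Ioi x, E (-y) • g y)).comp_hasDerivAt x d3
  have hD := d0.fun_add d4
  refine hD.congr_deriv ?_
  have hG1 : (2 * Complex.I * l) • (∫ y in Set.Ioi x, osc l (-y) • g y)
      = (∫ y in Set.Ioi x, E (-y) • g y) - ∫ y in Set.Ioi x, g y := by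
    rw [← integral_smul, ← integral_sub (i2 x) (i0 x)]
    congr 1; funext y
    rw [smul_smul, hosc, sub_smul, one_smul]
  have hzero : osc l (-x) + osc l x * E (-x) = 0 := by
    have := hadd x x
    rw [sub_self] at this
    have h0 : osc l 0 = 0 := by simp [osc]
    rw [h0] at this
    rw [mul_comm, ← this]
  have hAA : ∀ u, A (A u) = (2 * Complex.I * l) • A u := fun u => bgA_bgA ha hz u
  have hTx := congrFun hT x
  rw [hTx, ContinuousLinearMap.coe_restrictScalars', map_add A (∫ y in Set.Ioi x, g y), hAA,
    ← map_smul, smul_add, hG1, smul_smul, hosc]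
  set G0 := ∫ y in Set.Ioi x, g y
  set G1 := ∫ y in Set.Ioi x, osc l (-y) • g y
  set G2 := ∫ y in Set.Ioi x, E (-y) • g y
  have e1 : -(osc l (-x) • g x) + (osc l x • -(E (-x) • g x) + E x • G2) = E x • G2 := by
    have : (osc l (-x) + osc l x * E (-x)) • g x = 0 := by rw [hzero, zero_smul]
    rw [add_smul, mul_smul] at this
    rw [smul_neg, ← add_assoc, ← neg_add, this]
    simp
  rw [e1, ← map_add, show G0 + (G2 - G0 + (E x - 1) • G2) = E x • G2 by
    rw [sub_smul, one_smul]; abel]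
  abel

end IfoNLS

namespace IfoNLS

/-- A potential on the half-line written as `a + d`: `a` is its limit, of modulus `q₀ > 0`, and the
deviation `d` is continuous with an integrable first moment. -/
structure Background (q0 : ℝ) (a : ℂ) (d : ℝ → ℂ) : Prop where
  pos : 0 < q0
  norm_a : ‖a‖ = q0
  cont : Continuous d
  int : IntegrableOn (fun y => (1 + |y|) * ‖d y‖) (Set.Ioi 0)

/-- The weight that dominates the Volterra kernel on `[c, ∞)`. -/
noncomputable def volW (q0 : ℝ) (d : ℝ → ℂ) (c y : ℝ) : ℝ :=
  (4 + 3 * q0) * (1 + |c|) * ((1 + |y|) * ‖d y‖)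

/-- The tail integral of `volW`. -/
noncomputable def volTail (q0 : ℝ) (d : ℝ → ℂ) (c x : ℝ) : ℝ := ∫ y in Set.Ioi x, volW q0 d c y

/-- The terms of the Neumann series of the Volterra equation. -/
noncomputable def jostTerm (q0 : ℝ) (a : ℂ) (d : ℝ → ℂ) : ℕ → ℝ → ℂ → ℂ × ℂ
  | 0, _, z => colE a z
  | n + 1, x, z => -∫ y in Set.Ioi x, volK q0 a z (x - y) (d y) (jostTerm q0 a d n y z)

/-- The modified Jost column, as the sum of its Neumann series. -/
noncomputable def jostM (q0 : ℝ) (a : ℂ) (d : ℝ → ℂ) (x : ℝ) (z : ℂ) : ℂ × ℂ :=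
  ∑' n, jostTerm q0 a d n x z

namespace Background

variable {q0 : ℝ} {a : ℂ} {d : ℝ → ℂ}

theorem continuous_volW (h : Background q0 a d) (c : ℝ) : Continuous (volW q0 d c) := by
  unfold volW
  have := h.cont
  fun_prop

theorem volW_nonneg (h : Background q0 a d) (c y : ℝ) : 0 ≤ volW q0 d c y := by
  have := h.pos
  unfold volW
  positivity

theorem integrableOn_volW (h : Background q0 a d) (c x : ℝ) :
    IntegrableOn (volW q0 d c) (Set.Ioi x) :=
  integrableOn_Ioi_of_continuous (h.continuous_volW c) (h.int.const_mul _) x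

theorem volTail_nonneg (h : Background q0 a d) (c x : ℝ) : 0 ≤ volTail q0 d c x :=
  integral_nonneg fun y => h.volW_nonneg c y

theorem volTail_anti (h : Background q0 a d) (c : ℝ) : Antitone (volTail q0 d c) := by
  intro x y hxy
  exact setIntegral_mono_set (h.integrableOn_volW c x)
    (Eventually.of_forall fun y => h.volW_nonneg c y)
    (Set.Ioi_subset_Ioi hxy).eventuallyLE

theorem hasDerivAt_volTail (h : Background q0 a d) (c x : ℝ) :
    HasDerivAt (volTail q0 d c) (-volW q0 d c x) x :=
  hasDerivAt_integral_Ioi (h.continuous_volW c) (h.integrableOn_volW c 0) x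

theorem tendsto_volTail (h : Background q0 a d) (c : ℝ) :
    Tendsto (volTail q0 d c) atTop (𝓝 0) := by
  have h1 := intervalIntegral_tendsto_integral_Ioi 0 (h.integrableOn_volW c 0) tendsto_id
  have h2 : volTail q0 d c = fun x => (∫ y in Set.Ioi 0, volW q0 d c y)
      - ∫ y in (0 : ℝ)..x, volW q0 d c y := by
    funext x
    rw [← intervalIntegral.integral_interval_add_Ioi (h.integrableOn_volW c 0)
      (h.integrableOn_volW c x)]
    simp [volTail]
  rw [h2]
  simpa using h1.const_sub (∫ y in Set.Ioi 0, volW q0 d c y)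

/-- The exponential weight turns the Volterra operator into a contraction by the factor `1/2`. -/
theorem integrableOn_volW_exp (h : Background q0 a d) (c x : ℝ) :
    IntegrableOn (fun y => volW q0 d c y * Real.exp (2 * volTail q0 d c y)) (Set.Ioi x) ∧
      ∫ y in Set.Ioi x, volW q0 d c y * Real.exp (2 * volTail q0 d c y)
        = (Real.exp (2 * volTail q0 d c x) - 1) / 2 := by
  have hc : Continuous (volTail q0 d c) :=
    continuous_iff_continuousAt.2 fun x => (h.hasDerivAt_volTail c x).continuousAt
  have hi : IntegrableOn (fun y => volW q0 d c y * Real.exp (2 * volTail q0 d c y))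
      (Set.Ioi x) := by
    refine ((h.integrableOn_volW c x).mul_const (Real.exp (2 * volTail q0 d c x))).mono'
      ((h.continuous_volW c).mul (by fun_prop)).aestronglyMeasurable ?_
    filter_upwards [ae_restrict_mem measurableSet_Ioi] with y hy
    rw [Real.norm_eq_abs, abs_of_nonneg (mul_nonneg (h.volW_nonneg c y) (Real.exp_pos _).le)]
    refine mul_le_mul_of_nonneg_left (Real.exp_le_exp.2 ?_) (h.volW_nonneg c y)
    have := h.volTail_anti c (le_of_lt (Set.mem_Ioi.1 hy))
    linarith
  refine ⟨hi, ?_⟩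
  have hd : ∀ y ∈ Set.Ici x, HasDerivAt (fun y => -(Real.exp (2 * volTail q0 d c y) / 2))
      (volW q0 d c y * Real.exp (2 * volTail q0 d c y)) y := by
    intro y _
    refine ((((h.hasDerivAt_volTail c y).const_mul 2).exp.div_const 2).neg).congr_deriv ?_
    ring
  have hl : Tendsto (fun y => -(Real.exp (2 * volTail q0 d c y) / 2)) atTop (𝓝 (-(1 / 2))) := by
    have := (((h.tendsto_volTail c).const_mul 2).rexp.div_const 2).neg
    simpa using this
  rw [integral_Ioi_of_hasDerivAt_of_tendsto' hd hi hl]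
  ring

theorem norm_volK_le_volW (h : Background q0 a d) {z : ℂ} (hz : z ∈ outerLower q0) {c x y : ℝ}
    (hcx : c ≤ x) (hxy : x ≤ y) (u : ℂ × ℂ) :
    ‖volK q0 a z (x - y) (d y) u‖ ≤ volW q0 d c y * ‖u‖ := by
  refine (norm_volK_apply_le h.pos h.norm_a hz (by linarith) _ _).trans ?_
  have h1 : 1 + |x - y| ≤ (1 + |c|) * (1 + |y|) := by
    rw [abs_of_nonpos (by linarith)]
    nlinarith [neg_abs_le c, le_abs_self y, abs_nonneg c, abs_nonneg y,
      mul_nonneg (abs_nonneg c) (abs_nonneg y)]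
  have := h.pos
  calc _ ≤ (4 + 3 * q0) * ((1 + |c|) * (1 + |y|)) * ‖d y‖ * ‖u‖ := by gcongr
    _ = _ := by unfold volW; ring

theorem continuous_volK_apply (h : Background q0 a d) (z : ℂ) (x : ℝ) {u : ℝ → ℂ × ℂ}
    (hu : Continuous u) : Continuous fun y => volK q0 a z (x - y) (d y) (u y) := by
  have hd := h.cont
  have h1 : Continuous fun y => offG (d y) (u y) := by
    simp only [offG_apply]
    fun_prop
  simp only [volK_apply]
  exact h1.add ((continuous_osc.comp (by fun_prop)).smul ((bgA q0 a z).continuous.comp h1))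

theorem hasDerivAt_integral_volK (h : Background q0 a d) {z : ℂ} (hz : z ∈ outerLower q0)
    {u : ℝ → ℂ × ℂ} (hu : Continuous u) {M : ℝ} (hM : ∀ y, 0 ≤ y → ‖u y‖ ≤ M) (x : ℝ) :
    HasDerivAt (fun x => ∫ y in Set.Ioi x, volK q0 a z (x - y) (d y) (u y))
      (bgA q0 a z (∫ y in Set.Ioi x, volK q0 a z (x - y) (d y) (u y)) - offG (d x) (u x)) x := by
  have hd := h.cont
  have h1 : Continuous fun y => offG (d y) (u y) := by
    simp only [offG_apply]
    fun_prop
  simp only [volK_apply]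
  refine hasDerivAt_volterra h.norm_a (ne_zero_of_le_norm h.pos hz.1)
    (lamOf_ne_zero_of_mem h.pos hz) (lamOf_im_nonpos h.pos hz.1 hz.2.1) h1 ?_ x
  refine (h.int.mul_const M).mono' (by fun_prop) ?_
  filter_upwards [ae_restrict_mem measurableSet_Ioi] with y hy
  have hy0 : 0 ≤ y := le_of_lt hy
  rw [Real.norm_eq_abs, abs_of_nonneg (by positivity), mul_assoc]
  refine mul_le_mul_of_nonneg_left ?_ (by positivity)
  exact (norm_offG_apply_le _ _).trans (mul_le_mul_of_nonneg_left (hM y hy0) (norm_nonneg _))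

theorem jostTerm_spec (h : Background q0 a d) {z : ℂ} (hz : z ∈ outerLower q0) (n : ℕ) :
    Continuous (fun x => jostTerm q0 a d n x z) ∧ ∀ c x, c ≤ x →
      ‖jostTerm q0 a d n x z‖ ≤ Real.exp (2 * volTail q0 d c x) / 2 ^ n := by
  induction n with
  | zero =>
    refine ⟨continuous_const, fun c x _ => ?_⟩
    simp only [jostTerm, pow_zero, div_one]
    refine (norm_colE_le h.pos h.norm_a hz.1).trans (Real.one_le_exp ?_)
    have := h.volTail_nonneg c x
    linarith
  | succ n ih =>
    obtain ⟨ihc, ihb⟩ := ih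
    constructor
    · refine continuous_iff_continuousAt.2 fun x => ?_
      refine ContinuousAt.neg (HasDerivAt.continuousAt (h.hasDerivAt_integral_volK hz ihc
        (M := Real.exp (2 * volTail q0 d 0 0) / 2 ^ n) (fun y hy => ?_) x))
      refine (ihb 0 y hy).trans ?_
      gcongr
      exact h.volTail_anti 0 hy
    · intro c x hcx
      have key : ∀ y ∈ Set.Ioi x, ‖volK q0 a z (x - y) (d y) (jostTerm q0 a d n y z)‖
          ≤ (volW q0 d c y * Real.exp (2 * volTail q0 d c y)) / 2 ^ n := by
        intro y hy
        have hxy : x ≤ y := le_of_lt hy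
        refine (h.norm_volK_le_volW hz hcx hxy _).trans ?_
        rw [mul_div_assoc]
        exact mul_le_mul_of_nonneg_left (ihb c y (hcx.trans hxy)) (h.volW_nonneg c y)
      obtain ⟨hi, hv⟩ := h.integrableOn_volW_exp c x
      simp only [jostTerm, norm_neg]
      refine (norm_integral_le_of_norm_le (hi.div_const (2 ^ n)) ?_).trans ?_
      · filter_upwards [ae_restrict_mem measurableSet_Ioi] with y hy using key y hy
      · rw [integral_div, hv, div_div, pow_succ']
        gcongr
        linarith

theorem norm_volK_jostTerm_le (h : Background q0 a d) {z : ℂ} (hz : z ∈ outerLower q0) (n : ℕ)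
    {c x y : ℝ} (hcx : c ≤ x) (hxy : x ≤ y) :
    ‖volK q0 a z (x - y) (d y) (jostTerm q0 a d n y z)‖
      ≤ (volW q0 d c y * Real.exp (2 * volTail q0 d c y)) / 2 ^ n := by
  refine (h.norm_volK_le_volW hz hcx hxy _).trans ?_
  rw [mul_div_assoc]
  exact mul_le_mul_of_nonneg_left ((h.jostTerm_spec hz n).2 c y (hcx.trans hxy))
    (h.volW_nonneg c y)

theorem summable_bound (K : ℝ) : Summable fun n : ℕ => K / 2 ^ n :=
  (summable_geometric_two' (2 * K)).congr fun n => by ring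

theorem jostTerm_bound (h : Background q0 a d) {z : ℂ} (hz : z ∈ outerLower q0) (n : ℕ)
    {c x : ℝ} (hcx : c ≤ x) :
    ‖jostTerm q0 a d n x z‖ ≤ Real.exp (2 * volTail q0 d c c) / 2 ^ n := by
  refine ((h.jostTerm_spec hz n).2 c x hcx).trans ?_
  gcongr
  exact h.volTail_anti c hcx

theorem summable_jostTerm (h : Background q0 a d) {z : ℂ} (hz : z ∈ outerLower q0) (x : ℝ) :
    Summable fun n => jostTerm q0 a d n x z :=
  .of_norm_bounded (summable_bound _) fun n => h.jostTerm_bound hz n le_rfl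

theorem continuous_jostM (h : Background q0 a d) {z : ℂ} (hz : z ∈ outerLower q0) :
    Continuous fun x => jostM q0 a d x z := by
  refine continuous_iff_continuousAt.2 fun x => ?_
  have : ContinuousOn (fun x => jostM q0 a d x z) (Set.Ici (x - 1)) :=
    continuousOn_tsum (fun n => (h.jostTerm_spec hz n).1.continuousOn)
      (summable_bound (Real.exp (2 * volTail q0 d (x - 1) (x - 1))))
      fun n y hy => h.jostTerm_bound hz n hy
  exact this.continuousAt (Ici_mem_nhds (by linarith))

theorem norm_jostM_le (h : Background q0 a d) {z : ℂ} (hz : z ∈ outerLower q0) {c x : ℝ}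
    (hcx : c ≤ x) : ‖jostM q0 a d x z‖ ≤ 2 * Real.exp (2 * volTail q0 d c c) := by
  refine tsum_of_norm_bounded (f := fun n => jostTerm q0 a d n x z) ?_
    fun n => h.jostTerm_bound hz n hcx
  convert hasSum_geometric_two' (2 * Real.exp (2 * volTail q0 d c c)) using 2 with n
  ring

/-- The Volterra equation. -/
theorem jostM_eq (h : Background q0 a d) {z : ℂ} (hz : z ∈ outerLower q0) (x : ℝ) :
    jostM q0 a d x z
      = colE a z - ∫ y in Set.Ioi x, volK q0 a z (x - y) (d y) (jostM q0 a d y z) := by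
  have h1 : jostM q0 a d x z = colE a z + ∑' n, jostTerm q0 a d (n + 1) x z := by
    rw [jostM, (h.summable_jostTerm hz x).tsum_eq_zero_add]
    rfl
  obtain ⟨hi, hv⟩ := h.integrableOn_volW_exp x x
  have hint : ∀ n, IntegrableOn (fun y => volK q0 a z (x - y) (d y) (jostTerm q0 a d n y z))
      (Set.Ioi x) := fun n => by
    refine (hi.div_const (2 ^ n)).mono'
      (h.continuous_volK_apply z x (h.jostTerm_spec hz n).1).aestronglyMeasurable ?_
    filter_upwards [ae_restrict_mem measurableSet_Ioi] with y hy
    exact h.norm_volK_jostTerm_le hz n le_rfl (le_of_lt hy)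
  have h2 := hasSum_integral_of_summable_integral_norm hint ?_
  · have h3 : ∀ y, volK q0 a z (x - y) (d y) (jostM q0 a d y z)
        = ∑' n, volK q0 a z (x - y) (d y) (jostTerm q0 a d n y z) := fun y =>
      (volK q0 a z (x - y) (d y)).map_tsum (h.summable_jostTerm hz y)
    simp only [h3]
    rw [h1, sub_eq_add_neg, ← h2.tsum_eq, ← tsum_neg]
    rfl
  · refine .of_nonneg_of_le (fun n => integral_nonneg fun y => norm_nonneg _) (fun n => ?_)
      (summable_bound (∫ y in Set.Ioi x, volW q0 d x y * Real.exp (2 * volTail q0 d x y)))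
    rw [← integral_div]
    refine setIntegral_mono_on (hint n).norm (hi.div_const _) measurableSet_Ioi fun y hy => ?_
    exact h.norm_volK_jostTerm_le hz n le_rfl (le_of_lt hy)

/-- The differential equation of the modified column. -/
theorem hasDerivAt_jostM (h : Background q0 a d) {z : ℂ} (hz : z ∈ outerLower q0) (x : ℝ) :
    HasDerivAt (fun x => jostM q0 a d x z)
      (bgA q0 a z (jostM q0 a d x z) + offG (d x) (jostM q0 a d x z)) x := by
  have h1 := (h.hasDerivAt_integral_volK hz (h.continuous_jostM hz)
    (fun y hy => h.norm_jostM_le hz hy) x).const_sub (colE a z)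
  have h2 : (fun x => jostM q0 a d x z) = fun x => colE a z
      - ∫ y in Set.Ioi x, volK q0 a z (x - y) (d y) (jostM q0 a d y z) :=
    funext fun x => h.jostM_eq hz x
  have h3 : bgA q0 a z (jostM q0 a d x z)
      = -bgA q0 a z (∫ y in Set.Ioi x, volK q0 a z (x - y) (d y) (jostM q0 a d y z)) := by
    rw [h.jostM_eq hz x, map_sub, bgA_colE h.norm_a (ne_zero_of_le_norm h.pos hz.1), zero_sub]
  rw [h3, h2]
  refine h1.congr_deriv ?_
  abel

theorem norm_integral_volK_le (h : Background q0 a d) {z : ℂ} (hz : z ∈ outerLower q0) {x : ℝ}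
    (hx : 0 ≤ x) {u : ℝ → ℂ × ℂ} {M : ℝ} (hM : ∀ y, 0 ≤ y → ‖u y‖ ≤ M) :
    ‖∫ y in Set.Ioi x, volK q0 a z (x - y) (d y) (u y)‖ ≤ volTail q0 d 0 x * M := by
  rw [volTail, ← integral_mul_const]
  refine norm_integral_le_of_norm_le ((h.integrableOn_volW 0 x).mul_const M) ?_
  filter_upwards [ae_restrict_mem measurableSet_Ioi] with y hy
  have hxy : x ≤ y := le_of_lt hy
  exact (h.norm_volK_le_volW hz hx hxy _).trans
    (mul_le_mul_of_nonneg_left (hM y (hx.trans hxy)) (h.volW_nonneg 0 y))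

theorem tendsto_jostM_atTop (h : Background q0 a d) {z : ℂ} (hz : z ∈ outerLower q0) :
    Tendsto (fun x => jostM q0 a d x z) atTop (𝓝 (colE a z)) := by
  rw [tendsto_iff_norm_sub_tendsto_zero]
  have hl := (h.tendsto_volTail 0).mul_const (2 * Real.exp (2 * volTail q0 d 0 0))
  rw [zero_mul] at hl
  refine squeeze_zero' (Eventually.of_forall fun _ => norm_nonneg _) ?_ hl
  filter_upwards [eventually_ge_atTop 0] with x hx
  rw [h.jostM_eq hz x, sub_sub_cancel_left, norm_neg]
  exact h.norm_integral_volK_le hz hx fun y hy => h.norm_jostM_le hz hy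

theorem continuousOn_osc_lamOf (hq0 : 0 < q0) (s : ℝ) :
    ContinuousOn (fun z => osc (lamOf q0 z) s) (outerLower q0) := by
  have h1 : ContinuousOn (lamOf q0) (outerLower q0) :=
    (continuousOn_lamOf q0).mono fun z hz => ne_zero_of_le_norm hq0 hz.1
  unfold osc
  refine ContinuousOn.div (by fun_prop) (by fun_prop) fun z hz => ?_
  simp [lamOf_ne_zero_of_mem hq0 hz]

theorem differentiableOn_osc_lamOf (hq0 : 0 < q0) (s : ℝ) :
    DifferentiableOn ℂ (fun z => osc (lamOf q0 z) s) (outerLowerInt q0) := by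
  have h1 : DifferentiableOn ℂ (lamOf q0) (outerLowerInt q0) := fun z hz =>
    (differentiableAt_lamOf q0 (ne_zero_of_le_norm hq0 hz.1.le)).differentiableWithinAt
  unfold osc
  refine DifferentiableOn.div (by fun_prop) (by fun_prop) fun z hz => ?_
  simp [lamOf_ne_zero_of_mem hq0 (outerLowerInt_subset hq0 hz)]

theorem continuousOn_jostTerm (h : Background q0 a d) (n : ℕ) :
    ∀ x, ContinuousOn (fun z => jostTerm q0 a d n x z) (outerLower q0) := by
  have hne : ∀ z ∈ outerLower q0, z ≠ 0 := fun z hz => ne_zero_of_le_norm h.pos hz.1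
  induction n with
  | zero =>
    intro x
    simp only [jostTerm, colE]
    exact continuousOn_const.prodMk (ContinuousOn.neg
      (continuousOn_const.div continuousOn_id hne))
  | succ n ih =>
    intro x
    refine ContinuousOn.neg ?_
    refine continuousOn_of_dominated
      (bound := fun y => (volW q0 d x y * Real.exp (2 * volTail q0 d x y)) / 2 ^ n)
      (fun z hz => (h.continuous_volK_apply z x (h.jostTerm_spec hz n).1).aestronglyMeasurable)
      (fun z hz => ?_) ((h.integrableOn_volW_exp x x).1.div_const _) ?_
    · filter_upwards [ae_restrict_mem measurableSet_Ioi] with y hy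
      exact h.norm_volK_jostTerm_le hz n le_rfl (le_of_lt hy)
    · refine Eventually.of_forall fun y => ?_
      have h1 := ih y
      have h2 := continuousOn_osc_lamOf h.pos (x - y)
      have h3 : ContinuousOn (fun z : ℂ => Complex.I * (q0 : ℂ) ^ 2 / z) (outerLower q0) :=
        continuousOn_const.div continuousOn_id hne
      simp only [volK_apply, offG_apply, bgA_apply]
      fun_prop

theorem differentiableOn_jostTerm (h : Background q0 a d) (n : ℕ) :
    ∀ x, DifferentiableOn ℂ (fun z => jostTerm q0 a d n x z) (outerLowerInt q0) := by
  have hne : ∀ z ∈ outerLowerInt q0, z ≠ 0 := fun z hz => ne_zero_of_le_norm h.pos hz.1.le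
  have hsub := outerLowerInt_subset h.pos
  induction n with
  | zero =>
    intro x
    simp only [jostTerm, colE]
    exact (differentiableOn_const _).prodMk (DifferentiableOn.neg
      ((differentiableOn_const _).div differentiableOn_id hne))
  | succ n ih =>
    intro x
    refine DifferentiableOn.neg ?_
    refine differentiableOn_integral_of_dominated (isOpen_outerLowerInt q0)
      ((h.integrableOn_volW_exp x x).1.div_const (2 ^ n))
      (fun z hz => (h.continuous_volK_apply z x
        (h.jostTerm_spec (hsub hz) n).1).aestronglyMeasurable) ?_ ?_
    · filter_upwards [ae_restrict_mem measurableSet_Ioi] with y hy z hz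
      exact h.norm_volK_jostTerm_le (hsub hz) n le_rfl (le_of_lt hy)
    · refine Eventually.of_forall fun y => ?_
      have h1 := ih y
      have h2 := differentiableOn_osc_lamOf h.pos (x - y)
      have h3 : DifferentiableOn ℂ (fun z : ℂ => Complex.I * (q0 : ℂ) ^ 2 / z)
        (outerLowerInt q0) := (differentiableOn_const _).div differentiableOn_id hne
      simp only [volK_apply, offG_apply, bgA_apply]
      fun_prop

theorem continuousOn_jostM (h : Background q0 a d) (x : ℝ) :
    ContinuousOn (fun z => jostM q0 a d x z) (outerLower q0) :=
  continuousOn_tsum (fun n => h.continuousOn_jostTerm n x)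
    (summable_bound (Real.exp (2 * volTail q0 d x x)))
    fun n _ hz => h.jostTerm_bound hz n le_rfl

theorem differentiableOn_jostM (h : Background q0 a d) (x : ℝ) :
    DifferentiableOn ℂ (fun z => jostM q0 a d x z) (outerLowerInt q0) := by
  have hs := outerLowerInt_subset h.pos
  have hb := summable_bound (Real.exp (2 * volTail q0 d x x))
  have ho := isOpen_outerLowerInt q0
  have h1 := Complex.differentiableOn_tsum_of_summable_norm hb
    (fun n => (h.differentiableOn_jostTerm n x).fst) ho
    fun n z hz => (norm_fst_le _).trans (h.jostTerm_bound (hs hz) n le_rfl)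
  have h2 := Complex.differentiableOn_tsum_of_summable_norm hb
    (fun n => (h.differentiableOn_jostTerm n x).snd) ho
    fun n z hz => (norm_snd_le _).trans (h.jostTerm_bound (hs hz) n le_rfl)
  refine (h1.prodMk h2).congr fun z hz => ?_
  have hsum := h.summable_jostTerm (hs hz) x
  refine Prod.ext ?_ ?_
  · exact (ContinuousLinearMap.fst ℂ ℂ ℂ).map_tsum hsum
  · exact (ContinuousLinearMap.snd ℂ ℂ ℂ).map_tsum hsum

end Background

end IfoNLS

/-! ### The Jost column for large `z` -/

namespace IfoNLS

namespace Background

variable {q0 : ℝ} {a : ℂ} {d : ℝ → ℂ}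

/-- The filter of neighbourhoods of infinity in the closed region `outerLower`. -/
noncomputable def _root_.IfoNLS.atInfty (q0 : ℝ) : Filter ℂ :=
  Bornology.cobounded ℂ ⊓ 𝓟 (outerLower q0)

instance _root_.IfoNLS.atInfty_isCountablyGenerated (q0 : ℝ) :
    (atInfty q0).IsCountablyGenerated := by
  unfold atInfty
  rw [← comap_norm_atTop]
  infer_instance

theorem _root_.IfoNLS.mem_outerLower_atInfty (q0 : ℝ) : ∀ᶠ z in atInfty q0, z ∈ outerLower q0 :=
  mem_inf_of_right (mem_principal_self _)

theorem _root_.IfoNLS.tendsto_inv_atInfty (q0 : ℝ) :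
    Tendsto (fun z : ℂ => z⁻¹) (atInfty q0) (𝓝 0) :=
  tendsto_inv₀_cobounded.mono_left inf_le_left

theorem tendsto_lamOf_atInfty (h : Background q0 a d) :
    Tendsto (lamOf q0) (atInfty q0) (Bornology.cobounded ℂ ⊓ 𝓟 {l | l.im ≤ 0}) := by
  refine tendsto_inf.2 ⟨?_, tendsto_principal.2 ?_⟩
  · rw [← tendsto_norm_atTop_iff_cobounded]
    have h1 : Tendsto (fun z : ℂ => (‖z‖ - q0) / 2) (atInfty q0) atTop :=
      ((tendsto_atTop_add_const_right _ (-q0) (tendsto_norm_cobounded_atTop.mono_left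
        inf_le_left)).atTop_div_const two_pos)
    refine tendsto_atTop_mono' _ ?_ h1
    filter_upwards [mem_outerLower_atInfty q0] with z hz
    have hz0 : 0 < ‖z‖ := h.pos.trans_le hz.1
    unfold lamOf
    rw [norm_div, Complex.norm_ofNat]
    have h3 : ‖(q0 : ℂ) ^ 2 / z‖ ≤ q0 := by
      rw [norm_div, norm_pow, Complex.norm_real, Real.norm_eq_abs, sq_abs, div_le_iff₀ hz0]
      nlinarith [hz.1, h.pos]
    have h4 := norm_sub_le_norm_add z ((q0 : ℂ) ^ 2 / z)
    linarith
  · filter_upwards [mem_outerLower_atInfty q0] with z hz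
    exact lamOf_im_nonpos h.pos hz.1 hz.2.1

theorem tendsto_osc_atInfty (h : Background q0 a d) {s : ℝ} (hs : s ≤ 0) :
    Tendsto (fun z => osc (lamOf q0 z) s) (atInfty q0) (𝓝 0) := by
  have h1 : Tendsto (fun z => 1 / ‖lamOf q0 z‖) (atInfty q0) (𝓝 0) := by
    simp only [one_div]
    exact tendsto_inv_atTop_zero.comp (tendsto_norm_cobounded_atTop.comp
      ((tendsto_lamOf_atInfty h).mono_right inf_le_left))
  refine squeeze_zero_norm' ?_ h1
  filter_upwards [mem_outerLower_atInfty q0] with z hz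
  exact norm_osc_le_inv (lamOf_ne_zero_of_mem h.pos hz) (lamOf_im_nonpos h.pos hz.1 hz.2.1) hs

theorem tendsto_colE_atInfty (a : ℂ) : Tendsto (colE a) (atInfty q0) (𝓝 (1, 0)) := by
  unfold colE
  refine tendsto_const_nhds.prodMk_nhds ?_
  have := ((tendsto_inv_atInfty q0).const_mul (Complex.I * conj a)).neg
  simpa [div_eq_mul_inv] using this

/-- The second component of `1 + osc(s) A` at large `z`: multiplication by `exp (2 i λ s)`. -/
theorem tendsto_osc_mul_atInfty (h : Background q0 a d) {s : ℝ} (hs : s ≤ 0) :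
    Tendsto (fun z => 1 + osc (lamOf q0 z) s * (Complex.I * z)
      - Complex.exp (2 * Complex.I * lamOf q0 z * s)) (atInfty q0) (𝓝 0) := by
  have h1 : Tendsto (fun z : ℂ => (1 + (q0 : ℂ) ^ 2 * z⁻¹ * z⁻¹)⁻¹ - 1) (atInfty q0) (𝓝 0) := by
    have h2 := (((tendsto_inv_atInfty q0).const_mul ((q0 : ℂ) ^ 2)).mul
      (tendsto_inv_atInfty q0)).const_add 1
    simp only [mul_zero, add_zero] at h2
    simpa using (h2.inv₀ one_ne_zero).sub_const 1
  have h3 : Tendsto (fun z : ℂ => ‖(1 + (q0 : ℂ) ^ 2 * z⁻¹ * z⁻¹)⁻¹ - 1‖ * 2) (atInfty q0)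
      (𝓝 0) := by
    simpa using h1.norm.mul_const 2
  refine squeeze_zero_norm' ?_ h3
  filter_upwards [mem_outerLower_atInfty q0] with z hz
  have hz0 := ne_zero_of_le_norm h.pos hz.1
  have hl := lamOf_ne_zero_of_mem h.pos hz
  set E := Complex.exp (2 * Complex.I * lamOf q0 z * s) with hE
  have hE1 : ‖E - 1‖ ≤ 2 := by
    refine (norm_sub_le _ _).trans ?_
    have := norm_exp_two_I_mul_le (lamOf_im_nonpos h.pos hz.1 hz.2.1) hs
    rw [norm_one]; linarith
  have h4 : (1 + (q0 : ℂ) ^ 2 * z⁻¹ * z⁻¹)⁻¹ = z / (2 * lamOf q0 z) := by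
    have h5 : 2 * lamOf q0 z = z * (1 + (q0 : ℂ) ^ 2 * z⁻¹ * z⁻¹) := by
      unfold lamOf; field_simp
    rw [h5]
    have h6 : (1 + (q0 : ℂ) ^ 2 * z⁻¹ * z⁻¹) ≠ 0 := by
      intro h7; rw [h7, mul_zero] at h5; simp [hl] at h5
    rw [div_mul_cancel_left₀ hz0]
  have h8 : 1 + osc (lamOf q0 z) s * (Complex.I * z) - E
      = ((1 + (q0 : ℂ) ^ 2 * z⁻¹ * z⁻¹)⁻¹ - 1) * (E - 1) := by
    rw [h4]
    have : osc (lamOf q0 z) s = (E - 1) / (2 * Complex.I * lamOf q0 z) := rfl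
    rw [this]
    field_simp
    ring
  rw [h8, norm_mul]
  exact mul_le_mul_of_nonneg_left hE1 (norm_nonneg _)

theorem tendsto_jostTerm_one (h : Background q0 a d) (x : ℝ) :
    Tendsto (fun z => jostTerm q0 a d 1 x z) (atInfty q0) (𝓝 0) := by
  have hdi : ∀ x, IntegrableOn (fun y => ‖d y‖) (Set.Ioi x) := by
    intro x
    refine integrableOn_Ioi_of_continuous (c := 0) h.cont.norm ?_ x
    refine h.int.mono' h.cont.norm.aestronglyMeasurable (Eventually.of_forall fun y => ?_)
    rw [norm_norm]
    exact le_mul_of_one_le_left (norm_nonneg _) (by linarith [abs_nonneg y])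
  have hcd : Continuous fun y => -conj (d y) := (Complex.continuous_conj.comp h.cont).neg
  have hdc : IntegrableOn (fun y => -conj (d y)) (Set.Ioi x) :=
    (hdi x).mono' hcd.aestronglyMeasurable (Eventually.of_forall fun y => by simp)
  -- the oscillating part
  have hRL := (riemannLebesgue_Ioi hdc).comp (tendsto_lamOf_atInfty h)
  set W : ℂ → ℝ → ℂ × ℂ := fun z y =>
    (0, Complex.exp (2 * Complex.I * lamOf q0 z * ((x - y : ℝ) : ℂ)) * -conj (d y)) with hW
  have hWc : ∀ z, Continuous (W z) := fun z =>
    continuous_const.prodMk ((by fun_prop : Continuous fun y : ℝ =>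
      Complex.exp (2 * Complex.I * lamOf q0 z * ((x - y : ℝ) : ℂ))).mul hcd)
  have hWb : ∀ z ∈ outerLower q0, ∀ y ∈ Set.Ioi x, ‖W z y‖ ≤ ‖d y‖ := by
    intro z hz y hy
    have := norm_exp_two_I_mul_le (lamOf_im_nonpos h.pos hz.1 hz.2.1) (s := x - y)
      (by have := Set.mem_Ioi.1 hy; linarith)
    rw [hW, Prod.norm_def]
    simp only [norm_zero, norm_mul, norm_neg, RCLike.norm_conj]
    exact max_le (norm_nonneg _) (mul_le_of_le_one_left (norm_nonneg _) this)
  have hWi : ∀ z ∈ outerLower q0, IntegrableOn (W z) (Set.Ioi x) := fun z hz =>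
    (hdi x).mono' (hWc z).aestronglyMeasurable (by
      filter_upwards [ae_restrict_mem measurableSet_Ioi] with y hy using hWb z hz y hy)
  have hWlim : Tendsto (fun z => ∫ y in Set.Ioi x, W z y) (atInfty q0) (𝓝 0) := by
    have h1 : Tendsto (fun z => ((0 : ℂ), ∫ y in Set.Ioi x, Complex.exp
        (2 * Complex.I * lamOf q0 z * ((x - y : ℝ) : ℂ)) * -conj (d y))) (atInfty q0)
        (𝓝 ((0 : ℂ), (0 : ℂ))) := tendsto_const_nhds.prodMk_nhds hRL
    refine h1.congr' ?_
    filter_upwards [mem_outerLower_atInfty q0] with z hz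
    refine Prod.ext ?_ ?_
    · rw [fst_integral (hWi z hz)]; simp [hW]
    · rw [snd_integral (hWi z hz)]
  -- the remainder tends to zero by dominated convergence
  have hKc : ∀ z, Continuous fun y => volK q0 a z (x - y) (d y) (colE a z) := fun z =>
    h.continuous_volK_apply z x continuous_const
  have hKb : ∀ z ∈ outerLower q0, ∀ y ∈ Set.Ioi x,
      ‖volK q0 a z (x - y) (d y) (colE a z)‖ ≤ volW q0 d x y := by
    intro z hz y hy
    refine (h.norm_volK_le_volW hz le_rfl (le_of_lt hy) _).trans ?_
    exact mul_le_of_le_one_right (h.volW_nonneg x y) (norm_colE_le h.pos h.norm_a hz.1)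
  have hrem : Tendsto (fun z => ∫ y in Set.Ioi x,
      (volK q0 a z (x - y) (d y) (colE a z) - W z y)) (atInfty q0) (𝓝 0) := by
    rw [← integral_zero ℝ (ℂ × ℂ) (μ := volume.restrict (Set.Ioi x))]
    refine tendsto_integral_filter_of_dominated_convergence
      (fun y => volW q0 d x y + ‖d y‖)
      (Eventually.of_forall fun z => ((hKc z).sub (hWc z)).aestronglyMeasurable) ?_
      ((h.integrableOn_volW x x).add (hdi x)) ?_
    · filter_upwards [mem_outerLower_atInfty q0] with z hz
      filter_upwards [ae_restrict_mem measurableSet_Ioi] with y hy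
      exact (norm_sub_le _ _).trans (add_le_add (hKb z hz y hy) (hWb z hz y hy))
    · filter_upwards [ae_restrict_mem measurableSet_Ioi] with y hy
      have hs : x - y ≤ 0 := by have := Set.mem_Ioi.1 hy; linarith
      have l1 := tendsto_osc_atInfty h hs
      have l2 := tendsto_osc_mul_atInfty h hs
      have l3 : Tendsto (fun z => -(Complex.I * conj a / z)) (atInfty q0) (𝓝 0) := by
        have := ((tendsto_inv_atInfty q0).const_mul (Complex.I * conj a)).neg
        simpa [div_eq_mul_inv] using this
      have l4 : Tendsto (fun z => Complex.I * (q0 : ℂ) ^ 2 / z) (atInfty q0) (𝓝 0) := by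
        simpa [div_eq_mul_inv] using (tendsto_inv_atInfty q0).const_mul (Complex.I * (q0 : ℂ) ^ 2)
      have c1 := (l3.const_mul (d y)).add (l1.mul
        ((l4.mul (l3.const_mul (d y))).add (tendsto_const_nhds (x := a * -conj (d y)))))
      have c2 := (l2.const_mul (-conj (d y))).add
        (l1.mul (l3.const_mul (-conj a * d y)))
      simp only [mul_zero, zero_mul, add_zero, zero_add] at c1 c2
      refine (c1.prodMk_nhds c2).congr fun z => ?_
      simp only [volK_apply, offG_apply, bgA_apply, colE, hW]
      refine Prod.ext ?_ ?_
      · simp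
      · simp only [Prod.snd_add, Prod.smul_snd, Prod.snd_sub, smul_eq_mul]
        ring
  have hsum := (hrem.add hWlim).neg
  simp only [add_zero, neg_zero] at hsum
  refine hsum.congr' ?_
  filter_upwards [mem_outerLower_atInfty q0] with z hz
  have hKi : IntegrableOn (fun y => volK q0 a z (x - y) (d y) (colE a z)) (Set.Ioi x) :=
    (h.integrableOn_volW x x).mono' (hKc z).aestronglyMeasurable (by
      filter_upwards [ae_restrict_mem measurableSet_Ioi] with y hy using hKb z hz y hy)
  rw [integral_sub hKi (hWi z hz), sub_add_cancel]
  rfl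

theorem tendsto_jostTerm_succ (h : Background q0 a d) (n : ℕ) :
    ∀ x, Tendsto (fun z => jostTerm q0 a d (n + 1) x z) (atInfty q0) (𝓝 0) := by
  induction n with
  | zero => exact fun x => h.tendsto_jostTerm_one x
  | succ n ih =>
    intro x
    have key : Tendsto (fun z => ∫ y in Set.Ioi x,
        volK q0 a z (x - y) (d y) (jostTerm q0 a d (n + 1) y z)) (atInfty q0) (𝓝 0) := by
      rw [← integral_zero ℝ (ℂ × ℂ) (μ := volume.restrict (Set.Ioi x))]
      refine tendsto_integral_filter_of_dominated_convergence
        (fun y => (volW q0 d x y * Real.exp (2 * volTail q0 d x y)) / 2 ^ (n + 1)) ?_ ?_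
        ((h.integrableOn_volW_exp x x).1.div_const _) ?_
      · filter_upwards [mem_outerLower_atInfty q0] with z hz
        exact (h.continuous_volK_apply z x (h.jostTerm_spec hz (n + 1)).1).aestronglyMeasurable
      · filter_upwards [mem_outerLower_atInfty q0] with z hz
        filter_upwards [ae_restrict_mem measurableSet_Ioi] with y hy
        exact h.norm_volK_jostTerm_le hz _ le_rfl (le_of_lt hy)
      · filter_upwards [ae_restrict_mem measurableSet_Ioi] with y hy
        have h1 := ((ih y).norm.const_mul (volW q0 d x y))
        rw [norm_zero, mul_zero] at h1
        refine squeeze_zero_norm' ?_ h1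
        filter_upwards [mem_outerLower_atInfty q0] with z hz
        exact h.norm_volK_le_volW hz le_rfl (le_of_lt hy) _
    have := key.neg
    rw [neg_zero] at this
    exact this

theorem tendsto_jostM_atInfty (h : Background q0 a d) (x : ℝ) :
    Tendsto (fun z => jostM q0 a d x z) (atInfty q0) (𝓝 (1, 0)) := by
  have h1 : Tendsto (fun z => ∑' n, jostTerm q0 a d n x z) (atInfty q0)
      (𝓝 (∑' n : ℕ, if n = 0 then ((1 : ℂ), (0 : ℂ)) else 0)) := by
    refine tendsto_tsum_of_dominated_convergence
      (summable_bound (Real.exp (2 * volTail q0 d x x))) (fun n => ?_) ?_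
    · cases n with
      | zero => simpa [jostTerm] using tendsto_colE_atInfty a
      | succ n => simpa using h.tendsto_jostTerm_succ n x
    · filter_upwards [mem_outerLower_atInfty q0] with z hz n
      exact h.jostTerm_bound hz n le_rfl
  rwa [tsum_ite_eq] at h1

/-- Along the negative imaginary axis the Jost column converges at the rate `1/Y`. -/
theorem norm_jostM_sub_le (h : Background q0 a d) {D : ℝ} (hD : ∀ y, 0 ≤ y → ‖d y‖ ≤ D) :
    ∃ C, ∀ Y : ℝ, 2 * q0 ≤ Y → ‖jostM q0 a d 0 (-(Complex.I * Y)) - (1, 0)‖ ≤ C / Y := by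
  have hq := h.pos
  have hdi : ∀ x, IntegrableOn (fun y => ‖d y‖) (Set.Ioi x) := by
    intro x
    refine integrableOn_Ioi_of_continuous (c := 0) h.cont.norm ?_ x
    refine h.int.mono' h.cont.norm.aestronglyMeasurable (Eventually.of_forall fun y => ?_)
    rw [norm_norm]
    exact le_mul_of_one_le_left (norm_nonneg _) (by linarith [abs_nonneg y])
  have hD0 : 0 ≤ D := (norm_nonneg _).trans (hD 0 le_rfl)
  set M := 2 * Real.exp (2 * volTail q0 d 0 0) with hMdef
  have hM0 : 0 ≤ M := by positivity
  set J := ∫ y in Set.Ioi 0, ‖d y‖ with hJ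
  have hJ0 : 0 ≤ J := integral_nonneg fun y => norm_nonneg _
  set C2 := q0 + 4 * D * M + 3 * q0 * M * J with hC2
  have hC20 : 0 ≤ C2 := by positivity
  refine ⟨max C2 ((C2 + 4 * q0 * M) * J), fun Y hY => ?_⟩
  have hY0 : 0 < Y := by linarith
  set z : ℂ := -(Complex.I * Y) with hz
  have hzn : ‖z‖ = Y := by simp [hz, abs_of_pos hY0]
  have hzo : z ∈ outerLower q0 := by
    refine outerLowerInt_subset hq ⟨by rw [hzn]; linarith, ?_⟩
    simp [hz, hY0]
  have hz0 : z ≠ 0 := ne_zero_of_le_norm hq hzo.1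
  have hl0 := lamOf_ne_zero_of_mem hq hzo
  have hm : ∀ y, 0 ≤ y → ‖jostM q0 a d y z‖ ≤ M := fun y hy => h.norm_jostM_le hzo hy
  -- on the negative imaginary axis `2 i λ` is the positive number `η`
  set η : ℝ := Y - q0 ^ 2 / Y with hη
  have hηY : Y / 2 ≤ η := by
    have : q0 ^ 2 / Y ≤ Y / 2 := by rw [div_le_iff₀ hY0]; nlinarith
    linarith
  have hη0 : 0 < η := by linarith
  have hlam : 2 * Complex.I * lamOf q0 z = (η : ℂ) := by
    have hYc : (Y : ℂ) ≠ 0 := by exact_mod_cast hY0.ne'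
    simp only [lamOf, hz, hη]
    push_cast
    field_simp
    linear_combination (-(Y : ℂ) ^ 2) * Complex.I_sq
  have hη0c : (η : ℂ) ≠ 0 := by exact_mod_cast hη0.ne'
  have hIz : Complex.I * z = (Y : ℂ) := by
    rw [hz]; linear_combination (-(Y : ℂ)) * Complex.I_sq
  have hosc : ∀ s : ℝ, osc (lamOf q0 z) s = ((Real.exp (η * s) - 1) / η : ℝ) := by
    intro s
    unfold osc
    rw [hlam]; push_cast; ring
  have hoscb : ∀ s : ℝ, s ≤ 0 → ‖osc (lamOf q0 z) s‖ ≤ 2 / Y := by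
    intro s hs
    have h1 : Real.exp (η * s) ≤ 1 := Real.exp_le_one_iff.2 (by nlinarith)
    have h2 := Real.exp_pos (η * s)
    rw [hosc, Complex.norm_real, Real.norm_eq_abs, abs_div, abs_of_pos hη0,
      abs_of_nonpos (by linarith), div_le_div_iff₀ hη0 hY0]
    nlinarith
  have hYη : Y / η - 1 ≤ q0 / Y := by
    have : Y / η - 1 = q0 ^ 2 / Y / η := by
      rw [show q0 ^ 2 / Y = Y - η by rw [hη]; ring]
      field_simp
    rw [this, div_div, div_le_div_iff₀ (by positivity) hY0]
    nlinarith [mul_nonneg (by positivity : 0 ≤ q0 * Y) (by linarith : 0 ≤ η - q0)]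
  have hYη1 : 1 ≤ Y / η := by
    rw [one_le_div hη0, hη]
    have : 0 ≤ q0 ^ 2 / Y := by positivity
    linarith
  have hYη2 : Y / η ≤ 2 := by rw [div_le_iff₀ hη0]; linarith
  have hfac : ∀ s : ℝ, s ≤ 0 → ‖1 + osc (lamOf q0 z) s * (Complex.I * z)‖
      ≤ 2 * Real.exp (η * s) + q0 / Y := by
    intro s hs
    have h2 := Real.exp_pos (η * s)
    have : 1 + osc (lamOf q0 z) s * (Complex.I * z)
        = ((Real.exp (η * s) * (Y / η) - (Y / η - 1) : ℝ) : ℂ) := by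
      rw [hosc, hIz]; push_cast; field_simp; ring
    rw [this, Complex.norm_real, Real.norm_eq_abs]
    refine (abs_sub _ _).trans ?_
    rw [abs_of_nonneg (by positivity), abs_of_nonneg (by linarith)]
    nlinarith
  have hki : ∀ x, 0 ≤ x → IntegrableOn
      (fun y => volK q0 a z (x - y) (d y) (jostM q0 a d y z)) (Set.Ioi x) := by
    intro x hx
    refine ((h.integrableOn_volW 0 x).mul_const M).mono'
      (h.continuous_volK_apply z x (h.continuous_jostM hzo)).aestronglyMeasurable ?_
    filter_upwards [ae_restrict_mem measurableSet_Ioi] with y hy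
    have hxy : x ≤ y := le_of_lt hy
    exact (h.norm_volK_le_volW hzo hx hxy _).trans
      (mul_le_mul_of_nonneg_left (hm y (hx.trans hxy)) (h.volW_nonneg 0 y))
  have hJx : ∀ x, 0 ≤ x → ∫ y in Set.Ioi x, ‖d y‖ ≤ J := fun x hx =>
    setIntegral_mono_set (hdi 0) (Eventually.of_forall fun y => norm_nonneg _)
      (Set.Ioi_subset_Ioi hx).eventuallyLE
  have hinv : ‖-(Complex.I * conj a / z)‖ ≤ q0 / Y := by
    rw [norm_neg, norm_div, norm_mul, Complex.norm_I, one_mul, RCLike.norm_conj, h.norm_a, hzn]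
  -- the second component
  have hsec : ∀ x, 0 ≤ x → ‖(jostM q0 a d x z).2‖ ≤ C2 / Y := by
    intro x hx
    have hei : IntegrableOn (fun y => Real.exp (-η * y)) (Set.Ioi x) :=
      integrableOn_exp_mul_Ioi (by linarith) x
    have hexp : ∫ y in Set.Ioi x, Real.exp (η * x) * Real.exp (-η * y) = 1 / η := by
      rw [integral_const_mul, integral_exp_mul_Ioi (by linarith), neg_mul, Real.exp_neg]
      have := (Real.exp_pos (η * x)).ne'
      field_simp
    have hb1 : IntegrableOn (fun y => (2 * D * M) * (Real.exp (η * x) * Real.exp (-η * y)))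
      (Set.Ioi x) := (hei.const_mul _).const_mul _
    have hb2 : IntegrableOn (fun y => (3 * q0 / Y * M) * ‖d y‖) (Set.Ioi x) :=
      (hdi x).const_mul _
    have hint : ‖∫ y in Set.Ioi x, (volK q0 a z (x - y) (d y) (jostM q0 a d y z)).2‖
        ≤ ∫ y in Set.Ioi x, ((2 * D * M) * (Real.exp (η * x) * Real.exp (-η * y))
          + (3 * q0 / Y * M) * ‖d y‖) := by
      refine norm_integral_le_of_norm_le (hb1.add hb2) ?_
      filter_upwards [ae_restrict_mem measurableSet_Ioi] with y hy
      have hxy : x < y := hy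
      have hy0 : 0 ≤ y := hx.trans hxy.le
      have hs : x - y ≤ 0 := by linarith
      set m := jostM q0 a d y z with hmdef
      have hm1 : ‖m.1‖ ≤ M := (norm_fst_le m).trans (hm y hy0)
      have hm2 : ‖m.2‖ ≤ M := (norm_snd_le m).trans (hm y hy0)
      have e1 : (volK q0 a z (x - y) (d y) m).2
          = (-conj (d y) * m.1) * (1 + osc (lamOf q0 z) (x - y) * (Complex.I * z))
            + osc (lamOf q0 z) (x - y) * (-conj a * (d y * m.2)) := by
        simp only [volK_apply, offG_apply, bgA_apply, Prod.snd_add, Prod.smul_snd, smul_eq_mul]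
        ring
      have hE : Real.exp (η * (x - y)) = Real.exp (η * x) * Real.exp (-η * y) := by
        rw [← Real.exp_add]; congr 1; ring
      have f1 := hfac (x - y) hs
      have f2 := hoscb (x - y) hs
      rw [hE] at f1
      have hEp : 0 ≤ Real.exp (η * x) * Real.exp (-η * y) := by positivity
      rw [e1]
      calc _ ≤ (‖d y‖ * ‖m.1‖) * ‖1 + osc (lamOf q0 z) (x - y) * (Complex.I * z)‖
            + ‖osc (lamOf q0 z) (x - y)‖ * (q0 * (‖d y‖ * ‖m.2‖)) := by
            refine (norm_add_le _ _).trans (le_of_eq ?_)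
            simp only [norm_mul, norm_neg, RCLike.norm_conj, h.norm_a]
        _ ≤ (‖d y‖ * M) * (2 * (Real.exp (η * x) * Real.exp (-η * y)) + q0 / Y)
            + 2 / Y * (q0 * (‖d y‖ * M)) := by gcongr
        _ = (2 * (Real.exp (η * x) * Real.exp (-η * y))) * M * ‖d y‖
            + (3 * q0 / Y * M) * ‖d y‖ := by ring
        _ ≤ (2 * (Real.exp (η * x) * Real.exp (-η * y))) * M * D
            + (3 * q0 / Y * M) * ‖d y‖ := by
            have := hD y hy0
            gcongr
        _ = _ := by ring
    have hval : ∫ y in Set.Ioi x, ((2 * D * M) * (Real.exp (η * x) * Real.exp (-η * y))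
          + (3 * q0 / Y * M) * ‖d y‖) ≤ (4 * D * M + 3 * q0 * M * J) / Y := by
      rw [integral_add hb1 hb2, integral_const_mul, hexp, integral_const_mul]
      have h1 : 1 / η ≤ 2 / Y := by rw [div_le_div_iff₀ hη0 hY0]; linarith
      calc _ ≤ 2 * D * M * (2 / Y) + 3 * q0 / Y * M * J := by
            have := hJx x hx
            gcongr
        _ = _ := by ring
    have h2 : (jostM q0 a d x z).2 = -(Complex.I * conj a / z)
        - ∫ y in Set.Ioi x, (volK q0 a z (x - y) (d y) (jostM q0 a d y z)).2 := by
      rw [h.jostM_eq hzo x, Prod.snd_sub, snd_integral (hki x hx)]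
      rfl
    rw [h2]
    calc _ ≤ _ := norm_sub_le _ _
      _ ≤ q0 / Y + (4 * D * M + 3 * q0 * M * J) / Y := add_le_add hinv (hint.trans hval)
      _ = C2 / Y := by rw [hC2]; ring
  -- the first component
  have hfst : ‖(jostM q0 a d 0 z).1 - 1‖ ≤ (C2 + 4 * q0 * M) * J / Y := by
    have h2 : (jostM q0 a d 0 z).1 - 1
        = -∫ y in Set.Ioi 0, (volK q0 a z (0 - y) (d y) (jostM q0 a d y z)).1 := by
      nth_rewrite 1 [h.jostM_eq hzo 0]
      rw [Prod.fst_sub, fst_integral (hki 0 le_rfl)]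
      simp [colE]
    rw [h2, norm_neg]
    have h3 : (C2 + 4 * q0 * M) * J / Y
        = ∫ y in Set.Ioi 0, ((C2 + 4 * q0 * M) / Y) * ‖d y‖ := by
      rw [integral_const_mul]; ring
    rw [h3]
    refine norm_integral_le_of_norm_le ((hdi 0).const_mul _) ?_
    filter_upwards [ae_restrict_mem measurableSet_Ioi] with y hy
    have hy0 : 0 ≤ y := le_of_lt hy
    have hs : 0 - y ≤ 0 := by linarith
    set m := jostM q0 a d y z with hmdef
    have hm1 : ‖m.1‖ ≤ M := (norm_fst_le m).trans (hm y hy0)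
    have hm2 : ‖m.2‖ ≤ M := (norm_snd_le m).trans (hm y hy0)
    have hm3 : ‖m.2‖ ≤ C2 / Y := hsec y hy0
    have f2 := hoscb (0 - y) hs
    have hb : ‖Complex.I * (q0 : ℂ) ^ 2 / z‖ ≤ q0 := by
      rw [norm_div, norm_mul, Complex.norm_I, one_mul, norm_pow, Complex.norm_real,
        Real.norm_eq_abs, sq_abs, hzn, div_le_iff₀ hY0]
      nlinarith
    have e1 : (volK q0 a z (0 - y) (d y) m).1 = d y * m.2 + osc (lamOf q0 z) (0 - y)
        * (Complex.I * (q0 : ℂ) ^ 2 / z * (d y * m.2) + a * (-conj (d y) * m.1)) := by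
      simp only [volK_apply, offG_apply, bgA_apply, Prod.fst_add, Prod.smul_fst, smul_eq_mul]
    rw [e1]
    calc _ ≤ ‖d y‖ * ‖m.2‖ + ‖osc (lamOf q0 z) (0 - y)‖
          * (‖Complex.I * (q0 : ℂ) ^ 2 / z‖ * (‖d y‖ * ‖m.2‖) + q0 * (‖d y‖ * ‖m.1‖)) := by
          refine (norm_add_le _ _).trans (add_le_add (norm_mul _ _).le ?_)
          rw [norm_mul]
          refine mul_le_mul_of_nonneg_left ((norm_add_le _ _).trans (le_of_eq ?_)) (norm_nonneg _)
          simp only [norm_mul, norm_neg, RCLike.norm_conj, h.norm_a]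
      _ ≤ ‖d y‖ * (C2 / Y) + 2 / Y * (q0 * (‖d y‖ * M) + q0 * (‖d y‖ * M)) := by gcongr
      _ = _ := by ring
  rw [Prod.norm_def, Prod.fst_sub, Prod.snd_sub, sub_zero]
  refine max_le (hfst.trans ?_) ((hsec 0 le_rfl).trans ?_)
  · exact div_le_div_of_nonneg_right (le_max_right _ _) hY0.le
  · exact div_le_div_of_nonneg_right (le_max_left _ _) hY0.le

end Background

end IfoNLS

/-! ### Jost columns: existence, uniqueness, symmetries -/

namespace IfoNLS

/-- The standing assumptions on the potential at the time `t`. -/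
structure Potential (q0 : ℝ) (q : ℝ → ℝ → ℂ) (qp qm : ℂ) (t : ℝ) : Prop where
  pos : 0 < q0
  norm_qp : ‖qp‖ = q0
  norm_qm : ‖qm‖ = q0
  cont : Continuous fun x => q x t
  lim_qp : Tendsto (fun x => q x t) atTop (𝓝 qp)
  lim_qm : Tendsto (fun x => q x t) atBot (𝓝 qm)
  dec_qp : IntegrableOn (fun x : ℝ => ((1 + |x| : ℝ) : ℂ) * (q x t - qp)) (Set.Ici 0)
  dec_qm : IntegrableOn (fun x : ℝ => ((1 + |x| : ℝ) : ℂ) * (q x t - qm)) (Set.Iic 0)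

/-- The closure of `D⁻` without the origin and the branch points. -/
def closedDMinus (q0 : ℝ) : Set ℂ :=
  {z | z ≠ 0 ∧ z ≠ Complex.I * q0 ∧ z ≠ -(Complex.I * q0) ∧ (‖z‖ ^ 2 - q0 ^ 2) * z.im ≤ 0}

/-- The antiholomorphic involution `z ↦ -q₀² / z*`, which exchanges the two components of `D⁻`. -/
noncomputable def hatConj (q0 : ℝ) (z : ℂ) : ℂ := -((q0 : ℂ) ^ 2 / conj z)

theorem norm_hatConj (q0 : ℝ) (z : ℂ) : ‖hatConj q0 z‖ = q0 ^ 2 / ‖z‖ := by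
  rw [hatConj, norm_neg, norm_div, RCLike.norm_conj, norm_pow, Complex.norm_real, Real.norm_eq_abs,
    sq_abs]

theorem hatConj_im (q0 : ℝ) (z : ℂ) : (hatConj q0 z).im = -(q0 ^ 2 * z.im / ‖z‖ ^ 2) := by
  rw [hatConj, Complex.neg_im, ← Complex.normSq_eq_norm_sq, Complex.div_im, ← Complex.ofReal_pow,
    Complex.ofReal_im, Complex.ofReal_re, Complex.normSq_conj, Complex.conj_im]
  ring

theorem hatConj_hatConj {q0 : ℝ} (hq0 : 0 < q0) {z : ℂ} (hz : z ≠ 0) :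
    hatConj q0 (hatConj q0 z) = z := by
  have hq : (q0 : ℂ) ≠ 0 := by exact_mod_cast hq0.ne'
  simp only [hatConj, map_neg, map_div₀, Complex.conj_conj, map_pow, Complex.conj_ofReal]
  field_simp

theorem hatConj_ne_zero {q0 : ℝ} (hq0 : 0 < q0) {z : ℂ} (hz : z ≠ 0) : hatConj q0 z ≠ 0 := by
  have hq : (q0 : ℂ) ≠ 0 := by exact_mod_cast hq0.ne'
  have hz' : conj z ≠ 0 := (map_ne_zero _).2 hz
  simp [hatConj, hq, hz]

theorem hatConj_I (q0 : ℝ) (hq0 : 0 < q0) :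
    hatConj q0 (Complex.I * q0) = -(Complex.I * q0) := by
  have hq : (q0 : ℂ) ≠ 0 := by exact_mod_cast hq0.ne'
  have hI := Complex.I_ne_zero
  simp only [hatConj, map_mul, Complex.conj_I, Complex.conj_ofReal]
  field_simp
  simp

theorem hatConj_mem {q0 : ℝ} (hq0 : 0 < q0) {z : ℂ} (hz : z ∈ closedDMinus q0) :
    hatConj q0 z ∈ closedDMinus q0 := by
  obtain ⟨h0, h1, h2, h3⟩ := hz
  have hI := hatConj_I q0 hq0
  have hI' : hatConj q0 (-(Complex.I * q0)) = Complex.I * q0 := by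
    rw [← hI]
    refine hatConj_hatConj hq0 ?_
    simp [hq0.ne']
  refine ⟨hatConj_ne_zero hq0 h0, fun h => h2 ?_, fun h => h1 ?_, ?_⟩
  · rw [← hatConj_hatConj hq0 h0, h, hI]
  · rw [← hatConj_hatConj hq0 h0, h, hI']
  · rw [norm_hatConj, hatConj_im]
    have hn : 0 < ‖z‖ := norm_pos_iff.2 h0
    have : ((q0 ^ 2 / ‖z‖) ^ 2 - q0 ^ 2) * -(q0 ^ 2 * z.im / ‖z‖ ^ 2)
        = ((‖z‖ ^ 2 - q0 ^ 2) * z.im) * (q0 ^ 4 / ‖z‖ ^ 4) := by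
      field_simp; ring
    rw [this]
    exact mul_nonpos_of_nonpos_of_nonneg h3 (by positivity)

theorem outerLower_subset {q0 : ℝ} (hq0 : 0 < q0) : outerLower q0 ⊆ closedDMinus q0 := by
  rintro z ⟨h1, h2, h3⟩
  refine ⟨ne_zero_of_le_norm hq0 h1, ?_, h3, ?_⟩
  · rintro rfl
    simp at h2
    linarith
  · refine mul_nonpos_of_nonneg_of_nonpos ?_ h2
    have := pow_le_pow_left₀ hq0.le h1 2
    linarith

/-- A point of `closedDMinus` lies in `outerLower`, or its image under the involution does. -/
theorem mem_outerLower_or {q0 : ℝ} (hq0 : 0 < q0) {z : ℂ} (hz : z ∈ closedDMinus q0) :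
    z ∈ outerLower q0 ∨ (‖z‖ ≤ q0 ∧ 0 ≤ z.im ∧ hatConj q0 z ∈ outerLower q0) := by
  have hm := hatConj_mem hq0 hz
  obtain ⟨h0, h1, h2, h3⟩ := hz
  have hn : 0 < ‖z‖ := norm_pos_iff.2 h0
  by_cases hc : q0 ≤ ‖z‖ ∧ z.im ≤ 0
  · exact Or.inl ⟨hc.1, hc.2, h2⟩
  · right
    have h4 : ‖z‖ ≤ q0 ∧ 0 ≤ z.im := by
      rcases lt_trichotomy ‖z‖ q0 with h | h | h
      · refine ⟨h.le, ?_⟩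
        by_contra hi
        push Not at hi
        have := mul_pos_of_neg_of_neg (by nlinarith : ‖z‖ ^ 2 - q0 ^ 2 < 0) hi
        linarith
      · refine ⟨h.le, ?_⟩
        by_contra hi
        exact hc ⟨h.ge, by linarith⟩
      · exfalso
        refine hc ⟨h.le, ?_⟩
        by_contra hi
        push Not at hi
        have := mul_pos (by nlinarith : 0 < ‖z‖ ^ 2 - q0 ^ 2) hi
        linarith
    refine ⟨h4.1, h4.2, ?_, ?_, hm.2.2.1⟩
    · rw [norm_hatConj, le_div_iff₀ hn]
      nlinarith [h4.1]
    · rw [hatConj_im]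
      have : 0 ≤ q0 ^ 2 * z.im / ‖z‖ ^ 2 := by have := h4.2; positivity
      linarith

theorem lamOf_im_nonpos_of_mem {q0 : ℝ} {z : ℂ} (hz : z ∈ closedDMinus q0) :
    (lamOf q0 z).im ≤ 0 := by
  obtain ⟨h0, -, -, h3⟩ := hz
  have hn : 0 < ‖z‖ := norm_pos_iff.2 h0
  rw [lamOf_im]
  have : z.im * (1 - q0 ^ 2 / ‖z‖ ^ 2) / 2 = ((‖z‖ ^ 2 - q0 ^ 2) * z.im) / (2 * ‖z‖ ^ 2) := by
    field_simp
  rw [this]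
  exact div_nonpos_of_nonpos_of_nonneg h3 (by positivity)

theorem lamOf_conj (q0 : ℝ) (z : ℂ) : lamOf q0 (conj z) = conj (lamOf q0 z) := by
  simp [lamOf, map_ofNat]

theorem kOf_conj (q0 : ℝ) (z : ℂ) : kOf q0 (conj z) = conj (kOf q0 z) := by
  simp [kOf, map_ofNat]

theorem theta_conj (ε q0 x t : ℝ) (z : ℂ) : theta ε q0 x t (conj z) = conj (theta ε q0 x t z) := by
  simp [theta, lamOf_conj, kOf_conj, map_ofNat]

theorem gam_conj (q0 : ℝ) (z : ℂ) : gam q0 (conj z) = conj (gam q0 z) := by simp [gam]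

theorem lamOf_hat {q0 : ℝ} (hq0 : 0 < q0) {z : ℂ} (hz : z ≠ 0) :
    lamOf q0 (-((q0 : ℂ) ^ 2 / z)) = -lamOf q0 z := by
  have hq : (q0 : ℂ) ≠ 0 := by exact_mod_cast hq0.ne'
  simp only [lamOf]; field_simp; ring

theorem kOf_hat {q0 : ℝ} (hq0 : 0 < q0) {z : ℂ} (hz : z ≠ 0) :
    kOf q0 (-((q0 : ℂ) ^ 2 / z)) = kOf q0 z := by
  have hq : (q0 : ℂ) ≠ 0 := by exact_mod_cast hq0.ne'
  simp only [kOf]; field_simp; ring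

theorem theta_hat (ε : ℝ) {q0 : ℝ} (hq0 : 0 < q0) (x t : ℝ) {z : ℂ} (hz : z ≠ 0) :
    theta ε q0 x t (-((q0 : ℂ) ^ 2 / z)) = -theta ε q0 x t z := by
  simp [theta, lamOf_hat hq0 hz, kOf_hat hq0 hz]

/-- The phase splits as `θ(x) = λ x + θ(0)`. -/
theorem theta_eq (ε q0 x t : ℝ) (z : ℂ) :
    theta ε q0 x t z = lamOf q0 z * x + theta ε q0 0 t z := by
  simp only [theta]; push_cast; ring

theorem gam_ne_zero {q0 : ℝ} {z : ℂ} (h0 : z ≠ 0) (h1 : z ≠ Complex.I * q0)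
    (h2 : z ≠ -(Complex.I * q0)) : gam q0 z ≠ 0 := by
  unfold gam
  intro h
  have h3 : (z - Complex.I * q0) * (z + Complex.I * q0) = 0 := by
    field_simp at h
    linear_combination h - (q0 : ℂ) ^ 2 * Complex.I_sq
  rcases mul_eq_zero.1 h3 with h4 | h4
  · exact h1 (sub_eq_zero.1 h4)
  · exact h2 (eq_neg_of_add_eq_zero_left h4)

/-- `φ` solves the scattering problem `φ_x = U φ`. -/
def IsSol (q0 : ℝ) (q : ℝ → ℝ → ℂ) (t : ℝ) (z : ℂ) (φ : ℝ → Fin 2 → ℂ) : Prop :=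
  ∀ x, HasDerivAt φ ((laxU (kOf q0 z) (q x t)).mulVec (φ x)) x

theorem isSol_iff {q0 : ℝ} {q : ℝ → ℝ → ℂ} {t : ℝ} {z : ℂ} {φ : ℝ → Fin 2 → ℂ} :
    IsSol q0 q t z φ ↔ ∀ x, HasDerivAt (fun x => φ x 0)
      (-(Complex.I * kOf q0 z) * φ x 0 + q x t * φ x 1) x ∧ HasDerivAt (fun x => φ x 1)
      (-conj (q x t) * φ x 0 + Complex.I * kOf q0 z * φ x 1) x := by
  unfold IsSol
  refine forall_congr' fun x => ?_
  rw [hasDerivAt_pi, Fin.forall_fin_two]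
  simp [laxU, Matrix.mulVec, dotProduct]

theorem wr_const {q0 : ℝ} {q : ℝ → ℝ → ℂ} {t : ℝ} {z : ℂ} {φ ψ : ℝ → Fin 2 → ℂ}
    (hφ : IsSol q0 q t z φ) (hψ : IsSol q0 q t z ψ) (x y : ℝ) :
    wr (φ x) (ψ x) = wr (φ y) (ψ y) := by
  rw [isSol_iff] at hφ hψ
  have h : ∀ x, HasDerivAt (fun x => wr (φ x) (ψ x)) 0 x := by
    intro x
    have h1 := ((hφ x).1.mul (hψ x).2).sub ((hφ x).2.mul (hψ x).1)
    refine h1.congr_deriv ?_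
    ring
  exact is_const_of_deriv_eq_zero (fun x => (h x).differentiableAt) (fun x => (h x).deriv) x y

theorem IsSol.sub {q0 : ℝ} {q : ℝ → ℝ → ℂ} {t : ℝ} {z : ℂ} {φ ψ : ℝ → Fin 2 → ℂ}
    (hφ : IsSol q0 q t z φ) (hψ : IsSol q0 q t z ψ) : IsSol q0 q t z (φ - ψ) := fun x => by
  have := (hφ x).sub (hψ x)
  rw [← Matrix.mulVec_sub] at this
  exact this

theorem IsSol.smul {q0 : ℝ} {q : ℝ → ℝ → ℂ} {t : ℝ} {z : ℂ} {φ : ℝ → Fin 2 → ℂ} (c : ℂ)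
    (hφ : IsSol q0 q t z φ) : IsSol q0 q t z (c • φ) := fun x => by
  have := (hφ x).const_smul c
  rw [← Matrix.mulVec_smul] at this
  exact this

theorem wr_smul_smul (c : ℂ) (u v : Fin 2 → ℂ) : wr (c • u) (c • v) = c ^ 2 * wr u v := by
  simp [wr]; ring

namespace Potential

variable {q0 : ℝ} {q : ℝ → ℝ → ℂ} {qp qm : ℂ} {t : ℝ}

theorem exists_bound (h : Potential q0 q qp qm t) : ∃ B : ℝ, 0 ≤ B ∧ ∀ x, ‖q x t‖ ≤ B := by
  obtain ⟨a, ha⟩ := eventually_atTop.1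
    ((h.lim_qp.norm).eventually_le_const (show ‖qp‖ < ‖qp‖ + 1 by linarith))
  obtain ⟨b, hb⟩ := eventually_atBot.1
    ((h.lim_qm.norm).eventually_le_const (show ‖qm‖ < ‖qm‖ + 1 by linarith))
  obtain ⟨C, hC⟩ := isCompact_Icc.exists_bound_of_continuousOn (s := Set.Icc b a) h.cont.continuousOn
  refine ⟨max (q0 + 1) C, le_max_of_le_left (by linarith [h.pos]), fun x => ?_⟩
  rcases le_total a x with h1 | h1
  · exact (ha x h1).trans (by rw [h.norm_qp]; exact le_max_left _ _)
  rcases le_total x b with h2 | h2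
  · exact (hb x h2).trans (by rw [h.norm_qm]; exact le_max_left _ _)
  · exact (hC x ⟨h2, h1⟩).trans (le_max_right _ _)

theorem sol_unique (h : Potential q0 q qp qm t) {z : ℂ} {φ ψ : ℝ → Fin 2 → ℂ}
    (hφ : IsSol q0 q t z φ) (hψ : IsSol q0 q t z ψ) {x₀ : ℝ} (he : φ x₀ = ψ x₀) : φ = ψ := by
  obtain ⟨B, hB0, hB⟩ := h.exists_bound
  have hLip : ∀ x, LipschitzOnWith (Real.toNNReal (‖kOf q0 z‖ + B))
      (fun u : Fin 2 → ℂ => (laxU (kOf q0 z) (q x t)).mulVec u) Set.univ := by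
    intro x
    refine LipschitzOnWith.of_dist_le_mul fun u _ v _ => ?_
    rw [Real.coe_toNNReal _ (by positivity), dist_eq_norm, dist_eq_norm, ← Matrix.mulVec_sub]
    set w := u - v
    have h0 := norm_le_pi_norm w 0
    have h1 := norm_le_pi_norm w 1
    have hx := hB x
    refine (pi_norm_le_iff_of_nonneg (by positivity)).2 ?_
    rw [Fin.forall_fin_two]
    have e0 : (laxU (kOf q0 z) (q x t)).mulVec w 0
        = -(Complex.I * kOf q0 z) * w 0 + q x t * w 1 := by simp [laxU, Matrix.mulVec, dotProduct]
    have e1 : (laxU (kOf q0 z) (q x t)).mulVec w 1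
        = -conj (q x t) * w 0 + Complex.I * kOf q0 z * w 1 := by
      simp [laxU, Matrix.mulVec, dotProduct]
    rw [e0, e1]
    constructor
    · calc _ ≤ ‖kOf q0 z‖ * ‖w 0‖ + ‖q x t‖ * ‖w 1‖ := by
            refine (norm_add_le _ _).trans (le_of_eq ?_)
            simp
        _ ≤ ‖kOf q0 z‖ * ‖w‖ + B * ‖w‖ := by gcongr
        _ = _ := by ring
    · calc _ ≤ ‖q x t‖ * ‖w 0‖ + ‖kOf q0 z‖ * ‖w 1‖ := by
            refine (norm_add_le _ _).trans (le_of_eq ?_)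
            simp
        _ ≤ B * ‖w‖ + ‖kOf q0 z‖ * ‖w‖ := by gcongr
        _ = _ := by ring
  exact ODE_solution_unique_univ hLip (fun x => ⟨hφ x, Set.mem_univ _⟩)
    (fun x => ⟨hψ x, Set.mem_univ _⟩) he

/-- Jost columns are unique as soon as the exponential that normalizes them does not decay: the
Wronskian of the column with a difference of two columns is constant and tends to zero. -/
theorem jostColumn_unique (h : Potential q0 q qp qm t) {ε : ℝ} {l : Filter ℝ} [l.NeBot]
    {qa z : ℂ} {j : Fin 2}
    (hl : ∀ᶠ x : ℝ in l, 0 ≤ (sgn3 j * Complex.I * (lamOf q0 z * (x : ℂ))).re)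
    {φ ψ : ℝ → Fin 2 → ℂ} (hφ : IsJostColumn ε q0 q t l qa z j φ)
    (hψ : IsJostColumn ε q0 q t l qa z j ψ) : φ = ψ := by
  have hsφ : IsSol q0 q t z φ := hφ.1
  have hsD : IsSol q0 q t z (φ - ψ) := IsSol.sub hφ.1 hψ.1
  set e : ℝ → ℂ := fun x => Complex.exp (sgn3 j * Complex.I * theta ε q0 x t z) with he
  have hD : Tendsto (fun x => e x • (φ - ψ) x) l (𝓝 0) := by
    have := hφ.2.sub hψ.2
    rw [sub_self] at this
    refine this.congr fun x => ?_
    simp only [Pi.sub_apply, smul_sub, he]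
  have hφl : Tendsto (fun x => e x • φ x) l (𝓝 (fun i => eigE qa z i j)) := hφ.2
  have hE : eigE qa z j j = 1 := by fin_cases j <;> simp [eigE]
  -- the Wronskian vanishes
  have hw : ∀ x, wr (φ x) ((φ - ψ) x) = 0 := by
    have h1 : Tendsto (fun x => e x ^ 2 * wr (φ 0) ((φ - ψ) 0)) l (𝓝 0) := by
      have h2 : Tendsto (fun x => wr (e x • φ x) (e x • (φ - ψ) x)) l (𝓝 0) := by
        have a0 := (tendsto_pi_nhds.1 hφl 0).mul (tendsto_pi_nhds.1 hD 1)
        have a1 := (tendsto_pi_nhds.1 hφl 1).mul (tendsto_pi_nhds.1 hD 0)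
        have := a0.sub a1
        simpa [wr] using this
      refine h2.congr fun x => ?_
      rw [wr_smul_smul, wr_const hsφ hsD x 0]
    set C : ℝ := Real.exp (2 * (sgn3 j * Complex.I * theta ε q0 0 t z).re) with hC
    have hlow : ∀ᶠ x in l, C * ‖wr (φ 0) ((φ - ψ) 0)‖ ≤ ‖e x ^ 2 * wr (φ 0) ((φ - ψ) 0)‖ := by
      filter_upwards [hl] with x hx
      rw [norm_mul]
      refine mul_le_mul_of_nonneg_right ?_ (norm_nonneg _)
      rw [norm_pow, he]
      simp only
      rw [Complex.norm_exp, ← Real.exp_nat_mul, hC]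
      refine Real.exp_le_exp.2 ?_
      rw [theta_eq ε q0 x t z, mul_add, Complex.add_re]
      push_cast
      linarith
    have h3 : C * ‖wr (φ 0) ((φ - ψ) 0)‖ ≤ 0 := by
      refine le_of_tendsto_of_tendsto tendsto_const_nhds ?_ hlow
      simpa using h1.norm
    have hCpos : 0 < C := Real.exp_pos _
    have h4 : ‖wr (φ 0) ((φ - ψ) 0)‖ = 0 := by
      have := norm_nonneg (wr (φ 0) ((φ - ψ) 0))
      nlinarith
    intro x
    rw [wr_const hsφ hsD x 0]
    exact norm_eq_zero.1 h4
  -- hence the difference is a multiple of the column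
  obtain ⟨x₀, hx₀⟩ : ∃ x, φ x j ≠ 0 := by
    have h5 : ∀ᶠ x in l, (e x • φ x) j ≠ 0 :=
      (tendsto_pi_nhds.1 hφl j).eventually_ne (by rw [hE]; exact one_ne_zero)
    obtain ⟨x, hx⟩ := h5.exists
    exact ⟨x, fun h6 => hx (by simp [h6])⟩
  obtain ⟨r, hr⟩ : ∃ r : ℂ, (φ - ψ) x₀ = (r • φ) x₀ := by
    refine ⟨(φ - ψ) x₀ j / φ x₀ j, ?_⟩
    have h6 := hw x₀
    unfold wr at h6
    funext i
    simp only [Pi.smul_apply, smul_eq_mul]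
    fin_cases j <;> fin_cases i <;> simp only [Fin.zero_eta, Fin.mk_one] at hx₀ ⊢ <;>
      field_simp <;> first | linear_combination h6 | linear_combination -h6
  have hall := h.sol_unique hsD (hsφ.smul r) hr
  have hr0 : r = 0 := by
    have h7 : Tendsto (fun x => (e x • (φ - ψ) x) j) l (𝓝 (r * 1)) := by
      have h8 := (tendsto_pi_nhds.1 hφl j).const_mul r
      rw [hE] at h8
      refine h8.congr fun x => ?_
      rw [hall]
      simp only [Pi.smul_apply, smul_eq_mul]
      ring
    have := tendsto_nhds_unique h7 (tendsto_pi_nhds.1 hD j)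
    simpa using this
  rw [hr0, zero_smul] at hall
  exact sub_eq_zero.1 hall

/-- The growth condition of `jostColumn_unique` for the two columns attached to `D⁻`. -/
theorem growth_top {z : ℂ} (hz : (lamOf q0 z).im ≤ 0) :
    ∀ᶠ x : ℝ in atTop, 0 ≤ (sgn3 0 * Complex.I * (lamOf q0 z * (x : ℂ))).re := by
  filter_upwards [eventually_ge_atTop 0] with x hx
  simp [sgn3]
  nlinarith

theorem growth_bot {z : ℂ} (hz : (lamOf q0 z).im ≤ 0) :
    ∀ᶠ x : ℝ in atBot, 0 ≤ (sgn3 1 * Complex.I * (lamOf q0 z * (x : ℂ))).re := by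
  filter_upwards [eventually_le_atBot 0] with x hx
  simp [sgn3]
  nlinarith

theorem growth_top' {z : ℂ} (hz : 0 ≤ (lamOf q0 z).im) :
    ∀ᶠ x : ℝ in atTop, 0 ≤ (sgn3 1 * Complex.I * (lamOf q0 z * (x : ℂ))).re := by
  filter_upwards [eventually_ge_atTop 0] with x hx
  simp [sgn3]
  nlinarith

theorem growth_bot' {z : ℂ} (hz : 0 ≤ (lamOf q0 z).im) :
    ∀ᶠ x : ℝ in atBot, 0 ≤ (sgn3 0 * Complex.I * (lamOf q0 z * (x : ℂ))).re := by
  filter_upwards [eventually_le_atBot 0] with x hx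
  simp [sgn3]
  nlinarith

theorem _root_.IfoNLS.jost_spec {ε : ℝ} {l : Filter ℝ} {qa z : ℂ} {j : Fin 2}
    {φ : ℝ → Fin 2 → ℂ} (hφ : IsJostColumn ε q0 q t l qa z j φ) :
    IsJostColumn ε q0 q t l qa z j (jost ε q0 q t l qa z j) := by
  have hex : ∃ φ, IsJostColumn ε q0 q t l qa z j φ := ⟨φ, hφ⟩
  unfold jost
  rw [dif_pos hex]
  exact hex.choose_spec

theorem jost_eq (h : Potential q0 q qp qm t) {ε : ℝ} {l : Filter ℝ} [l.NeBot] {qa z : ℂ}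
    {j : Fin 2} (hl : ∀ᶠ x : ℝ in l, 0 ≤ (sgn3 j * Complex.I * (lamOf q0 z * (x : ℂ))).re)
    {φ : ℝ → Fin 2 → ℂ} (hφ : IsJostColumn ε q0 q t l qa z j φ) :
    jost ε q0 q t l qa z j = φ :=
  h.jostColumn_unique hl (jost_spec hφ) hφ

/-- The right half-line problem of the potential. -/
theorem backgroundRight (h : Potential q0 q qp qm t) :
    Background q0 qp fun x => q x t - qp where
  pos := h.pos
  norm_a := h.norm_qp
  cont := h.cont.sub continuous_const
  int := by
    refine (h.dec_qp.mono_set Set.Ioi_subset_Ici_self).norm.congr (Eventually.of_forall fun y => ?_)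
    simp only [norm_mul, Complex.norm_real, Real.norm_eq_abs]
    rw [abs_of_nonneg (by positivity)]

/-- The left half-line problem, reflected to the right half-line. -/
theorem backgroundLeft (h : Potential q0 q qp qm t) :
    Background q0 (conj qm) fun x => conj (q (-x) t - qm) where
  pos := h.pos
  norm_a := by rw [RCLike.norm_conj, h.norm_qm]
  cont := Complex.continuous_conj.comp ((h.cont.comp continuous_neg).sub continuous_const)
  int := by
    have h1 := (h.dec_qm.mono_set Set.Iio_subset_Iic_self).norm
    have h2 : IntegrableOn (fun x : ℝ => ‖((1 + |(-x)| : ℝ) : ℂ) * (q (-x) t - qm)‖)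
        (Set.Ioi 0) := by
      have := (Measure.measurePreserving_neg (volume : Measure ℝ)).integrableOn_comp_preimage
        (Homeomorph.neg ℝ).measurableEmbedding (f := fun x : ℝ =>
          ‖((1 + |x| : ℝ) : ℂ) * (q x t - qm)‖) (s := Set.Iio 0)
      have h3 := this.2 h1
      simpa [Function.comp_def] using h3
    refine h2.congr (Eventually.of_forall fun y => ?_)
    simp only [norm_mul, Complex.norm_real, Real.norm_eq_abs, RCLike.norm_conj, abs_neg]
    rw [abs_of_nonneg (by positivity)]

theorem hasDerivAt_exp_theta (ε q0 t : ℝ) (z c : ℂ) (x : ℝ) :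
    HasDerivAt (fun x : ℝ => Complex.exp (c * theta ε q0 x t z))
      (Complex.exp (c * theta ε q0 x t z) * (c * lamOf q0 z)) x := by
  have h1 : HasDerivAt (fun x : ℝ => c * theta ε q0 x t z) (c * lamOf q0 z) x := by
    have h2 : (fun x : ℝ => c * theta ε q0 x t z)
        = fun x : ℝ => c * (lamOf q0 z * x + theta ε q0 0 t z) := by
      funext x; rw [theta_eq]
    rw [h2]
    have h3 : HasDerivAt (fun s : ℝ => lamOf q0 z * (s : ℂ)) (lamOf q0 z * 1) x :=
      (Complex.ofRealCLM.hasDerivAt (x := x)).const_mul _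
    rw [mul_one] at h3
    exact (h3.add_const _).const_mul c
  exact h1.cexp

theorem isJostColumn_right (h : Potential q0 q qp qm t) (ε : ℝ) {z : ℂ} (hz : z ∈ outerLower q0) :
    IsJostColumn ε q0 q t atTop qp z 0 (fun x => Complex.exp (-Complex.I * theta ε q0 x t z) •
      ![(jostM q0 qp (fun x => q x t - qp) x z).1, (jostM q0 qp (fun x => q x t - qp) x z).2]) := by
  have hb := h.backgroundRight
  have hz0 := ne_zero_of_le_norm h.pos hz.1
  constructor
  · refine isSol_iff.2 fun x => ?_
    have hm := hb.hasDerivAt_jostM hz x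
    have he := hasDerivAt_exp_theta ε q0 t z (-Complex.I) x
    have h1 := he.mul hm.fst
    have h2 := he.mul hm.snd
    simp only [bgA_apply, offG_apply, Prod.fst_add, Prod.snd_add] at h1 h2
    simp only [Pi.smul_apply, smul_eq_mul, Matrix.cons_val_zero, Matrix.cons_val_one]
    constructor
    · refine h1.congr_deriv ?_
      simp only [lamOf, kOf]
      field_simp
      ring
    · refine h2.congr_deriv ?_
      simp only [lamOf, kOf, map_sub]
      field_simp
      ring
  · have hl := hb.tendsto_jostM_atTop hz
    rw [tendsto_pi_nhds, Fin.forall_fin_two]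
    have hE : ∀ x, Complex.exp (sgn3 0 * Complex.I * theta ε q0 x t z)
        * Complex.exp (-Complex.I * theta ε q0 x t z) = 1 := fun x => by
      rw [← Complex.exp_add]; simp [sgn3]
    constructor
    · refine ((continuous_fst.tendsto _).comp hl).congr fun x => ?_
      simp only [Pi.smul_apply, smul_eq_mul, Matrix.cons_val_zero, Function.comp]
      rw [← mul_assoc, hE, one_mul]
    · refine ((continuous_snd.tendsto _).comp hl).congr fun x => ?_
      simp only [Pi.smul_apply, smul_eq_mul, Matrix.cons_val_one, Function.comp]
      rw [← mul_assoc, hE, one_mul]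
      rfl

theorem isJostColumn_left (h : Potential q0 q qp qm t) (ε : ℝ) {z : ℂ} (hz : z ∈ outerLower q0) :
    IsJostColumn ε q0 q t atBot qm z 1 (fun x => Complex.exp (Complex.I * theta ε q0 x t z) •
      ![(jostM q0 (conj qm) (fun x => conj (q (-x) t - qm)) (-x) z).2,
        (jostM q0 (conj qm) (fun x => conj (q (-x) t - qm)) (-x) z).1]) := by
  have hb := h.backgroundLeft
  have hz0 := ne_zero_of_le_norm h.pos hz.1
  constructor
  · refine isSol_iff.2 fun x => ?_
    have hm := (hb.hasDerivAt_jostM hz (-x)).scomp x (hasDerivAt_neg x)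
    have he := hasDerivAt_exp_theta ε q0 t z Complex.I x
    have h1 := he.mul hm.fst
    have h2 := he.mul hm.snd
    simp only [bgA_apply, offG_apply, Prod.fst_add, Prod.snd_add, neg_smul, one_smul,
      Function.comp_apply, Prod.fst_neg, Prod.snd_neg, neg_neg, Complex.conj_conj] at h1 h2
    simp only [Pi.smul_apply, smul_eq_mul, Matrix.cons_val_zero, Matrix.cons_val_one]
    constructor
    · refine h2.congr_deriv ?_
      simp only [lamOf, kOf]
      field_simp
      ring
    · refine h1.congr_deriv ?_
      simp only [lamOf, kOf, map_sub]
      field_simp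
      ring
  · have hl := (hb.tendsto_jostM_atTop hz).comp tendsto_neg_atBot_atTop
    rw [tendsto_pi_nhds, Fin.forall_fin_two]
    have hE : ∀ x, Complex.exp (sgn3 1 * Complex.I * theta ε q0 x t z)
        * Complex.exp (Complex.I * theta ε q0 x t z) = 1 := fun x => by
      rw [← Complex.exp_add]; simp [sgn3]
    constructor
    · have := (continuous_snd.tendsto _).comp hl
      simp only [colE, Complex.conj_conj] at this
      refine this.congr fun x => ?_
      simp only [Pi.smul_apply, smul_eq_mul, Matrix.cons_val_zero, Function.comp]
      rw [← mul_assoc, hE, one_mul]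
    · refine ((continuous_fst.tendsto _).comp hl).congr fun x => ?_
      simp only [Pi.smul_apply, smul_eq_mul, Matrix.cons_val_one, Function.comp]
      rw [← mul_assoc, hE, one_mul]
      rfl

end Potential

end IfoNLS

/-! ### Symmetries of the Jost columns and the scattering coefficients -/

namespace IfoNLS

theorem IsJostColumn.conj_zero {ε q0 : ℝ} {q : ℝ → ℝ → ℂ} {t : ℝ} {l : Filter ℝ} {qa z : ℂ}
    {φ : ℝ → Fin 2 → ℂ} (h : IsJostColumn ε q0 q t l qa z 0 φ) :
    IsJostColumn ε q0 q t l qa (conj z) 1 fun x => ![-conj (φ x 1), conj (φ x 0)] := by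
  have h1 := isSol_iff.1 h.1
  constructor
  · refine isSol_iff.2 fun x => ?_
    simp only [Matrix.cons_val_zero, Matrix.cons_val_one]
    constructor
    · refine (h1 x).2.star.fun_neg.congr_deriv ?_
      simp [kOf_conj]
    · refine (h1 x).1.star.congr_deriv ?_
      simp [kOf_conj]; ring
  · have h2 := tendsto_pi_nhds.1 h.2
    rw [tendsto_pi_nhds, Fin.forall_fin_two]
    constructor
    · have h3 := ((Complex.continuous_conj.tendsto _).comp (h2 1)).neg
      have e : eigE qa (conj z) 0 1 = -conj (eigE qa z 1 0) := by simp [eigE]; ring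
      rw [e]
      refine h3.congr fun x => ?_
      simp [sgn3, ← Complex.exp_conj, theta_conj]
    · have h3 := ((Complex.continuous_conj.tendsto _).comp (h2 0))
      have e : eigE qa (conj z) 1 1 = conj (eigE qa z 0 0) := by simp [eigE]
      rw [e]
      refine h3.congr fun x => ?_
      simp [sgn3, ← Complex.exp_conj, theta_conj]

theorem IsJostColumn.conj_one {ε q0 : ℝ} {q : ℝ → ℝ → ℂ} {t : ℝ} {l : Filter ℝ} {qa z : ℂ}
    {φ : ℝ → Fin 2 → ℂ} (h : IsJostColumn ε q0 q t l qa z 1 φ) :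
    IsJostColumn ε q0 q t l qa (conj z) 0 fun x => ![conj (φ x 1), -conj (φ x 0)] := by
  have h1 := isSol_iff.1 h.1
  constructor
  · refine isSol_iff.2 fun x => ?_
    simp only [Matrix.cons_val_zero, Matrix.cons_val_one]
    constructor
    · refine (h1 x).2.star.congr_deriv ?_
      simp [kOf_conj]; ring
    · refine (h1 x).1.star.fun_neg.congr_deriv ?_
      simp [kOf_conj]
  · have h2 := tendsto_pi_nhds.1 h.2
    rw [tendsto_pi_nhds, Fin.forall_fin_two]
    constructor
    · have h3 := ((Complex.continuous_conj.tendsto _).comp (h2 1))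
      have e : eigE qa (conj z) 0 0 = conj (eigE qa z 1 1) := by simp [eigE]
      rw [e]
      refine h3.congr fun x => ?_
      simp [sgn3, ← Complex.exp_conj, theta_conj]
    · have h3 := ((Complex.continuous_conj.tendsto _).comp (h2 0)).neg
      have e : eigE qa (conj z) 1 0 = -conj (eigE qa z 0 1) := by simp [eigE]; ring
      rw [e]
      refine h3.congr fun x => ?_
      simp [sgn3, ← Complex.exp_conj, theta_conj]

/-- The involution `z ↦ -q₀²/z` exchanges the columns of the Jost solutions. -/
theorem IsJostColumn.hat_zero {ε q0 : ℝ} (hq0 : 0 < q0) {q : ℝ → ℝ → ℂ} {t : ℝ} {l : Filter ℝ}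
    {qa z : ℂ} (hqa : ‖qa‖ = q0) (hz : z ≠ 0) {φ : ℝ → Fin 2 → ℂ}
    (h : IsJostColumn ε q0 q t l qa z 0 φ) :
    IsJostColumn ε q0 q t l qa (-((q0 : ℂ) ^ 2 / z)) 1
      ((Complex.I * qa * z / (q0 : ℂ) ^ 2) • φ) := by
  have hq : (q0 : ℂ) ≠ 0 := by exact_mod_cast hq0.ne'
  have hn : qa * conj qa = (q0 : ℂ) ^ 2 := by rw [Complex.mul_conj, Complex.normSq_eq_norm_sq, hqa]; simp
  constructor
  · have := IsSol.smul (Complex.I * qa * z / (q0 : ℂ) ^ 2) h.1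
    intro x
    rw [kOf_hat hq0 hz]
    exact this x
  · have h3 := h.2.const_smul (Complex.I * qa * z / (q0 : ℂ) ^ 2)
    have e : (Complex.I * qa * z / (q0 : ℂ) ^ 2) • (fun i => eigE qa z i 0)
        = fun i => eigE qa (-((q0 : ℂ) ^ 2 / z)) i 1 := by
      funext i
      fin_cases i
      · simp [eigE]; field_simp
      · simp [eigE]; field_simp; rw [mul_assoc, hn]; simp
    rw [e] at h3
    refine h3.congr fun x => ?_
    rw [theta_hat ε hq0 x t hz, Pi.smul_apply, smul_comm]
    simp [sgn3]

theorem IsJostColumn.hat_one {ε q0 : ℝ} (hq0 : 0 < q0) {q : ℝ → ℝ → ℂ} {t : ℝ} {l : Filter ℝ}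
    {qa z : ℂ} (hqa : ‖qa‖ = q0) (hz : z ≠ 0) {φ : ℝ → Fin 2 → ℂ}
    (h : IsJostColumn ε q0 q t l qa z 1 φ) :
    IsJostColumn ε q0 q t l qa (-((q0 : ℂ) ^ 2 / z)) 0
      ((Complex.I * conj qa * z / (q0 : ℂ) ^ 2) • φ) := by
  have hq : (q0 : ℂ) ≠ 0 := by exact_mod_cast hq0.ne'
  have hn : conj qa * qa = (q0 : ℂ) ^ 2 := by
    rw [mul_comm, Complex.mul_conj, Complex.normSq_eq_norm_sq, hqa]; simp
  constructor
  · have := IsSol.smul (Complex.I * conj qa * z / (q0 : ℂ) ^ 2) h.1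
    intro x
    rw [kOf_hat hq0 hz]
    exact this x
  · have h3 := h.2.const_smul (Complex.I * conj qa * z / (q0 : ℂ) ^ 2)
    have e : (Complex.I * conj qa * z / (q0 : ℂ) ^ 2) • (fun i => eigE qa z i 1)
        = fun i => eigE qa (-((q0 : ℂ) ^ 2 / z)) i 0 := by
      funext i
      fin_cases i
      · simp [eigE]; field_simp; rw [mul_assoc, hn]; simp
      · simp [eigE]; field_simp
    rw [e] at h3
    refine h3.congr fun x => ?_
    rw [theta_hat ε hq0 x t hz, Pi.smul_apply, smul_comm]
    simp [sgn3]

theorem conj_hat (q0 : ℝ) (z : ℂ) : conj (-((q0 : ℂ) ^ 2 / z)) = hatConj q0 z := by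
  simp [hatConj]

theorem sigmaReg_subset (q0 : ℝ) : SigmaReg q0 ⊆ closedDMinus q0 := by
  rintro z ⟨h1, h2⟩
  simp only [Set.mem_insert_iff, Set.mem_singleton_iff, not_or] at h2
  refine ⟨h2.1, h2.2.1, h2.2.2, ?_⟩
  rcases h1 with h | h <;> simp [h]

theorem conj_mem_sigmaReg {q0 : ℝ} {z : ℂ} (hz : z ∈ SigmaReg q0) : conj z ∈ SigmaReg q0 := by
  obtain ⟨h1, h2⟩ := hz
  simp only [Set.mem_insert_iff, Set.mem_singleton_iff, not_or] at h2
  refine ⟨?_, ?_⟩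
  · rcases h1 with h | h
    · left; simp [h]
    · right; simpa using h
  · simp only [Set.mem_insert_iff, Set.mem_singleton_iff, not_or]
    refine ⟨(map_ne_zero _).2 h2.1, fun h => h2.2.2 ?_, fun h => h2.2.1 ?_⟩
    · rw [← Complex.conj_conj z, h]; simp
    · rw [← Complex.conj_conj z, h]; simp

theorem dMinus_subset {q0 : ℝ} : DMinus q0 ⊆ closedDMinus q0 := by
  intro z hz
  have hz' : (‖z‖ ^ 2 - q0 ^ 2) * z.im < 0 := hz
  refine ⟨?_, ?_, ?_, hz'.le⟩ <;> rintro rfl <;> simp at hz'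

theorem conj_mem_dMinus {q0 : ℝ} {z : ℂ} (hz : z ∈ DPlus q0) : conj z ∈ DMinus q0 := by
  have hz' : 0 < (‖z‖ ^ 2 - q0 ^ 2) * z.im := hz
  show (‖conj z‖ ^ 2 - q0 ^ 2) * (conj z).im < 0
  rw [RCLike.norm_conj, Complex.conj_im]; linarith

/-- A lower bound for `γ` in terms of the direction of `z`. -/
theorem abs_re_le_norm_gam {q0 : ℝ} (hq0 : 0 < q0) {z : ℂ} (hz : q0 ≤ ‖z‖) :
    |z.re| ≤ 2 * ‖gam q0 z‖ * ‖z‖ := by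
  have hz0 := ne_zero_of_le_norm hq0 hz
  have hn : 0 < ‖z‖ := norm_pos_iff.2 hz0
  have h1 : gam q0 z = (z ^ 2 + (q0 : ℂ) ^ 2) / z ^ 2 := by unfold gam; field_simp
  have h2 : ‖gam q0 z‖ * ‖z‖ ^ 2 = ‖z ^ 2 + (q0 : ℂ) ^ 2‖ := by
    rw [h1, norm_div, norm_pow]; field_simp
  have h3 : ‖z ^ 2 + (q0 : ℂ) ^ 2‖ ^ 2
      = (z.re ^ 2 - z.im ^ 2 + q0 ^ 2) ^ 2 + 4 * z.re ^ 2 * z.im ^ 2 := by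
    rw [← Complex.normSq_eq_norm_sq, Complex.normSq_apply]
    simp [pow_two]; ring
  have h4 : ‖z‖ ^ 2 = z.re ^ 2 + z.im ^ 2 := by
    rw [← Complex.normSq_eq_norm_sq, Complex.normSq_apply]; ring
  have h5 : (|z.re| * ‖z‖) ^ 2 ≤ (2 * ‖z ^ 2 + (q0 : ℂ) ^ 2‖) ^ 2 := by
    rw [mul_pow, mul_pow, h3, h4, sq_abs]
    set x := z.re ^ 2
    set y := z.im ^ 2
    have hx : 0 ≤ x := sq_nonneg _
    have hy : 0 ≤ y := sq_nonneg _
    rcases le_total (2 * y) x with h | h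
    · have : (x / 2) ^ 2 ≤ (x - y + q0 ^ 2) ^ 2 := by
        apply pow_le_pow_left₀ (by positivity)
        nlinarith [sq_nonneg q0]
      nlinarith [mul_nonneg hx hy]
    · nlinarith [mul_nonneg hx hy, sq_nonneg (x - y + q0 ^ 2), mul_nonneg hx (sub_nonneg.2 h)]
  have h6 := abs_le_of_sq_le_sq' h5 (by positivity)
  rw [← h2] at h6
  have : |z.re| * ‖z‖ ≤ (2 * ‖gam q0 z‖ * ‖z‖) * ‖z‖ := by nlinarith [h6.2]
  exact le_of_mul_le_mul_right this hn

namespace Potential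

variable {q0 : ℝ} {q : ℝ → ℝ → ℂ} {qp qm : ℂ} {t : ℝ}

theorem isJostColumn_top (h : Potential q0 q qp qm t) (ε : ℝ) {z : ℂ} (hz : z ∈ closedDMinus q0) :
    IsJostColumn ε q0 q t atTop qp z 0 (jost ε q0 q t atTop qp z 0) := by
  rcases mem_outerLower_or h.pos hz with h1 | ⟨-, -, h1⟩
  · exact jost_spec (h.isJostColumn_right ε h1)
  · have h2 := ((h.isJostColumn_right ε h1).hat_zero h.pos h.norm_qp
      (hatConj_ne_zero h.pos hz.1)).conj_one
    rw [conj_hat, hatConj_hatConj h.pos hz.1] at h2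
    exact jost_spec h2

theorem isJostColumn_bot (h : Potential q0 q qp qm t) (ε : ℝ) {z : ℂ} (hz : z ∈ closedDMinus q0) :
    IsJostColumn ε q0 q t atBot qm z 1 (jost ε q0 q t atBot qm z 1) := by
  rcases mem_outerLower_or h.pos hz with h1 | ⟨-, -, h1⟩
  · exact jost_spec (h.isJostColumn_left ε h1)
  · have h2 := ((h.isJostColumn_left ε h1).hat_one h.pos h.norm_qm
      (hatConj_ne_zero h.pos hz.1)).conj_zero
    rw [conj_hat, hatConj_hatConj h.pos hz.1] at h2
    exact jost_spec h2

theorem jost_top_conj (h : Potential q0 q qp qm t) (ε : ℝ) {z : ℂ} (hz : z ∈ closedDMinus q0) :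
    jost ε q0 q t atTop qp (conj z) 1 = fun x =>
      ![-conj (jost ε q0 q t atTop qp z 0 x 1), conj (jost ε q0 q t atTop qp z 0 x 0)] := by
  refine h.jost_eq (growth_top' ?_) (h.isJostColumn_top ε hz).conj_zero
  rw [lamOf_conj, Complex.conj_im]
  linarith [lamOf_im_nonpos_of_mem hz]

theorem jost_bot_conj (h : Potential q0 q qp qm t) (ε : ℝ) {z : ℂ} (hz : z ∈ closedDMinus q0) :
    jost ε q0 q t atBot qm (conj z) 0 = fun x =>
      ![conj (jost ε q0 q t atBot qm z 1 x 1), -conj (jost ε q0 q t atBot qm z 1 x 0)] := by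
  refine h.jost_eq (growth_bot' ?_) (h.isJostColumn_bot ε hz).conj_one
  rw [lamOf_conj, Complex.conj_im]
  linarith [lamOf_im_nonpos_of_mem hz]

theorem s22_conj (h : Potential q0 q qp qm t) (ε : ℝ) {z : ℂ} (hz : z ∈ closedDMinus q0) :
    s22 ε q0 q qp qm t (conj z) = conj (s11 ε q0 q qp qm t z) := by
  rw [s22, h.jost_top_conj ε hz, h.jost_bot_conj ε hz, s11, gam_conj, map_div₀]
  congr 1
  simp [wr]; ring

theorem s12_eq (h : Potential q0 q qp qm t) (ε : ℝ) {z : ℂ} (hz : z ∈ SigmaReg q0) :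
    s12 ε q0 q qp qm t z = -conj (s21 ε q0 q qp qm t (conj z)) := by
  have h1 := sigmaReg_subset q0 hz
  have h2 := sigmaReg_subset q0 (conj_mem_sigmaReg hz)
  have e1 := h.jost_top_conj ε h2
  have e2 := h.jost_bot_conj ε h1
  rw [Complex.conj_conj] at e1
  rw [s12, s21, e1, e2, gam_conj, map_div₀, Complex.conj_conj, ← neg_div]
  congr 1
  simp [wr]; ring

/-- The two columns of a Jost solution have the Wronskian `γ` of their limits. -/
theorem wr_eq_gam {ε : ℝ} {l : Filter ℝ} [l.NeBot] {qa z : ℂ} (hz : z ≠ 0) (hqa : ‖qa‖ = q0)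
    {φ ψ : ℝ → Fin 2 → ℂ} (hφ : IsJostColumn ε q0 q t l qa z 0 φ)
    (hψ : IsJostColumn ε q0 q t l qa z 1 ψ) (x : ℝ) : wr (φ x) (ψ x) = gam q0 z := by
  have hn : qa * conj qa = (q0 : ℂ) ^ 2 := by rw [Complex.mul_conj, Complex.normSq_eq_norm_sq, hqa]; simp
  have a := tendsto_pi_nhds.1 hφ.2
  have b := tendsto_pi_nhds.1 hψ.2
  have h1 := ((a 0).mul (b 1)).sub ((a 1).mul (b 0))
  have e : eigE qa z 0 0 * eigE qa z 1 1 - eigE qa z 1 0 * eigE qa z 0 1 = gam q0 z := by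
    simp only [eigE, gam, Matrix.of_apply, Matrix.cons_val', Matrix.cons_val_zero,
      Matrix.cons_val_one, Matrix.cons_val_fin_one, ← hn]
    field_simp
    linear_combination (-qa * conj qa) * Complex.I_sq
  rw [e] at h1
  refine tendsto_nhds_unique ?_ h1
  refine tendsto_const_nhds.congr fun y => ?_
  rw [wr_const hφ.1 hψ.1 x y]
  have : Complex.exp (sgn3 0 * Complex.I * theta ε q0 y t z)
      * Complex.exp (sgn3 1 * Complex.I * theta ε q0 y t z) = 1 := by
    rw [← Complex.exp_add]; simp [sgn3]
  simp only [Pi.smul_apply, smul_eq_mul, wr]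
  linear_combination (φ y 1 * ψ y 0 - φ y 0 * ψ y 1) * this

theorem det_scattering (h : Potential q0 q qp qm t) (ε : ℝ) {z : ℂ} (hz : z ∈ SigmaReg q0) :
    s11 ε q0 q qp qm t z * s22 ε q0 q qp qm t z - s12 ε q0 q qp qm t z * s21 ε q0 q qp qm t z
      = 1 := by
  have h1 := sigmaReg_subset q0 hz
  have h2 := sigmaReg_subset q0 (conj_mem_sigmaReg hz)
  have ht : IsJostColumn ε q0 q t atTop qp z 1 (jost ε q0 q t atTop qp z 1) := by
    have := (h.isJostColumn_top ε h2).conj_zero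
    rw [Complex.conj_conj] at this
    exact jost_spec this
  have hb : IsJostColumn ε q0 q t atBot qm z 0 (jost ε q0 q t atBot qm z 0) := by
    have := (h.isJostColumn_bot ε h2).conj_one
    rw [Complex.conj_conj] at this
    exact jost_spec this
  have w1 := wr_eq_gam h1.1 h.norm_qp (h.isJostColumn_top ε h1) ht 0
  have w2 := wr_eq_gam h1.1 h.norm_qm hb (h.isJostColumn_bot ε h1) 0
  have hg := gam_ne_zero h1.1 h1.2.1 h1.2.2.1
  simp only [s11, s12, s21, s22]
  field_simp
  rw [pow_two]
  nth_rw 1 [← w1]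
  rw [← w2]
  simp only [wr]
  ring

/-- By `det S = 1` and the symmetry `z ↦ z*`, the function `1 + ρ ρ*` is given by `s₁₁` alone. -/
theorem onePlusRho_eq (h : Potential q0 q qp qm t) (ε : ℝ)
    (hreg : ∀ ζ ∈ SigmaReg q0, s11 ε q0 q qp qm t ζ ≠ 0) {ζ : ℂ} (hζ : ζ ∈ SigmaReg q0) :
    onePlusRho ε q0 q qp qm t ζ
      = (s11 ε q0 q qp qm t ζ * conj (s11 ε q0 q qp qm t (conj ζ)))⁻¹ := by
  have h2 := conj_mem_sigmaReg hζ
  have e1 := h.det_scattering ε hζ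
  have e2 := h.s22_conj ε (sigmaReg_subset q0 h2)
  rw [Complex.conj_conj] at e2
  rw [h.s12_eq ε hζ, e2] at e1
  have n1 := hreg ζ hζ
  have n2 := (map_ne_zero (starRingEnd ℂ)).2 (hreg _ h2)
  rw [onePlusRho, rho, rho, map_div₀]
  field_simp
  linear_combination e1

/-- On the real axis `det S = 1` reads `|s₁₁|² + |s₂₁|² = 1`. -/
theorem norm_s11_le_one (h : Potential q0 q qp qm t) (ε : ℝ) {z : ℂ} (hz : z ∈ SigmaReg q0)
    (him : z.im = 0) : ‖s11 ε q0 q qp qm t z‖ ≤ 1 := by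
  have hc : conj z = z := Complex.conj_eq_iff_im.2 him
  have e1 := h.det_scattering ε hz
  have e2 := h.s22_conj ε (sigmaReg_subset q0 hz)
  have e3 := h.s12_eq ε hz
  rw [hc] at e2 e3
  rw [e2, e3, Complex.mul_conj, neg_mul, sub_neg_eq_add, mul_comm (conj _), Complex.mul_conj,
    Complex.normSq_eq_norm_sq, Complex.normSq_eq_norm_sq] at e1
  have e4 : ‖s11 ε q0 q qp qm t z‖ ^ 2 + ‖s21 ε q0 q qp qm t z‖ ^ 2 = 1 := by exact_mod_cast e1
  have := sq_nonneg ‖s21 ε q0 q qp qm t z‖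
  nlinarith [norm_nonneg (s11 ε q0 q qp qm t z)]

/-- The relation between the values of `s₁₁` in the two components of `D⁻`; it carries the phase
difference of the boundary values of the potential. -/
theorem s11_hatConj (h : Potential q0 q qp qm t) (ε : ℝ) {z : ℂ} (hz : z ∈ closedDMinus q0) :
    s11 ε q0 q qp qm t (hatConj q0 z) = qm / qp * conj (s11 ε q0 q qp qm t z) := by
  have hz0 := hz.1
  have hq : (q0 : ℂ) ≠ 0 := by exact_mod_cast h.pos.ne'
  have hqp : qp ≠ 0 := by rw [← norm_ne_zero_iff, h.norm_qp]; exact h.pos.ne'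
  have hn : qp * conj qp = (q0 : ℂ) ^ 2 := by
    rw [Complex.mul_conj, Complex.normSq_eq_norm_sq, h.norm_qp]; simp
  have hm := hatConj_mem h.pos hz
  have a1 := ((h.isJostColumn_top ε hz).hat_zero h.pos h.norm_qp hz0).conj_one
  have a2 := ((h.isJostColumn_bot ε hz).hat_one h.pos h.norm_qm hz0).conj_zero
  rw [conj_hat] at a1 a2
  have hlam := lamOf_im_nonpos_of_mem hm
  rw [s11, h.jost_eq (growth_top hlam) a1, h.jost_eq (growth_bot hlam) a2, s11, map_div₀,
    ← gam_conj]
  have hg : gam q0 (hatConj q0 z) = conj z ^ 2 / (q0 : ℂ) ^ 2 * gam q0 (conj z) := by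
    have : conj z ≠ 0 := (map_ne_zero _).2 hz0
    simp only [gam, hatConj]; field_simp
    ring
  have hzc : conj z ≠ 0 := (map_ne_zero _).2 hz0
  have hg0 : gam q0 (conj z) ≠ 0 := by
    rw [gam_conj]; exact (map_ne_zero _).2 (gam_ne_zero hz.1 hz.2.1 hz.2.2.1)
  rw [hg]
  simp only [wr, Pi.smul_apply, smul_eq_mul, map_mul, map_div₀, Complex.conj_I, map_pow,
    Complex.conj_ofReal, Complex.conj_conj, map_sub, Matrix.cons_val_zero, Matrix.cons_val_one]
  have e : conj qp = (q0 : ℂ) ^ 2 / qp := by field_simp; linear_combination hn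
  rw [e]
  field_simp
  linear_combination (-qm * (conj ((jost ε q0 q t atTop qp z 0 0) 0)
      * conj ((jost ε q0 q t atBot qm z 1 0) 1)
    - conj ((jost ε q0 q t atTop qp z 0 0) 1)
      * conj ((jost ε q0 q t atBot qm z 1 0) 0))) * Complex.I_sq

/-- On `outerLower`, the coefficient `s₁₁` in terms of the two modified Jost columns. -/
theorem s11_eq (h : Potential q0 q qp qm t) (ε : ℝ) {z : ℂ} (hz : z ∈ outerLower q0) :
    s11 ε q0 q qp qm t z =
      ((jostM q0 qp (fun x => q x t - qp) 0 z).1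
          * (jostM q0 (conj qm) (fun x => conj (q (-x) t - qm)) 0 z).1
        - (jostM q0 qp (fun x => q x t - qp) 0 z).2
          * (jostM q0 (conj qm) (fun x => conj (q (-x) t - qm)) 0 z).2) / gam q0 z := by
  have hlam := lamOf_im_nonpos_of_mem (outerLower_subset h.pos hz)
  rw [s11, h.jost_eq (growth_top hlam) (h.isJostColumn_right ε hz),
    h.jost_eq (growth_bot hlam) (h.isJostColumn_left ε hz)]
  congr 1
  have : Complex.exp (-Complex.I * theta ε q0 0 t z) * Complex.exp (Complex.I * theta ε q0 0 t z)
      = 1 := by rw [← Complex.exp_add]; simp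
  simp only [wr, Pi.smul_apply, smul_eq_mul, Matrix.cons_val_zero, Matrix.cons_val_one, neg_zero]
  linear_combination ((jostM q0 qp (fun x => q x t - qp) 0 z).1
          * (jostM q0 (conj qm) (fun x => conj (q (-x) t - qm)) 0 z).1
        - (jostM q0 qp (fun x => q x t - qp) 0 z).2
          * (jostM q0 (conj qm) (fun x => conj (q (-x) t - qm)) 0 z).2) * this

theorem continuousOn_gam (hq0 : 0 < q0) : ContinuousOn (gam q0) {z | q0 ≤ ‖z‖} := by
  unfold gam
  refine continuousOn_const.add (continuousOn_const.div (by fun_prop) fun z hz => ?_)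
  exact pow_ne_zero _ (ne_zero_of_le_norm hq0 hz)

theorem continuousOn_s11 (h : Potential q0 q qp qm t) (ε : ℝ) :
    ContinuousOn (s11 ε q0 q qp qm t) (outerLower q0) := by
  have c1 := h.backgroundRight.continuousOn_jostM 0
  have c2 := h.backgroundLeft.continuousOn_jostM 0
  refine ContinuousOn.congr ?_ fun z hz => h.s11_eq ε hz
  refine ContinuousOn.div ((c1.fst.mul c2.fst).sub (c1.snd.mul c2.snd))
    ((continuousOn_gam h.pos).mono fun z hz => hz.1) fun z hz => ?_
  have := outerLower_subset h.pos hz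
  exact gam_ne_zero this.1 this.2.1 this.2.2.1

theorem differentiableOn_s11 (h : Potential q0 q qp qm t) (ε : ℝ) :
    DifferentiableOn ℂ (s11 ε q0 q qp qm t) (outerLowerInt q0) := by
  have c1 := h.backgroundRight.differentiableOn_jostM 0
  have c2 := h.backgroundLeft.differentiableOn_jostM 0
  refine DifferentiableOn.congr ?_ fun z hz => h.s11_eq ε (outerLowerInt_subset h.pos hz)
  refine DifferentiableOn.fun_div ((c1.fst.mul c2.fst).sub (c1.snd.mul c2.snd)) ?_ fun z hz => ?_
  · unfold gam
    refine (differentiableOn_const _).add ((differentiableOn_const _).div (by fun_prop) ?_)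
    intro z hz
    exact pow_ne_zero _ (ne_zero_of_le_norm h.pos hz.1.le)
  · have := outerLower_subset h.pos (outerLowerInt_subset h.pos hz)
    exact gam_ne_zero this.1 this.2.1 this.2.2.1

theorem tendsto_gam_atInfty (q0 : ℝ) : Tendsto (gam q0) (atInfty q0) (𝓝 1) := by
  have h1 := ((tendsto_inv_atInfty q0).pow 2).const_mul ((q0 : ℂ) ^ 2)
  have := h1.const_add 1
  simp only [ne_eq, OfNat.ofNat_ne_zero, not_false_eq_true, zero_pow, mul_zero, add_zero] at this
  refine this.congr fun z => ?_
  simp [gam, div_eq_mul_inv]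

theorem tendsto_s11_atInfty (h : Potential q0 q qp qm t) (ε : ℝ) :
    Tendsto (s11 ε q0 q qp qm t) (atInfty q0) (𝓝 1) := by
  have c1 := h.backgroundRight.tendsto_jostM_atInfty 0
  have c2 := h.backgroundLeft.tendsto_jostM_atInfty 0
  have := ((c1.fst_nhds.mul c2.fst_nhds).sub (c1.snd_nhds.mul c2.snd_nhds)).div
    (tendsto_gam_atInfty q0) one_ne_zero
  simp only [mul_one, mul_zero, sub_zero, div_one] at this
  refine this.congr' ?_
  filter_upwards [mem_outerLower_atInfty q0] with z hz
  exact (h.s11_eq ε hz).symm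

/-- Near the branch point `s₁₁` is bounded by the inverse of the cosine of the argument. -/
theorem norm_s11_mul_abs_re_le (h : Potential q0 q qp qm t) (ε : ℝ) :
    ∃ C : ℝ, ∀ z ∈ outerLower q0, ‖s11 ε q0 q qp qm t z‖ * |z.re| ≤ C * ‖z‖ := by
  set C1 := 2 * Real.exp (2 * volTail q0 (fun x => q x t - qp) 0 0)
  set C2 := 2 * Real.exp (2 * volTail q0 (fun x => conj (q (-x) t - qm)) 0 0)
  refine ⟨4 * (C1 * C2), fun z hz => ?_⟩
  have hmem := outerLower_subset h.pos hz
  have hg := gam_ne_zero hmem.1 hmem.2.1 hmem.2.2.1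
  have b1 := h.backgroundRight.norm_jostM_le hz (le_refl (0 : ℝ))
  have b2 := h.backgroundLeft.norm_jostM_le hz (le_refl (0 : ℝ))
  have hC1 : 0 ≤ C1 := by positivity
  have h1 : ‖s11 ε q0 q qp qm t z‖ * ‖gam q0 z‖ ≤ 2 * (C1 * C2) := by
    rw [h.s11_eq ε hz, ← norm_mul, div_mul_cancel₀ _ hg]
    refine (norm_sub_le _ _).trans ?_
    rw [norm_mul, norm_mul]
    have := mul_le_mul ((norm_fst_le _).trans b1) ((norm_fst_le _).trans b2) (norm_nonneg _) hC1
    have := mul_le_mul ((norm_snd_le _).trans b1) ((norm_snd_le _).trans b2) (norm_nonneg _) hC1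
    linarith
  calc ‖s11 ε q0 q qp qm t z‖ * |z.re|
      ≤ ‖s11 ε q0 q qp qm t z‖ * (2 * ‖gam q0 z‖ * ‖z‖) := by
        gcongr; exact abs_re_le_norm_gam h.pos hz.1
    _ = 2 * (‖s11 ε q0 q qp qm t z‖ * ‖gam q0 z‖) * ‖z‖ := by ring
    _ ≤ 2 * (2 * (C1 * C2)) * ‖z‖ := by gcongr
    _ = _ := by ring

theorem norm_s11_sub_one_le (h : Potential q0 q qp qm t) (ε : ℝ) :
    ∃ C : ℝ, ∀ Y : ℝ, 2 * q0 ≤ Y → ‖s11 ε q0 q qp qm t (-(Complex.I * Y)) - 1‖ ≤ C / Y := by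
  obtain ⟨B, hB0, hB⟩ := h.exists_bound
  obtain ⟨C1, h1⟩ := h.backgroundRight.norm_jostM_sub_le (D := B + q0) fun y _ =>
    (norm_sub_le _ _).trans (by rw [h.norm_qp]; linarith [hB y])
  obtain ⟨C2, h2⟩ := h.backgroundLeft.norm_jostM_sub_le (D := B + q0) fun y _ => by
    rw [RCLike.norm_conj]
    exact (norm_sub_le _ _).trans (by rw [h.norm_qm]; linarith [hB (-y)])
  have hq := h.pos
  set K1 := max C1 0
  set K2 := max C2 0
  have hK1 : 0 ≤ K1 := le_max_right _ _
  have hK2 : 0 ≤ K2 := le_max_right _ _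
  refine ⟨2 * (K1 + K2 + 2 * (K1 * K2 / q0) + q0), fun Y hY => ?_⟩
  have hY0 : 0 < Y := by linarith
  have hz : -(Complex.I * (Y : ℂ)) ∈ outerLower q0 := by
    refine ⟨by simp [abs_of_pos hY0]; linarith, by simp; linarith, fun e => ?_⟩
    have := congrArg Complex.im e
    simp at this
    linarith
  set z : ℂ := -(Complex.I * (Y : ℂ))
  set u := jostM q0 qp (fun x => q x t - qp) 0 z
  set v := jostM q0 (conj qm) (fun x => conj (q (-x) t - qm)) 0 z
  have u1 : ‖u - (1, 0)‖ ≤ K1 / Y :=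
    (h1 Y hY).trans (by gcongr; exact le_max_left _ _)
  have v1 : ‖v - (1, 0)‖ ≤ K2 / Y :=
    (h2 Y hY).trans (by gcongr; exact le_max_left _ _)
  have ua : ‖u.1 - 1‖ ≤ K1 / Y := (norm_fst_le (u - (1, 0))).trans u1
  have ub : ‖u.2‖ ≤ K1 / Y := by simpa using (norm_snd_le (u - (1, 0))).trans u1
  have va : ‖v.1 - 1‖ ≤ K2 / Y := (norm_fst_le (v - (1, 0))).trans v1
  have vb : ‖v.2‖ ≤ K2 / Y := by simpa using (norm_snd_le (v - (1, 0))).trans v1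
  have hgz : gam q0 z = ((1 - q0 ^ 2 / Y ^ 2 : ℝ) : ℂ) := by
    have hY' : (Y : ℂ) ≠ 0 := by exact_mod_cast hY0.ne'
    simp only [gam, z, neg_sq, mul_pow, Complex.I_sq]
    push_cast
    field_simp
    ring
  have hr : q0 ^ 2 / Y ^ 2 ≤ 1 / 2 := by
    rw [div_le_iff₀ (by positivity)]; nlinarith
  have hgn : 1 / 2 ≤ ‖gam q0 z‖ := by
    rw [hgz, Complex.norm_real, Real.norm_eq_abs, abs_of_nonneg (by linarith)]
    linarith
  have hg1 : ‖1 - gam q0 z‖ ≤ q0 / Y := by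
    have : 1 - gam q0 z = ((q0 ^ 2 / Y ^ 2 : ℝ) : ℂ) := by rw [hgz]; push_cast; ring
    rw [this, Complex.norm_real, Real.norm_eq_abs, abs_of_nonneg (by positivity),
      div_le_div_iff₀ (by positivity) hY0]
    nlinarith [mul_pos hq hY0]
  have hg0 : gam q0 z ≠ 0 := norm_pos_iff.1 (by linarith)
  have e : s11 ε q0 q qp qm t z - 1
      = ((u.1 - 1) + (v.1 - 1) + (u.1 - 1) * (v.1 - 1) - u.2 * v.2 + (1 - gam q0 z))
        / gam q0 z := by
    rw [h.s11_eq ε hz]; field_simp; ring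
  have hKK : (K1 / Y) * (K2 / Y) ≤ (K1 * K2 / q0) / Y := by
    rw [div_mul_div_comm, div_div, div_le_div_iff₀ (by positivity) (by positivity)]
    have : q0 ≤ Y := by linarith
    have h3 : 0 ≤ K1 * K2 := by positivity
    have : K1 * K2 * (q0 * Y) ≤ K1 * K2 * (Y * Y) := by gcongr
    linarith
  have hnum : ‖(u.1 - 1) + (v.1 - 1) + (u.1 - 1) * (v.1 - 1) - u.2 * v.2 + (1 - gam q0 z)‖
      ≤ (K1 + K2 + 2 * (K1 * K2 / q0) + q0) / Y := by
    have m1 : ‖(u.1 - 1) * (v.1 - 1)‖ ≤ (K1 * K2 / q0) / Y := by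
      rw [norm_mul]; exact (mul_le_mul ua va (norm_nonneg _) (by positivity)).trans hKK
    have m2 : ‖u.2 * v.2‖ ≤ (K1 * K2 / q0) / Y := by
      rw [norm_mul]; exact (mul_le_mul ub vb (norm_nonneg _) (by positivity)).trans hKK
    calc _ ≤ ‖u.1 - 1‖ + ‖v.1 - 1‖ + ‖(u.1 - 1) * (v.1 - 1)‖ + ‖u.2 * v.2‖
          + ‖1 - gam q0 z‖ :=
        (norm_add_le _ _).trans (add_le_add_left ((norm_sub_le _ _).trans
          (add_le_add_left (norm_add₃_le) _)) _)
      _ ≤ K1 / Y + K2 / Y + (K1 * K2 / q0) / Y + (K1 * K2 / q0) / Y + q0 / Y := by gcongr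
      _ = _ := by ring
  rw [e, norm_div, div_le_iff₀ (by linarith)]
  refine hnum.trans ?_
  have : 0 ≤ (K1 + K2 + 2 * (K1 * K2 / q0) + q0) / Y := by positivity
  have e2 : 2 * (K1 + K2 + 2 * (K1 * K2 / q0) + q0) / Y
      = 2 * ((K1 + K2 + 2 * (K1 * K2 / q0) + q0) / Y) := by ring
  rw [e2]
  nlinarith

end Potential

end IfoNLS

/-! ### Splitting off the zeros -/

namespace IfoNLS

/-- The properties of `s₁₁` on `{|z| ≥ q₀, Im z ≤ 0}` that are inherited by its quotient by a
Blaschke product. -/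
structure OuterFn (q0 : ℝ) (a : ℂ → ℂ) : Prop where
  pos : 0 < q0
  cont : ContinuousOn a (outerLower q0)
  diff : DifferentiableOn ℂ a (outerLowerInt q0)
  lim : Tendsto a (atInfty q0) (𝓝 1)
  upper : ∃ C : ℝ, ∀ᶠ z in 𝓝[outerLower q0] (-(Complex.I * q0)), ‖a z‖ * |z.re| ≤ C
  lower : ∃ c > 0, ∀ᶠ z in 𝓝[outerLower q0] (-(Complex.I * q0)), c ≤ ‖a z‖
  decay : (fun Y : ℝ => a (-(Complex.I * Y)) - 1) =O[atTop] fun Y : ℝ => Y⁻¹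
  real : ∀ z ∈ outerLower q0, z.im = 0 → ‖a z‖ ≤ 1

/-- The factor of the Blaschke product attached to the zero `w`. -/
noncomputable def blaschkeFactor (q0 : ℝ) (w z : ℂ) : ℂ :=
  ((z - w) * (z + (q0 : ℂ) ^ 2 / conj w)) / ((z - conj w) * (z + (q0 : ℂ) ^ 2 / w))

section Factor

variable {q0 : ℝ} {w z : ℂ}

theorem sub_conj_ne_zero (hw : w ∈ outerLowerInt q0) (hz : z ∈ outerLower q0) :
    z - conj w ≠ 0 := fun h => by
  have h1 := congrArg Complex.im (sub_eq_zero.1 h)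
  rw [Complex.conj_im] at h1
  linarith [hw.2, hz.2.1]

theorem add_div_ne_zero (hq0 : 0 < q0) {v : ℂ} (hw : q0 < ‖v‖) (hz : q0 ≤ ‖z‖) :
    z + (q0 : ℂ) ^ 2 / v ≠ 0 := fun h => by
  have h1 := congrArg norm (eq_neg_of_add_eq_zero_left h)
  rw [norm_neg, norm_div, norm_pow, Complex.norm_real, Real.norm_eq_abs, abs_of_pos hq0,
    eq_div_iff (by linarith)] at h1
  nlinarith

theorem blaschkeFactor_mul_conj (hq0 : 0 < q0) (hw : w ∈ outerLowerInt q0)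
    (hz : z ∈ outerLower q0) (hne : z ≠ w) :
    blaschkeFactor q0 w z * blaschkeFactor q0 (conj w) z = 1 := by
  have h1 := sub_conj_ne_zero hw hz
  have h2 := add_div_ne_zero hq0 hw.1 hz.1
  have h3 := add_div_ne_zero (v := conj w) hq0 (by rw [RCLike.norm_conj]; exact hw.1) hz.1
  have h4 := sub_ne_zero.2 hne
  simp only [blaschkeFactor, Complex.conj_conj]
  rw [div_mul_div_comm, div_eq_one_iff_eq]
  · ring
  · exact mul_ne_zero (mul_ne_zero h1 h2) (mul_ne_zero h4 h3)

theorem differentiableAt_blaschkeFactor_conj (hq0 : 0 < q0) (hw : w ∈ outerLowerInt q0)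
    (hz : q0 ≤ ‖z‖) (hne : z ≠ w) : DifferentiableAt ℂ (blaschkeFactor q0 (conj w)) z := by
  have h3 := add_div_ne_zero (v := conj w) hq0 (by rw [RCLike.norm_conj]; exact hw.1) hz
  have h4 := sub_ne_zero.2 hne
  unfold blaschkeFactor
  refine DifferentiableAt.fun_div (by fun_prop) (by fun_prop) ?_
  simp only [Complex.conj_conj]
  exact mul_ne_zero h4 h3

theorem norm_blaschkeFactor_of_im_eq_zero (hq0 : 0 < q0) (hw : w ∈ outerLowerInt q0)
    (hz : z ∈ outerLower q0) (him : z.im = 0) : ‖blaschkeFactor q0 (conj w) z‖ = 1 := by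
  have hc : conj z = z := Complex.conj_eq_iff_im.2 him
  have h1 := sub_conj_ne_zero hw hz
  have h2 := add_div_ne_zero hq0 hw.1 hz.1
  have e1 : ‖z - conj w‖ = ‖z - w‖ := by
    rw [← RCLike.norm_conj (z - w), map_sub, hc]
  have e2 : ‖z + (q0 : ℂ) ^ 2 / conj w‖ = ‖z + (q0 : ℂ) ^ 2 / w‖ := by
    rw [← RCLike.norm_conj (z + (q0 : ℂ) ^ 2 / w)]; simp [hc]
  rw [blaschkeFactor, Complex.conj_conj, norm_div, norm_mul, norm_mul, e1, e2]
  refine div_self (mul_ne_zero ?_ (norm_ne_zero_iff.2 h2))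
  rw [← e1]; exact norm_ne_zero_iff.2 h1

/-- At infinity, a power of a Blaschke factor is `1 + O(1/z)`: it is a rational function of `1/z`
with the value one at zero. -/
theorem blaschkeFactor_pow_sub_one_isBigO (v : ℂ) (m : ℕ) :
    (fun z => blaschkeFactor q0 v z ^ m - 1) =O[Bornology.cobounded ℂ] fun z => z⁻¹ := by
  set R : ℂ → ℂ := fun u => (((1 - v * u) * (1 + (q0 : ℂ) ^ 2 / conj v * u))
    / ((1 - conj v * u) * (1 + (q0 : ℂ) ^ 2 / v * u))) ^ m with hR
  have hd : DifferentiableAt ℂ R 0 := by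
    refine DifferentiableAt.fun_pow (DifferentiableAt.fun_div (by fun_prop) (by fun_prop) ?_) m
    simp
  have h1 := hd.isBigO_sub.comp_tendsto (tendsto_inv₀_cobounded (α := ℂ))
  have hR0 : R 0 = 1 := by simp [hR]
  refine (h1.congr' ?_ ?_)
  · filter_upwards [Bornology.eventually_ne_cobounded (0 : ℂ)] with z hz
    show R z⁻¹ - R 0 = _
    rw [hR0]
    simp only [hR, blaschkeFactor]
    congr 2
    have e1 : z - v = z * (1 - v * z⁻¹) := by field_simp
    have e2 : z - conj v = z * (1 - conj v * z⁻¹) := by field_simp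
    have e3 : ∀ c : ℂ, z + c = z * (1 + c * z⁻¹) := fun c => by field_simp
    rw [e1, e2, e3, e3 ((q0 : ℂ) ^ 2 / v), mul_mul_mul_comm, mul_mul_mul_comm z _ z,
      mul_div_mul_left _ _ (mul_ne_zero hz hz)]
  · filter_upwards with z
    simp

theorem tendsto_blaschkeFactor_pow (v : ℂ) (m : ℕ) :
    Tendsto (fun z => blaschkeFactor q0 v z ^ m) (Bornology.cobounded ℂ) (𝓝 1) := by
  have h := (blaschkeFactor_pow_sub_one_isBigO (q0 := q0) v m).trans_tendsto
    (tendsto_inv₀_cobounded (α := ℂ))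
  simpa using h.add_const 1

end Factor

theorem tendsto_neg_I_mul_cobounded :
    Tendsto (fun Y : ℝ => -(Complex.I * (Y : ℂ))) atTop (Bornology.cobounded ℂ) := by
  rw [← tendsto_norm_atTop_iff_cobounded]
  simpa using tendsto_abs_atTop_atTop

namespace OuterFn

variable {q0 : ℝ} {a : ℂ → ℂ}

/-- A zero of finite order in the open region is split off by a power of its Blaschke factor. -/
theorem exists_split (ha : OuterFn q0 a) {w : ℂ} (hw : w ∈ outerLowerInt q0)
    (hiso : ∀ᶠ z in 𝓝[≠] w, a z ≠ 0) :
    ∃ (m : ℕ) (g : ℂ → ℂ), OuterFn q0 g ∧ g w ≠ 0 ∧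
      ∀ z ∈ outerLower q0, a z = blaschkeFactor q0 w z ^ m * g z := by
  have hq0 := ha.pos
  have hwo : w ∈ outerLower q0 := outerLowerInt_subset hq0 hw
  have hopen := (isOpen_outerLowerInt q0).mem_nhds hw
  have han : AnalyticAt ℂ a w := ha.diff.analyticAt hopen
  have hord : analyticOrderAt a w ≠ ⊤ := by
    rw [Ne, analyticOrderAt_eq_top]
    intro h
    have h1 := h.filter_mono (nhdsWithin_le_nhds (s := {w}ᶜ))
    obtain ⟨z, hz⟩ := (hiso.and h1).exists
    exact hz.1 hz.2
  obtain ⟨u, hu, hu0, hau⟩ := han.analyticOrderAt_ne_top.1 hord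
  set m := analyticOrderNatAt a w
  set r : ℂ → ℂ := fun z => (((z - conj w) * (z + (q0 : ℂ) ^ 2 / w))
    / (z + (q0 : ℂ) ^ 2 / conj w)) ^ m with hr
  have d1 := sub_conj_ne_zero hw hwo
  have d2 := add_div_ne_zero hq0 hw.1 hwo.1
  have d3 := add_div_ne_zero (v := conj w) hq0 (by rw [RCLike.norm_conj]; exact hw.1) hwo.1
  have hrd : DifferentiableAt ℂ r w := by
    have : DifferentiableAt ℂ (fun z => ((z - conj w) * (z + (q0 : ℂ) ^ 2 / w))
        / (z + (q0 : ℂ) ^ 2 / conj w)) w :=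
      DifferentiableAt.fun_div (by fun_prop) (by fun_prop) d3
    exact this.pow m
  set c : ℂ → ℂ := fun z => blaschkeFactor q0 (conj w) z ^ m with hc
  set g : ℂ → ℂ := fun z => if z = w then u w * r w else a z * c z with hg
  have hgw : g w = u w * r w := by simp [hg]
  have hgne : ∀ z, z ≠ w → g z = a z * c z := fun z hz => by simp [hg, hz]
  have hgev : g =ᶠ[𝓝 w] fun z => u z * r z := by
    filter_upwards [hau, hopen] with z hz hzo
    by_cases h : z = w
    · rw [h, hgw]
    · rw [hgne z h, hz, hc, hr]
      have h4 := sub_ne_zero.2 h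
      simp only [blaschkeFactor, Complex.conj_conj, smul_eq_mul]
      rw [mul_comm (_ ^ m) (u z), mul_assoc, ← mul_pow]
      congr 2
      field_simp
  have hgd : DifferentiableAt ℂ g w := (hu.differentiableAt.mul hrd).congr_of_eventuallyEq hgev
  have hcd : ∀ z, q0 ≤ ‖z‖ → z ≠ w → DifferentiableAt ℂ c z := fun z h1 h2 =>
    (differentiableAt_blaschkeFactor_conj hq0 hw h1 h2).pow m
  have hevne : ∀ z, z ≠ w → g =ᶠ[𝓝 z] fun z => a z * c z := fun z hz => by
    filter_upwards [isOpen_compl_singleton.mem_nhds hz] with y hy using hgne y hy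
  have hbw : -(Complex.I * (q0 : ℂ)) ≠ w := fun h => by
    have := hw.1
    rw [← h] at this
    simp [abs_of_pos hq0] at this
  have hbn : q0 ≤ ‖-(Complex.I * (q0 : ℂ))‖ := by simp [abs_of_pos hq0]
  have hcb := (hcd _ hbn hbw).continuousAt
  have hcb0 : c (-(Complex.I * (q0 : ℂ))) ≠ 0 := by
    refine pow_ne_zero _ (div_ne_zero (mul_ne_zero ?_ ?_) (mul_ne_zero ?_ ?_))
    · refine fun h => ?_
      have h1 := congrArg Complex.im (sub_eq_zero.1 h)
      simp at h1
      linarith [hw.2]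
    · rw [Complex.conj_conj]; exact add_div_ne_zero hq0 hw.1 hbn
    · rw [Complex.conj_conj]; exact sub_ne_zero.2 hbw
    · exact add_div_ne_zero (v := conj w) hq0 (by rw [RCLike.norm_conj]; exact hw.1) hbn
  have hevb := (hevne _ hbw).filter_mono (nhdsWithin_le_nhds (s := outerLower q0))
  have hcinf : Tendsto c (Bornology.cobounded ℂ) (𝓝 1) := tendsto_blaschkeFactor_pow _ m
  have hcont : ContinuousOn g (outerLower q0) := by
    intro z hz
    by_cases h : z = w
    · rw [h]; exact hgd.continuousAt.continuousWithinAt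
    · have h1 := (ha.cont z hz).mul (hcd z hz.1 h).continuousAt.continuousWithinAt
      exact h1.congr_of_eventuallyEq ((hevne z h).filter_mono nhdsWithin_le_nhds) (hgne z h)
  refine ⟨m, g, ⟨hq0, hcont, ?_, ?_, ?_, ?_, ?_, ?_⟩, ?_, ?_⟩
  · intro z hz
    by_cases h : z = w
    · rw [h]; exact hgd.differentiableWithinAt
    · have h1 := (ha.diff.differentiableAt ((isOpen_outerLowerInt q0).mem_nhds hz)).mul
        (hcd z hz.1.le h)
      exact (h1.congr_of_eventuallyEq (hevne z h)).differentiableWithinAt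
  · have h1 := ha.lim.mul (hcinf.mono_left (inf_le_left : atInfty q0 ≤ _))
    rw [mul_one] at h1
    refine h1.congr' ?_
    have : ∀ᶠ z in atInfty q0, z ≠ w :=
      (Bornology.eventually_ne_cobounded w).filter_mono (inf_le_left : atInfty q0 ≤ _)
    filter_upwards [this] with z hz using (hgne z hz).symm
  · obtain ⟨C, hC⟩ := ha.upper
    have h1 : ∀ᶠ z in 𝓝[outerLower q0] (-(Complex.I * (q0 : ℂ))),
        ‖c z‖ ≤ ‖c (-(Complex.I * (q0 : ℂ)))‖ + 1 :=
      (hcb.norm.eventually_le_const (by linarith)).filter_mono nhdsWithin_le_nhds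
    refine ⟨max C 0 * (‖c (-(Complex.I * (q0 : ℂ)))‖ + 1), ?_⟩
    filter_upwards [hC, h1, hevb] with z h2 h3 h4
    rw [h4, norm_mul, mul_right_comm]
    exact mul_le_mul (h2.trans (le_max_left _ _)) h3 (norm_nonneg _) (le_max_right _ _)
  · obtain ⟨k, hk, hC⟩ := ha.lower
    have hpos : 0 < ‖c (-(Complex.I * (q0 : ℂ)))‖ := norm_pos_iff.2 hcb0
    have h1 : ∀ᶠ z in 𝓝[outerLower q0] (-(Complex.I * (q0 : ℂ))),
        ‖c (-(Complex.I * (q0 : ℂ)))‖ / 2 ≤ ‖c z‖ :=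
      (hcb.norm.eventually_const_le (by linarith)).filter_mono nhdsWithin_le_nhds
    refine ⟨k * (‖c (-(Complex.I * (q0 : ℂ)))‖ / 2), by positivity, ?_⟩
    filter_upwards [hC, h1, hevb] with z h2 h3 h4
    rw [h4, norm_mul]
    exact mul_le_mul h2 h3 (by positivity) (norm_nonneg _)
  · have h1 := (blaschkeFactor_pow_sub_one_isBigO (q0 := q0) (conj w) m).comp_tendsto
      tendsto_neg_I_mul_cobounded
    have h1' : (fun Y : ℝ => c (-(Complex.I * (Y : ℂ))) - 1) =O[atTop] fun Y : ℝ => Y⁻¹ := by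
      refine h1.trans (Asymptotics.isBigO_of_le _ fun Y => ?_)
      simp
    have h2 : (fun Y : ℝ => c (-(Complex.I * (Y : ℂ)))) =O[atTop] fun _ : ℝ => (1 : ℝ) :=
      (hcinf.comp tendsto_neg_I_mul_cobounded).isBigO_one ℝ
    have h3 := (ha.decay.mul h2).add (h1'.trans (Asymptotics.isBigO_of_le _ fun Y => by simp) :
      _ =O[atTop] fun Y : ℝ => Y⁻¹ * (1 : ℝ))
    simp only [mul_one] at h3
    refine h3.congr' ?_ EventuallyEq.rfl
    have : ∀ᶠ Y : ℝ in atTop, -(Complex.I * (Y : ℂ)) ≠ w :=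
      tendsto_neg_I_mul_cobounded.eventually (Bornology.eventually_ne_cobounded w)
    filter_upwards [this] with Y hY
    rw [hgne _ hY]; ring
  · intro z hz him
    have h : z ≠ w := fun h => by rw [h] at him; exact hw.2.ne him
    rw [hgne z h, norm_mul, hc]
    simp only [norm_pow]
    rw [norm_blaschkeFactor_of_im_eq_zero hq0 hw hz him, one_pow, mul_one]
    exact ha.real z hz him
  · rw [hgw]
    exact mul_ne_zero hu0 (pow_ne_zero _ (div_ne_zero (mul_ne_zero d1 d2) d3))
  · intro z hz
    by_cases h : z = w
    · rw [h, hau.self_of_nhds, hgw, hr]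
      rcases Nat.eq_zero_or_pos m with hm | hm
      · simp [hm]
      · simp [hm.ne', blaschkeFactor]
    · rw [hgne z h, hc, mul_left_comm, ← mul_pow, blaschkeFactor_mul_conj hq0 hw hz h, one_pow,
        mul_one]

theorem blaschkeFactor_ne_zero {w z : ℂ} (hq0 : 0 < q0) (hw : w ∈ outerLowerInt q0)
    (hz : z ∈ outerLower q0) (hne : z ≠ w) : blaschkeFactor q0 w z ≠ 0 :=
  left_ne_zero_of_mul_eq_one (blaschkeFactor_mul_conj hq0 hw hz hne)

/-- Splitting off all zeros. -/
theorem exists_factorization (s : Finset ℂ) : ∀ {a : ℂ → ℂ}, OuterFn q0 a →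
    (∀ w ∈ s, w ∈ outerLowerInt q0) → (∀ z ∈ outerLower q0, a z = 0 ↔ z ∈ s) →
    ∃ (m : ℂ → ℕ) (g : ℂ → ℂ), OuterFn q0 g ∧ (∀ z ∈ outerLower q0, g z ≠ 0) ∧
      ∀ z ∈ outerLower q0, a z = (∏ w ∈ s, blaschkeFactor q0 w z ^ m w) * g z := by
  induction s using Finset.induction_on with
  | empty => exact fun {a} ha _ hz => ⟨0, a, ha, fun z hzo h => by simpa using (hz z hzo).1 h,
      fun z _ => by simp⟩
  | insert w s hws ih =>
    intro a ha hs hz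
    have hw := hs w (Finset.mem_insert_self w s)
    have hiso : ∀ᶠ z in 𝓝[≠] w, a z ≠ 0 := by
      have h1 : ∀ᶠ z in 𝓝[≠] w, z ∈ outerLowerInt q0 :=
        mem_nhdsWithin_of_mem_nhds ((isOpen_outerLowerInt q0).mem_nhds hw)
      have h2 : ∀ᶠ z in 𝓝[≠] w, z ∉ s :=
        mem_nhdsWithin_of_mem_nhds (s.finite_toSet.isClosed.isOpen_compl.mem_nhds hws)
      filter_upwards [h1, h2, self_mem_nhdsWithin] with z h3 h4 h5 h6
      rcases Finset.mem_insert.1 ((hz z (outerLowerInt_subset ha.pos h3)).1 h6) with h | h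
      · exact h5 h
      · exact h4 h
    obtain ⟨k, g, hg, hgw, hag⟩ := ha.exists_split hw hiso
    obtain ⟨m, h, hh, hh0, hgh⟩ := ih hg (fun v hv => hs v (Finset.mem_insert_of_mem hv))
      (fun z hzo => by
        by_cases hzw : z = w
        · rw [hzw]; exact iff_of_false hgw hws
        · have h1 := hz z hzo
          rw [hag z hzo, mul_eq_zero, Finset.mem_insert] at h1
          have h2 := pow_ne_zero k (blaschkeFactor_ne_zero ha.pos hw hzo hzw)
          simpa [h2, hzw] using h1)
    refine ⟨Function.update m w k, h, hh, hh0, fun z hzo => ?_⟩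
    rw [Finset.prod_insert hws, Function.update_self, mul_assoc, hag z hzo, hgh z hzo]
    congr 2
    refine Finset.prod_congr rfl fun v hv => ?_
    rw [Function.update_of_ne (fun e : v = w => hws (e ▸ hv))]

end OuterFn

/-- The multiplicities in a factorization are read off from the order of vanishing. -/
theorem eq_of_factorization {q0 : ℝ} {a g : ℂ → ℂ} {s : Finset ℂ} {m : ℂ → ℕ} (hq0 : 0 < q0)
    (hs : ∀ w ∈ s, w ∈ outerLowerInt q0) (hgd : DifferentiableOn ℂ g (outerLowerInt q0))
    (hg0 : ∀ z ∈ outerLower q0, g z ≠ 0)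
    (ha : ∀ z ∈ outerLower q0, a z = (∏ w ∈ s, blaschkeFactor q0 w z ^ m w) * g z)
    {w : ℂ} (hw : w ∈ s) {k : ℕ} (h0 : ∀ i < k, iteratedDeriv i a w = 0)
    (hk : iteratedDeriv k a w ≠ 0) : m w = k := by
  have hwi := hs w hw
  have hwo := outerLowerInt_subset hq0 hwi
  have hopen := (isOpen_outerLowerInt q0).mem_nhds hwi
  set u : ℂ → ℂ := fun z => ((z + (q0 : ℂ) ^ 2 / conj w) / ((z - conj w) * (z + (q0 : ℂ) ^ 2 / w)))
    ^ m w * ((∏ v ∈ s.erase w, blaschkeFactor q0 v z ^ m v) * g z) with hu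
  have hud : DifferentiableOn ℂ u (outerLowerInt q0) := by
    refine DifferentiableOn.fun_mul (DifferentiableOn.fun_pow (DifferentiableOn.fun_div
      (by fun_prop) (by fun_prop) fun z hz => ?_) _) (DifferentiableOn.fun_mul ?_ hgd)
    · exact mul_ne_zero (sub_conj_ne_zero hwi (outerLowerInt_subset hq0 hz))
        (add_div_ne_zero hq0 hwi.1 hz.1.le)
    · refine DifferentiableOn.fun_finsetProd fun v hv => DifferentiableOn.fun_pow ?_ _
      have hvi := hs v (Finset.mem_of_mem_erase hv)
      unfold blaschkeFactor
      refine DifferentiableOn.fun_div (by fun_prop) (by fun_prop) fun z hz => ?_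
      exact mul_ne_zero (sub_conj_ne_zero hvi (outerLowerInt_subset hq0 hz))
        (add_div_ne_zero hq0 hvi.1 hz.1.le)
  have hu0 : u w ≠ 0 := by
    refine mul_ne_zero (pow_ne_zero _ (div_ne_zero ?_ (mul_ne_zero (sub_conj_ne_zero hwi hwo)
      (add_div_ne_zero hq0 hwi.1 hwo.1)))) (mul_ne_zero ?_ (hg0 w hwo))
    · exact add_div_ne_zero (v := conj w) hq0 (by rw [RCLike.norm_conj]; exact hwi.1) hwo.1
    · refine Finset.prod_ne_zero_iff.2 fun v hv => pow_ne_zero _ ?_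
      exact OuterFn.blaschkeFactor_ne_zero hq0 (hs v (Finset.mem_of_mem_erase hv)) hwo
        (Finset.ne_of_mem_erase hv).symm
  have hau : ∀ᶠ z in 𝓝 w, a z = (z - w) ^ m w • u z := by
    filter_upwards [hopen] with z hz
    rw [ha z (outerLowerInt_subset hq0 hz), ← Finset.mul_prod_erase s _ hw, hu, smul_eq_mul]
    simp only [blaschkeFactor]
    rw [mul_div_assoc, mul_pow]
    ring
  have hua : AnalyticAt ℂ u w := hud.analyticAt hopen
  have haa : AnalyticAt ℂ a w := by
    have h1 : AnalyticAt ℂ (fun z : ℂ => z - w) w := by fun_prop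
    refine ((h1.pow (m w)).smul hua).congr ?_
    filter_upwards [hau] with z hz using hz.symm
  have e1 : analyticOrderAt a w = m w := (haa.analyticOrderAt_eq_natCast).2 ⟨u, hua, hu0, hau⟩
  have e2 : analyticOrderAt a w = k :=
    (analyticOrderAt_eq_nat_iff_iteratedDeriv_eq_zero haa).2 ⟨h0, hk⟩
  rw [e1] at e2
  exact_mod_cast e2

end IfoNLS

/-! ### Logarithms on star-shaped sets and on the strip -/

namespace IfoNLS

/-- A continuous function without zeros on a star-shaped set has a continuous logarithm: the
radial homotopy to the centre lifts through the covering `exp`. -/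
theorem exists_continuous_log {S : Set ℂ} {w₀ : ℂ} (hS : StarConvex ℝ w₀ S) (hw₀ : w₀ ∈ S)
    {g : ℂ → ℂ} (hg : ContinuousOn g S) (h0 : ∀ w ∈ S, g w ≠ 0) :
    ∃ f : ℂ → ℂ, ContinuousOn f S ∧ ∀ w ∈ S, Complex.exp (f w) = g w := by
  have hmem : ∀ (t : unitInterval) (w : S), w₀ + (t : ℝ) • ((w : ℂ) - w₀) ∈ S := fun t w =>
    hS.add_smul_sub_mem w.2 t.2.1 t.2.2
  set H : C(unitInterval × S, {z : ℂ // z ≠ 0}) :=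
    ⟨fun p => ⟨g (w₀ + (p.1 : ℝ) • ((p.2 : ℂ) - w₀)), h0 _ (hmem p.1 p.2)⟩, by
      refine Continuous.subtype_mk ?_ _
      refine hg.comp_continuous (by fun_prop) fun p => hmem p.1 p.2⟩ with hH
  set k : C(S, ℂ) := ContinuousMap.const S (Complex.log (g w₀))
  have hk : ∀ w : S, H (0, w) = (fun z : ℂ => (⟨_, z.exp_ne_zero⟩ : {z : ℂ // z ≠ 0})) (k w) := by
    intro w
    apply Subtype.ext
    simp [hH, k, Complex.exp_log (h0 w₀ hw₀)]
  set F := Complex.isCoveringMap_exp.liftHomotopy H k hk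
  have hF : ∀ w : S, Complex.exp (F (1, w)) = g w := by
    intro w
    have h1 := congrFun (Complex.isCoveringMap_exp.liftHomotopy_lifts H k hk) (1, w)
    have h2 := congrArg Subtype.val h1
    have h3 : Complex.exp (F (1, w)) = g (w₀ + ((1 : unitInterval) : ℝ) • ((w : ℂ) - w₀)) := h2
    rw [h3]
    simp
  classical
  refine ⟨fun w => if h : w ∈ S then F (1, ⟨w, h⟩) else 0, ?_, fun w hw => ?_⟩
  · rw [continuousOn_iff_continuous_domRestrict]
    have : S.domRestrict (fun w => if h : w ∈ S then F (1, ⟨w, h⟩) else 0) = fun w : S => F (1, w) := by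
      funext w
      simp [Set.domRestrict]
    rw [this]
    fun_prop
  · simp only [hw, dif_pos]
    exact hF ⟨w, hw⟩

/-- Two continuous logarithms of the same function on a connected set agree once they agree at a
point. -/
theorem eqOn_of_exp_eqOn {S : Set ℂ} (hS : IsPreconnected S) {f₁ f₂ : ℂ → ℂ}
    (h₁ : ContinuousOn f₁ S) (h₂ : ContinuousOn f₂ S)
    (he : ∀ w ∈ S, Complex.exp (f₁ w) = Complex.exp (f₂ w)) {w₀ : ℂ} (hw₀ : w₀ ∈ S)
    (h : f₁ w₀ = f₂ w₀) : Set.EqOn f₁ f₂ S :=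
  Complex.isCoveringMap_exp.eqOn_of_comp_eqOn hS h₁ h₂ (fun w hw => Subtype.ext (he w hw)) hw₀ h

/-- The point `-iπ/2`, which is mapped to the branch point `-i q₀` by `w ↦ q₀ e^w`. -/
noncomputable def branchPt : ℂ := -(Complex.I * ((Real.pi / 2 : ℝ) : ℂ))

@[simp] theorem branchPt_re : branchPt.re = 0 := by simp [branchPt, -Complex.ofReal_div]

@[simp] theorem branchPt_im : branchPt.im = -(Real.pi / 2) := by
  simp [branchPt, -Complex.ofReal_div]

theorem exp_branchPt : Complex.exp branchPt = -Complex.I := by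
  have : branchPt = -(Real.pi / 2 * Complex.I) := by simp only [branchPt]; push_cast; ring
  rw [this, Complex.exp_neg, Complex.exp_pi_div_two_mul_I, Complex.inv_I]

/-- The half-strip `{Re w ≥ 0, -π ≤ Im w ≤ 0}` without `-iπ/2`. The map `w ↦ q₀ e^w` identifies it
with `{|z| ≥ q₀, Im z ≤ 0}` without the branch point `-i q₀`. -/
def strip : Set ℂ := {w | 0 ≤ w.re ∧ -Real.pi ≤ w.im ∧ w.im ≤ 0 ∧ w ≠ branchPt}

/-- The interior of the half-strip. -/
def stripInt : Set ℂ := {w | 0 < w.re ∧ -Real.pi < w.im ∧ w.im < 0}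

theorem isOpen_stripInt : IsOpen stripInt :=
  (isOpen_lt continuous_const Complex.continuous_re).inter
    ((isOpen_lt continuous_const Complex.continuous_im).inter
      (isOpen_lt Complex.continuous_im continuous_const))

theorem ne_branchPt_of_re {w : ℂ} (h : w.re ≠ 0) : w ≠ branchPt := by
  rintro rfl
  simp at h

theorem ne_branchPt_of_im {w : ℂ} (h : w.im ≠ -(Real.pi / 2)) : w ≠ branchPt := by
  rintro rfl
  simp at h

theorem stripInt_subset : stripInt ⊆ strip := fun _ h =>
  ⟨h.1.le, h.2.1.le, h.2.2.le, ne_branchPt_of_re h.1.ne'⟩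

/-- The filter of the end of the half-strip. -/
def stripTop : Filter ℂ := comap Complex.re atTop ⊓ 𝓟 strip

theorem eventually_stripTop (T : ℝ) : ∀ᶠ w in stripTop, w ∈ strip ∧ T ≤ w.re :=
  ((tendsto_comap.eventually (eventually_ge_atTop T)).filter_mono inf_le_left).and
    ((eventually_principal.2 fun _ h => h).filter_mono inf_le_right) |>.mono fun _ h => ⟨h.2, h.1⟩

theorem starConvex_strip : StarConvex ℝ (1 + branchPt) strip := by
  have hpi := Real.pi_pos
  rintro w ⟨h1, h2, h3, h4⟩ a b ha hb hab
  have hre : (a • (1 + branchPt) + b • w).re = a + b * w.re := by simp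
  have him : (a • (1 + branchPt) + b • w).im = -a * (Real.pi / 2) + b * w.im := by simp
  refine ⟨?_, ?_, ?_, fun h => ?_⟩
  · rw [hre]; positivity
  · rw [him]; nlinarith
  · rw [him]; nlinarith
  · have e := congrArg Complex.re h
    rw [hre, branchPt_re] at e
    have ha0 : a = 0 := by nlinarith [mul_nonneg hb h1]
    have hb1 : b = 1 := by linarith
    rw [ha0, hb1] at h
    simp only [zero_smul, one_smul, zero_add] at h
    exact h4 h

theorem add_branchPt_mem {T : ℝ} (hT : 0 < T) : (T : ℂ) + branchPt ∈ stripInt := by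
  have hpi := Real.pi_pos
  exact ⟨by simpa using hT, by simp; linarith, by simp; linarith⟩

theorem norm_expMap {q0 : ℝ} (hq0 : 0 < q0) (w : ℂ) :
    ‖(q0 : ℂ) * Complex.exp w‖ = q0 * Real.exp w.re := by
  rw [norm_mul, Complex.norm_exp, Complex.norm_real, Real.norm_eq_abs, abs_of_pos hq0]

theorem expMap_re (q0 : ℝ) (w : ℂ) :
    ((q0 : ℂ) * Complex.exp w).re = q0 * Real.exp w.re * Real.sin (w.im + Real.pi / 2) := by
  rw [Complex.re_ofReal_mul, Complex.exp_re, Real.sin_add_pi_div_two]; ring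

theorem expMap_im (q0 : ℝ) (w : ℂ) :
    ((q0 : ℂ) * Complex.exp w).im = q0 * Real.exp w.re * Real.sin w.im := by
  rw [Complex.im_ofReal_mul, Complex.exp_im]; ring

theorem expMap_mem {q0 : ℝ} (hq0 : 0 < q0) {w : ℂ} (hw : w ∈ strip) :
    (q0 : ℂ) * Complex.exp w ∈ outerLower q0 := by
  obtain ⟨h1, h2, h3, h4⟩ := hw
  have hpi := Real.pi_pos
  refine ⟨?_, ?_, fun h => h4 ?_⟩
  · rw [norm_expMap hq0]; nlinarith [Real.one_le_exp h1]
  · rw [expMap_im]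
    exact mul_nonpos_of_nonneg_of_nonpos (by positivity)
      (Real.sin_nonpos_of_nonpos_of_neg_pi_le h3 h2)
  · have hn := norm_expMap hq0 w
    have hr := expMap_re q0 w
    rw [h] at hn hr
    simp [abs_of_pos hq0] at hn hr
    rw [eq_comm] at hn
    have hre : w.re = 0 := by simpa [hq0.ne'] using hn
    have him : w.im + Real.pi / 2 = 0 := by
      rcases hr with hr | hr
      · exact absurd hr hq0.ne'
      · exact (Real.sin_eq_zero_iff_of_lt_of_lt (by linarith) (by linarith)).1 hr
    apply Complex.ext
    · simpa using hre
    · rw [branchPt_im]; linarith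

theorem expMap_mem_int {q0 : ℝ} (hq0 : 0 < q0) {w : ℂ} (hw : w ∈ stripInt) :
    (q0 : ℂ) * Complex.exp w ∈ outerLowerInt q0 := by
  obtain ⟨h1, h2, h3⟩ := hw
  refine ⟨?_, ?_⟩
  · rw [norm_expMap hq0]; nlinarith [Real.one_lt_exp_iff.2 h1]
  · rw [expMap_im]
    exact mul_neg_of_pos_of_neg (by positivity) (Real.sin_neg_of_neg_of_neg_pi_lt h3 h2)

theorem tendsto_expMap_stripTop {q0 : ℝ} (hq0 : 0 < q0) :
    Tendsto (fun w => (q0 : ℂ) * Complex.exp w) stripTop (atInfty q0) := by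
  refine tendsto_inf.2 ⟨?_, tendsto_principal.2 ?_⟩
  · rw [← tendsto_norm_atTop_iff_cobounded]
    have h1 : Tendsto Complex.re stripTop atTop := tendsto_comap.mono_left inf_le_left
    have h2 := (Real.tendsto_exp_atTop.comp h1).const_mul_atTop hq0
    refine h2.congr fun w => ?_
    rw [norm_expMap hq0]; rfl
  · filter_upwards [eventually_stripTop 0] with w hw using expMap_mem hq0 hw.1

/-- The properties of the logarithm of the zero-free part of `s₁₁` in the coordinate `w` of the
half-strip. The imaginary part need not be bounded at `-iπ/2`, and at infinity nothing but the
decay on the middle line is known about the rate. -/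
structure StripLog (f : ℂ → ℂ) : Prop where
  cont : ContinuousOn f strip
  diff : DifferentiableOn ℂ f stripInt
  lim : Tendsto f stripTop (𝓝 0)
  re_le : ∃ M : ℝ, ∀ w ∈ strip, w.re ≤ 1 → w.im ≠ -(Real.pi / 2) →
    |(f w).re| ≤ M * |w.im + Real.pi / 2| ^ (-(1 / 4) : ℝ)
  nonpos : ∀ u : ℝ, 0 ≤ u → (f u).re ≤ 0
  nonpos' : ∀ u : ℝ, 0 ≤ u → (f (u - Complex.I * Real.pi)).re ≤ 0
  decay : (fun T : ℝ => f (T + branchPt)) =O[atTop] fun T : ℝ => Real.exp (-T)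

/-- The upper bound of `g` by the inverse distance to the ray through the branch point and the
lower bound by a constant give a bound of the logarithm by a small power. -/
theorem re_log_bound {g f : ℂ → ℂ} {q0 : ℝ} (hg : OuterFn q0 g) (hf : ContinuousOn f strip)
    (he : ∀ w ∈ strip, Complex.exp (f w) = g ((q0 : ℂ) * Complex.exp w)) :
    ∃ M : ℝ, ∀ w ∈ strip, w.re ≤ 1 → w.im ≠ -(Real.pi / 2) →
      |(f w).re| ≤ M * |w.im + Real.pi / 2| ^ (-(1 / 4) : ℝ) := by
  have hq0 := hg.pos
  have hpi := Real.pi_pos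
  obtain ⟨C, hC⟩ := hg.upper
  obtain ⟨c, hc, hcl⟩ := hg.lower
  have htend : Tendsto (fun w => (q0 : ℂ) * Complex.exp w) (𝓝[strip] branchPt)
      (𝓝[outerLower q0] (-(Complex.I * q0))) := by
    refine tendsto_nhdsWithin_of_tendsto_nhds_of_eventually_within _ ?_ ?_
    · have h1 : ContinuousAt (fun w => (q0 : ℂ) * Complex.exp w) branchPt := by fun_prop
      have h2 := h1.tendsto
      rw [exp_branchPt] at h2
      have e : (q0 : ℂ) * -Complex.I = -(Complex.I * q0) := by ring
      rw [e] at h2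
      exact h2.mono_left nhdsWithin_le_nhds
    · filter_upwards [self_mem_nhdsWithin] with w hw using expMap_mem hq0 hw
  obtain ⟨δ, hδ, hball⟩ := Metric.mem_nhdsWithin_iff.1 (htend.eventually (hC.and hcl))
  -- away from the branch point the logarithm is bounded by compactness
  have hcomp : IsCompact ((Set.Icc (0 : ℝ) 1 ×ℂ Set.Icc (-Real.pi) 0) \ Metric.ball branchPt δ) :=
    (isCompact_Icc.reProdIm isCompact_Icc).diff Metric.isOpen_ball
  obtain ⟨M1, hM1⟩ := hcomp.exists_bound_of_continuousOn (f := f) (hf.mono fun w hw =>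
    ⟨hw.1.1.1, hw.1.2.1, hw.1.2.2, fun h => hw.2 (h ▸ Metric.mem_ball_self hδ)⟩)
  set C' := max C 1 * (Real.pi / (2 * q0)) with hC'
  have hC'0 : 0 < C' := by have : 0 < max C 1 := lt_max_of_lt_right one_pos; positivity
  refine ⟨max (2 * M1) (max (4 * C' ^ (1 / 4 : ℝ)) (2 * |Real.log c|)), fun w hw hw1 him => ?_⟩
  set τ := |w.im + Real.pi / 2| with hτ
  have hτ0 : 0 < τ := abs_pos.2 fun h => him (by linarith)
  have hτ1 : τ ≤ Real.pi / 2 := abs_le.2 ⟨by linarith [hw.2.1], by linarith [hw.2.2.1]⟩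
  have hτp : 1 / 2 ≤ τ ^ (-(1 / 4) : ℝ) := by
    have h2 : τ ≤ 2 := hτ1.trans (by linarith [Real.pi_le_four])
    rw [Real.rpow_neg hτ0.le, ← one_div]
    refine one_div_le_one_div_of_le (by positivity) ?_
    calc τ ^ (1 / 4 : ℝ) ≤ 2 ^ (1 / 4 : ℝ) := Real.rpow_le_rpow hτ0.le h2 (by norm_num)
      _ ≤ 2 ^ (1 : ℝ) := Real.rpow_le_rpow_of_exponent_le (by norm_num) (by norm_num)
      _ = 2 := by norm_num
  have hτp0 : 0 < τ ^ (-(1 / 4) : ℝ) := by positivity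
  by_cases hb : w ∈ Metric.ball branchPt δ
  · obtain ⟨hup, hlo⟩ : _ ∧ _ := hball ⟨hb, hw⟩
    rw [← he w hw, Complex.norm_exp] at hup hlo
    rw [abs_le]
    constructor
    · have h1 : Real.log c ≤ (f w).re := (Real.log_le_iff_le_exp hc).2 hlo
      have h2 : -(2 * |Real.log c| * τ ^ (-(1 / 4) : ℝ)) ≤ Real.log c := by
        have := neg_abs_le (Real.log c)
        nlinarith [abs_nonneg (Real.log c)]
      refine le_trans ?_ (h2.trans h1)
      rw [neg_le_neg_iff]
      exact mul_le_mul_of_nonneg_right ((le_max_right _ _).trans (le_max_right _ _)) hτp0.le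
    · have h3 : q0 * (2 / Real.pi * τ) ≤ |((q0 : ℂ) * Complex.exp w).re| := by
        rw [expMap_re, abs_mul, abs_of_pos (by positivity : 0 < q0 * Real.exp w.re)]
        have := Real.mul_abs_le_abs_sin hτ1
        have h4 := Real.one_le_exp hw.1
        calc q0 * (2 / Real.pi * τ) ≤ q0 * |Real.sin (w.im + Real.pi / 2)| := by gcongr
          _ ≤ q0 * Real.exp w.re * |Real.sin (w.im + Real.pi / 2)| := by
            refine mul_le_mul_of_nonneg_right ?_ (abs_nonneg _)
            nlinarith
      have h5 : Real.exp (f w).re ≤ C' / τ := by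
        rw [le_div_iff₀ hτ0, hC']
        have h6 : Real.exp (f w).re * (q0 * (2 / Real.pi * τ)) ≤ max C 1 :=
          (mul_le_mul_of_nonneg_left h3 (Real.exp_pos _).le).trans (hup.trans (le_max_left _ _))
        have h7 : Real.exp (f w).re * τ
            = Real.exp (f w).re * (q0 * (2 / Real.pi * τ)) * (Real.pi / (2 * q0)) := by
          field_simp
        rw [h7]
        exact mul_le_mul_of_nonneg_right h6 (by positivity)
      have h8 : (f w).re ≤ Real.log (C' / τ) := (Real.le_log_iff_exp_le (by positivity)).2 h5
      have h9 := Real.log_le_rpow_div (by positivity : 0 ≤ C' / τ) (by norm_num : (0 : ℝ) < 1 / 4)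
      have h10 : (C' / τ) ^ (1 / 4 : ℝ) / (1 / 4) = 4 * C' ^ (1 / 4 : ℝ) * τ ^ (-(1 / 4) : ℝ) := by
        rw [Real.div_rpow hC'0.le hτ0.le, Real.rpow_neg hτ0.le]
        ring
      rw [h10] at h9
      refine (h8.trans h9).trans (mul_le_mul_of_nonneg_right ?_ hτp0.le)
      exact (le_max_left _ _).trans (le_max_right _ _)
  · have h1 := hM1 w ⟨⟨⟨hw.1, hw1⟩, ⟨hw.2.1, hw.2.2.1⟩⟩, hb⟩
    have h2 := (Complex.abs_re_le_norm (f w)).trans h1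
    have h3 : 0 ≤ M1 := (norm_nonneg _).trans h1
    calc |(f w).re| ≤ M1 := h2
      _ ≤ 2 * M1 * τ ^ (-(1 / 4) : ℝ) := by nlinarith
      _ ≤ _ := mul_le_mul_of_nonneg_right (le_max_left _ _) hτp0.le

theorem convex_tail (T : ℝ) (hT : 0 < T) : Convex ℝ {w : ℂ | w ∈ strip ∧ T ≤ w.re} := by
  have : {w : ℂ | w ∈ strip ∧ T ≤ w.re}
      = {w : ℂ | T ≤ w.re} ∩ ({w : ℂ | -Real.pi ≤ w.im} ∩ {w : ℂ | w.im ≤ 0}) := by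
    ext w
    constructor
    · exact fun h => ⟨h.2, h.1.2.1, h.1.2.2.1⟩
    · exact fun h => ⟨⟨hT.le.trans h.1, h.2.1, h.2.2,
        ne_branchPt_of_re (hT.trans_le h.1).ne'⟩, h.1⟩
  rw [this]
  exact (convex_halfSpace_re_ge T).inter
    ((convex_halfSpace_im_ge _).inter (convex_halfSpace_im_le 0))

/-- A continuous logarithm of a differentiable function is differentiable. -/
theorem differentiableAt_of_exp_eq {f G : ℂ → ℂ} {w : ℂ} (hf : ContinuousAt f w)
    (hG : DifferentiableAt ℂ G w) (he : ∀ᶠ v in 𝓝 w, Complex.exp (f v) = G v) :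
    DifferentiableAt ℂ f w := by
  have hw := he.self_of_nhds
  have hG0 : G w ≠ 0 := hw ▸ Complex.exp_ne_zero _
  have h1 : DifferentiableAt ℂ (fun v => f w + Complex.log (G v / G w)) w := by
    refine (DifferentiableAt.clog (hG.div_const _) ?_).const_add _
    rw [div_self hG0]
    exact Complex.one_mem_slitPlane
  refine h1.congr_of_eventuallyEq ?_
  have h2 : ∀ᶠ v in 𝓝 w, ‖f v - f w‖ < 1 := by
    have := Metric.continuousAt_iff'.1 hf 1 one_pos
    simpa [dist_eq_norm] using this
  filter_upwards [he, h2] with v h3 h4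
  have h5 := (Complex.abs_im_le_norm (f v - f w)).trans_lt h4
  rw [abs_lt] at h5
  have hpi := Real.pi_gt_three
  rw [← h3, ← hw, ← Complex.exp_sub, Complex.log_exp (by linarith) (by linarith)]
  ring

theorem OuterFn.exists_stripLog {g : ℂ → ℂ} {q0 : ℝ} (hg : OuterFn q0 g)
    (h0 : ∀ z ∈ outerLower q0, g z ≠ 0) :
    ∃ f, StripLog f ∧ ∀ w ∈ strip, Complex.exp (f w) = g ((q0 : ℂ) * Complex.exp w) := by
  have hq0 := hg.pos
  have hpi := Real.pi_pos
  set G : ℂ → ℂ := fun w => g ((q0 : ℂ) * Complex.exp w) with hG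
  have hGc : ContinuousOn G strip :=
    hg.cont.comp (by fun_prop) fun w hw => expMap_mem hq0 hw
  have hmid : (1 : ℂ) + branchPt ∈ strip := by
    have := stripInt_subset (add_branchPt_mem one_pos)
    simpa using this
  obtain ⟨k, hk, hkG⟩ := exists_continuous_log starConvex_strip hmid hGc
    fun w hw => h0 _ (expMap_mem hq0 hw)
  have hGlim : Tendsto G stripTop (𝓝 1) := hg.lim.comp (tendsto_expMap_stripTop hq0)
  -- normalization at infinity
  obtain ⟨T, hT, hTG⟩ : ∃ T : ℝ, 0 < T ∧ ∀ w ∈ strip, T ≤ w.re → G w ∈ Complex.slitPlane := by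
    have h1 := hGlim.eventually (Complex.isOpen_slitPlane.mem_nhds Complex.one_mem_slitPlane)
    rw [stripTop, eventually_inf_principal, eventually_comap] at h1
    obtain ⟨T, hT⟩ := eventually_atTop.1 h1
    exact ⟨max T 1, lt_max_of_lt_right one_pos, fun w hw hwT =>
      hT _ ((le_max_left _ _).trans hwT) w rfl hw⟩
  have hw1 : (T : ℂ) + branchPt ∈ strip := stripInt_subset (add_branchPt_mem hT)
  set c := k ((T : ℂ) + branchPt) - Complex.log (G ((T : ℂ) + branchPt)) with hc
  have hec : Complex.exp c = 1 := by
    rw [hc, Complex.exp_sub, hkG _ hw1, Complex.exp_log (h0 _ (expMap_mem hq0 hw1))]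
    exact div_self (h0 _ (expMap_mem hq0 hw1))
  set f : ℂ → ℂ := fun w => k w - c with hf
  have hfc : ContinuousOn f strip := hk.sub continuousOn_const
  have hfe : ∀ w ∈ strip, Complex.exp (f w) = G w := fun w hw => by
    rw [hf, Complex.exp_sub, hec, div_one, hkG w hw]
  have htail : Set.EqOn f (fun w => Complex.log (G w)) {w | w ∈ strip ∧ T ≤ w.re} := by
    refine eqOn_of_exp_eqOn (convex_tail T hT).isPreconnected (hfc.mono fun w hw => hw.1)
      ((hGc.mono fun w hw => hw.1).clog fun w hw => hTG w hw.1 hw.2) (fun w hw => ?_)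
      (w₀ := (T : ℂ) + branchPt) ⟨hw1, by simp⟩ ?_
    · rw [hfe w hw.1, Complex.exp_log (h0 _ (expMap_mem hq0 hw.1))]
    · simp only [hf, hc]; ring
  have hnorm : ∀ w ∈ strip, ((q0 : ℂ) * Complex.exp w).im = 0 → (f w).re ≤ 0 := fun w hw him => by
    have h1 := hg.real _ (expMap_mem hq0 hw) him
    have h2 := congrArg norm (hfe w hw)
    rw [Complex.norm_exp] at h2
    rw [← Real.exp_le_one_iff, h2]
    exact h1
  refine ⟨f, ⟨hfc, fun w hw => ?_, ?_, re_log_bound hg hfc hfe, fun u hu => ?_, fun u hu => ?_, ?_⟩,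
    hfe⟩
  · have hwn := isOpen_stripInt.mem_nhds hw
    refine (differentiableAt_of_exp_eq (G := G) ?_ ?_ ?_).differentiableWithinAt
    · exact (hfc w (stripInt_subset hw)).continuousAt
        (mem_of_superset hwn stripInt_subset)
    · have h1 := hg.diff.differentiableAt
        ((isOpen_outerLowerInt q0).mem_nhds (expMap_mem_int hq0 hw))
      exact h1.comp w (by fun_prop)
    · filter_upwards [hwn] with v hv using hfe v (stripInt_subset hv)
  · have h1 : Tendsto (fun w => Complex.log (G w)) stripTop (𝓝 (Complex.log 1)) :=
      ((continuousAt_clog Complex.one_mem_slitPlane).tendsto).comp hGlim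
    rw [Complex.log_one] at h1
    refine h1.congr' ?_
    filter_upwards [eventually_stripTop T] with w hw using (htail hw).symm
  · refine hnorm _ ⟨by simpa using hu, by simpa using hpi.le, by simp, ?_⟩ ?_
    · refine ne_branchPt_of_im ?_
      simp [hpi.ne']
    · rw [expMap_im]; simp
  · refine hnorm _ ⟨by simpa using hu, by simp, by simpa using hpi.le, ?_⟩ ?_
    · refine ne_branchPt_of_im ?_
      simp; linarith
    · rw [expMap_im]; simp
  · have hpt : ∀ s : ℝ, (q0 : ℂ) * Complex.exp (s + branchPt)
        = -(Complex.I * ((q0 * Real.exp s : ℝ) : ℂ)) := fun s => by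
      rw [Complex.exp_add, exp_branchPt]; push_cast; ring
    have hY : Tendsto (fun s : ℝ => q0 * Real.exp s) atTop atTop :=
      Real.tendsto_exp_atTop.const_mul_atTop hq0
    have h1 : (fun s : ℝ => G (s + branchPt) - 1) =O[atTop] fun s : ℝ => Real.exp (-s) := by
      have h2 := hg.decay.comp_tendsto hY
      refine Asymptotics.IsBigO.trans (h2.congr' (f₂ := fun s : ℝ => G (s + branchPt) - 1)
        (Eventually.of_forall fun s => ?_) EventuallyEq.rfl) ?_
      · simp only [Function.comp, hG, hpt]
      · refine Asymptotics.IsBigO.of_bound q0⁻¹ (Eventually.of_forall fun s => ?_)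
        simp only [Function.comp, norm_inv, norm_mul, Real.norm_eq_abs, Real.abs_exp, mul_inv,
          Real.exp_neg, abs_of_pos hq0]
        exact le_rfl
    have h3 : Tendsto (fun s : ℝ => G (s + branchPt)) atTop (𝓝 1) := by
      have h4 := h1.trans_tendsto (Real.tendsto_exp_neg_atTop_nhds_zero)
      simpa using h4.add_const 1
    have h5 : (fun s : ℝ => Complex.log (G (s + branchPt)) - Complex.log 1) =O[atTop]
        fun s : ℝ => G (s + branchPt) - 1 :=
      ((Complex.differentiableAt_log Complex.one_mem_slitPlane).isBigO_sub).comp_tendsto h3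
    refine ((h5.trans h1).congr' ?_ EventuallyEq.rfl)
    filter_upwards [eventually_ge_atTop T] with s hs
    rw [Complex.log_one, sub_zero]
    exact (htail ⟨stripInt_subset (add_branchPt_mem (hT.trans_le hs)), by simpa using hs⟩).symm

/-- The Schwarz reflection of a function on the strip in the middle line `Im w = -π/2`. -/
noncomputable def reflect (f : ℂ → ℂ) (w : ℂ) : ℂ := conj (f (conj w - Complex.I * Real.pi))

theorem reflect_mem {w : ℂ} (hw : w ∈ strip) : conj w - Complex.I * Real.pi ∈ strip := by
  obtain ⟨h1, h2, h3, h4⟩ := hw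
  refine ⟨by simpa using h1, by simpa using h3, by simp; linarith, fun h => h4 ?_⟩
  have e1 := congrArg Complex.re h
  have e2 := congrArg Complex.im h
  simp at e1 e2
  apply Complex.ext
  · simpa using e1
  · rw [branchPt_im]; linarith

theorem reflect_mem_int {w : ℂ} (hw : w ∈ stripInt) : conj w - Complex.I * Real.pi ∈ stripInt := by
  obtain ⟨h1, h2, h3⟩ := hw
  exact ⟨by simpa using h1, by simpa using h3, by simp; linarith⟩

theorem StripLog.reflect {f : ℂ → ℂ} (h : StripLog f) : StripLog (reflect f) := by
  have hc : Continuous fun w : ℂ => conj w - Complex.I * Real.pi :=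
    Complex.continuous_conj.sub continuous_const
  refine ⟨?_, ?_, ?_, ?_, ?_, ?_, ?_⟩
  · exact Complex.continuous_conj.comp_continuousOn
      (h.cont.comp hc.continuousOn fun w hw => reflect_mem hw)
  · intro w hw
    have h1 := h.diff.differentiableAt (isOpen_stripInt.mem_nhds (reflect_mem_int hw))
    have h2 : DifferentiableAt ℂ (fun v => f (v - Complex.I * Real.pi)) (conj w) :=
      h1.comp (conj w) (by fun_prop)
    have h3 := h2.conj_conj
    rw [Complex.conj_conj] at h3
    exact h3.differentiableWithinAt
  · have h1 : Tendsto (fun w : ℂ => conj w - Complex.I * Real.pi) stripTop stripTop := by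
      refine tendsto_inf.2 ⟨tendsto_comap_iff.2 ?_, tendsto_principal.2 ?_⟩
      · refine (tendsto_comap.mono_left (inf_le_left : stripTop ≤ _)).congr fun w => ?_
        simp
      · filter_upwards [eventually_stripTop 0] with w hw using reflect_mem hw.1
    have h2 := (Complex.continuous_conj.tendsto 0).comp (h.lim.comp h1)
    rw [map_zero] at h2
    exact h2
  · obtain ⟨M, hM⟩ := h.re_le
    refine ⟨M, fun w hw h1 h2 => ?_⟩
    have h3 := hM _ (reflect_mem hw) (by simpa using h1) (by simp; intro e; apply h2; linarith)
    have e : |(conj w - Complex.I * (Real.pi : ℂ)).im + Real.pi / 2| = |w.im + Real.pi / 2| := by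
      rw [← abs_neg]; congr 1; simp; ring
    rw [e] at h3
    simpa [IfoNLS.reflect] using h3
  · intro u hu
    simpa [IfoNLS.reflect] using h.nonpos' u hu
  · intro u hu
    have := h.nonpos u hu
    simpa [IfoNLS.reflect] using this
  · refine (Asymptotics.isBigO_norm_left.1 ((Asymptotics.isBigO_norm_left.2 h.decay).congr_left
      fun T => ?_))
    rw [IfoNLS.reflect, RCLike.norm_conj]
    congr 2
    apply Complex.ext
    · simp
    · simp; ring

end IfoNLS

/-! ### The residue theorem on a rectangle and a convergence theorem -/

namespace IfoNLS

/-- The integral over the boundary of the rectangle `[x₀,x₁] × [y₀,y₁]`, counterclockwise. -/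
noncomputable def rectInt (F : ℂ → ℂ) (x₀ x₁ y₀ y₁ : ℝ) : ℂ :=
  (∫ x : ℝ in x₀..x₁, F (x + y₀ * Complex.I)) - (∫ x : ℝ in x₀..x₁, F (x + y₁ * Complex.I))
    + Complex.I * (∫ y : ℝ in y₀..y₁, F (x₁ + y * Complex.I))
    - Complex.I * (∫ y : ℝ in y₀..y₁, F (x₀ + y * Complex.I))

theorem rectInt_eq_zero {F : ℂ → ℂ} {x₀ x₁ y₀ y₁ : ℝ} (hx : x₀ ≤ x₁) (hy : y₀ ≤ y₁)
    (hc : ContinuousOn F (Set.Icc x₀ x₁ ×ℂ Set.Icc y₀ y₁))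
    (hd : DifferentiableOn ℂ F (Set.Ioo x₀ x₁ ×ℂ Set.Ioo y₀ y₁)) : rectInt F x₀ x₁ y₀ y₁ = 0 := by
  have h := Complex.integral_boundary_rect_eq_zero_of_continuousOn_of_differentiableOn F
    ⟨x₀, y₀⟩ ⟨x₁, y₁⟩ (by simpa only [Set.uIcc_of_le hx, Set.uIcc_of_le hy] using hc)
    (by simpa only [min_eq_left hx, min_eq_left hy, max_eq_right hx, max_eq_right hy] using hd)
  simp only [smul_eq_mul] at h
  exact h

section Sides

variable {F : ℂ → ℂ} {x₀ x₁ y₀ y₁ : ℝ}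

theorem horizontal_continuousOn {s : Set ℂ} (hc : ContinuousOn F s) {y : ℝ}
    (h : ∀ x ∈ Set.Icc x₀ x₁, ((x : ℂ) + y * Complex.I) ∈ s) :
    ContinuousOn (fun x : ℝ => F (x + y * Complex.I)) (Set.Icc x₀ x₁) :=
  hc.comp (by fun_prop) h

theorem vertical_continuousOn {s : Set ℂ} (hc : ContinuousOn F s) {x : ℝ}
    (h : ∀ y ∈ Set.Icc y₀ y₁, ((x : ℂ) + y * Complex.I) ∈ s) :
    ContinuousOn (fun y : ℝ => F (x + y * Complex.I)) (Set.Icc y₀ y₁) :=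
  hc.comp (by fun_prop) h

end Sides

/-- The winding number of the boundary of a rectangle: the principal logarithm is a primitive on
three of the sides, and its reflection on the fourth. -/
theorem rectInt_inv_sub {w₀ : ℂ} {x₀ x₁ y₀ y₁ : ℝ} (hx₀ : x₀ < w₀.re) (hx₁ : w₀.re < x₁)
    (hy₀ : y₀ < w₀.im) (hy₁ : w₀.im < y₁) :
    rectInt (fun w => (w - w₀)⁻¹) x₀ x₁ y₀ y₁ = 2 * Real.pi * Complex.I := by
  have hre : ∀ x y : ℝ, ((x : ℂ) + y * Complex.I - w₀).re = x - w₀.re := fun x y => by simp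
  have him : ∀ x y : ℝ, ((x : ℂ) + y * Complex.I - w₀).im = y - w₀.im := fun x y => by simp
  have hH : ∀ y : ℝ, y - w₀.im ≠ 0 → ∫ x : ℝ in x₀..x₁, ((x : ℂ) + y * Complex.I - w₀)⁻¹
      = Complex.log (x₁ + y * Complex.I - w₀) - Complex.log (x₀ + y * Complex.I - w₀) := by
    intro y hy
    have hs : ∀ x : ℝ, ((x : ℂ) + y * Complex.I - w₀) ∈ Complex.slitPlane := fun x =>
      Or.inr (by rw [him]; exact hy)
    refine intervalIntegral.integral_eq_sub_of_hasDerivAt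
      (f := fun x : ℝ => Complex.log ((x : ℂ) + y * Complex.I - w₀)) (fun x _ => ?_) ?_
    · have h1 : HasDerivAt (fun x : ℝ => (x : ℂ) + y * Complex.I - w₀) 1 x :=
        ((Complex.ofRealCLM.hasDerivAt (x := x)).add_const _).sub_const _
      simpa using h1.clog_real (hs x)
    · refine ContinuousOn.intervalIntegrable fun x _ => ContinuousAt.continuousWithinAt ?_
      exact ContinuousAt.inv₀ (by fun_prop) (Complex.slitPlane_ne_zero (hs x))
  have hV : ∫ y : ℝ in y₀..y₁, ((x₁ : ℂ) + y * Complex.I - w₀)⁻¹ * Complex.I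
      = Complex.log (x₁ + y₁ * Complex.I - w₀) - Complex.log (x₁ + y₀ * Complex.I - w₀) := by
    have hs : ∀ y : ℝ, ((x₁ : ℂ) + y * Complex.I - w₀) ∈ Complex.slitPlane := fun y =>
      Or.inl (by rw [hre]; linarith)
    refine intervalIntegral.integral_eq_sub_of_hasDerivAt
      (f := fun y : ℝ => Complex.log ((x₁ : ℂ) + y * Complex.I - w₀)) (fun y _ => ?_) ?_
    · have h1 : HasDerivAt (fun y : ℝ => (x₁ : ℂ) + y * Complex.I - w₀) (1 * Complex.I) y :=
        (((Complex.ofRealCLM.hasDerivAt (x := y)).mul_const _).const_add _).sub_const _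
      refine (h1.clog_real (hs y)).congr_deriv ?_
      rw [one_mul, div_eq_inv_mul]
    · refine ContinuousOn.intervalIntegrable fun y _ => ContinuousAt.continuousWithinAt ?_
      have h1 : ContinuousAt (fun y : ℝ => ((x₁ : ℂ) + y * Complex.I - w₀)⁻¹) y :=
        ContinuousAt.inv₀ (by fun_prop) (Complex.slitPlane_ne_zero (hs y))
      exact h1.mul continuousAt_const
  have hV' : ∫ y : ℝ in y₀..y₁, ((x₀ : ℂ) + y * Complex.I - w₀)⁻¹ * Complex.I
      = Complex.log (-(x₀ + y₁ * Complex.I - w₀)) - Complex.log (-(x₀ + y₀ * Complex.I - w₀)) := by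
    have hs : ∀ y : ℝ, -((x₀ : ℂ) + y * Complex.I - w₀) ∈ Complex.slitPlane := fun y =>
      Or.inl (by rw [Complex.neg_re, hre]; linarith)
    have hne : ∀ y : ℝ, ((x₀ : ℂ) + y * Complex.I - w₀) ≠ 0 := fun y h =>
      Complex.slitPlane_ne_zero (hs y) (by rw [h, neg_zero])
    refine intervalIntegral.integral_eq_sub_of_hasDerivAt
      (f := fun y : ℝ => Complex.log (-((x₀ : ℂ) + y * Complex.I - w₀))) (fun y _ => ?_) ?_
    · have h1 : HasDerivAt (fun y : ℝ => -((x₀ : ℂ) + y * Complex.I - w₀)) (-(1 * Complex.I)) y :=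
        ((((Complex.ofRealCLM.hasDerivAt (x := y)).mul_const _).const_add _).sub_const _).fun_neg
      refine (h1.clog_real (hs y)).congr_deriv ?_
      rw [one_mul, neg_div_neg_eq, div_eq_inv_mul]
    · refine ContinuousOn.intervalIntegrable fun y _ => ContinuousAt.continuousWithinAt ?_
      have h1 : ContinuousAt (fun y : ℝ => ((x₀ : ℂ) + y * Complex.I - w₀)⁻¹) y :=
        ContinuousAt.inv₀ (by fun_prop) (hne y)
      exact h1.mul continuousAt_const
  have hneg : ∀ z : ℂ, 0 < z.im → Complex.log (-z) = Complex.log z - Real.pi * Complex.I := by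
    intro z hz
    simp only [Complex.log, norm_neg, Complex.arg_neg_eq_arg_sub_pi_of_im_pos hz]
    push_cast; ring
  have hneg' : ∀ z : ℂ, z.im < 0 → Complex.log (-z) = Complex.log z + Real.pi * Complex.I := by
    intro z hz
    simp only [Complex.log, norm_neg, Complex.arg_neg_eq_arg_add_pi_of_im_neg hz]
    push_cast; ring
  rw [intervalIntegral.integral_mul_const] at hV hV'
  rw [rectInt, hH y₀ (by linarith), hH y₁ (by linarith), mul_comm Complex.I, hV,
    mul_comm Complex.I, hV', hneg _ (by rw [him]; linarith), hneg' _ (by rw [him]; linarith)]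
  ring

/-- The residue theorem for a rectangle and a simple pole. -/
theorem rectInt_eq_residue {F : ℂ → ℂ} {w₀ c : ℂ} {x₀ x₁ y₀ y₁ : ℝ} (hx₀ : x₀ < w₀.re)
    (hx₁ : w₀.re < x₁) (hy₀ : y₀ < w₀.im) (hy₁ : w₀.im < y₁)
    (hc : ContinuousOn F ((Set.Icc x₀ x₁ ×ℂ Set.Icc y₀ y₁) \ {w₀}))
    (hd : DifferentiableOn ℂ F ((Set.Ioo x₀ x₁ ×ℂ Set.Ioo y₀ y₁) \ {w₀}))
    (hres : Tendsto (fun w => (w - w₀) * F w) (𝓝[≠] w₀) (𝓝 c)) :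
    rectInt F x₀ x₁ y₀ y₁ = 2 * Real.pi * Complex.I * c := by
  have hx : x₀ < x₁ := hx₀.trans hx₁
  have hy : y₀ < y₁ := hy₀.trans hy₁
  set R := Set.Icc x₀ x₁ ×ℂ Set.Icc y₀ y₁ with hR
  set R' := Set.Ioo x₀ x₁ ×ℂ Set.Ioo y₀ y₁ with hR'
  have hR'R : R' ⊆ R := fun w hw => ⟨Set.Ioo_subset_Icc_self hw.1, Set.Ioo_subset_Icc_self hw.2⟩
  have hmem : R' ∈ 𝓝 w₀ := (isOpen_Ioo.reProdIm isOpen_Ioo).mem_nhds ⟨⟨hx₀, hx₁⟩, ⟨hy₀, hy₁⟩⟩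
  have hmemR : R ∈ 𝓝 w₀ := mem_of_superset hmem hR'R
  set φ : ℂ → ℂ := Function.update (fun w => (w - w₀) * F w) w₀ c with hφ
  have hφ0 : φ w₀ = c := Function.update_self ..
  have hφne : ∀ w, w ≠ w₀ → φ w = (w - w₀) * F w := fun w hw => Function.update_of_ne hw ..
  have hφc0 : ContinuousAt φ w₀ := continuousAt_update_same.2 hres
  have hφd : DifferentiableOn ℂ φ R' := by
    refine (Complex.differentiableOn_compl_singleton_and_continuousAt_iff hmem).1 ⟨?_, hφc0⟩
    refine DifferentiableOn.congr (f := fun w => (w - w₀) * F w) ?_ fun w hw => hφne w hw.2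
    exact DifferentiableOn.fun_mul (by fun_prop) hd
  have hφc : ContinuousOn φ R := by
    intro w hw
    by_cases h : w = w₀
    · rw [h]; exact hφc0.continuousWithinAt
    · have h1 : ContinuousWithinAt (fun w => (w - w₀) * F w) (R \ {w₀}) w :=
        ContinuousWithinAt.mul (by fun_prop) (hc w ⟨hw, h⟩)
      have h2 : ContinuousWithinAt φ (R \ {w₀}) w := h1.congr (fun v hv => hφne v hv.2) (hφne w h)
      exact h2.mono_of_mem_nhdsWithin (inter_mem_nhdsWithin R (isOpen_compl_singleton.mem_nhds h))
  have hψd : DifferentiableOn ℂ (dslope φ w₀) R' := (Complex.differentiableOn_dslope hmem).2 hφd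
  have hψc : ContinuousOn (dslope φ w₀) R :=
    (continuousOn_dslope hmemR).2 ⟨hφc, hφd.differentiableAt hmem⟩
  have h0 := rectInt_eq_zero hx.le hy.le hψc hψd
  have h1 := rectInt_inv_sub hx₀ hx₁ hy₀ hy₁
  have hFe : ∀ w, w ≠ w₀ → F w = dslope φ w₀ w + c * (w - w₀)⁻¹ := fun w hw => by
    have h2 := sub_ne_zero.2 hw
    rw [dslope_of_ne _ hw, slope_def_field, hφne w hw, hφ0]
    field_simp
    ring
  have hic : ContinuousOn (fun w : ℂ => c * (w - w₀)⁻¹) {w₀}ᶜ :=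
    continuousOn_const.mul ((continuousOn_id.sub continuousOn_const).inv₀ fun w hw =>
      sub_ne_zero.2 hw)
  have hhor : ∀ y, y ∈ Set.Icc y₀ y₁ → y ≠ w₀.im → ∫ x : ℝ in x₀..x₁, F (x + y * Complex.I)
      = (∫ x : ℝ in x₀..x₁, dslope φ w₀ (x + y * Complex.I))
        + c * ∫ x : ℝ in x₀..x₁, ((x : ℂ) + y * Complex.I - w₀)⁻¹ := by
    intro y hyI hyne
    have hne : ∀ x : ℝ, (x : ℂ) + y * Complex.I ≠ w₀ := fun x h => hyne (by simp [← h])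
    rw [← intervalIntegral.integral_const_mul, ← intervalIntegral.integral_add]
    · exact intervalIntegral.integral_congr fun x _ => hFe _ (hne x)
    · refine (horizontal_continuousOn hψc fun x hxI => ?_).intervalIntegrable_of_Icc hx.le
      exact ⟨by simpa using hxI, by simpa using hyI⟩
    · exact (horizontal_continuousOn hic fun x _ => hne x).intervalIntegrable_of_Icc hx.le
  have hver : ∀ x, x ∈ Set.Icc x₀ x₁ → x ≠ w₀.re → ∫ y : ℝ in y₀..y₁, F (x + y * Complex.I)
      = (∫ y : ℝ in y₀..y₁, dslope φ w₀ (x + y * Complex.I))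
        + c * ∫ y : ℝ in y₀..y₁, ((x : ℂ) + y * Complex.I - w₀)⁻¹ := by
    intro x hxI hxne
    have hne : ∀ y : ℝ, (x : ℂ) + y * Complex.I ≠ w₀ := fun y h => hxne (by simp [← h])
    rw [← intervalIntegral.integral_const_mul, ← intervalIntegral.integral_add]
    · exact intervalIntegral.integral_congr fun y _ => hFe _ (hne y)
    · refine (vertical_continuousOn hψc fun y hyI => ?_).intervalIntegrable_of_Icc hy.le
      exact ⟨by simpa using hxI, by simpa using hyI⟩
    · exact (vertical_continuousOn hic fun y _ => hne y).intervalIntegrable_of_Icc hy.le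
  unfold rectInt at h0 h1 ⊢
  rw [hhor y₀ (Set.left_mem_Icc.2 hy.le) hy₀.ne, hhor y₁ (Set.right_mem_Icc.2 hy.le) hy₁.ne',
    hver x₁ (Set.right_mem_Icc.2 hx.le) hx₁.ne', hver x₀ (Set.left_mem_Icc.2 hx.le) hx₀.ne]
  linear_combination h0 + c * h1

/-- Radial truncation at the radius `R`. -/
noncomputable def truncAt (R : ℝ) (z : ℂ) : ℂ := ((R / max R ‖z‖ : ℝ) : ℂ) * z

theorem continuous_truncAt {R : ℝ} (hR : 0 < R) : Continuous (truncAt R) := by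
  unfold truncAt
  have : ∀ z : ℂ, max R ‖z‖ ≠ 0 := fun z => (lt_max_of_lt_left hR).ne'
  fun_prop (disch := exact this _)

theorem norm_truncAt_le {R : ℝ} (hR : 0 < R) (z : ℂ) : ‖truncAt R z‖ ≤ R := by
  have h : 0 < max R ‖z‖ := lt_max_of_lt_left hR
  rw [truncAt, norm_mul, Complex.norm_real, Real.norm_eq_abs, abs_of_nonneg (by positivity),
    div_mul_eq_mul_div, div_le_iff₀ h]
  exact mul_le_mul_of_nonneg_left (le_max_right _ _) hR.le

theorem norm_sub_truncAt_le {R : ℝ} (hR : 0 < R) (z : ℂ) : ‖z - truncAt R z‖ ≤ ‖z‖ ^ 2 / R := by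
  have h : 0 < max R ‖z‖ := lt_max_of_lt_left hR
  have e : z - truncAt R z = ((1 - R / max R ‖z‖ : ℝ) : ℂ) * z := by rw [truncAt]; push_cast; ring
  have h1 : R / max R ‖z‖ ≤ 1 := (div_le_one h).2 (le_max_left _ _)
  rw [e, norm_mul, Complex.norm_real, Real.norm_eq_abs, abs_of_nonneg (by linarith)]
  rcases le_total ‖z‖ R with h2 | h2
  · rw [max_eq_left h2, div_self hR.ne', sub_self, zero_mul]; positivity
  · rw [max_eq_right h2, le_div_iff₀ hR]
    have h3 : 0 < ‖z‖ := hR.trans_le h2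
    have h4 : (1 - R / ‖z‖) * ‖z‖ = ‖z‖ - R := by field_simp
    rw [h4]
    nlinarith

/-- On a finite measure space, a uniform bound of the square integrals allows to pass to the limit
in the integrals. -/
theorem tendsto_integral_of_sq_bounded {α : Type*} [MeasurableSpace α] {μ : Measure α}
    [IsFiniteMeasure μ] {f : ℕ → α → ℂ} {g : α → ℂ} {K : ℝ}
    (hf : ∀ n, AEStronglyMeasurable (f n) μ)
    (hlim : ∀ᵐ x ∂μ, Tendsto (fun n => f n x) atTop (𝓝 (g x)))
    (hint : ∀ n, Integrable (fun x => ‖f n x‖ ^ 2) μ) (hK : ∀ n, ∫ x, ‖f n x‖ ^ 2 ∂μ ≤ K) :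
    MemLp g 2 μ ∧ Integrable g μ ∧ Tendsto (fun n => ∫ x, f n x ∂μ) atTop (𝓝 (∫ x, g x ∂μ)) := by
  have hgm : AEStronglyMeasurable g μ := aestronglyMeasurable_of_tendsto_ae atTop hf hlim
  have hf2 : ∀ n, MemLp (f n) 2 μ := fun n => (memLp_two_iff_integrable_sq_norm (hf n)).2 (hint n)
  have hK0 : 0 ≤ K := (integral_nonneg fun x => by positivity).trans (hK 0)
  have hnorm : ∀ n, eLpNorm (f n) 2 μ ≤ ENNReal.ofReal (Real.sqrt K) := fun n => by
    rw [(hf2 n).eLpNorm_eq_integral_rpow_norm two_ne_zero ENNReal.ofNat_ne_top]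
    refine ENNReal.ofReal_le_ofReal ?_
    simp only [ENNReal.toReal_ofNat, Real.rpow_two]
    rw [Real.sqrt_eq_rpow, one_div]
    exact Real.rpow_le_rpow (integral_nonneg fun x => by positivity) (hK n) (by norm_num)
  have hg2n : eLpNorm g 2 μ ≤ ENNReal.ofReal (Real.sqrt K) := by
    refine (Lp.eLpNorm_lim_le_liminf_eLpNorm hf g hlim).trans ?_
    refine (liminf_le_liminf (Eventually.of_forall hnorm)).trans ?_
    simp
  have hg2 : MemLp g 2 μ := ⟨hgm, hg2n.trans_lt ENNReal.ofReal_lt_top⟩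
  have hgi : Integrable g μ := hg2.integrable (by norm_num)
  have hgsq : Integrable (fun x => ‖g x‖ ^ 2) μ := (memLp_two_iff_integrable_sq_norm hgm).1 hg2
  refine ⟨hg2, hgi, ?_⟩
  set K' := max K (∫ x, ‖g x‖ ^ 2 ∂μ)
  have hfi : ∀ n, Integrable (f n) μ := fun n => (hf2 n).integrable (by norm_num)
  have key : ∀ R : ℝ, 0 < R → ∀ h : α → ℂ, Integrable h μ → Integrable (fun x => ‖h x‖ ^ 2) μ →
      ∫ x, ‖h x‖ ^ 2 ∂μ ≤ K' →
      ‖(∫ x, h x ∂μ) - ∫ x, truncAt R (h x) ∂μ‖ ≤ K' / R := by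
    intro R hR h h1 h2 h3
    have h4 : Integrable (fun x => truncAt R (h x)) μ :=
      Integrable.mono' (integrable_const R)
        ((continuous_truncAt hR).comp_aestronglyMeasurable h1.aestronglyMeasurable)
        (Eventually.of_forall fun x => norm_truncAt_le hR _)
    rw [← integral_sub h1 h4]
    refine (norm_integral_le_of_norm_le (h2.div_const R)
      (Eventually.of_forall fun x => norm_sub_truncAt_le hR (h x))).trans ?_
    rw [integral_div]
    gcongr
  rw [Metric.tendsto_atTop]
  intro ε hε
  have hK'0 : 0 ≤ K' := hK0.trans (le_max_left _ _)
  set R := 3 * (K' + 1) / ε with hR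
  have hR0 : 0 < R := by positivity
  have hKR : K' / R < ε / 3 := by
    rw [hR, div_lt_iff₀ (by positivity)]
    have : ε / 3 * (3 * (K' + 1) / ε) = K' + 1 := by field_simp
    linarith
  have htr : Tendsto (fun n => ∫ x, truncAt R (f n x) ∂μ) atTop (𝓝 (∫ x, truncAt R (g x) ∂μ)) := by
    refine tendsto_integral_of_dominated_convergence (fun _ => R)
      (fun n => (continuous_truncAt hR0).comp_aestronglyMeasurable (hf n)) (integrable_const R)
      (fun n => Eventually.of_forall fun x => norm_truncAt_le hR0 _) ?_
    filter_upwards [hlim] with x hx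
    exact ((continuous_truncAt hR0).tendsto _).comp hx
  obtain ⟨N, hN⟩ := Metric.tendsto_atTop.1 htr (ε / 3) (by positivity)
  refine ⟨N, fun n hn => ?_⟩
  have a1 := key R hR0 (f n) (hfi n) (hint n) ((hK n).trans (le_max_left _ _))
  have a2 := key R hR0 g hgi hgsq (le_max_right _ _)
  have a3 := hN n hn
  rw [dist_eq_norm] at a3 ⊢
  have e : (∫ x, f n x ∂μ) - ∫ x, g x ∂μ
      = ((∫ x, f n x ∂μ) - ∫ x, truncAt R (f n x) ∂μ)
        + ((∫ x, truncAt R (f n x) ∂μ) - ∫ x, truncAt R (g x) ∂μ)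
        - ((∫ x, g x ∂μ) - ∫ x, truncAt R (g x) ∂μ) := by ring
  rw [e]
  calc _ ≤ ‖(∫ x, f n x ∂μ) - ∫ x, truncAt R (f n x) ∂μ‖
        + ‖(∫ x, truncAt R (f n x) ∂μ) - ∫ x, truncAt R (g x) ∂μ‖
        + ‖(∫ x, g x ∂μ) - ∫ x, truncAt R (g x) ∂μ‖ :=
      (norm_sub_le _ _).trans (add_le_add_left (norm_add_le _ _) _)
    _ < ε := by linarith

end IfoNLS

/-! ### Contour integrals over the boundary of the half-strip -/

namespace IfoNLS

/-- The integral of `H` over the boundary of `[0,T] × [-π,0]` without the side `Re w = T`, with the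
upper side from left to right. -/
noncomputable def openInt (H : ℂ → ℂ) (T : ℝ) : ℂ :=
  (∫ u : ℝ in (0 : ℝ)..T, H (u + (0 : ℝ) * Complex.I))
    - (∫ u : ℝ in (0 : ℝ)..T, H (u + (-Real.pi : ℝ) * Complex.I))
    + Complex.I * ∫ s : ℝ in (-Real.pi)..0, H ((0 : ℝ) + s * Complex.I)

/-- The closed half-strip. -/
def closedStrip : Set ℂ := Set.Ici 0 ×ℂ Set.Icc (-Real.pi) 0

theorem strip_subset : strip ⊆ closedStrip := fun _ h => ⟨h.1, h.2.1, h.2.2.1⟩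

/-- The square integrals over the segments `Re w = δ` stay bounded as `δ → 0`. -/
def SqBounded (g : ℂ → ℂ) : Prop :=
  ∃ K η : ℝ, 0 < η ∧ ∀ δ : ℝ, 0 < δ → δ ≤ η →
    ∫ s : ℝ in (-Real.pi)..0, ‖g (δ + s * Complex.I)‖ ^ 2 ≤ K

theorem mk_mem_strip {x y : ℝ} (hx : 0 ≤ x) (hy : y ∈ Set.Icc (-Real.pi) 0)
    (h : x ≠ 0 ∨ y ≠ -(Real.pi / 2)) : (x : ℂ) + y * Complex.I ∈ strip := by
  refine ⟨by simpa using hx, by simpa using hy.1, by simpa using hy.2, ?_⟩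
  rcases h with h | h
  · exact ne_branchPt_of_re (by simpa using h)
  · exact ne_branchPt_of_im (by simpa using h)

/-- The contour integral over the open boundary of the half-strip by the residue theorem. The
singularity at the boundary point `-iπ/2` does no harm because of the bound of the square
integrals. -/
theorem openInt_eq {g : ℂ → ℂ} {w₀ c : ℂ} (hw₀ : w₀ ∈ stripInt)
    (hc : ContinuousOn g (strip \ {w₀})) (hd : DifferentiableOn ℂ g (stripInt \ {w₀}))
    (hres : Tendsto (fun w => (w - w₀) * g w) (𝓝[≠] w₀) (𝓝 c)) (hsq : SqBounded g) {T : ℝ}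
    (hT : w₀.re < T) :
    openInt g T = Complex.I * (∫ s : ℝ in (-Real.pi)..0, g (T + s * Complex.I))
      - 2 * Real.pi * Complex.I * c ∧
    MemLp (fun s : ℝ => g ((0 : ℝ) + s * Complex.I)) 2
      (volume.restrict (Set.Ioc (-Real.pi) 0)) := by
  have hpi := Real.pi_pos
  obtain ⟨K, η, hη, hK⟩ := hsq
  have hT0 : 0 < T := hw₀.1.trans hT
  set m := min η w₀.re with hm
  have hm0 : 0 < m := lt_min hη hw₀.1
  set d : ℕ → ℝ := fun n => m / (n + 2) with hdn
  have hd0 : ∀ n, 0 < d n := fun n => by simp only [hdn]; positivity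
  have hdm : ∀ n, d n < m := fun n => by
    simp only [hdn]
    rw [div_lt_iff₀ (by positivity)]
    have : (0 : ℝ) ≤ n := Nat.cast_nonneg n
    nlinarith
  have hdlim : Tendsto d atTop (𝓝 0) := by
    have h1 : Tendsto (fun n : ℕ => (n : ℝ) + 2) atTop atTop :=
      tendsto_atTop_add_const_right _ _ tendsto_natCast_atTop_atTop
    exact h1.const_div_atTop m
  have hdw : ∀ n, d n < w₀.re := fun n => (hdm n).trans_le (min_le_right _ _)
  have hrect : ∀ n, rectInt g (d n) T (-Real.pi) 0 = 2 * Real.pi * Complex.I * c := by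
    intro n
    refine rectInt_eq_residue (hdw n) hT hw₀.2.1 hw₀.2.2 (hc.mono ?_) (hd.mono ?_) hres
    · rintro w ⟨⟨h1, h2⟩, h3⟩
      have h1' : 0 < w.re := (hd0 n).trans_le h1.1
      exact ⟨⟨h1'.le, h2.1, h2.2, ne_branchPt_of_re h1'.ne'⟩, h3⟩
    · rintro w ⟨⟨h1, h2⟩, h3⟩
      exact ⟨⟨(hd0 n).trans h1.1, h2.1, h2.2⟩, h3⟩
  have hline : ∀ y : ℝ, y ∈ Set.Icc (-Real.pi) 0 → y ≠ -(Real.pi / 2) → y ≠ w₀.im →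
      Tendsto (fun n => ∫ u : ℝ in d n..T, g (u + y * Complex.I)) atTop
        (𝓝 (∫ u : ℝ in (0 : ℝ)..T, g (u + y * Complex.I))) := by
    intro y hy hy1 hy2
    have h1 : ContinuousOn (fun u : ℝ => g (u + y * Complex.I)) (Set.Icc 0 T) :=
      horizontal_continuousOn hc fun x hx =>
        ⟨mk_mem_strip hx.1 hy (Or.inr hy1), fun h => hy2 (by simp [← Set.mem_singleton_iff.1 h])⟩
    have h2 := intervalIntegral.continuousOn_primitive_interval_left (μ := volume)
      (f := fun u : ℝ => g (u + y * Complex.I)) (a := 0) (b := T)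
      (by rw [Set.uIcc_of_le hT0.le]; exact h1.integrableOn_Icc)
    have h3 := h2 0 Set.left_mem_uIcc
    refine h3.tendsto.comp (tendsto_nhdsWithin_iff.2 ⟨hdlim, Eventually.of_forall fun n => ?_⟩)
    rw [Set.uIcc_of_le hT0.le]
    exact ⟨(hd0 n).le, ((hdw n).trans hT).le⟩
  have hvc : ∀ n, ContinuousOn (fun s : ℝ => g (d n + s * Complex.I)) (Set.Icc (-Real.pi) 0) :=
    fun n => vertical_continuousOn hc fun y hy =>
      ⟨mk_mem_strip (hd0 n).le hy (Or.inl (hd0 n).ne'), fun h => (hdw n).ne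
        (by simp [← Set.mem_singleton_iff.1 h])⟩
  have hleft := tendsto_integral_of_sq_bounded (μ := volume.restrict (Set.Ioc (-Real.pi) 0))
    (f := fun n (s : ℝ) => g (d n + s * Complex.I)) (g := fun s : ℝ => g ((0 : ℝ) + s * Complex.I))
    (K := K)
    (fun n => ((hvc n).mono Set.Ioc_subset_Icc_self).aestronglyMeasurable measurableSet_Ioc)
    (by
      have hne : ∀ᵐ s : ℝ ∂volume.restrict (Set.Ioc (-Real.pi) 0), s ≠ -(Real.pi / 2) :=
        ae_restrict_of_ae (by simp [ae_iff, measure_singleton])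
      filter_upwards [hne, ae_restrict_mem measurableSet_Ioc] with s hs hsI
      have hsI' := Set.Ioc_subset_Icc_self hsI
      have hmem0 : ((0 : ℝ) : ℂ) + s * Complex.I ∈ strip \ {w₀} :=
        ⟨mk_mem_strip le_rfl hsI' (Or.inr hs), fun h => hw₀.1.ne
          (by simp [← Set.mem_singleton_iff.1 h])⟩
      refine (hc _ hmem0).tendsto.comp (tendsto_nhdsWithin_iff.2
        ⟨?_, Eventually.of_forall fun n => ⟨mk_mem_strip (hd0 n).le hsI' (Or.inr hs), fun h =>
          (hdw n).ne (by simp [← Set.mem_singleton_iff.1 h])⟩⟩)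
      exact ((Complex.continuous_ofReal.tendsto 0).comp hdlim).add_const _)
    (fun n => (((hvc n).norm.pow 2).integrableOn_Icc).mono_set Set.Ioc_subset_Icc_self)
    (fun n => by
      have := hK (d n) (hd0 n) ((hdm n).le.trans (min_le_left _ _))
      rwa [intervalIntegral.integral_of_le (by linarith)] at this)
  refine ⟨?_, hleft.1⟩
  have hl := hleft.2.2
  simp only [← intervalIntegral.integral_of_le (show -Real.pi ≤ 0 by linarith)] at hl
  have hb := hline (-Real.pi) (Set.left_mem_Icc.2 (by linarith)) (by intro h; linarith)
    (hw₀.2.1.ne)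
  have ht := hline 0 (Set.right_mem_Icc.2 (by linarith)) (by intro h; linarith) (hw₀.2.2.ne')
  have hall := ((hb.sub ht).add_const
    (Complex.I * (∫ s : ℝ in (-Real.pi)..0, g (T + s * Complex.I)))).sub (hl.const_mul Complex.I)
  have hcon : Tendsto (fun n => rectInt g (d n) T (-Real.pi) 0) atTop
      (𝓝 (2 * Real.pi * Complex.I * c)) := by
    simp only [hrect]; exact tendsto_const_nhds
  have := tendsto_nhds_unique hall hcon
  unfold openInt
  linear_combination -this

theorem tendsto_integral_vertical {g : ℂ → ℂ} {w₀ ℓ : ℂ} (hw₀ : w₀ ∈ stripInt)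
    (hc : ContinuousOn g (strip \ {w₀})) (hlim : Tendsto g stripTop (𝓝 ℓ)) :
    Tendsto (fun T : ℝ => ∫ s : ℝ in (-Real.pi)..0, g (T + s * Complex.I)) atTop
      (𝓝 (Real.pi * ℓ)) := by
  have hpi := Real.pi_pos
  rw [Metric.tendsto_atTop]
  intro ε hε
  have h1 := Metric.tendsto_nhds.1 hlim (ε / (2 * Real.pi)) (by positivity)
  rw [stripTop, eventually_inf_principal, eventually_comap] at h1
  obtain ⟨T₁, hT₁⟩ := eventually_atTop.1 h1
  refine ⟨max (max T₁ 0) (w₀.re + 1), fun T hT => ?_⟩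
  have hTa : T₁ ≤ T := (le_max_left _ _).trans ((le_max_left _ _).trans hT)
  have hTc : w₀.re < T := by linarith [(le_max_right (max T₁ 0) (w₀.re + 1)).trans hT]
  have hTb : 0 < T := hw₀.1.trans hTc
  have hcont : ContinuousOn (fun s : ℝ => g (T + s * Complex.I)) (Set.Icc (-Real.pi) 0) :=
    vertical_continuousOn hc fun y hy => ⟨mk_mem_strip hTb.le hy (Or.inl hTb.ne'), fun h =>
      hTc.ne' (by simp [← Set.mem_singleton_iff.1 h])⟩
  have e : (∫ s : ℝ in (-Real.pi)..0, g (T + s * Complex.I)) - Real.pi * ℓ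
      = ∫ s : ℝ in (-Real.pi)..0, (g (T + s * Complex.I) - ℓ) := by
    rw [intervalIntegral.integral_sub (hcont.intervalIntegrable_of_Icc (by linarith))
      intervalIntegrable_const, intervalIntegral.integral_const]
    simp
  rw [dist_eq_norm, e]
  have h2 := intervalIntegral.norm_integral_le_of_norm_le_const (a := -Real.pi) (b := 0)
    (f := fun s : ℝ => g (T + s * Complex.I) - ℓ) (C := ε / (2 * Real.pi)) fun s hs => by
      rw [Set.uIoc_of_le (by linarith)] at hs
      have := hT₁ T hTa (T + s * Complex.I) (by simp)
        (mk_mem_strip hTb.le (Set.Ioc_subset_Icc_self hs) (Or.inl hTb.ne'))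
      rw [dist_eq_norm] at this
      exact this.le
  refine h2.trans_lt ?_
  rw [zero_sub, neg_neg, abs_of_pos hpi]
  have : ε / (2 * Real.pi) * Real.pi = ε / 2 := by field_simp
  linarith

/-- A kernel on the half-strip with at most one pole, at `w₀` with the residue `r`, and with the
limit `ℓ` at the end. -/
structure StripKernel (k : ℂ → ℂ) (w₀ r ℓ : ℂ) : Prop where
  mem : w₀ ∈ stripInt
  cont : ContinuousOn k (closedStrip \ {w₀})
  diff : DifferentiableOn ℂ k (stripInt \ {w₀})
  res : Tendsto (fun w => (w - w₀) * k w) (𝓝[≠] w₀) (𝓝 r)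
  lim : Tendsto k stripTop (𝓝 ℓ)

theorem StripKernel.bounded {k : ℂ → ℂ} {w₀ r ℓ : ℂ} (h : StripKernel k w₀ r ℓ) :
    ∃ B η : ℝ, 0 < η ∧ ∀ x y : ℝ, 0 ≤ x → x ≤ η → y ∈ Set.Icc (-Real.pi) 0 →
      ((x : ℂ) + y * Complex.I ∈ closedStrip \ {w₀}) ∧ ‖k (x + y * Complex.I)‖ ≤ B := by
  have hη : 0 < w₀.re / 2 := by have := h.mem.1; linarith
  have hsub : Set.Icc 0 (w₀.re / 2) ×ℂ Set.Icc (-Real.pi) 0 ⊆ closedStrip \ {w₀} := by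
    rintro w ⟨h1, h2⟩
    refine ⟨⟨h1.1, h2⟩, fun hw => ?_⟩
    rw [Set.mem_singleton_iff.1 hw] at h1
    linarith [h1.2]
  obtain ⟨B, hB⟩ := (isCompact_Icc.reProdIm isCompact_Icc).exists_bound_of_continuousOn
    (h.cont.mono hsub)
  refine ⟨B, w₀.re / 2, hη, fun x y h1 h2 h3 => ?_⟩
  have hm : (x : ℂ) + y * Complex.I ∈ Set.Icc 0 (w₀.re / 2) ×ℂ Set.Icc (-Real.pi) 0 :=
    ⟨by simpa using ⟨h1, h2⟩, by simpa using h3⟩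
  exact ⟨hsub hm, hB _ hm⟩

theorem StripKernel.sqBounded_mul {k f : ℂ → ℂ} {w₀ r ℓ : ℂ} (h : StripKernel k w₀ r ℓ)
    (hf : SqBounded f) (hfc : ContinuousOn f strip) : SqBounded fun w => f w * k w := by
  have hpi := Real.pi_pos
  obtain ⟨B, η, hη, hB⟩ := h.bounded
  obtain ⟨K, η', hη', hK⟩ := hf
  refine ⟨B ^ 2 * K, min η η', lt_min hη hη', fun δ hδ hδm => ?_⟩
  have hδ1 := hδm.trans (min_le_left _ _)
  have hfv : ContinuousOn (fun s : ℝ => f (δ + s * Complex.I)) (Set.Icc (-Real.pi) 0) :=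
    vertical_continuousOn hfc fun y hy => mk_mem_strip hδ.le hy (Or.inl hδ.ne')
  have hkv : ContinuousOn (fun s : ℝ => k (δ + s * Complex.I)) (Set.Icc (-Real.pi) 0) :=
    vertical_continuousOn h.cont fun y hy => (hB δ y hδ.le hδ1 hy).1
  refine le_trans ?_ (mul_le_mul_of_nonneg_left (hK δ hδ (hδm.trans (min_le_right _ _)))
    (sq_nonneg B))
  rw [← intervalIntegral.integral_const_mul]
  refine intervalIntegral.integral_mono_on (by linarith)
    (((hfv.mul hkv).norm.pow 2).intervalIntegrable_of_Icc (by linarith))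
    ((continuousOn_const.mul (hfv.norm.pow 2)).intervalIntegrable_of_Icc (by linarith))
    fun s hs => ?_
  simp only [norm_mul]
  have h1 := (hB δ s hδ.le hδ1 hs).2
  rw [mul_pow, mul_comm]
  gcongr

theorem StripKernel.tendsto_openInt_mul {k f : ℂ → ℂ} {w₀ r ℓ : ℂ} (h : StripKernel k w₀ r ℓ)
    (hf : SqBounded f) (hfc : ContinuousOn f strip) (hfd : DifferentiableOn ℂ f stripInt) {m : ℂ}
    (hfl : Tendsto f stripTop (𝓝 m)) :
    Tendsto (openInt fun w => f w * k w) atTop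
      (𝓝 (Complex.I * Real.pi * (m * ℓ) - 2 * Real.pi * Complex.I * (r * f w₀))) := by
  have hcont : ContinuousOn (fun w => f w * k w) (strip \ {w₀}) :=
    (hfc.mono sdiff_le).mul (h.cont.mono fun w hw => ⟨strip_subset hw.1, hw.2⟩)
  have hdiff : DifferentiableOn ℂ (fun w => f w * k w) (stripInt \ {w₀}) :=
    (hfd.mono sdiff_le).fun_mul h.diff
  have hf0 : ContinuousAt f w₀ :=
    (hfd.differentiableAt (isOpen_stripInt.mem_nhds h.mem)).continuousAt
  have hres : Tendsto (fun w => (w - w₀) * (f w * k w)) (𝓝[≠] w₀) (𝓝 (r * f w₀)) :=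
    (h.res.mul (hf0.tendsto.mono_left nhdsWithin_le_nhds)).congr fun w => by ring
  have h1 := ((tendsto_integral_vertical h.mem hcont (hfl.mul h.lim)).const_mul Complex.I).sub_const
    (2 * Real.pi * Complex.I * (r * f w₀))
  rw [← mul_assoc Complex.I] at h1
  refine h1.congr' ?_
  filter_upwards [eventually_gt_atTop w₀.re] with T hT
  exact (openInt_eq h.mem hcont hdiff hres (h.sqBounded_mul hf hfc) hT).1.symm

theorem intervalIntegrable_abs_rpow :
    IntervalIntegrable (fun s : ℝ => |s + Real.pi / 2| ^ (-(1 / 2) : ℝ)) volume (-Real.pi) 0 := by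
  have hpi := Real.pi_pos
  have h1 : IntervalIntegrable (fun x : ℝ => x ^ (-(1 / 2) : ℝ)) volume 0 (Real.pi / 2) :=
    intervalIntegral.intervalIntegrable_rpow' (by norm_num)
  refine IntervalIntegrable.trans (b := -(Real.pi / 2)) ?_ ?_
  · have h2 := (h1.comp_sub_left (-(Real.pi / 2))).symm
    have e1 : -(Real.pi / 2) - Real.pi / 2 = -Real.pi := by ring
    rw [e1, sub_zero] at h2
    refine h2.congr fun s hs => ?_
    rw [Set.uIoc_of_le (by linarith)] at hs
    show (-(Real.pi / 2) - s) ^ (-(1 / 2) : ℝ) = |s + Real.pi / 2| ^ (-(1 / 2) : ℝ)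
    rw [abs_of_nonpos (by linarith [hs.2])]
    congr 1; ring
  · have h2 := h1.comp_add_right (Real.pi / 2)
    rw [zero_sub, sub_self] at h2
    refine h2.congr fun s hs => ?_
    rw [Set.uIoc_of_le (by linarith)] at hs
    show (s + Real.pi / 2) ^ (-(1 / 2) : ℝ) = |s + Real.pi / 2| ^ (-(1 / 2) : ℝ)
    rw [abs_of_nonneg (by linarith [hs.1])]

/-- The logarithm has bounded square integrals: the contour integral of `f²` vanishes, so that the
square integral of the imaginary part is controlled by that of the real part. -/
theorem StripLog.sqBounded {f : ℂ → ℂ} (h : StripLog f) : SqBounded f := by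
  have hpi := Real.pi_pos
  have hpi3 := Real.pi_gt_three
  obtain ⟨M, hM⟩ := h.re_le
  have hcomp : IsCompact ((Set.Icc (0 : ℝ) 1 ×ℂ Set.Icc (-Real.pi) 0) \ Metric.ball branchPt 1) :=
    (isCompact_Icc.reProdIm isCompact_Icc).diff Metric.isOpen_ball
  obtain ⟨B, hB⟩ := hcomp.exists_bound_of_continuousOn (f := f) (h.cont.mono fun w hw =>
    ⟨hw.1.1.1, hw.1.2.1, hw.1.2.2, fun h => hw.2 (h ▸ Metric.mem_ball_self one_pos)⟩)
  have hfar : ∀ x y : ℝ, x ∈ Set.Icc (0 : ℝ) 1 → y ∈ Set.Icc (-Real.pi) 0 →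
      (1 ≤ x ∨ 1 ≤ |y + Real.pi / 2|) → ‖f (x + y * Complex.I)‖ ≤ B := by
    intro x y hx hy hxy
    refine hB _ ⟨⟨by simpa using hx, by simpa using hy⟩, fun hb => ?_⟩
    rw [Metric.mem_ball, dist_eq_norm] at hb
    rcases hxy with h1 | h1
    · have := (Complex.abs_re_le_norm _).trans_lt hb
      simp at this
      rw [abs_lt] at this
      linarith
    · have := (Complex.abs_im_le_norm _).trans_lt hb
      simp at this
      linarith
  have hB0 : 0 ≤ B := (norm_nonneg _).trans (hfar 1 0 (by simp) (by simp [hpi.le]) (Or.inl le_rfl))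
  set J := ∫ s : ℝ in (-Real.pi)..0, |s + Real.pi / 2| ^ (-(1 / 2) : ℝ)
  refine ⟨2 * (M ^ 2 * J) + (2 * B ^ 2 + Real.pi * B ^ 2), 1 / 2, by norm_num, fun δ hδ hδ2 => ?_⟩
  have hrect : rectInt (fun w => f w ^ 2) δ 1 (-Real.pi) 0 = 0 := by
    refine rectInt_eq_zero (by linarith) (by linarith) ((h.cont.pow 2).mono ?_) ((h.diff.pow 2).mono ?_)
    · rintro w ⟨h1, h2⟩
      have h1' : 0 < w.re := hδ.trans_le h1.1
      exact ⟨h1'.le, h2.1, h2.2, ne_branchPt_of_re h1'.ne'⟩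
    · rintro w ⟨h1, h2⟩
      exact ⟨hδ.trans h1.1, h2.1, h2.2⟩
  have hhor : ∀ y : ℝ, y ∈ Set.Icc (-Real.pi) 0 → 1 ≤ |y + Real.pi / 2| →
      ‖∫ x : ℝ in δ..1, f (x + y * Complex.I) ^ 2‖ ≤ B ^ 2 := by
    intro y hy hy1
    have := intervalIntegral.norm_integral_le_of_norm_le_const (a := δ) (b := 1)
      (f := fun x : ℝ => f (x + y * Complex.I) ^ 2) (C := B ^ 2) fun x hx => by
        rw [Set.uIoc_of_le (by linarith)] at hx
        rw [norm_pow]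
        exact pow_le_pow_left₀ (norm_nonneg _)
          (hfar x y ⟨by linarith [hx.1], hx.2⟩ hy (Or.inr hy1)) 2
    refine this.trans ?_
    rw [abs_of_nonneg (by linarith)]
    nlinarith [sq_nonneg B]
  have hver : ‖∫ s : ℝ in (-Real.pi)..0, f ((1 : ℝ) + s * Complex.I) ^ 2‖ ≤ Real.pi * B ^ 2 := by
    have := intervalIntegral.norm_integral_le_of_norm_le_const (a := -Real.pi) (b := 0)
      (f := fun s : ℝ => f ((1 : ℝ) + s * Complex.I) ^ 2) (C := B ^ 2) fun s hs => by
        rw [Set.uIoc_of_le (by linarith)] at hs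
        rw [norm_pow]
        exact pow_le_pow_left₀ (norm_nonneg _)
          (hfar 1 s (by simp) (Set.Ioc_subset_Icc_self hs) (Or.inl le_rfl)) 2
    refine this.trans ?_
    rw [zero_sub, neg_neg, abs_of_pos hpi, mul_comm]
  have hsq : ‖∫ s : ℝ in (-Real.pi)..0, f (δ + s * Complex.I) ^ 2‖ ≤ 2 * B ^ 2 + Real.pi * B ^ 2 := by
    unfold rectInt at hrect
    have a1 := hhor (-Real.pi) (Set.left_mem_Icc.2 (by linarith))
      (by rw [abs_of_nonpos (by linarith)]; linarith)
    have a2 := hhor 0 (Set.right_mem_Icc.2 (by linarith))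
      (by rw [abs_of_nonneg (by linarith)]; linarith)
    have e : ‖∫ s : ℝ in (-Real.pi)..0, f (δ + s * Complex.I) ^ 2‖
        = ‖Complex.I * ∫ s : ℝ in (-Real.pi)..0, f (δ + s * Complex.I) ^ 2‖ := by simp
    rw [e, ← sub_eq_zero.1 hrect]
    calc _ ≤ ‖(∫ x : ℝ in δ..1, f (x + (-Real.pi : ℝ) * Complex.I) ^ 2)‖
          + ‖(∫ x : ℝ in δ..1, f (x + (0 : ℝ) * Complex.I) ^ 2)‖
          + ‖Complex.I * ∫ s : ℝ in (-Real.pi)..0, f ((1 : ℝ) + s * Complex.I) ^ 2‖ :=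
        (norm_add_le _ _).trans (add_le_add_left (norm_sub_le _ _) _)
      _ ≤ _ := by
        rw [norm_mul, Complex.norm_I, one_mul]
        linarith
  have hfv : ContinuousOn (fun s : ℝ => f (δ + s * Complex.I)) (Set.Icc (-Real.pi) 0) :=
    vertical_continuousOn h.cont fun y hy => mk_mem_strip hδ.le hy (Or.inl hδ.ne')
  have hle : -Real.pi ≤ 0 := by linarith
  have hrev : ContinuousOn (fun s : ℝ => (f (δ + s * Complex.I)).re) (Set.Icc (-Real.pi) 0) :=
    Complex.continuous_re.comp_continuousOn hfv
  have hsqv : ContinuousOn (fun s : ℝ => (f (δ + s * Complex.I) ^ 2).re) (Set.Icc (-Real.pi) 0) :=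
    Complex.continuous_re.comp_continuousOn (hfv.pow 2)
  have e1 : ∫ s : ℝ in (-Real.pi)..0, ‖f (δ + s * Complex.I)‖ ^ 2
      = 2 * (∫ s : ℝ in (-Real.pi)..0, (f (δ + s * Complex.I)).re ^ 2)
        - (∫ s : ℝ in (-Real.pi)..0, f (δ + s * Complex.I) ^ 2).re := by
    have e2 : (∫ s : ℝ in (-Real.pi)..0, f (δ + s * Complex.I) ^ 2).re
        = ∫ s : ℝ in (-Real.pi)..0, (f (δ + s * Complex.I) ^ 2).re := by
      have := Complex.reCLM.intervalIntegral_comp_comm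
        ((hfv.pow 2).intervalIntegrable_of_Icc (μ := volume) hle)
      simpa using this.symm
    have e3 : IntervalIntegrable (fun s : ℝ => 2 * (f (δ + s * Complex.I)).re ^ 2) volume
        (-Real.pi) 0 := (continuousOn_const.mul (hrev.pow 2)).intervalIntegrable_of_Icc hle
    rw [e2, ← intervalIntegral.integral_const_mul, ← intervalIntegral.integral_sub e3
      (hsqv.intervalIntegrable_of_Icc hle)]
    refine intervalIntegral.integral_congr fun s _ => ?_
    rw [← Complex.normSq_eq_norm_sq, Complex.normSq_apply, pow_two (f _), Complex.mul_re]
    ring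
  have e3 : ∫ s : ℝ in (-Real.pi)..0, (f (δ + s * Complex.I)).re ^ 2 ≤ M ^ 2 * J := by
    rw [← intervalIntegral.integral_const_mul]
    refine intervalIntegral.integral_mono_ae_restrict hle
      ((hrev.pow 2).intervalIntegrable_of_Icc hle) (intervalIntegrable_abs_rpow.const_mul _) ?_
    have hne : ∀ᵐ s : ℝ ∂volume.restrict (Set.Icc (-Real.pi) 0), s ≠ -(Real.pi / 2) :=
      ae_restrict_of_ae (by simp [ae_iff, measure_singleton])
    filter_upwards [hne, ae_restrict_mem measurableSet_Icc] with s hs hsI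
    have h1 := hM _ (mk_mem_strip hδ.le hsI (Or.inl hδ.ne')) (by simp; linarith) (by simpa using hs)
    simp only [Complex.add_im, Complex.ofReal_im, Complex.mul_im, Complex.ofReal_re, Complex.I_im,
      mul_one, Complex.I_re, mul_zero, add_zero, zero_add] at h1
    have h2 : 0 ≤ |s + Real.pi / 2| := abs_nonneg _
    have h3 := pow_le_pow_left₀ (abs_nonneg _) h1 2
    rw [sq_abs, mul_pow, ← Real.rpow_natCast (_ ^ _) 2, ← Real.rpow_mul h2] at h3
    norm_num at h3 ⊢
    exact h3
  rw [e1]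
  have h5 := (neg_le_abs _).trans ((Complex.abs_re_le_norm _).trans hsq)
  linarith

end IfoNLS

/-! ### The Cauchy kernel on the half-strip and integrability on the rays -/

namespace IfoNLS

/-- The Cauchy kernel `dζ / (ζ - a)` in the coordinate `ζ = q₀ e^w`. -/
noncomputable def kern (q0 : ℝ) (a w : ℂ) : ℂ :=
  (q0 : ℂ) * Complex.exp w / ((q0 : ℂ) * Complex.exp w - a)

theorem tendsto_kern {q0 : ℝ} (hq0 : 0 < q0) (a : ℂ) : Tendsto (kern q0 a) stripTop (𝓝 1) := by
  have h1 : Tendsto (fun z : ℂ => (1 - a * z⁻¹)⁻¹) (Bornology.cobounded ℂ) (𝓝 1) := by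
    have h2 := (((tendsto_inv₀_cobounded (α := ℂ)).const_mul a).const_sub 1)
    rw [mul_zero, sub_zero] at h2
    simpa using h2.inv₀ one_ne_zero
  refine (h1.comp ((tendsto_expMap_stripTop hq0).mono_right inf_le_left)).congr fun w => ?_
  have h3 : (q0 : ℂ) * Complex.exp w ≠ 0 :=
    mul_ne_zero (by exact_mod_cast hq0.ne') (Complex.exp_ne_zero w)
  simp only [Function.comp, kern]
  generalize (q0 : ℂ) * Complex.exp w = z at h3
  rw [← div_eq_mul_inv, one_sub_div h3, inv_div]

theorem StripKernel.of_continuousOn {k : ℂ → ℂ} {ℓ w₁ : ℂ} (hw₁ : w₁ ∈ stripInt)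
    (hc : ContinuousOn k closedStrip) (hd : DifferentiableOn ℂ k stripInt)
    (hl : Tendsto k stripTop (𝓝 ℓ)) : StripKernel k w₁ 0 ℓ := by
  refine ⟨hw₁, hc.mono sdiff_le, hd.mono sdiff_le, ?_, hl⟩
  have h1 : ContinuousAt k w₁ := (hd.differentiableAt (isOpen_stripInt.mem_nhds hw₁)).continuousAt
  have h2 : ContinuousAt (fun w => (w - w₁) * k w) w₁ := ContinuousAt.mul (by fun_prop) h1
  have h3 := h2.tendsto
  simp only [sub_self, zero_mul] at h3
  exact h3.mono_left nhdsWithin_le_nhds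

theorem differentiableAt_kern {q0 : ℝ} {a w : ℂ} (h : (q0 : ℂ) * Complex.exp w ≠ a) :
    DifferentiableAt ℂ (kern q0 a) w := by
  unfold kern
  exact DifferentiableAt.fun_div (by fun_prop) (by fun_prop) (sub_ne_zero.2 h)

theorem expMap_mem_closed {q0 : ℝ} (hq0 : 0 < q0) {w : ℂ} (hw : w ∈ closedStrip) :
    q0 ≤ ‖(q0 : ℂ) * Complex.exp w‖ ∧ ((q0 : ℂ) * Complex.exp w).im ≤ 0 := by
  obtain ⟨h1, h2, h3⟩ := hw
  constructor
  · rw [norm_expMap hq0]; nlinarith [Real.one_le_exp (Set.mem_Ici.1 h1)]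
  · rw [expMap_im]
    exact mul_nonpos_of_nonneg_of_nonpos (by positivity)
      (Real.sin_nonpos_of_nonpos_of_neg_pi_le h3 h2)

theorem stripKernel_kern_of_notMem {q0 : ℝ} (hq0 : 0 < q0) {a : ℂ}
    (ha : ¬(q0 ≤ ‖a‖ ∧ a.im ≤ 0)) {w₁ : ℂ} (hw₁ : w₁ ∈ stripInt) :
    StripKernel (kern q0 a) w₁ 0 1 := by
  have hne : ∀ w ∈ closedStrip, (q0 : ℂ) * Complex.exp w ≠ a := fun w hw h =>
    ha (h ▸ expMap_mem_closed hq0 hw)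
  exact StripKernel.of_continuousOn hw₁
    (fun w hw => (differentiableAt_kern (hne w hw)).continuousAt.continuousWithinAt)
    (fun w hw => (differentiableAt_kern
      (hne w (strip_subset (stripInt_subset hw)))).differentiableWithinAt) (tendsto_kern hq0 a)

/-- The coordinate `w ↦ q₀ e^w` takes the value at an interior point only once. -/
theorem eq_of_expMap_eq {q0 : ℝ} (hq0 : 0 < q0) {w w₀ : ℂ} (hw : w ∈ closedStrip)
    (hw₀ : w₀ ∈ stripInt) (h : (q0 : ℂ) * Complex.exp w = (q0 : ℂ) * Complex.exp w₀) : w = w₀ := by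
  have hpi := Real.pi_pos
  have hq : (q0 : ℂ) ≠ 0 := by exact_mod_cast hq0.ne'
  have h1 := mul_left_cancel₀ hq h
  have h2 : -Real.pi < w.im := by
    refine lt_of_le_of_ne hw.2.1 fun e => ?_
    have h3 := (expMap_mem_int hq0 hw₀).2
    rw [← h, expMap_im, ← e, Real.sin_neg, Real.sin_pi] at h3
    simp at h3
  exact Complex.exp_inj_of_neg_pi_lt_of_le_pi h2 ((hw.2.2).trans hpi.le) hw₀.2.1
    (hw₀.2.2.le.trans hpi.le) h1

theorem stripKernel_kern {q0 : ℝ} (hq0 : 0 < q0) {w₀ : ℂ} (hw₀ : w₀ ∈ stripInt) :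
    StripKernel (kern q0 ((q0 : ℂ) * Complex.exp w₀)) w₀ 1 1 := by
  have hq : (q0 : ℂ) ≠ 0 := by exact_mod_cast hq0.ne'
  have hne : ∀ w ∈ closedStrip, w ≠ w₀ → (q0 : ℂ) * Complex.exp w ≠ (q0 : ℂ) * Complex.exp w₀ :=
    fun w hw hww h => hww (eq_of_expMap_eq hq0 hw hw₀ h)
  refine ⟨hw₀, fun w hw => (differentiableAt_kern (hne w hw.1 hw.2)).continuousAt.continuousWithinAt,
    fun w hw => (differentiableAt_kern (hne w (strip_subset (stripInt_subset hw.1))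
      hw.2)).differentiableWithinAt, ?_, tendsto_kern hq0 _⟩
  have hd : HasDerivAt (fun w => (q0 : ℂ) * Complex.exp w) ((q0 : ℂ) * Complex.exp w₀) w₀ :=
    (Complex.hasDerivAt_exp w₀).const_mul _
  have h0 : (q0 : ℂ) * Complex.exp w₀ ≠ 0 := mul_ne_zero hq (Complex.exp_ne_zero _)
  have h1 := (hd.tendsto_slope.inv₀ h0).mul
    (hd.continuousAt.tendsto.mono_left (nhdsWithin_le_nhds (s := {w₀}ᶜ)))
  rw [inv_mul_cancel₀ h0] at h1
  refine h1.congr fun w => ?_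
  rw [slope_def_field, inv_div, kern]
  ring

theorem StripKernel.sub {k₁ k₂ : ℂ → ℂ} {w₀ r₁ r₂ ℓ₁ ℓ₂ : ℂ} (h₁ : StripKernel k₁ w₀ r₁ ℓ₁)
    (h₂ : StripKernel k₂ w₀ r₂ ℓ₂) :
    StripKernel (fun w => k₁ w - k₂ w) w₀ (r₁ - r₂) (ℓ₁ - ℓ₂) :=
  ⟨h₁.mem, h₁.cont.sub h₂.cont, h₁.diff.sub h₂.diff,
    (h₁.res.sub h₂.res).congr fun w => by ring, h₁.lim.sub h₂.lim⟩

theorem StripKernel.memLp_mul {k f : ℂ → ℂ} {w₀ r ℓ : ℂ} (h : StripKernel k w₀ r ℓ)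
    (hf : SqBounded f) (hfc : ContinuousOn f strip) (hfd : DifferentiableOn ℂ f stripInt) :
    MemLp (fun s : ℝ => f ((0 : ℝ) + s * Complex.I) * k ((0 : ℝ) + s * Complex.I)) 2
      (volume.restrict (Set.Ioc (-Real.pi) 0)) := by
  have hcont : ContinuousOn (fun w => f w * k w) (strip \ {w₀}) :=
    (hfc.mono sdiff_le).mul (h.cont.mono fun w hw => ⟨strip_subset hw.1, hw.2⟩)
  have hdiff : DifferentiableOn ℂ (fun w => f w * k w) (stripInt \ {w₀}) :=
    (hfd.mono sdiff_le).fun_mul h.diff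
  have hf0 : ContinuousAt f w₀ :=
    (hfd.differentiableAt (isOpen_stripInt.mem_nhds h.mem)).continuousAt
  have hres : Tendsto (fun w => (w - w₀) * (f w * k w)) (𝓝[≠] w₀) (𝓝 (r * f w₀)) :=
    (h.res.mul (hf0.tendsto.mono_left nhdsWithin_le_nhds)).congr fun w => by ring
  exact (openInt_eq h.mem hcont hdiff hres (h.sqBounded_mul hf hfc) (lt_add_one _)).2

theorem stripKernel_one : StripKernel (fun _ => (1 : ℂ)) ((1 : ℝ) + branchPt) 0 1 :=
  StripKernel.of_continuousOn (add_branchPt_mem one_pos) continuousOn_const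
    (differentiableOn_const _) tendsto_const_nhds

/-- The logarithm is square integrable on the left side of the half-strip. -/
theorem StripLog.memLp {f : ℂ → ℂ} (h : StripLog f) :
    MemLp (fun s : ℝ => f ((0 : ℝ) + s * Complex.I)) 2
      (volume.restrict (Set.Ioc (-Real.pi) 0)) := by
  simpa using stripKernel_one.memLp_mul h.sqBounded h.cont h.diff

theorem horizontal_zero (u : ℝ) : (u : ℂ) + ((0 : ℝ) : ℂ) * Complex.I = u := by simp

theorem horizontal_neg_pi (u : ℝ) :
    (u : ℂ) + ((-Real.pi : ℝ) : ℂ) * Complex.I = u - Complex.I * Real.pi := by push_cast; ring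

theorem StripLog.continuousOn_ray {f : ℂ → ℂ} (h : StripLog f) :
    ContinuousOn (fun u : ℝ => f u) (Set.Ici 0) := by
  refine h.cont.comp (by fun_prop) fun u hu => ?_
  have := mk_mem_strip (Set.mem_Ici.1 hu) (y := 0) ⟨by linarith [Real.pi_pos], le_rfl⟩
    (Or.inr (by have := Real.pi_pos; intro e; linarith))
  rwa [horizontal_zero] at this

theorem StripLog.continuousOn_ray' {f : ℂ → ℂ} (h : StripLog f) :
    ContinuousOn (fun u : ℝ => f (u - Complex.I * Real.pi)) (Set.Ici 0) := by
  refine h.cont.comp (by fun_prop) fun u hu => ?_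
  have := mk_mem_strip (Set.mem_Ici.1 hu) (y := -Real.pi) ⟨le_rfl, by linarith [Real.pi_pos]⟩
    (Or.inr (by have := Real.pi_pos; intro e; linarith))
  rwa [horizontal_neg_pi] at this

/-- The Poisson kernel of the lower half-plane at `-i q₀ e^S`, up to a factor, on the rays. -/
noncomputable def poisson (S u : ℝ) : ℝ :=
  2 * Real.exp (S + u) / (Real.exp (2 * u) + Real.exp (2 * S))

theorem poisson_pos (S u : ℝ) : 0 < poisson S u := by unfold poisson; positivity

theorem continuous_poisson (S : ℝ) : Continuous (poisson S) := by
  unfold poisson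
  have : ∀ u, Real.exp (2 * u) + Real.exp (2 * S) ≠ 0 := fun u => by positivity
  fun_prop (disch := exact this _)

theorem exp_neg_le_poisson {S u : ℝ} (h0 : 0 ≤ u) (h1 : u ≤ S) : Real.exp (-S) ≤ poisson S u := by
  rw [poisson, le_div_iff₀ (by positivity), mul_add, ← Real.exp_add, ← Real.exp_add]
  have a1 : Real.exp (-S + 2 * u) ≤ Real.exp (S + u) := Real.exp_le_exp.2 (by linarith)
  have a2 : Real.exp (-S + 2 * S) ≤ Real.exp (S + u) := Real.exp_le_exp.2 (by linarith)
  linarith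

/-- The difference of the Cauchy kernels of the mirror points `∓ i q₀ e^S`. -/
noncomputable def diffKern (S : ℝ) (w : ℂ) : ℂ :=
  kern 1 (((1 : ℝ) : ℂ) * Complex.exp (S + branchPt)) w
    - kern 1 (-(((1 : ℝ) : ℂ) * Complex.exp (S + branchPt))) w

theorem stripKernel_diffKern {S : ℝ} (hS : 0 < S) :
    StripKernel (diffKern S) (S + branchPt) 1 0 := by
  have hm := add_branchPt_mem hS
  have h2 : ¬((1 : ℝ) ≤ ‖-(((1 : ℝ) : ℂ) * Complex.exp (S + branchPt))‖ ∧
      (-(((1 : ℝ) : ℂ) * Complex.exp (S + branchPt))).im ≤ 0) := fun h => by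
    have := (expMap_mem_int one_pos hm).2
    rw [Complex.neg_im] at h
    linarith [h.2]
  have := (stripKernel_kern one_pos hm).sub (stripKernel_kern_of_notMem one_pos h2 hm)
  rw [sub_zero, sub_self] at this
  exact this

theorem diffKern_eq (S : ℝ) {w : ℂ} (h : Complex.exp w ^ 2 + Complex.exp S ^ 2 ≠ 0) :
    diffKern S w = -(2 * Complex.I * Complex.exp S * Complex.exp w)
      / (Complex.exp w ^ 2 + Complex.exp S ^ 2) := by
  have e : Complex.exp w ^ 2 + Complex.exp S ^ 2
      = (Complex.exp w + Complex.I * Complex.exp S) * (Complex.exp w - Complex.I * Complex.exp S) := by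
    linear_combination (Complex.exp (S : ℂ)) ^ 2 * Complex.I_sq
  rw [e] at h
  have h1 := left_ne_zero_of_mul h
  have h2 := right_ne_zero_of_mul h
  have h1' : Complex.exp w + Complex.exp S * Complex.I ≠ 0 := by rwa [mul_comm Complex.I] at h1
  have h2' : Complex.exp w - Complex.exp S * Complex.I ≠ 0 := by rwa [mul_comm Complex.I] at h2
  rw [e]
  simp only [diffKern, kern, Complex.ofReal_one, one_mul, Complex.exp_add, exp_branchPt, mul_neg,
    sub_neg_eq_add, neg_neg]
  rw [div_sub_div _ _ h1' h2', div_eq_div_iff (mul_ne_zero h1' h2') (mul_ne_zero h1 h2)]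
  ring

theorem diffKern_ray (S u : ℝ) : diffKern S u = -(Complex.I * poisson S u) := by
  have h : Complex.exp u ^ 2 + Complex.exp S ^ 2
      = ((Real.exp (2 * u) + Real.exp (2 * S) : ℝ) : ℂ) := by
    push_cast; rw [← Complex.exp_nat_mul, ← Complex.exp_nat_mul]; push_cast; ring
  have h0 : ((Real.exp (2 * u) + Real.exp (2 * S) : ℝ) : ℂ) ≠ 0 := by
    exact_mod_cast (by positivity : Real.exp (2 * u) + Real.exp (2 * S) ≠ 0)
  rw [diffKern_eq S (h ▸ h0), h, poisson, Complex.ofReal_div]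
  push_cast
  rw [Complex.exp_add]
  ring

theorem diffKern_ray' (S u : ℝ) :
    diffKern S (u - Complex.I * Real.pi) = Complex.I * poisson S u := by
  have e : Complex.exp (u - Complex.I * Real.pi) = -Complex.exp u := by
    rw [Complex.exp_sub, mul_comm Complex.I, Complex.exp_pi_mul_I]; ring
  have h : Complex.exp u ^ 2 + Complex.exp S ^ 2
      = ((Real.exp (2 * u) + Real.exp (2 * S) : ℝ) : ℂ) := by
    push_cast; rw [← Complex.exp_nat_mul, ← Complex.exp_nat_mul]; push_cast; ring
  have h0 : ((Real.exp (2 * u) + Real.exp (2 * S) : ℝ) : ℂ) ≠ 0 := by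
    exact_mod_cast (by positivity : Real.exp (2 * u) + Real.exp (2 * S) ≠ 0)
  have h' : Complex.exp (u - Complex.I * Real.pi) ^ 2 + Complex.exp S ^ 2
      = ((Real.exp (2 * u) + Real.exp (2 * S) : ℝ) : ℂ) := by rw [e, neg_sq, h]
  rw [diffKern_eq S (h' ▸ h0), h', e, poisson, Complex.ofReal_div]
  push_cast
  rw [Complex.exp_add]
  ring

theorem norm_diffKern_left_le {S : ℝ} (hS : 1 ≤ S) (s : ℝ) :
    ‖diffKern S (((0 : ℝ) : ℂ) + s * Complex.I)‖ ≤ 4 * Real.exp (-S) := by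
  have hw : ‖Complex.exp (((0 : ℝ) : ℂ) + s * Complex.I)‖ = 1 := by
    rw [Complex.norm_exp]; simp
  have hn : ‖Complex.exp (S : ℂ)‖ = Real.exp S := by rw [Complex.norm_exp]; simp
  have hS2 : 2 ≤ Real.exp S := by linarith [Real.add_one_le_exp S]
  have hlow : Real.exp S ^ 2 / 2
      ≤ ‖Complex.exp (((0 : ℝ) : ℂ) + s * Complex.I) ^ 2 + Complex.exp S ^ 2‖ := by
    have := norm_sub_le_norm_add (Complex.exp (S : ℂ) ^ 2)
      (Complex.exp (((0 : ℝ) : ℂ) + s * Complex.I) ^ 2)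
    rw [norm_pow, norm_pow, hw, hn, add_comm] at this
    nlinarith
  have hpos : 0 < Real.exp S ^ 2 / 2 := by positivity
  rw [diffKern_eq S (norm_pos_iff.1 (hpos.trans_le hlow)), norm_div, norm_neg, norm_mul, norm_mul,
    norm_mul, hw, hn, Complex.norm_I]
  simp only [Complex.norm_ofNat, mul_one]
  rw [div_le_iff₀ (hpos.trans_le hlow), Real.exp_neg]
  calc 2 * Real.exp S = 4 * (Real.exp S)⁻¹ * (Real.exp S ^ 2 / 2) := by field_simp; norm_num
    _ ≤ _ := by gcongr

/-- On the two rays the real part of the logarithm is integrable: its integral against the Poisson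
kernel at `-i q₀ e^S` is `O(e^{-S})`, because the value of the logarithm at that point and the
contribution of the circle are. -/
theorem StripLog.exists_integral_le {f : ℂ → ℂ} (h : StripLog f) :
    ∃ C : ℝ, ∀ᶠ S : ℝ in atTop, ∫ u : ℝ in (0 : ℝ)..S,
      (-(f u).re - (f (u - Complex.I * Real.pi)).re) ≤ C := by
  have hpi := Real.pi_pos
  obtain ⟨D, hD⟩ := h.decay.bound
  have hf1 : IntegrableOn (fun s : ℝ => f ((0 : ℝ) + s * Complex.I)) (Set.Ioc (-Real.pi) 0) :=
    h.memLp.integrable (by norm_num)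
  set J := ∫ s in Set.Ioc (-Real.pi) 0, ‖f ((0 : ℝ) + s * Complex.I)‖
  refine ⟨2 * Real.pi * D + 4 * J, ?_⟩
  filter_upwards [hD, eventually_ge_atTop 1] with S hS hS1
  have hS0 : 0 < S := by linarith
  have hk := stripKernel_diffKern hS0
  have hlim := hk.tendsto_openInt_mul h.sqBounded h.cont h.diff h.lim
  set L := ∫ s : ℝ in (-Real.pi)..0, f ((0 : ℝ) + s * Complex.I)
    * diffKern S ((0 : ℝ) + s * Complex.I) with hL
  set A : ℝ → ℝ := fun u => -(f u).re - (f (u - Complex.I * Real.pi)).re with hA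
  have hA0 : ∀ u, 0 ≤ u → 0 ≤ A u := fun u hu => by
    have := h.nonpos u hu
    have := h.nonpos' u hu
    simp only [hA]; linarith
  have hAc : ContinuousOn A (Set.Ici 0) :=
    (Complex.continuous_re.comp_continuousOn h.continuousOn_ray).neg.sub
      (Complex.continuous_re.comp_continuousOn h.continuousOn_ray')
  have hop : ∀ T : ℝ, 0 ≤ T → (Complex.I * openInt (fun w => f w * diffKern S w) T + L).re
      = -∫ u : ℝ in (0 : ℝ)..T, A u * poisson S u := by
    intro T hT
    have c1 : ContinuousOn (fun u : ℝ => f u * poisson S u) (Set.Icc 0 T) :=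
      (h.continuousOn_ray.mono Set.Icc_subset_Ici_self).mul
        (Complex.continuous_ofReal.comp (continuous_poisson S)).continuousOn
    have c2 : ContinuousOn (fun u : ℝ => f (u - Complex.I * Real.pi) * poisson S u) (Set.Icc 0 T) :=
      (h.continuousOn_ray'.mono Set.Icc_subset_Ici_self).mul
        (Complex.continuous_ofReal.comp (continuous_poisson S)).continuousOn
    have e : Complex.I * openInt (fun w => f w * diffKern S w) T + L
        = ∫ u : ℝ in (0 : ℝ)..T, (f u * poisson S u + f (u - Complex.I * Real.pi) * poisson S u) := by
      rw [intervalIntegral.integral_add (c1.intervalIntegrable_of_Icc hT)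
        (c2.intervalIntegrable_of_Icc hT)]
      simp only [openInt, horizontal_zero, horizontal_neg_pi, diffKern_ray, diffKern_ray']
      have e1 : ∀ u : ℝ, f u * -(Complex.I * poisson S u) = -Complex.I * (f u * poisson S u) :=
        fun u => by ring
      have e2 : ∀ u : ℝ, f (u - Complex.I * Real.pi) * (Complex.I * poisson S u)
          = Complex.I * (f (u - Complex.I * Real.pi) * poisson S u) := fun u => by ring
      simp only [e1, e2, intervalIntegral.integral_const_mul]
      rw [← hL]
      linear_combination (-(∫ u : ℝ in (0 : ℝ)..T, f u * poisson S u)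
        - (∫ u : ℝ in (0 : ℝ)..T, f (u - Complex.I * Real.pi) * poisson S u) + L) * Complex.I_sq
    rw [e, ← intervalIntegral.integral_neg]
    have e3 := Complex.reCLM.intervalIntegral_comp_comm
      ((c1.add c2).intervalIntegrable_of_Icc (μ := volume) hT)
    simp only [Complex.reCLM_apply] at e3
    refine e3.symm.trans (intervalIntegral.integral_congr fun u _ => ?_)
    simp [hA]
    ring
  have hlim2 : Tendsto (fun T : ℝ => ∫ u : ℝ in (0 : ℝ)..T, A u * poisson S u) atTop
      (𝓝 (-(2 * Real.pi * f (S + branchPt) + L).re)) := by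
    have h1 := (Complex.continuous_re.tendsto _).comp ((hlim.const_mul Complex.I).add_const L)
    have e : Complex.I * (Complex.I * Real.pi * (0 * 0)
        - 2 * Real.pi * Complex.I * (1 * f (S + branchPt))) + L
        = 2 * Real.pi * f (S + branchPt) + L := by
      linear_combination (-2 * Real.pi * f (S + branchPt)) * Complex.I_sq
    rw [e] at h1
    refine h1.neg.congr' ?_
    filter_upwards [eventually_ge_atTop 0] with T hT
    rw [Function.comp, hop T hT, neg_neg]
  have hAPc : ContinuousOn (fun u => A u * poisson S u) (Set.Ici 0) :=
    hAc.mul (continuous_poisson S).continuousOn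
  have hmono : ∫ u : ℝ in (0 : ℝ)..S, A u * poisson S u ≤ -(2 * Real.pi * f (S + branchPt) + L).re := by
    refine ge_of_tendsto hlim2 ?_
    filter_upwards [eventually_ge_atTop S] with T hT
    refine intervalIntegral.integral_mono_interval le_rfl hS0.le hT ?_
      ((hAPc.mono Set.Icc_subset_Ici_self).intervalIntegrable_of_Icc (hS0.le.trans hT))
    filter_upwards [ae_restrict_mem measurableSet_Ioc] with u hu
    exact mul_nonneg (hA0 u hu.1.le) (poisson_pos S u).le
  have hLn : ‖L‖ ≤ 4 * Real.exp (-S) * J := by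
    rw [hL, intervalIntegral.integral_of_le (by linarith), ← integral_const_mul]
    refine norm_integral_le_of_norm_le (hf1.norm.const_mul _) (Eventually.of_forall fun s => ?_)
    rw [norm_mul, mul_comm]
    exact mul_le_mul_of_nonneg_right (norm_diffKern_left_le hS1 s) (norm_nonneg _)
  have hfS : ‖f (S + branchPt)‖ ≤ D * Real.exp (-S) := by
    refine hS.trans (le_of_eq ?_)
    rw [Real.norm_eq_abs, Real.abs_exp]
  have hup : -(2 * Real.pi * f (S + branchPt) + L).re ≤ (2 * Real.pi * D + 4 * J) * Real.exp (-S) := by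
    refine (neg_le_abs _).trans ((Complex.abs_re_le_norm _).trans ((norm_add_le _ _).trans ?_))
    have e : ‖2 * (Real.pi : ℂ) * f (S + branchPt)‖ = 2 * Real.pi * ‖f (S + branchPt)‖ := by
      rw [norm_mul, norm_mul, Complex.norm_real, Real.norm_eq_abs, abs_of_pos hpi]; simp
    rw [e]
    have := mul_le_mul_of_nonneg_left hfS (by positivity : 0 ≤ 2 * Real.pi)
    linarith
  have hlow : Real.exp (-S) * ∫ u : ℝ in (0 : ℝ)..S, A u ≤ ∫ u : ℝ in (0 : ℝ)..S, A u * poisson S u := by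
    rw [← intervalIntegral.integral_const_mul]
    refine intervalIntegral.integral_mono_on hS0.le
      ((continuousOn_const.mul (hAc.mono Set.Icc_subset_Ici_self)).intervalIntegrable_of_Icc hS0.le)
      ((hAPc.mono Set.Icc_subset_Ici_self).intervalIntegrable_of_Icc hS0.le) fun u hu => ?_
    rw [mul_comm]
    exact mul_le_mul_of_nonneg_left (exp_neg_le_poisson hu.1 hu.2) (hA0 u hu.1)
  have := (hlow.trans hmono).trans hup
  rw [mul_comm] at this
  exact le_of_mul_le_mul_right this (Real.exp_pos _)

/-- Both terms of the integrand in `StripLog.exists_integral_le` are nonnegative, so that the bound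
of the integrals gives integrability. -/
theorem StripLog.integrableOn_re {f : ℂ → ℂ} (h : StripLog f) :
    IntegrableOn (fun u : ℝ => (f u).re) (Set.Ioi 0) ∧
      IntegrableOn (fun u : ℝ => (f (u - Complex.I * Real.pi)).re) (Set.Ioi 0) := by
  obtain ⟨C, hC⟩ := h.exists_integral_le
  set A : ℝ → ℝ := fun u => -(f u).re - (f (u - Complex.I * Real.pi)).re with hA
  have hc1 := Complex.continuous_re.comp_continuousOn h.continuousOn_ray
  have hc2 := Complex.continuous_re.comp_continuousOn h.continuousOn_ray'
  have hAc : ContinuousOn A (Set.Ici 0) := hc1.neg.sub hc2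
  have hA0 : ∀ u, 0 ≤ u → 0 ≤ A u := fun u hu => by
    have := h.nonpos u hu
    have := h.nonpos' u hu
    simp only [hA]; linarith
  have hAi : IntegrableOn A (Set.Ioi 0) := by
    refine integrableOn_Ioi_of_intervalIntegral_norm_bounded C 0 (l := atTop) (b := fun i : ℝ => i)
      (fun i => ((hAc.mono Set.Icc_subset_Ici_self).integrableOn_Icc).mono_set
        Set.Ioc_subset_Icc_self) tendsto_id ?_
    filter_upwards [hC, eventually_ge_atTop 0] with S hS hS0
    refine le_trans (le_of_eq (intervalIntegral.integral_congr fun u hu => ?_)) hS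
    rw [Set.uIcc_of_le hS0] at hu
    rw [Real.norm_eq_abs, abs_of_nonneg (hA0 u hu.1)]
  constructor
  · refine Integrable.mono' hAi ((hc1.mono Set.Ioi_subset_Ici_self).aestronglyMeasurable
      measurableSet_Ioi) ?_
    filter_upwards [ae_restrict_mem measurableSet_Ioi] with u hu
    have h1 := h.nonpos u (le_of_lt hu)
    have h2 := h.nonpos' u (le_of_lt hu)
    rw [Real.norm_eq_abs]
    simp only [hA]
    rw [abs_of_nonpos h1]
    linarith
  · refine Integrable.mono' hAi ((hc2.mono Set.Ioi_subset_Ici_self).aestronglyMeasurable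
      measurableSet_Ioi) ?_
    filter_upwards [ae_restrict_mem measurableSet_Ioi] with u hu
    have h1 := h.nonpos u (le_of_lt hu)
    have h2 := h.nonpos' u (le_of_lt hu)
    rw [Real.norm_eq_abs]
    simp only [hA]
    rw [abs_of_nonpos h2]
    linarith

end IfoNLS

/-! ### Integrals over `Σ` in logarithmic coordinates -/

namespace IfoNLS

/-- The form `H(ζ) dζ` in the coordinate `ζ = q₀ e^w`. -/
noncomputable def logForm (q0 : ℝ) (H : ℂ → ℂ) (w : ℂ) : ℂ :=
  (q0 : ℂ) * Complex.exp w * H ((q0 : ℂ) * Complex.exp w)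

/-- The integral over the part of `Σ` between the circles of radius `q₀ e^{-T}` and `q₀ e^T`: the
outer part of `Σ` in the coordinate `ζ = q₀ e^w`, and the inner one in `ζ = q₀ e^{-w}`. -/
noncomputable def sigT (q0 : ℝ) (H : ℂ → ℂ) (T : ℝ) : ℂ :=
  openInt (logForm q0 H) T - openInt (fun w => logForm q0 H (-w)) T

theorem expRay_hasDerivAt (c τ u : ℝ) :
    HasDerivAt (fun u : ℝ => c * Real.exp (τ * u)) (c * (Real.exp (τ * u) * τ)) u := by
  have h : HasDerivAt (fun u : ℝ => τ * u) τ u := by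
    simpa using (hasDerivAt_id u).const_mul τ
  exact h.exp.const_mul c

theorem expRay_injective {c τ : ℝ} (hc : c ≠ 0) (hτ : τ ≠ 0) :
    Function.Injective fun u : ℝ => c * Real.exp (τ * u) := fun _ _ h =>
  mul_left_cancel₀ hτ (Real.exp_injective (mul_left_cancel₀ hc h))

theorem abs_expRay_deriv {c τ : ℝ} (hτ : |τ| = 1) (u : ℝ) :
    |c * (Real.exp (τ * u) * τ)| = |c| * Real.exp (τ * u) := by
  rw [abs_mul, abs_mul, hτ, Real.abs_exp, mul_one]

theorem integrableOn_expRay_iff {c τ : ℝ} (hc : c ≠ 0) (hτ : |τ| = 1) (F : ℝ → ℂ) :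
    IntegrableOn F ((fun u : ℝ => c * Real.exp (τ * u)) '' Set.Ioi 0) ↔
      IntegrableOn (fun u => (|c| * Real.exp (τ * u)) • F (c * Real.exp (τ * u))) (Set.Ioi 0) := by
  have hτ0 : τ ≠ 0 := fun h => by simp [h] at hτ
  rw [integrableOn_image_iff_integrableOn_abs_deriv_smul measurableSet_Ioi
    (fun u _ => (expRay_hasDerivAt c τ u).hasDerivWithinAt) (expRay_injective hc hτ0).injOn]
  simp only [abs_expRay_deriv hτ]

theorem tendsto_expRay {c τ : ℝ} (hc : c ≠ 0) (hτ : |τ| = 1) {F : ℝ → ℂ}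
    (hF : IntegrableOn F ((fun u : ℝ => c * Real.exp (τ * u)) '' Set.Ioi 0)) :
    Tendsto (fun T => ∫ u : ℝ in (0 : ℝ)..T,
        (|c| * Real.exp (τ * u)) • F (c * Real.exp (τ * u))) atTop
      (𝓝 (∫ x in (fun u : ℝ => c * Real.exp (τ * u)) '' Set.Ioi 0, F x)) := by
  have hτ0 : τ ≠ 0 := fun h => by simp [h] at hτ
  rw [integral_image_eq_integral_abs_deriv_smul measurableSet_Ioi
    (fun u _ => (expRay_hasDerivAt c τ u).hasDerivWithinAt) (expRay_injective hc hτ0).injOn]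
  simp only [abs_expRay_deriv hτ]
  exact intervalIntegral_tendsto_integral_Ioi 0 ((integrableOn_expRay_iff hc hτ F).1 hF) tendsto_id

theorem image_expRay {q0 : ℝ} (hq0 : 0 < q0) :
    (fun u : ℝ => q0 * Real.exp (1 * u)) '' Set.Ioi 0 = Set.Ioi q0 := by
  ext x
  constructor
  · rintro ⟨u, hu, rfl⟩
    have := Real.one_lt_exp_iff.2 (Set.mem_Ioi.1 hu)
    simp only [Set.mem_Ioi, one_mul]
    nlinarith
  · intro hx
    have hx' : q0 < x := hx
    refine ⟨Real.log (x / q0), Real.log_pos ((one_lt_div hq0).2 hx'), ?_⟩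
    simp only [one_mul]
    rw [Real.exp_log (div_pos (hq0.trans hx') hq0)]
    field_simp

theorem image_expRay_inv {q0 : ℝ} (hq0 : 0 < q0) :
    (fun u : ℝ => q0 * Real.exp (-1 * u)) '' Set.Ioi 0 = Set.Ioo 0 q0 := by
  ext x
  constructor
  · rintro ⟨u, hu, rfl⟩
    have h1 : Real.exp (-1 * u) < 1 := Real.exp_lt_one_iff.2 (by have := Set.mem_Ioi.1 hu; linarith)
    have h2 := Real.exp_pos (-1 * u)
    constructor <;> simp only <;> nlinarith
  · rintro ⟨h1, h2⟩
    refine ⟨Real.log (q0 / x), Real.log_pos ((one_lt_div h1).2 h2), ?_⟩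
    simp only [neg_mul, one_mul]
    rw [← Real.log_inv, inv_div, Real.exp_log (div_pos h1 hq0)]
    field_simp

theorem image_neg_expRay (q0 τ : ℝ) : (fun u : ℝ => -q0 * Real.exp (τ * u)) '' Set.Ioi 0
    = Neg.neg '' ((fun u : ℝ => q0 * Real.exp (τ * u)) '' Set.Ioi 0) := by
  rw [Set.image_image]
  simp only [neg_mul]

theorem image_expRay_neg {q0 : ℝ} (hq0 : 0 < q0) :
    (fun u : ℝ => -q0 * Real.exp (1 * u)) '' Set.Ioi 0 = Set.Iio (-q0) := by
  rw [image_neg_expRay, image_expRay hq0]; simp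

theorem image_expRay_neg_inv {q0 : ℝ} (hq0 : 0 < q0) :
    (fun u : ℝ => -q0 * Real.exp (-1 * u)) '' Set.Ioi 0 = Set.Ioo (-q0) 0 := by
  rw [image_neg_expRay, image_expRay_inv hq0]; simp

/-- Integrability on the real axis amounts to integrability on its four pieces
`± q₀ e^{±u}`, `u > 0`. -/
theorem integrable_iff_expRay {q0 : ℝ} (hq0 : 0 < q0) {F : ℝ → ℂ} :
    Integrable F ↔ (∀ c ∈ ({q0, -q0} : Set ℝ), ∀ τ ∈ ({1, -1} : Set ℝ),
      IntegrableOn F ((fun u : ℝ => c * Real.exp (τ * u)) '' Set.Ioi 0)) := by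
  simp only [Set.mem_insert_iff, Set.mem_singleton_iff, forall_eq_or_imp, forall_eq]
  rw [image_expRay hq0, image_expRay_inv hq0, image_expRay_neg hq0, image_expRay_neg_inv hq0,
    ← integrableOn_univ]
  constructor
  · intro h
    exact ⟨⟨h.mono_set (Set.subset_univ _), h.mono_set (Set.subset_univ _)⟩,
      h.mono_set (Set.subset_univ _), h.mono_set (Set.subset_univ _)⟩
  · rintro ⟨⟨h1, h2⟩, h3, h4⟩
    have h2' := (integrableOn_Ioc_iff_integrableOn_Ioo (μ := volume)).2 h2
    have h3' := (integrableOn_Iic_iff_integrableOn_Iio (μ := volume)).2 h3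
    have h4' := (integrableOn_Ioc_iff_integrableOn_Ioo (μ := volume)).2 h4
    have h5 := ((h3'.union h4').union h2').union h1
    rwa [Set.Iic_union_Ioc_eq_Iic (by linarith), Set.Iic_union_Ioc_eq_Iic hq0.le,
      Set.Iic_union_Ioi] at h5

theorem integral_Ioo_eq_add {q0 : ℝ} (hq0 : 0 < q0) {F : ℝ → ℂ} (hF : Integrable F) :
    ∫ x in Set.Ioo (-q0) q0, F x = (∫ x in Set.Ioo 0 q0, F x) + ∫ x in Set.Ioo (-q0) 0, F x := by
  rw [← integral_Ioc_eq_integral_Ioo, ← integral_Ioc_eq_integral_Ioo,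
    ← integral_Ioc_eq_integral_Ioo, ← intervalIntegral.integral_of_le (by linarith),
    ← intervalIntegral.integral_of_le hq0.le, ← intervalIntegral.integral_of_le (by linarith),
    add_comm, intervalIntegral.integral_add_adjacent_intervals hF.intervalIntegrable
      hF.intervalIntegrable]

theorem logForm_ray (q0 : ℝ) (H : ℂ → ℂ) (w : ℂ) (τ u : ℝ) (h : w = τ * u) :
    logForm q0 H w = (q0 * Real.exp (τ * u)) • H ((q0 * Real.exp (τ * u) : ℝ) : ℂ) := by
  rw [logForm, h, Complex.real_smul]
  push_cast
  rfl

theorem logForm_ray' (q0 : ℝ) (H : ℂ → ℂ) (w : ℂ) (τ u : ℝ)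
    (h : Complex.exp w = -Complex.exp (τ * u)) :
    logForm q0 H w = -((q0 * Real.exp (τ * u)) • H ((-q0 * Real.exp (τ * u) : ℝ) : ℂ)) := by
  rw [logForm, h, Complex.real_smul]
  push_cast
  rw [mul_neg, neg_mul, neg_mul]

theorem logForm_circ (q0 : ℝ) (H : ℂ → ℂ) (w : ℂ) (s : ℝ) (h : w = s * Complex.I) :
    logForm q0 H w = circPt q0 s * H (circPt q0 s) := by
  rw [logForm, h, circPt, mul_comm (s : ℂ)]

theorem exp_sub_I_mul_pi (w : ℂ) : Complex.exp (w - Complex.I * Real.pi) = -Complex.exp w := by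
  rw [Complex.exp_sub, mul_comm Complex.I, Complex.exp_pi_mul_I]; ring

theorem exp_add_I_mul_pi (w : ℂ) : Complex.exp (w + Complex.I * Real.pi) = -Complex.exp w := by
  rw [Complex.exp_add, mul_comm Complex.I, Complex.exp_pi_mul_I]; ring

/-- Change of variables in the integral over `Σ`. The points `-q₀ e^{±u}` are on the lower side
`Im w = -π` of the half-strip, and the upper half circle is the image of its left side under
`w ↦ q₀ e^{-w}`. -/
theorem tendsto_sigT {q0 : ℝ} (hq0 : 0 < q0) {H : ℂ → ℂ} (hH : SigmaIntegrable q0 H) :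
    Tendsto (sigT q0 H) atTop (𝓝 (sigmaIntegral q0 H)) := by
  have hpi := Real.pi_pos
  have hI := (integrable_iff_expRay hq0).1 hH.1
  have ha : ∀ c τ : ℝ, c ∈ ({q0, -q0} : Set ℝ) → τ ∈ ({1, -1} : Set ℝ) →
      Tendsto (fun T => ∫ u : ℝ in (0 : ℝ)..T,
        (q0 * Real.exp (τ * u)) • H ((c * Real.exp (τ * u) : ℝ) : ℂ)) atTop
      (𝓝 (∫ x in (fun u : ℝ => c * Real.exp (τ * u)) '' Set.Ioi 0, H (x : ℂ))) := by
    intro c τ hc hτ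
    have hc' : |c| = q0 := by
      rcases hc with rfl | rfl
      · exact abs_of_pos hq0
      · rw [abs_neg, abs_of_pos hq0]
    have hτ' : |τ| = 1 := by rcases hτ with rfl | rfl <;> simp
    have hc0 : c ≠ 0 := fun h => by simp [h] at hc'; exact hq0.ne hc'
    have := tendsto_expRay hc0 hτ' (hI c hc τ hτ)
    rwa [hc'] at this
  have h1 := ha q0 1 (by simp) (by simp)
  have h2 := ha q0 (-1) (by simp) (by simp)
  have h3 := ha (-q0) 1 (by simp) (by simp)
  have h4 := ha (-q0) (-1) (by simp) (by simp)
  rw [image_expRay hq0] at h1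
  rw [image_expRay_inv hq0] at h2
  rw [image_expRay_neg hq0] at h3
  rw [image_expRay_neg_inv hq0] at h4
  have hc1 : (∫ s in Set.Ioo (-Real.pi) 0, H (circPt q0 s) * (Complex.I * circPt q0 s))
      = Complex.I * ∫ s : ℝ in (-Real.pi)..0, circPt q0 s * H (circPt q0 s) := by
    rw [← intervalIntegral.integral_const_mul, intervalIntegral.integral_of_le (by linarith),
      integral_Ioc_eq_integral_Ioo]
    exact integral_congr_ae (Eventually.of_forall fun s => by ring)
  have hc2 : (∫ s in Set.Ioo 0 Real.pi, H (circPt q0 s) * (Complex.I * circPt q0 s))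
      = Complex.I * ∫ s : ℝ in (-Real.pi)..0, circPt q0 (-s) * H (circPt q0 (-s)) := by
    rw [intervalIntegral.integral_comp_neg (fun s => circPt q0 s * H (circPt q0 s)),
      ← intervalIntegral.integral_const_mul, neg_zero, neg_neg,
      intervalIntegral.integral_of_le (by linarith), integral_Ioc_eq_integral_Ioo]
    exact integral_congr_ae (Eventually.of_forall fun s => by ring)
  have hall := (((h1.add h3).add_const
    (Complex.I * ∫ s : ℝ in (-Real.pi)..0, circPt q0 s * H (circPt q0 s))).sub
      ((h2.add h4).add_const
    (Complex.I * ∫ s : ℝ in (-Real.pi)..0, circPt q0 (-s) * H (circPt q0 (-s)))))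
  rw [sigmaIntegral, hc1, hc2, integral_Ioo_eq_add hq0 hH.1]
  convert hall using 1
  · funext T
    have e1 : ∀ u : ℝ, logForm q0 H (u + ((0 : ℝ) : ℂ) * Complex.I)
        = (q0 * Real.exp (1 * u)) • H ((q0 * Real.exp (1 * u) : ℝ) : ℂ) := fun u =>
      logForm_ray q0 H _ 1 u (by simp)
    have e2 : ∀ u : ℝ, logForm q0 H (-(u + ((0 : ℝ) : ℂ) * Complex.I))
        = (q0 * Real.exp (-1 * u)) • H ((q0 * Real.exp (-1 * u) : ℝ) : ℂ) := fun u =>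
      logForm_ray q0 H _ (-1) u (by simp)
    have e3 : ∀ u : ℝ, logForm q0 H (u + ((-Real.pi : ℝ) : ℂ) * Complex.I)
        = -((q0 * Real.exp (1 * u)) • H ((-q0 * Real.exp (1 * u) : ℝ) : ℂ)) := fun u =>
      logForm_ray' q0 H _ 1 u (by rw [horizontal_neg_pi, exp_sub_I_mul_pi]; simp)
    have e4 : ∀ u : ℝ, logForm q0 H (-(u + ((-Real.pi : ℝ) : ℂ) * Complex.I))
        = -((q0 * Real.exp (-1 * u)) • H ((-q0 * Real.exp (-1 * u) : ℝ) : ℂ)) := fun u =>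
      logForm_ray' q0 H _ (-1) u (by
        rw [horizontal_neg_pi, show -((u : ℂ) - Complex.I * Real.pi) = -u + Complex.I * Real.pi by
          ring, exp_add_I_mul_pi]; simp)
    have e5 : ∀ s : ℝ, logForm q0 H (((0 : ℝ) : ℂ) + s * Complex.I)
        = circPt q0 s * H (circPt q0 s) := fun s => logForm_circ q0 H _ s (by simp)
    have e6 : ∀ s : ℝ, logForm q0 H (-(((0 : ℝ) : ℂ) + s * Complex.I))
        = circPt q0 (-s) * H (circPt q0 (-s)) := fun s => logForm_circ q0 H _ (-s) (by simp)
    simp only [sigT, openInt, e1, e2, e3, e4, e5, e6, intervalIntegral.integral_neg]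
    ring
  · congr 1
    ring

theorem logForm_conj (q0 : ℝ) (H : ℂ → ℂ) (w : ℂ) :
    logForm q0 (fun ζ => conj (H (conj ζ))) w = conj (logForm q0 H (conj w)) := by
  simp [logForm, ← Complex.exp_conj]

theorem logForm_eq_of_exp_eq {q0 : ℝ} {H : ℂ → ℂ} {w v : ℂ} (h : Complex.exp w = Complex.exp v) :
    logForm q0 H w = logForm q0 H v := by
  simp only [logForm, h]

theorem logForm_conj_top (q0 : ℝ) (H : ℂ → ℂ) (u : ℝ) :
    logForm q0 (fun ζ => conj (H (conj ζ))) (u + ((0 : ℝ) : ℂ) * Complex.I)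
      = conj (logForm q0 H (u + ((0 : ℝ) : ℂ) * Complex.I)) := by
  rw [logForm_conj]; simp

theorem logForm_conj_top_neg (q0 : ℝ) (H : ℂ → ℂ) (u : ℝ) :
    logForm q0 (fun ζ => conj (H (conj ζ))) (-(u + ((0 : ℝ) : ℂ) * Complex.I))
      = conj (logForm q0 H (-(u + ((0 : ℝ) : ℂ) * Complex.I))) := by
  rw [logForm_conj]; simp

theorem logForm_conj_bot (q0 : ℝ) (H : ℂ → ℂ) (u : ℝ) :
    logForm q0 (fun ζ => conj (H (conj ζ))) (u + ((-Real.pi : ℝ) : ℂ) * Complex.I)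
      = conj (logForm q0 H (u + ((-Real.pi : ℝ) : ℂ) * Complex.I)) := by
  rw [logForm_conj]
  congr 1
  refine logForm_eq_of_exp_eq ?_
  rw [horizontal_neg_pi, exp_sub_I_mul_pi, ← exp_add_I_mul_pi]; simp

theorem logForm_conj_bot_neg (q0 : ℝ) (H : ℂ → ℂ) (u : ℝ) :
    logForm q0 (fun ζ => conj (H (conj ζ))) (-(u + ((-Real.pi : ℝ) : ℂ) * Complex.I))
      = conj (logForm q0 H (-(u + ((-Real.pi : ℝ) : ℂ) * Complex.I))) := by
  rw [logForm_conj]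
  congr 1
  refine logForm_eq_of_exp_eq ?_
  rw [horizontal_neg_pi, show -((u : ℂ) - Complex.I * Real.pi) = -u + Complex.I * Real.pi by
    ring, exp_add_I_mul_pi, ← exp_sub_I_mul_pi]
  simp [sub_eq_add_neg]

theorem logForm_conj_left (q0 : ℝ) (H : ℂ → ℂ) (s : ℝ) :
    logForm q0 (fun ζ => conj (H (conj ζ))) (((0 : ℝ) : ℂ) + s * Complex.I)
      = conj (logForm q0 H (-(((0 : ℝ) : ℂ) + s * Complex.I))) := by
  rw [logForm_conj]; simp

theorem logForm_conj_left_neg (q0 : ℝ) (H : ℂ → ℂ) (s : ℝ) :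
    logForm q0 (fun ζ => conj (H (conj ζ))) (-(((0 : ℝ) : ℂ) + s * Complex.I))
      = conj (logForm q0 H (((0 : ℝ) : ℂ) + s * Complex.I)) := by
  rw [logForm_conj]; simp

/-- The reflection `H ↦ H(ζ*)*` conjugates the integral: it preserves the real axis, and it
exchanges the two half circles, which are both oriented from `-q₀` to `q₀`. -/
theorem sigT_conj (q0 : ℝ) (H : ℂ → ℂ) (T : ℝ) :
    sigT q0 (fun ζ => conj (H (conj ζ))) T = conj (sigT q0 H T) := by
  have ec : ∀ (G : ℝ → ℂ) (a b : ℝ), ∫ u : ℝ in a..b, conj (G u) = conj (∫ u : ℝ in a..b, G u) := by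
    intro G a b
    simp only [intervalIntegral, integral_conj, map_sub]
  simp only [sigT, openInt, logForm_conj_top, logForm_conj_top_neg, logForm_conj_bot,
    logForm_conj_bot_neg, logForm_conj_left, logForm_conj_left_neg, ec]
  simp only [map_sub, map_add, map_mul, Complex.conj_I]
  ring

/-- Integrability of all the terms of `openInt`. -/
structure OpenIntegrable (G : ℂ → ℂ) (T : ℝ) : Prop where
  top : IntervalIntegrable (fun u : ℝ => G (u + (0 : ℝ) * Complex.I)) volume 0 T
  bot : IntervalIntegrable (fun u : ℝ => G (u + (-Real.pi : ℝ) * Complex.I)) volume 0 T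
  left : IntervalIntegrable (fun s : ℝ => G ((0 : ℝ) + s * Complex.I)) volume (-Real.pi) 0

theorem intervalIntegrable_conj {g : ℝ → ℂ} {a b : ℝ} (h : IntervalIntegrable g volume a b) :
    IntervalIntegrable (fun x => conj (g x)) volume a b :=
  ⟨(Complex.conjLIE.integrable_comp_iff).2 h.1, (Complex.conjLIE.integrable_comp_iff).2 h.2⟩

/-- Integrability of all the terms of `sigT`. -/
def SigTIntegrable (q0 : ℝ) (H : ℂ → ℂ) (T : ℝ) : Prop :=
  OpenIntegrable (logForm q0 H) T ∧ OpenIntegrable (fun w => logForm q0 H (-w)) T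

theorem SigTIntegrable.conj {q0 : ℝ} {H : ℂ → ℂ} {T : ℝ} (h : SigTIntegrable q0 H T) :
    SigTIntegrable q0 (fun ζ => conj (H (conj ζ))) T := by
  refine ⟨⟨?_, ?_, ?_⟩, ?_, ?_, ?_⟩
  · simpa only [logForm_conj_top] using intervalIntegrable_conj h.1.top
  · simpa only [logForm_conj_bot] using intervalIntegrable_conj h.1.bot
  · simpa only [logForm_conj_left] using intervalIntegrable_conj h.2.left
  · simpa only [logForm_conj_top_neg] using intervalIntegrable_conj h.2.top
  · simpa only [logForm_conj_bot_neg] using intervalIntegrable_conj h.2.bot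
  · simpa only [logForm_conj_left_neg] using intervalIntegrable_conj h.1.left

theorem OpenIntegrable.openInt_add {G₁ G₂ : ℂ → ℂ} {T : ℝ} (h₁ : OpenIntegrable G₁ T)
    (h₂ : OpenIntegrable G₂ T) :
    openInt (fun w => G₁ w + G₂ w) T = openInt G₁ T + openInt G₂ T := by
  simp only [openInt]
  rw [intervalIntegral.integral_add h₁.top h₂.top, intervalIntegral.integral_add h₁.bot h₂.bot,
    intervalIntegral.integral_add h₁.left h₂.left]
  ring

theorem openInt_neg (G : ℂ → ℂ) (T : ℝ) : openInt (fun w => -G w) T = -openInt G T := by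
  simp only [openInt, intervalIntegral.integral_neg]
  ring

theorem SigTIntegrable.sigT_add {q0 : ℝ} {H₁ H₂ : ℂ → ℂ} {T : ℝ} (h₁ : SigTIntegrable q0 H₁ T)
    (h₂ : SigTIntegrable q0 H₂ T) :
    sigT q0 (fun ζ => H₁ ζ + H₂ ζ) T = sigT q0 H₁ T + sigT q0 H₂ T := by
  have e : ∀ w, logForm q0 (fun ζ => H₁ ζ + H₂ ζ) w = logForm q0 H₁ w + logForm q0 H₂ w :=
    fun w => mul_add _ _ _
  have e1 := h₁.1.openInt_add h₂.1
  have e2 := h₁.2.openInt_add h₂.2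
  simp only [← e] at e1 e2
  rw [sigT, sigT, sigT, e1, e2]
  ring

theorem sigT_neg (q0 : ℝ) (H : ℂ → ℂ) (T : ℝ) : sigT q0 (fun ζ => -H ζ) T = -sigT q0 H T := by
  have e : logForm q0 (fun ζ => -H ζ) = fun w => -logForm q0 H w := funext fun w => mul_neg _ _
  rw [sigT, sigT, e, openInt_neg, openInt_neg]
  ring

/-- The contour integral over the boundary of the half-strip depends only on the values on the
boundary without `-iπ/2`. -/
theorem openInt_congr {G₁ G₂ : ℂ → ℂ} (h : ∀ w ∈ strip, w ∉ stripInt → G₁ w = G₂ w) {T : ℝ}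
    (hT : 0 ≤ T) : openInt G₁ T = openInt G₂ T := by
  have hpi := Real.pi_pos
  simp only [openInt]
  congr 1
  · congr 1
    · refine intervalIntegral.integral_congr fun u hu => ?_
      rw [Set.uIcc_of_le hT] at hu
      exact h _ (mk_mem_strip hu.1 ⟨by linarith, le_rfl⟩ (Or.inr (by intro e; linarith)))
        (fun hw => by simpa using hw.2.2)
    · refine intervalIntegral.integral_congr fun u hu => ?_
      rw [Set.uIcc_of_le hT] at hu
      exact h _ (mk_mem_strip hu.1 ⟨le_rfl, by linarith⟩ (Or.inr (by intro e; linarith)))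
        (fun hw => by simpa using hw.2.1)
  · congr 1
    refine intervalIntegral.integral_congr_ae ?_
    have hne : ∀ᵐ s : ℝ, s ≠ -(Real.pi / 2) := by simp [ae_iff, measure_singleton]
    filter_upwards [hne] with s hs hsI
    rw [Set.uIoc_of_le (by linarith)] at hsI
    exact h _ (mk_mem_strip le_rfl (Set.Ioc_subset_Icc_self hsI) (Or.inr hs))
      (fun hw => by simpa using hw.1)

theorem OpenIntegrable.congr {G₁ G₂ : ℂ → ℂ} {T : ℝ} (h₁ : OpenIntegrable G₁ T)
    (h : ∀ w ∈ strip, w ∉ stripInt → G₁ w = G₂ w) (hT : 0 ≤ T) : OpenIntegrable G₂ T := by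
  have hpi := Real.pi_pos
  refine ⟨h₁.top.congr fun u hu => ?_, h₁.bot.congr fun u hu => ?_, h₁.left.congr_ae ?_⟩
  · rw [Set.uIoc_of_le hT] at hu
    exact h _ (mk_mem_strip hu.1.le ⟨by linarith, le_rfl⟩ (Or.inr (by intro e; linarith)))
      (fun hw => by simpa using hw.2.2)
  · rw [Set.uIoc_of_le hT] at hu
    exact h _ (mk_mem_strip hu.1.le ⟨le_rfl, by linarith⟩ (Or.inr (by intro e; linarith)))
      (fun hw => by simpa using hw.2.1)
  · have hne : ∀ᵐ s : ℝ ∂volume.restrict (Set.uIoc (-Real.pi) 0), s ≠ -(Real.pi / 2) :=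
      ae_restrict_of_ae (by simp [ae_iff, measure_singleton])
    filter_upwards [hne, ae_restrict_mem measurableSet_uIoc] with s hs hsI
    rw [Set.uIoc_of_le (by linarith)] at hsI
    exact h _ (mk_mem_strip le_rfl (Set.Ioc_subset_Icc_self hsI) (Or.inr hs))
      (fun hw => by simpa using hw.1)

/-- The boundary of the half-strip is mapped to `Σ`. -/
theorem expMap_mem_sigmaReg {q0 : ℝ} (hq0 : 0 < q0) {w : ℂ} (hw : w ∈ strip) (hw' : w ∉ stripInt) :
    (q0 : ℂ) * Complex.exp w ∈ SigmaReg q0 := by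
  have h1 := expMap_mem hq0 hw
  refine ⟨?_, ?_⟩
  · by_cases h : w.re = 0
    · right
      rw [norm_expMap hq0, h, Real.exp_zero, mul_one]
    · left
      have h2 : w.im = -Real.pi ∨ w.im = 0 := by
        by_contra hc
        rw [not_or] at hc
        exact hw' ⟨lt_of_le_of_ne hw.1 (Ne.symm h), lt_of_le_of_ne hw.2.1 (Ne.symm hc.1),
          lt_of_le_of_ne hw.2.2.1 hc.2⟩
      rw [expMap_im]
      rcases h2 with h2 | h2 <;> simp [h2]
  · simp only [Set.mem_insert_iff, Set.mem_singleton_iff, not_or]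
    refine ⟨mul_ne_zero (by exact_mod_cast hq0.ne') (Complex.exp_ne_zero w), fun h => ?_, h1.2.2⟩
    have h2 := h1.2.1
    rw [h] at h2
    simp at h2
    linarith

theorem expMap_neg_mem_sigmaReg {q0 : ℝ} (hq0 : 0 < q0) {w : ℂ} (hw : w ∈ strip)
    (hw' : w ∉ stripInt) : (q0 : ℂ) * Complex.exp (-w) ∈ SigmaReg q0 := by
  have h1 := expMap_mem_sigmaReg hq0 hw hw'
  have hq : (q0 : ℂ) ≠ 0 := by exact_mod_cast hq0.ne'
  have hI : ∀ c : ℂ, c = Complex.I ∨ c = -Complex.I → (q0 : ℂ) * Complex.exp (-w) = c * q0 →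
      (q0 : ℂ) * Complex.exp w = -c * q0 := by
    intro c hc h
    rw [mul_comm c] at h
    have h2 := mul_left_cancel₀ hq h
    rw [Complex.exp_neg] at h2
    rw [← inv_inv (Complex.exp w), h2]
    rcases hc with rfl | rfl <;> simp [mul_comm]
  have h2 := h1.2
  simp only [Set.mem_insert_iff, Set.mem_singleton_iff, not_or] at h2
  refine ⟨?_, ?_⟩
  · rcases h1.1 with h | h
    · left
      rw [expMap_im] at h ⊢
      have : Real.sin w.im = 0 := by
        rcases mul_eq_zero.1 h with h | h
        · exact absurd h (by positivity)
        · exact h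
      simp [this]
    · right
      rw [norm_expMap hq0] at h ⊢
      have h3 : Real.exp w.re = 1 := mul_left_cancel₀ hq0.ne' (by linarith)
      rw [Complex.neg_re, Real.exp_neg, h3]; simp
  · simp only [Set.mem_insert_iff, Set.mem_singleton_iff, not_or]
    refine ⟨mul_ne_zero hq (Complex.exp_ne_zero _), fun h => h2.2.2 ?_, fun h => h2.2.1 ?_⟩
    · rw [hI Complex.I (Or.inl rfl) h, neg_mul]
    · rw [hI (-Complex.I) (Or.inr rfl) (by rw [h, neg_mul]), neg_neg]

theorem OpenIntegrable.of_continuousOn {g : ℂ → ℂ} (hg : ContinuousOn g strip)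
    (hl : MemLp (fun s : ℝ => g ((0 : ℝ) + s * Complex.I)) 2
      (volume.restrict (Set.Ioc (-Real.pi) 0)))
    {k : ℂ → ℂ} {w₀ r ℓ : ℂ} (hk : StripKernel k w₀ r ℓ) {T : ℝ} (hT : 0 ≤ T) :
    OpenIntegrable (fun w => g w * k w) T := by
  have hpi := Real.pi_pos
  have hm : ∀ y : ℝ, y ∈ Set.Icc (-Real.pi) 0 → y ≠ -(Real.pi / 2) → y ≠ w₀.im →
      IntervalIntegrable (fun u : ℝ => (fun w => g w * k w) (u + y * Complex.I)) volume 0 T := by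
    intro y hy hy1 hy2
    refine ContinuousOn.intervalIntegrable_of_Icc hT ?_
    have hc : ContinuousOn (fun w => g w * k w) (strip \ {w₀}) :=
      (hg.mono sdiff_le).mul (hk.cont.mono fun w hw => ⟨strip_subset hw.1, hw.2⟩)
    exact horizontal_continuousOn hc fun x hx =>
      ⟨mk_mem_strip hx.1 hy (Or.inr hy1), fun h => hy2 (by simp [← Set.mem_singleton_iff.1 h])⟩
  refine ⟨hm 0 ⟨by linarith, le_rfl⟩ (by intro e; linarith) hk.mem.2.2.ne', hm (-Real.pi)
    ⟨le_rfl, by linarith⟩ (by intro e; linarith) hk.mem.2.1.ne, ?_⟩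
  rw [intervalIntegrable_iff_integrableOn_Ioc_of_le (by linarith)]
  obtain ⟨B, η, hη, hB⟩ := hk.bounded
  have hkc : ContinuousOn (fun s : ℝ => k ((0 : ℝ) + s * Complex.I)) (Set.Icc (-Real.pi) 0) :=
    vertical_continuousOn hk.cont fun y hy => (hB 0 y le_rfl hη.le hy).1
  refine Integrable.mul_bdd (c := B) (hl.integrable (by norm_num))
    ((hkc.mono Set.Ioc_subset_Icc_self).aestronglyMeasurable measurableSet_Ioc) ?_
  filter_upwards [ae_restrict_mem measurableSet_Ioc] with s hs
  exact (hB 0 s le_rfl hη.le (Set.Ioc_subset_Icc_self hs)).2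

end IfoNLS

/-! ### The logarithm on the closure of `D⁻` -/

namespace IfoNLS

/-- The inverse of `w ↦ q₀ e^w` from `outerLower` to the half-strip. -/
noncomputable def stripCoord (q0 : ℝ) (z : ℂ) : ℂ := Complex.log (Complex.I * z / q0) + branchPt

theorem stripCoord_slit {q0 : ℝ} (hq0 : 0 < q0) {z : ℂ} (hz : z ∈ outerLower q0) :
    Complex.I * z / q0 ∈ Complex.slitPlane := by
  obtain ⟨h1, h2, h3⟩ := hz
  rw [Complex.mem_slitPlane_iff, Complex.div_ofReal_re, Complex.div_ofReal_im]
  simp only [Complex.mul_re, Complex.mul_im, Complex.I_re, Complex.I_im, zero_mul, one_mul,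
    zero_sub, zero_add]
  rcases h2.lt_or_eq with h | h
  · left
    exact div_pos (by linarith) hq0
  · right
    intro h4
    have h5 : z.re = 0 := by
      rcases div_eq_zero_iff.1 h4 with h5 | h5
      · exact h5
      · exact absurd h5 hq0.ne'
    exact ne_zero_of_le_norm hq0 h1 (Complex.ext h5 h)

theorem exp_stripCoord {q0 : ℝ} (hq0 : 0 < q0) {z : ℂ} (hz : z ∈ outerLower q0) :
    (q0 : ℂ) * Complex.exp (stripCoord q0 z) = z := by
  have hq : (q0 : ℂ) ≠ 0 := by exact_mod_cast hq0.ne'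
  rw [stripCoord, Complex.exp_add, Complex.exp_log (Complex.slitPlane_ne_zero (stripCoord_slit hq0 hz)),
    exp_branchPt]
  field_simp
  linear_combination (-z) * Complex.I_sq

theorem stripCoord_mem {q0 : ℝ} (hq0 : 0 < q0) {z : ℂ} (hz : z ∈ outerLower q0) :
    stripCoord q0 z ∈ strip := by
  have hexp := exp_stripCoord hq0 hz
  have hn := norm_expMap hq0 (stripCoord q0 z)
  rw [hexp] at hn
  obtain ⟨h1, h2, h3⟩ := hz
  have harg : |Complex.arg (Complex.I * z / q0)| ≤ Real.pi / 2 := by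
    rw [Complex.abs_arg_le_pi_div_two_iff, Complex.div_ofReal_re]
    exact div_nonneg (by simpa using h2) hq0.le
  have him : (stripCoord q0 z).im = Complex.arg (Complex.I * z / q0) - Real.pi / 2 := by
    rw [stripCoord, Complex.add_im, Complex.log_im, branchPt_im]; ring
  rw [abs_le] at harg
  refine ⟨?_, by rw [him]; linarith, by rw [him]; linarith, fun h => h3 ?_⟩
  · rw [hn] at h1
    exact Real.one_le_exp_iff.1 ((le_mul_iff_one_le_right hq0).1 h1)
  · rw [← hexp, h, exp_branchPt]; ring

theorem stripCoord_expMap {q0 : ℝ} (hq0 : 0 < q0) {w : ℂ} (hw : w ∈ strip) :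
    stripCoord q0 ((q0 : ℂ) * Complex.exp w) = w := by
  have hpi := Real.pi_pos
  have hq : (q0 : ℂ) ≠ 0 := by exact_mod_cast hq0.ne'
  have e : Complex.I * ((q0 : ℂ) * Complex.exp w) / q0 = Complex.exp (w - branchPt) := by
    rw [Complex.exp_sub, exp_branchPt, div_eq_div_iff hq (neg_ne_zero.2 Complex.I_ne_zero)]
    linear_combination (-(q0 : ℂ) * Complex.exp w) * Complex.I_sq
  obtain ⟨h1, h2, h3, h4⟩ := hw
  rw [stripCoord, e, Complex.log_exp, sub_add_cancel]
  · rw [Complex.sub_im, branchPt_im]; linarith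
  · rw [Complex.sub_im, branchPt_im]; linarith

theorem continuousOn_stripCoord {q0 : ℝ} (hq0 : 0 < q0) :
    ContinuousOn (stripCoord q0) (outerLower q0) := by
  have h : ContinuousOn (fun z : ℂ => Complex.I * z / q0) (outerLower q0) := by fun_prop
  exact (h.clog fun z hz => stripCoord_slit hq0 hz).add continuousOn_const

open Classical in
/-- The extension of the logarithm `f` to the closure of `D⁻`: in the lower component of `D⁻` it is
`f` in the coordinate of the half-strip, and the upper component is covered by the symmetry
`z ↦ -q₀²/z*`, up to the additive constant `iκ`. -/
noncomputable def glueLog (q0 : ℝ) (f : ℂ → ℂ) (κ : ℝ) (z : ℂ) : ℂ :=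
  if z ∈ outerLower q0 then f (stripCoord q0 z)
  else Complex.I * κ + conj (f (stripCoord q0 (hatConj q0 z)))

/-- The two definitions of the extension agree at `± q₀`. -/
def Glues (f : ℂ → ℂ) (κ : ℝ) : Prop :=
  f 0 = Complex.I * κ + conj (f (-(Complex.I * Real.pi)))

theorem zero_mem_strip : (0 : ℂ) ∈ strip :=
  ⟨le_rfl, by simpa using Real.pi_pos.le, le_rfl, ne_branchPt_of_im (by simp [Real.pi_ne_zero])⟩

theorem neg_I_mul_pi_mem_strip : -(Complex.I * Real.pi) ∈ strip := by
  have hpi := Real.pi_pos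
  refine ⟨by simp, by simp, by simpa using hpi.le, ne_branchPt_of_im ?_⟩
  simp
  intro h
  linarith

theorem stripCoord_q0 {q0 : ℝ} (hq0 : 0 < q0) : stripCoord q0 q0 = 0 := by
  simpa using stripCoord_expMap hq0 zero_mem_strip

theorem stripCoord_neg_q0 {q0 : ℝ} (hq0 : 0 < q0) :
    stripCoord q0 (-q0) = -(Complex.I * Real.pi) := by
  have := stripCoord_expMap hq0 neg_I_mul_pi_mem_strip
  rwa [Complex.exp_neg, mul_comm Complex.I, Complex.exp_pi_mul_I, inv_neg, inv_one, mul_neg,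
    mul_one, mul_comm _ Complex.I] at this

/-- The second branch of `glueLog` is also valid on the overlap `{± q₀}` of the two regions. -/
theorem glueLog_of_hatConj_mem {q0 : ℝ} (hq0 : 0 < q0) {f : ℂ → ℂ} {κ : ℝ} (hκ : Glues f κ) {z : ℂ}
    (hz : hatConj q0 z ∈ outerLower q0) :
    glueLog q0 f κ z = Complex.I * κ + conj (f (stripCoord q0 (hatConj q0 z))) := by
  by_cases h : z ∈ outerLower q0
  · have hn := norm_hatConj q0 z
    have hi := hatConj_im q0 z
    have h0 := ne_zero_of_le_norm hq0 h.1
    have hz1 := hz.1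
    have hzn : 0 < ‖z‖ := norm_pos_iff.2 h0
    have hnorm : ‖z‖ = q0 := by
      refine le_antisymm ?_ h.1
      rw [hn, le_div_iff₀ hzn] at hz1
      nlinarith
    have him : z.im = 0 := by
      refine le_antisymm h.2.1 ?_
      have h2 := hz.2.1
      rw [hi, hnorm, neg_nonpos] at h2
      have e : q0 ^ 2 * z.im / q0 ^ 2 = z.im := by field_simp
      linarith
    have hre : z.re = q0 ∨ z.re = -q0 := by
      have e := Complex.sq_norm z
      rw [Complex.normSq_apply, him, hnorm] at e
      exact sq_eq_sq_iff_eq_or_eq_neg.1 (by nlinarith)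
    have hq : (q0 : ℂ) ≠ 0 := by exact_mod_cast hq0.ne'
    rw [glueLog, if_pos h]
    rcases hre with h | h
    · have e : z = q0 := Complex.ext (by simpa using h) (by simpa using him)
      have e2 : hatConj q0 q0 = -(q0 : ℂ) := by
        simp only [hatConj, Complex.conj_ofReal]; field_simp
      rw [e, e2, stripCoord_q0 hq0, stripCoord_neg_q0 hq0]
      exact hκ
    · have e : z = -q0 := Complex.ext (by simpa using h) (by simpa using him)
      have e2 : hatConj q0 (-q0) = (q0 : ℂ) := by
        simp only [hatConj, map_neg, Complex.conj_ofReal]; field_simp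
      rw [e, e2, stripCoord_q0 hq0, stripCoord_neg_q0 hq0, hκ]
      simp
  · rw [glueLog, if_neg h]

theorem glueLog_expMap {q0 : ℝ} (hq0 : 0 < q0) (f : ℂ → ℂ) (κ : ℝ) {w : ℂ} (hw : w ∈ strip) :
    glueLog q0 f κ ((q0 : ℂ) * Complex.exp w) = f w := by
  rw [glueLog, if_pos (expMap_mem hq0 hw), stripCoord_expMap hq0 hw]

theorem hatConj_expMap_neg {q0 : ℝ} (hq0 : 0 < q0) (w : ℂ) :
    hatConj q0 ((q0 : ℂ) * Complex.exp (-w))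
      = (q0 : ℂ) * Complex.exp (conj w - Complex.I * Real.pi) := by
  have hq : (q0 : ℂ) ≠ 0 := by exact_mod_cast hq0.ne'
  have he := Complex.exp_ne_zero (conj w)
  rw [exp_sub_I_mul_pi, hatConj, map_mul, Complex.conj_ofReal, ← Complex.exp_conj, map_neg,
    Complex.exp_neg]
  field_simp

theorem glueLog_expMap_neg {q0 : ℝ} (hq0 : 0 < q0) {f : ℂ → ℂ} {κ : ℝ} (hκ : Glues f κ) {w : ℂ}
    (hw : w ∈ strip) :
    glueLog q0 f κ ((q0 : ℂ) * Complex.exp (-w)) = Complex.I * κ + reflect f w := by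
  have e := hatConj_expMap_neg hq0 w
  have hm := reflect_mem hw
  rw [glueLog_of_hatConj_mem hq0 hκ (by rw [e]; exact expMap_mem hq0 hm), e,
    stripCoord_expMap hq0 hm]
  rfl

theorem continuousOn_glueLog {q0 : ℝ} (hq0 : 0 < q0) {f : ℂ → ℂ} (hf : ContinuousOn f strip)
    {κ : ℝ} (hκ : Glues f κ) : ContinuousOn (glueLog q0 f κ) (closedDMinus q0) := by
  set A := {z : ℂ | q0 ≤ ‖z‖ ∧ z.im ≤ 0} with hA
  set B := {z : ℂ | ‖z‖ ≤ q0 ∧ 0 ≤ z.im} with hB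
  have hAc : IsClosed A := (isClosed_le continuous_const continuous_norm).inter
    (isClosed_le Complex.continuous_im continuous_const)
  have hBc : IsClosed B := (isClosed_le continuous_norm continuous_const).inter
    (isClosed_le continuous_const Complex.continuous_im)
  have hcover : closedDMinus q0 ⊆ (closedDMinus q0 ∩ A) ∪ (closedDMinus q0 ∩ B) := by
    intro z hz
    rcases mem_outerLower_or hq0 hz with h | h
    · exact Or.inl ⟨hz, h.1, h.2.1⟩
    · exact Or.inr ⟨hz, h.1, h.2.1⟩
  have hcA : ContinuousOn (glueLog q0 f κ) (closedDMinus q0 ∩ A) := by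
    have hsub : ∀ z ∈ closedDMinus q0 ∩ A, z ∈ outerLower q0 := fun z hz =>
      ⟨hz.2.1, hz.2.2, hz.1.2.2.1⟩
    refine ContinuousOn.congr (f := fun z => f (stripCoord q0 z)) ?_ fun z hz => ?_
    · exact hf.comp ((continuousOn_stripCoord hq0).mono hsub) fun z hz =>
        stripCoord_mem hq0 (hsub z hz)
    · rw [glueLog, if_pos (hsub z hz)]
  have hcB : ContinuousOn (glueLog q0 f κ) (closedDMinus q0 ∩ B) := by
    have hsub : ∀ z ∈ closedDMinus q0 ∩ B, hatConj q0 z ∈ outerLower q0 := fun z hz => by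
      have hm := hatConj_mem hq0 hz.1
      have hn : 0 < ‖z‖ := norm_pos_iff.2 hz.1.1
      refine ⟨?_, ?_, hm.2.2.1⟩
      · rw [norm_hatConj, le_div_iff₀ hn]
        nlinarith [hz.2.1]
      · rw [hatConj_im, neg_nonpos]
        exact div_nonneg (mul_nonneg (sq_nonneg _) hz.2.2) (sq_nonneg _)
    have hh : ContinuousOn (hatConj q0) (closedDMinus q0 ∩ B) := fun z hz =>
      ((continuousAt_const.div Complex.continuous_conj.continuousAt
        ((map_ne_zero _).2 hz.1.1)).neg).continuousWithinAt
    refine ContinuousOn.congr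
      (f := fun z => Complex.I * κ + conj (f (stripCoord q0 (hatConj q0 z)))) ?_ fun z hz => ?_
    · refine continuousOn_const.add (Complex.continuous_conj.comp_continuousOn ?_)
      exact hf.comp ((continuousOn_stripCoord hq0).comp hh hsub) fun z hz =>
        stripCoord_mem hq0 (hsub z hz)
    · exact glueLog_of_hatConj_mem hq0 hκ (hsub z hz)
  have hpt : ∀ {C : Set ℂ}, IsClosed C → ContinuousOn (glueLog q0 f κ) (closedDMinus q0 ∩ C) →
      ∀ z, z ∈ closedDMinus q0 → ContinuousWithinAt (glueLog q0 f κ) (closedDMinus q0 ∩ C) z := by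
    intro C hC hc z hz
    by_cases h : z ∈ C
    · exact hc z ⟨hz, h⟩
    · exact continuousWithinAt_of_notMem_closure fun h2 => h
        (hC.closure_subset (closure_mono Set.inter_subset_right h2))
  exact fun z hz => ((hpt hAc hcA z hz).union (hpt hBc hcB z hz)).mono hcover

/-- The logarithm of `1 / (exp Ψ(ζ) (exp Ψ(ζ*))*)` on `Σ`, with `Ψ` the extension of `f`. -/
noncomputable def jumpLog (q0 : ℝ) (f : ℂ → ℂ) (κ : ℝ) (ζ : ℂ) : ℂ :=
  -glueLog q0 f κ ζ - conj (glueLog q0 f κ (conj ζ))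

theorem jumpLog_conj (q0 : ℝ) (f : ℂ → ℂ) (κ : ℝ) (ζ : ℂ) :
    jumpLog q0 f κ (conj ζ) = conj (jumpLog q0 f κ ζ) := by
  simp only [jumpLog, map_sub, map_neg, Complex.conj_conj]
  ring

theorem jumpLog_ofReal (q0 : ℝ) (f : ℂ → ℂ) (κ x : ℝ) :
    jumpLog q0 f κ x = ((-2 * (glueLog q0 f κ x).re : ℝ) : ℂ) := by
  rw [jumpLog, Complex.conj_ofReal]
  apply Complex.ext <;> simp
  ring

theorem isLogOnSigma_jumpLog {q0 : ℝ} (hq0 : 0 < q0) {f : ℂ → ℂ} (hf : ContinuousOn f strip)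
    {κ : ℝ} (hκ : Glues f κ) {r : ℂ → ℂ}
    (hr : ∀ ζ ∈ SigmaReg q0, r ζ = (Complex.exp (glueLog q0 f κ ζ)
      * conj (Complex.exp (glueLog q0 f κ (conj ζ))))⁻¹) :
    IsLogOnSigma q0 r (jumpLog q0 f κ) := by
  have hc := (continuousOn_glueLog hq0 hf hκ).mono (sigmaReg_subset q0)
  refine ⟨?_, fun ζ hζ => ?_, fun ζ _ him => ?_⟩
  · exact hc.neg.sub (Complex.continuous_conj.comp_continuousOn
      (hc.comp Complex.continuous_conj.continuousOn fun ζ hζ => conj_mem_sigmaReg hζ))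
  · rw [hr ζ hζ, ← Complex.exp_conj, ← Complex.exp_add, ← Complex.exp_neg, jumpLog]
    congr 1
    ring
  · have e : ζ = (ζ.re : ℂ) := Complex.ext (by simp) (by simp [him])
    rw [e, jumpLog_ofReal, Complex.ofReal_im]

theorem eq_of_im_eq_zero_of_exp_eq {a b : ℂ} (ha : a.im = 0) (hb : b.im = 0)
    (h : Complex.exp a = Complex.exp b) : a = b := by
  have e := congrArg (‖·‖) h
  simp only [Complex.norm_exp] at e
  exact Complex.ext (Real.exp_injective e) (ha.trans hb.symm)

/-- The determination of the logarithm on `Σ` is unique: it is prescribed on the real axis, and both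
components of the circle without `± i q₀` meet the real axis. -/
theorem IsLogOnSigma.eqOn {q0 : ℝ} (hq0 : 0 < q0) {r L₁ L₂ : ℂ → ℂ} (h₁ : IsLogOnSigma q0 r L₁)
    (h₂ : IsLogOnSigma q0 r L₂) : Set.EqOn L₁ L₂ (SigmaReg q0) := by
  have hpi := Real.pi_pos
  have hreal : ∀ ζ ∈ SigmaReg q0, ζ.im = 0 → L₁ ζ = L₂ ζ := fun ζ hζ him =>
    eq_of_im_eq_zero_of_exp_eq (h₁.2.2 ζ hζ him) (h₂.2.2 ζ hζ him)
      ((h₁.2.1 ζ hζ).trans (h₂.2.1 ζ hζ).symm)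
  have hmain : ∀ c : ℝ, |c| = q0 → ∀ s ∈ Set.Ioo (-(Real.pi / 2)) (Real.pi / 2),
      L₁ (c * Complex.exp (s * Complex.I)) = L₂ (c * Complex.exp (s * Complex.I)) := by
    intro c hc s hs
    set S := (fun s : ℝ => (c : ℂ) * Complex.exp (s * Complex.I)) ''
      Set.Ioo (-(Real.pi / 2)) (Real.pi / 2) with hS
    have hc0 : c ≠ 0 := fun h => by simp [h] at hc; exact hq0.ne hc
    have hsub : S ⊆ SigmaReg q0 := by
      rintro _ ⟨s, hs, rfl⟩
      have hre : ((c : ℂ) * Complex.exp (s * Complex.I)).re ≠ 0 := by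
        rw [Complex.re_ofReal_mul, Complex.exp_ofReal_mul_I_re]
        exact mul_ne_zero hc0 (Real.cos_pos_of_mem_Ioo hs).ne'
      refine ⟨Or.inr ?_, ?_⟩
      · rw [norm_mul, Complex.norm_exp_ofReal_mul_I, mul_one, Complex.norm_real, Real.norm_eq_abs, hc]
      · simp only [Set.mem_insert_iff, Set.mem_singleton_iff, not_or]
        refine ⟨fun h => hre ?_, fun h => hre ?_, fun h => hre ?_⟩ <;> rw [h] <;> simp
    have hconn : IsPreconnected S := isPreconnected_Ioo.image _ (by fun_prop)
    have h0 : (c : ℂ) ∈ S := ⟨0, ⟨by linarith, by linarith⟩, by simp⟩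
    exact eqOn_of_exp_eqOn hconn (h₁.1.mono hsub) (h₂.1.mono hsub)
      (fun w hw => (h₁.2.1 w (hsub hw)).trans (h₂.2.1 w (hsub hw)).symm) h0
      (hreal _ (hsub h0) (by simp)) ⟨s, hs, rfl⟩
  have harg : ∀ v : ℂ, 0 < v.re → Complex.arg v ∈ Set.Ioo (-(Real.pi / 2)) (Real.pi / 2) :=
    fun v hv => abs_lt.1 (Complex.abs_arg_lt_pi_div_two_iff.2 (Or.inl hv))
  intro ζ hζ
  rcases hζ.1 with h | h
  · exact hreal ζ hζ h
  rcases lt_trichotomy ζ.re 0 with h3 | h3 | h3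
  · have e : ((-q0 : ℝ) : ℂ) * Complex.exp (Complex.arg (-ζ) * Complex.I) = ζ := by
      have := Complex.norm_mul_exp_arg_mul_I (-ζ)
      rw [norm_neg, h] at this
      rw [Complex.ofReal_neg, neg_mul, this, neg_neg]
    rw [← e]
    exact hmain (-q0) (by rw [abs_neg, abs_of_pos hq0]) _ (harg _ (by simpa using h3))
  · exfalso
    have e := Complex.sq_norm ζ
    rw [Complex.normSq_apply, h3, h] at e
    have h4 := hζ.2
    simp only [Set.mem_insert_iff, Set.mem_singleton_iff, not_or] at h4
    rcases sq_eq_sq_iff_eq_or_eq_neg.1 (by nlinarith : ζ.im ^ 2 = q0 ^ 2) with h5 | h5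
    · exact h4.2.1 (Complex.ext (by simpa using h3) (by simpa using h5))
    · exact h4.2.2 (Complex.ext (by simpa using h3) (by simpa using h5))
  · have e : (q0 : ℂ) * Complex.exp (Complex.arg ζ * Complex.I) = ζ := by
      have := Complex.norm_mul_exp_arg_mul_I ζ
      rwa [h] at this
    rw [← e]
    exact hmain q0 (abs_of_pos hq0) _ (harg _ h3)

end IfoNLS

/-! ### Integrability of the logarithm along `Σ` -/

namespace IfoNLS

theorem ray_mem_strip {u : ℝ} (hu : 0 ≤ u) : (u : ℂ) ∈ strip := by
  have hpi := Real.pi_pos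
  have := mk_mem_strip hu (y := 0) ⟨by linarith, le_rfl⟩ (Or.inr (by intro e; linarith))
  simpa using this

theorem ray_mem_strip' {u : ℝ} (hu : 0 ≤ u) : (u : ℂ) - Complex.I * Real.pi ∈ strip := by
  have hpi := Real.pi_pos
  have := mk_mem_strip hu (y := -Real.pi) ⟨le_rfl, by linarith⟩ (Or.inr (by intro e; linarith))
  rwa [horizontal_neg_pi] at this

/-- On the four rays of `Σ` the real part of the extended logarithm is that of `f` on one of the
horizontal sides of the half-strip. -/
theorem glueLog_re_ray {q0 : ℝ} (hq0 : 0 < q0) {f : ℂ → ℂ} {κ : ℝ} (hκ : Glues f κ) {u : ℝ}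
    (hu : 0 ≤ u) :
    (glueLog q0 f κ ((q0 * Real.exp (1 * u) : ℝ) : ℂ)).re = (f u).re ∧
    (glueLog q0 f κ ((-q0 * Real.exp (1 * u) : ℝ) : ℂ)).re = (f (u - Complex.I * Real.pi)).re ∧
    (glueLog q0 f κ ((q0 * Real.exp (-1 * u) : ℝ) : ℂ)).re = (f (u - Complex.I * Real.pi)).re ∧
    (glueLog q0 f κ ((-q0 * Real.exp (-1 * u) : ℝ) : ℂ)).re = (f u).re := by
  have e1 : ((q0 * Real.exp (1 * u) : ℝ) : ℂ) = q0 * Complex.exp u := by simp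
  have e2 : ((-q0 * Real.exp (1 * u) : ℝ) : ℂ) = q0 * Complex.exp (u - Complex.I * Real.pi) := by
    rw [exp_sub_I_mul_pi]; simp
  have e3 : ((q0 * Real.exp (-1 * u) : ℝ) : ℂ) = q0 * Complex.exp (-u) := by simp
  have e4 : ((-q0 * Real.exp (-1 * u) : ℝ) : ℂ)
      = q0 * Complex.exp (-(u - Complex.I * Real.pi)) := by
    rw [show -((u : ℂ) - Complex.I * Real.pi) = -u + Complex.I * Real.pi by ring, exp_add_I_mul_pi]
    simp
  refine ⟨?_, ?_, ?_, ?_⟩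
  · rw [e1, glueLog_expMap hq0 f κ (ray_mem_strip hu)]
  · rw [e2, glueLog_expMap hq0 f κ (ray_mem_strip' hu)]
  · rw [e3, glueLog_expMap_neg hq0 hκ (ray_mem_strip hu)]
    simp [reflect]
  · rw [e4, glueLog_expMap_neg hq0 hκ (ray_mem_strip' hu)]
    simp [reflect]

theorem StripLog.integrableOn_jumpLog_ray {f : ℂ → ℂ} (hf : StripLog f) {q0 : ℝ} (hq0 : 0 < q0)
    {κ : ℝ} (hκ : Glues f κ) {c τ : ℝ} (hc : c ∈ ({q0, -q0} : Set ℝ))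
    (hτ : τ ∈ ({1, -1} : Set ℝ)) :
    IntegrableOn (fun u : ℝ => jumpLog q0 f κ ((c * Real.exp (τ * u) : ℝ) : ℂ)) (Set.Ioi 0) := by
  obtain ⟨h1, h2⟩ := hf.integrableOn_re
  have h1' : IntegrableOn (fun u : ℝ => ((-2 * (f u).re : ℝ) : ℂ)) (Set.Ioi 0) :=
    (h1.const_mul (-2)).ofReal
  have h2' : IntegrableOn (fun u : ℝ => ((-2 * (f (u - Complex.I * Real.pi)).re : ℝ) : ℂ))
      (Set.Ioi 0) := (h2.const_mul (-2)).ofReal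
  simp only [jumpLog_ofReal]
  rcases hc with rfl | rfl <;> rcases hτ with rfl | rfl
  · exact h1'.congr_fun (fun u hu => by
      simp only [(glueLog_re_ray hq0 hκ (le_of_lt hu)).1]) measurableSet_Ioi
  · exact h2'.congr_fun (fun u hu => by
      simp only [(glueLog_re_ray hq0 hκ (le_of_lt hu)).2.2.1]) measurableSet_Ioi
  · exact h2'.congr_fun (fun u hu => by
      simp only [(glueLog_re_ray hq0 hκ (le_of_lt hu)).2.1]) measurableSet_Ioi
  · exact h1'.congr_fun (fun u hu => by
      simp only [(glueLog_re_ray hq0 hκ (le_of_lt hu)).2.2.2]) measurableSet_Ioi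

theorem circPt_eq (q0 s : ℝ) :
    circPt q0 s = (q0 : ℂ) * Complex.exp (((0 : ℝ) : ℂ) + s * Complex.I) := by
  rw [circPt, mul_comm Complex.I]; simp

theorem circPt_neg_eq (q0 s : ℝ) :
    circPt q0 (-s) = (q0 : ℂ) * Complex.exp (-(((0 : ℝ) : ℂ) + s * Complex.I)) := by
  rw [circPt, mul_comm Complex.I]; simp

theorem conj_circPt (q0 s : ℝ) : conj (circPt q0 s) = circPt q0 (-s) := by
  simp [circPt, ← Complex.exp_conj]

/-- The upper half circle reduces to the lower one by the symmetry `L(ζ*) = L(ζ)*`. -/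
theorem StripLog.integrableOn_jumpLog_circPt {f : ℂ → ℂ} (hf : StripLog f) {q0 : ℝ} (hq0 : 0 < q0)
    {κ : ℝ} (hκ : Glues f κ) :
    IntegrableOn (fun s : ℝ => jumpLog q0 f κ (circPt q0 s)) (Set.Ioo (-Real.pi) Real.pi) := by
  have hpi := Real.pi_pos
  have h1 : IntervalIntegrable (fun s : ℝ => jumpLog q0 f κ (circPt q0 s)) volume (-Real.pi) 0 := by
    have g1 : IntegrableOn (fun s : ℝ => f ((0 : ℝ) + s * Complex.I)) (Set.Ioc (-Real.pi) 0) :=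
      hf.memLp.integrable (by norm_num)
    have g2 : IntegrableOn (fun s : ℝ => IfoNLS.reflect f ((0 : ℝ) + s * Complex.I))
        (Set.Ioc (-Real.pi) 0) := hf.reflect.memLp.integrable (by norm_num)
    have g2' : IntegrableOn (fun s : ℝ =>
        conj (Complex.I * κ + IfoNLS.reflect f ((0 : ℝ) + s * Complex.I))) (Set.Ioc (-Real.pi) 0) :=
      (Complex.conjLIE.integrable_comp_iff).2 ((integrable_const _).add g2)
    rw [intervalIntegrable_iff_integrableOn_Ioc_of_le (by linarith)]
    refine (g1.neg.sub g2').congr ?_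
    have hne : ∀ᵐ s : ℝ ∂volume.restrict (Set.Ioc (-Real.pi) 0), s ≠ -(Real.pi / 2) :=
      ae_restrict_of_ae (by simp [ae_iff, measure_singleton])
    filter_upwards [hne, ae_restrict_mem measurableSet_Ioc] with s hs hsI
    have hm := mk_mem_strip le_rfl (Set.Ioc_subset_Icc_self hsI) (Or.inr hs)
    rw [jumpLog, conj_circPt, circPt_neg_eq, circPt_eq, glueLog_expMap hq0 f κ hm,
      glueLog_expMap_neg hq0 hκ hm]
    rfl
  have h2 : IntervalIntegrable (fun s : ℝ => jumpLog q0 f κ (circPt q0 s)) volume 0 Real.pi := by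
    have h3 := intervalIntegrable_conj (h1.comp_sub_left 0).symm
    simp only [zero_sub, neg_zero, sub_neg_eq_add, zero_add] at h3
    refine h3.congr fun s _ => ?_
    rw [← jumpLog_conj, conj_circPt, neg_neg]
  have h3 := h1.trans h2
  rw [intervalIntegrable_iff_integrableOn_Ioo_of_le (by linarith)] at h3
  exact h3

theorem circPt_ne_zero {q0 : ℝ} (hq0 : 0 < q0) (s : ℝ) : circPt q0 s ≠ 0 :=
  mul_ne_zero (by exact_mod_cast hq0.ne') (Complex.exp_ne_zero _)

theorem norm_circPt {q0 : ℝ} (hq0 : 0 < q0) (s : ℝ) : ‖circPt q0 s‖ = q0 := by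
  rw [circPt_eq, norm_expMap hq0]; simp

theorem continuous_circPt (q0 : ℝ) : Continuous (circPt q0) := by
  unfold circPt
  fun_prop

theorem ofReal_mem_sigmaReg {q0 x : ℝ} (hx : x ≠ 0) : (x : ℂ) ∈ SigmaReg q0 := by
  refine ⟨Or.inl (by simp), ?_⟩
  simp only [Set.mem_insert_iff, Set.mem_singleton_iff, not_or]
  refine ⟨by exact_mod_cast hx, fun h => hx ?_, fun h => hx ?_⟩ <;>
    simpa using congrArg Complex.re h

theorem circPt_mem_sigmaReg {q0 s : ℝ} (hq0 : 0 < q0) (hs : s ∈ Set.Ioo (-Real.pi) Real.pi)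
    (h1 : s ≠ Real.pi / 2) (h2 : s ≠ -(Real.pi / 2)) : circPt q0 s ∈ SigmaReg q0 := by
  have hpi := Real.pi_pos
  have hq : (q0 : ℂ) ≠ 0 := by exact_mod_cast hq0.ne'
  have hcos : Real.cos s ≠ 0 := by
    intro h
    rcases lt_or_ge s 0 with h0 | h0
    · have h4 : Real.cos (-s) = Real.cos (Real.pi / 2) := by
        rw [Real.cos_neg, h, Real.cos_pi_div_two]
      have := Real.injOn_cos ⟨by linarith, by linarith [hs.1]⟩ ⟨by linarith, by linarith⟩ h4
      exact h2 (by linarith)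
    · have h4 : Real.cos s = Real.cos (Real.pi / 2) := by rw [h, Real.cos_pi_div_two]
      exact h1 (Real.injOn_cos ⟨h0, hs.2.le⟩ ⟨by linarith, by linarith⟩ h4)
  have hre : (circPt q0 s).re ≠ 0 := by
    rw [circPt, mul_comm Complex.I, Complex.re_ofReal_mul, Complex.exp_ofReal_mul_I_re]
    exact mul_ne_zero hq0.ne' hcos
  refine ⟨Or.inr (norm_circPt hq0 s), ?_⟩
  simp only [Set.mem_insert_iff, Set.mem_singleton_iff, not_or]
  refine ⟨fun h => hre ?_, fun h => hre ?_, fun h => hre ?_⟩ <;> rw [h] <;> simp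

theorem SigmaIntegrable.congr {q0 : ℝ} (hq0 : 0 < q0) {H₁ H₂ : ℂ → ℂ} (h : SigmaIntegrable q0 H₁)
    (he : Set.EqOn H₁ H₂ (SigmaReg q0)) : SigmaIntegrable q0 H₂ := by
  refine ⟨h.1.congr ?_, h.2.congr ?_⟩
  · have hne : ∀ᵐ x : ℝ, x ≠ 0 := by simp [ae_iff, measure_singleton]
    filter_upwards [hne] with x hx using he (ofReal_mem_sigmaReg hx)
  · have hne : ∀ c : ℝ, ∀ᵐ s : ℝ ∂volume.restrict (Set.Ioo (-Real.pi) Real.pi), s ≠ c :=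
      fun c => ae_restrict_of_ae (by simp [ae_iff, measure_singleton])
    filter_upwards [hne (Real.pi / 2), hne (-(Real.pi / 2)), ae_restrict_mem measurableSet_Ioo] with
      s h1 h2 hs using he (circPt_mem_sigmaReg hq0 hs h1 h2)

theorem sigmaIntegral_congr {q0 : ℝ} (hq0 : 0 < q0) {H₁ H₂ : ℂ → ℂ}
    (he : Set.EqOn H₁ H₂ (SigmaReg q0)) : sigmaIntegral q0 H₁ = sigmaIntegral q0 H₂ := by
  have hpi := Real.pi_pos
  have hr : ∀ S : Set ℝ, ∫ x in S, H₁ (x : ℂ) = ∫ x in S, H₂ (x : ℂ) := fun S => by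
    have hne : ∀ᵐ x : ℝ, x ≠ 0 := by simp [ae_iff, measure_singleton]
    refine integral_congr_ae (ae_restrict_of_ae ?_)
    filter_upwards [hne] with x hx using he (ofReal_mem_sigmaReg hx)
  have hc : ∀ S : Set ℝ, MeasurableSet S → S ⊆ Set.Ioo (-Real.pi) Real.pi →
      ∫ s in S, H₁ (circPt q0 s) * (Complex.I * circPt q0 s)
        = ∫ s in S, H₂ (circPt q0 s) * (Complex.I * circPt q0 s) := fun S hS hsub => by
    have hne : ∀ c : ℝ, ∀ᵐ s : ℝ ∂volume.restrict S, s ≠ c :=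
      fun c => ae_restrict_of_ae (by simp [ae_iff, measure_singleton])
    refine integral_congr_ae ?_
    filter_upwards [hne (Real.pi / 2), hne (-(Real.pi / 2)), ae_restrict_mem hS] with s h1 h2 hs
    rw [he (circPt_mem_sigmaReg hq0 (hsub hs) h1 h2)]
  rw [sigmaIntegral, sigmaIntegral, hr, hr, hr,
    hc _ measurableSet_Ioo (Set.Ioo_subset_Ioo_left (by linarith)),
    hc _ measurableSet_Ioo (Set.Ioo_subset_Ioo_right hpi.le)]

theorem StripLog.sigmaIntegrable_jumpLog_div {f : ℂ → ℂ} (hf : StripLog f) {q0 : ℝ} (hq0 : 0 < q0)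
    {κ : ℝ} (hκ : Glues f κ) : SigmaIntegrable q0 fun ζ => jumpLog q0 f κ ζ / ζ := by
  constructor
  · rw [integrable_iff_expRay hq0]
    intro c hc τ hτ
    have hc0 : c ≠ 0 := by rcases hc with rfl | rfl; exacts [hq0.ne', (neg_lt_zero.2 hq0).ne]
    have hτ' : |τ| = 1 := by rcases hτ with rfl | rfl <;> simp
    rw [integrableOn_expRay_iff hc0 hτ' fun x : ℝ => jumpLog q0 f κ x / x]
    refine IntegrableOn.congr_fun (Integrable.const_mul (hf.integrableOn_jumpLog_ray hq0 hκ hc hτ)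
      ((|c| / c : ℝ) : ℂ)) (fun u _ => ?_) measurableSet_Ioi
    have hcc : (c : ℂ) ≠ 0 := by exact_mod_cast hc0
    have he : ((Real.exp (τ * u) : ℝ) : ℂ) ≠ 0 := by exact_mod_cast (Real.exp_pos _).ne'
    simp only [Complex.real_smul, Complex.ofReal_mul, Complex.ofReal_div]
    field_simp
  · have h1 : ∀ s : ℝ, jumpLog q0 f κ (circPt q0 s) / circPt q0 s
        = jumpLog q0 f κ (circPt q0 s) * (circPt q0 s)⁻¹ := fun s => div_eq_mul_inv _ _
    simp only [h1]
    refine Integrable.mul_bdd (c := q0⁻¹) (hf.integrableOn_jumpLog_circPt hq0 hκ)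
      ((continuous_circPt q0).inv₀ (circPt_ne_zero hq0)).aestronglyMeasurable
      (Eventually.of_forall fun s => ?_)
    rw [norm_inv, norm_circPt hq0]

/-- Off `Σ` the Cauchy kernel `1/(ζ - z)` is bounded by a multiple of `1/ζ`. -/
theorem SigmaIntegrable.cauchy {q0 : ℝ} (hq0 : 0 < q0) {L : ℂ → ℂ}
    (hL : SigmaIntegrable q0 fun ζ => L ζ / ζ) {z : ℂ} (hz : z.im ≠ 0) (hz' : ‖z‖ ≠ q0) :
    SigmaIntegrable q0 fun ζ => L ζ / (ζ - z) := by
  have hx : ∀ x : ℝ, (x : ℂ) - z ≠ 0 := fun x h => hz (by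
    rw [← sub_eq_zero.1 h, Complex.ofReal_im])
  have hs : ∀ s : ℝ, circPt q0 s - z ≠ 0 := fun s h => hz' (by
    rw [← sub_eq_zero.1 h, norm_circPt hq0])
  have key : SigmaIntegrable q0 fun ζ => L ζ / ζ * (ζ / (ζ - z)) := by
    constructor
    · refine Integrable.mul_bdd (c := 1 + ‖z‖ / |z.im|) hL.1
        (Continuous.div (by fun_prop) (by fun_prop) hx).aestronglyMeasurable
        (Eventually.of_forall fun x => ?_)
      have e : (x : ℂ) / (x - z) = 1 + z / (x - z) := by
        field_simp [hx x]
        ring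
      rw [e]
      refine (norm_add_le _ _).trans ?_
      rw [norm_one, norm_div]
      have h2 : |z.im| ≤ ‖(x : ℂ) - z‖ := by
        have := Complex.abs_im_le_norm ((x : ℂ) - z)
        simpa using this
      have h3 : 0 < |z.im| := abs_pos.2 hz
      gcongr
    · refine Integrable.mul_bdd (c := q0 / |q0 - ‖z‖|) hL.2
        (((continuous_circPt q0).div ((continuous_circPt q0).sub continuous_const)
          hs).aestronglyMeasurable) (Eventually.of_forall fun s => ?_)
      have h3 : 0 < |q0 - ‖z‖| := abs_pos.2 (sub_ne_zero.2 (Ne.symm hz'))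
      rw [norm_div, norm_circPt hq0]
      have h4 := abs_norm_sub_norm_le (circPt q0 s) z
      rw [norm_circPt hq0] at h4
      gcongr
  refine key.congr hq0 fun ζ hζ => ?_
  have h2 := hζ.2
  simp only [Set.mem_insert_iff, Set.mem_singleton_iff, not_or] at h2
  have h0 := h2.1
  show L ζ / ζ * (ζ / (ζ - z)) = L ζ / (ζ - z)
  rw [div_mul_div_comm, mul_comm ζ, mul_div_mul_right _ _ h0]

/-! ### Cauchy integrals of the logarithm over `Σ` -/

theorem SqBounded.const_add {g : ℂ → ℂ} (hg : SqBounded g) (hc : ContinuousOn g strip) (c : ℂ) :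
    SqBounded fun w => c + g w := by
  have hpi := Real.pi_pos
  obtain ⟨K, η, hη, hK⟩ := hg
  refine ⟨Real.pi * (2 * ‖c‖ ^ 2) + 2 * K, η, hη, fun δ hδ hδm => ?_⟩
  have hgv : ContinuousOn (fun s : ℝ => g (δ + s * Complex.I)) (Set.Icc (-Real.pi) 0) :=
    vertical_continuousOn hc fun y hy => mk_mem_strip hδ.le hy (Or.inl hδ.ne')
  have i1 : IntervalIntegrable (fun s : ℝ => ‖c + g (δ + s * Complex.I)‖ ^ 2) volume (-Real.pi) 0 :=
    ((continuousOn_const.add hgv).norm.pow 2).intervalIntegrable_of_Icc (by linarith)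
  have i2 : IntervalIntegrable (fun s : ℝ => 2 * ‖g (δ + s * Complex.I)‖ ^ 2) volume
      (-Real.pi) 0 :=
    (continuousOn_const.mul (hgv.norm.pow 2)).intervalIntegrable_of_Icc (by linarith)
  have h1 : ∫ s : ℝ in (-Real.pi)..0, ‖c + g (δ + s * Complex.I)‖ ^ 2
      ≤ ∫ s : ℝ in (-Real.pi)..0, (2 * ‖c‖ ^ 2 + 2 * ‖g (δ + s * Complex.I)‖ ^ 2) := by
    refine intervalIntegral.integral_mono_on (by linarith) i1 (intervalIntegrable_const.add i2)
      fun s _ => ?_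
    have h2 := norm_add_le c (g (δ + s * Complex.I))
    have h3 := pow_le_pow_left₀ (norm_nonneg _) h2 2
    nlinarith [sq_nonneg (‖c‖ - ‖g (δ + s * Complex.I)‖)]
  rw [intervalIntegral.integral_add intervalIntegrable_const i2, intervalIntegral.integral_const,
    intervalIntegral.integral_const_mul, zero_sub, neg_neg, smul_eq_mul] at h1
  have := hK δ hδ hδm
  linarith

/-- The integral over `Σ` of a form which is the product of a square bounded function and a kernel
on both parts of `Σ`, by residues. -/
theorem sigT_of_kernels {f g k k' H : ℂ → ℂ} {q0 : ℝ} {w₀ r r' ℓ ℓ' m m' : ℂ}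
    (hk : StripKernel k w₀ r ℓ) (hk' : StripKernel k' w₀ r' ℓ')
    (hfs : SqBounded f) (hfc : ContinuousOn f strip) (hfd : DifferentiableOn ℂ f stripInt)
    (hfl : Tendsto f stripTop (𝓝 m))
    (hfm : MemLp (fun s : ℝ => f ((0 : ℝ) + s * Complex.I)) 2
      (volume.restrict (Set.Ioc (-Real.pi) 0)))
    (hgs : SqBounded g) (hgc : ContinuousOn g strip) (hgd : DifferentiableOn ℂ g stripInt)
    (hgl : Tendsto g stripTop (𝓝 m'))
    (hgm : MemLp (fun s : ℝ => g ((0 : ℝ) + s * Complex.I)) 2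
      (volume.restrict (Set.Ioc (-Real.pi) 0)))
    (e1 : ∀ w ∈ strip, w ∉ stripInt → f w * k w = logForm q0 H w)
    (e2 : ∀ w ∈ strip, w ∉ stripInt → g w * k' w = logForm q0 H (-w)) :
    (∀ T, 0 ≤ T → SigTIntegrable q0 H T) ∧
    Tendsto (sigT q0 H) atTop
      (𝓝 ((Complex.I * Real.pi * (m * ℓ) - 2 * Real.pi * Complex.I * (r * f w₀))
        - (Complex.I * Real.pi * (m' * ℓ') - 2 * Real.pi * Complex.I * (r' * g w₀)))) := by
  constructor
  · intro T hT
    exact ⟨(OpenIntegrable.of_continuousOn hfc hfm hk hT).congr e1 hT,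
      (OpenIntegrable.of_continuousOn hgc hgm hk' hT).congr e2 hT⟩
  · have t1 := hk.tendsto_openInt_mul hfs hfc hfd hfl
    have t2 := hk'.tendsto_openInt_mul hgs hgc hgd hgl
    refine (t1.sub t2).congr' ?_
    filter_upwards [eventually_ge_atTop 0] with T hT
    rw [sigT, openInt_congr e1 hT, openInt_congr e2 hT]

/-- The Cauchy integrals of the extended logarithm by residues, for a point `z` off `Σ` or `z = 0`.
The kernel has the coordinates `k` and `k'` on the outer and on the inner part of `Σ`. -/
theorem StripLog.sigT_cauchy {f : ℂ → ℂ} (hf : StripLog f) {q0 : ℝ} (hq0 : 0 < q0) {κ : ℝ}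
    (hκ : Glues f κ) {z w₀ r r' ℓ ℓ' : ℂ} {k k' : ℂ → ℂ} (hk : StripKernel k w₀ r ℓ)
    (hk' : StripKernel k' w₀ r' ℓ')
    (hkk : ∀ w ∈ strip, w ∉ stripInt → k w = kern q0 z w)
    (hkk' : ∀ w ∈ strip, w ∉ stripInt → k' w = kern q0 z (-w)) :
    (∀ T, 0 ≤ T → SigTIntegrable q0 (fun ζ => glueLog q0 f κ ζ / (ζ - z)) T) ∧
    Tendsto (sigT q0 fun ζ => glueLog q0 f κ ζ / (ζ - z)) atTop
      (𝓝 ((Complex.I * Real.pi * (0 * ℓ) - 2 * Real.pi * Complex.I * (r * f w₀))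
        - (Complex.I * Real.pi * (Complex.I * κ * ℓ')
          - 2 * Real.pi * Complex.I * (r' * (Complex.I * κ + IfoNLS.reflect f w₀))))) := by
  have hr := hf.reflect
  have hgc : ContinuousOn (fun w => Complex.I * κ + IfoNLS.reflect f w) strip :=
    continuousOn_const.add hr.cont
  have hgd : DifferentiableOn ℂ (fun w => Complex.I * κ + IfoNLS.reflect f w) stripInt :=
    hr.diff.const_add _
  have hgs := hr.sqBounded.const_add hr.cont (Complex.I * κ)
  have hgl : Tendsto (fun w => Complex.I * κ + IfoNLS.reflect f w) stripTop
      (𝓝 (Complex.I * κ)) := by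
    have := hr.lim.const_add (Complex.I * (κ : ℂ))
    rwa [add_zero] at this
  have hgm : MemLp (fun s : ℝ => Complex.I * κ + IfoNLS.reflect f ((0 : ℝ) + s * Complex.I)) 2
      (volume.restrict (Set.Ioc (-Real.pi) 0)) :=
    MemLp.add (f := fun _ : ℝ => Complex.I * (κ : ℂ)) (memLp_const _) hr.memLp
  refine sigT_of_kernels (f := f) (g := fun w => Complex.I * κ + IfoNLS.reflect f w) hk hk'
    hf.sqBounded hf.cont hf.diff hf.lim hf.memLp hgs hgc hgd hgl hgm (fun w hw hw' => ?_) fun w hw hw' => ?_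
  · rw [hkk w hw hw', logForm, glueLog_expMap hq0 f κ hw, kern]
    ring
  · rw [hkk' w hw hw', logForm, glueLog_expMap_neg hq0 hκ hw, kern]
    ring

/-- On the inner part of `Σ` the Cauchy kernel is `1` minus the kernel of the inverted point. -/
theorem kern_neg {q0 : ℝ} (hq0 : 0 < q0) {z w : ℂ} (hz : z ≠ 0)
    (h : (q0 : ℂ) * Complex.exp (-w) ≠ z) :
    1 - kern q0 ((q0 : ℂ) ^ 2 / z) w = kern q0 z (-w) := by
  have hq : (q0 : ℂ) ≠ 0 := by exact_mod_cast hq0.ne'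
  have he := Complex.exp_ne_zero w
  have h1 : (q0 : ℂ) - z * Complex.exp w ≠ 0 := by
    intro h2
    apply h
    rw [Complex.exp_neg, sub_eq_zero.1 h2]
    field_simp
  have h2 : (q0 : ℂ) * Complex.exp w - (q0 : ℂ) ^ 2 / z ≠ 0 := by
    have : (q0 : ℂ) * Complex.exp w - (q0 : ℂ) ^ 2 / z = -(q0 / z * (q0 - z * Complex.exp w)) := by
      field_simp
      ring
    rw [this]
    exact neg_ne_zero.2 (mul_ne_zero (div_ne_zero hq hz) h1)
  have h3 : (q0 : ℂ) * Complex.exp (-w) - z ≠ 0 := sub_ne_zero.2 h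
  rw [kern, kern, one_sub_div h2, div_eq_div_iff h2 h3, Complex.exp_neg]
  field_simp
  ring

theorem stripCoord_mem_int {q0 : ℝ} (hq0 : 0 < q0) {z : ℂ} (hz : z ∈ outerLowerInt q0) :
    stripCoord q0 z ∈ stripInt := by
  have hz' := outerLowerInt_subset hq0 hz
  have hm := stripCoord_mem hq0 hz'
  by_contra h
  rcases (expMap_mem_sigmaReg hq0 hm h).1 with h1 | h1 <;> rw [exp_stripCoord hq0 hz'] at h1
  · exact hz.2.ne h1
  · exact hz.1.ne' h1

theorem norm_sq_div {q0 : ℝ} (z : ℂ) : ‖(q0 : ℂ) ^ 2 / z‖ = q0 ^ 2 / ‖z‖ := by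
  rw [norm_div, norm_pow, Complex.norm_real, Real.norm_eq_abs, sq_abs]

theorem im_sq_div (q0 : ℝ) (z : ℂ) : ((q0 : ℂ) ^ 2 / z).im = -(q0 ^ 2 * z.im / ‖z‖ ^ 2) := by
  rw [← hatConj_im, ← conj_hat, Complex.conj_im, Complex.neg_im, neg_neg]

/-- The Cauchy integral reproduces the extended logarithm in `D⁻`. -/
theorem StripLog.tendsto_sigT_dMinus {f : ℂ → ℂ} (hf : StripLog f) {q0 : ℝ} (hq0 : 0 < q0) {κ : ℝ}
    (hκ : Glues f κ) {z : ℂ} (hz : z ∈ DMinus q0) :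
    (∀ T, 0 ≤ T → SigTIntegrable q0 (fun ζ => glueLog q0 f κ ζ / (ζ - z)) T) ∧
    Tendsto (sigT q0 fun ζ => glueLog q0 f κ ζ / (ζ - z)) atTop
      (𝓝 (-(2 * Real.pi * Complex.I * glueLog q0 f κ z))) := by
  have hq : (q0 : ℂ) ≠ 0 := by exact_mod_cast hq0.ne'
  have hz1 : (‖z‖ ^ 2 - q0 ^ 2) * z.im < 0 := hz
  have him : z.im ≠ 0 := fun h => by rw [h] at hz1; simp at hz1
  have hn : ‖z‖ ≠ q0 := fun h => by rw [h] at hz1; simp at hz1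
  have hz0 : z ≠ 0 := fun h => him (by rw [h]; rfl)
  have hzn : 0 < ‖z‖ := norm_pos_iff.2 hz0
  have hnot : z ∉ SigmaReg q0 := fun h => h.1.elim him hn
  have hkk' : ∀ w ∈ strip, w ∉ stripInt →
      1 - kern q0 ((q0 : ℂ) ^ 2 / z) w = kern q0 z (-w) := fun w hw hw' =>
    kern_neg hq0 hz0 fun h => hnot (h ▸ expMap_neg_mem_sigmaReg hq0 hw hw')
  rcases lt_or_gt_of_ne hn with h | h
  · have hi : 0 < z.im := by
      by_contra hc
      push Not at hc
      have := mul_nonneg_of_nonpos_of_nonpos (by nlinarith : ‖z‖ ^ 2 - q0 ^ 2 ≤ 0) hc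
      linarith
    have hm : (q0 : ℂ) ^ 2 / z ∈ outerLowerInt q0 := by
      refine ⟨?_, ?_⟩
      · rw [norm_sq_div, lt_div_iff₀ hzn]; nlinarith
      · rw [im_sq_div, neg_lt_zero]; positivity
    have hw := stripCoord_mem_int hq0 hm
    have hew := exp_stripCoord hq0 (outerLowerInt_subset hq0 hm)
    set w₀ := stripCoord q0 ((q0 : ℂ) ^ 2 / z)
    have hzw : z = (q0 : ℂ) * Complex.exp (-w₀) := by
      have he := Complex.exp_ne_zero w₀
      rw [Complex.exp_neg]
      field_simp
      field_simp at hew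
      linear_combination hew
    have hk' := (StripKernel.of_continuousOn hw continuousOn_const (differentiableOn_const (1 : ℂ))
      tendsto_const_nhds).sub (stripKernel_kern hq0 hw)
    rw [hew] at hk'
    have hk := stripKernel_kern_of_notMem hq0 (a := z) (fun hc => by linarith [hc.1]) hw
    have := hf.sigT_cauchy hq0 hκ hk hk' (fun _ _ _ => rfl) hkk'
    refine ⟨this.1, ?_⟩
    convert this.2 using 2
    conv_lhs => rw [hzw, glueLog_expMap_neg hq0 hκ (stripInt_subset hw)]
    ring
  · have hi : z.im < 0 := by
      by_contra hc
      push Not at hc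
      have := mul_nonneg (by nlinarith : 0 ≤ ‖z‖ ^ 2 - q0 ^ 2) hc
      linarith
    have hm : z ∈ outerLowerInt q0 := ⟨h, hi⟩
    have hw := stripCoord_mem_int hq0 hm
    have hew := exp_stripCoord hq0 (outerLowerInt_subset hq0 hm)
    set w₀ := stripCoord q0 z
    have hk' := (StripKernel.of_continuousOn hw continuousOn_const (differentiableOn_const (1 : ℂ))
      tendsto_const_nhds).sub (stripKernel_kern_of_notMem hq0 (a := (q0 : ℂ) ^ 2 / z) (fun hc => by
        have h1 := hc.1
        rw [norm_sq_div, le_div_iff₀ hzn] at h1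
        nlinarith) hw)
    have hk := stripKernel_kern hq0 hw
    rw [hew] at hk
    have := hf.sigT_cauchy hq0 hκ hk hk' (fun _ _ _ => rfl) hkk'
    refine ⟨this.1, ?_⟩
    convert this.2 using 2
    conv_lhs => rw [← hew, glueLog_expMap hq0 f κ (stripInt_subset hw)]
    ring

theorem StripLog.tendsto_sigT_dPlus {f : ℂ → ℂ} (hf : StripLog f) {q0 : ℝ} (hq0 : 0 < q0) {κ : ℝ}
    (hκ : Glues f κ) {z : ℂ} (hz : z ∈ DPlus q0) :
    (∀ T, 0 ≤ T → SigTIntegrable q0 (fun ζ => glueLog q0 f κ ζ / (ζ - z)) T) ∧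
    Tendsto (sigT q0 fun ζ => glueLog q0 f κ ζ / (ζ - z)) atTop (𝓝 0) := by
  have hz1 : 0 < (‖z‖ ^ 2 - q0 ^ 2) * z.im := hz
  have him : z.im ≠ 0 := fun h => by rw [h] at hz1; simp at hz1
  have hn : ‖z‖ ≠ q0 := fun h => by rw [h] at hz1; simp at hz1
  have hz0 : z ≠ 0 := fun h => him (by rw [h]; rfl)
  have hzn : 0 < ‖z‖ := norm_pos_iff.2 hz0
  have hnot : z ∉ SigmaReg q0 := fun h => h.1.elim him hn
  have hkk' : ∀ w ∈ strip, w ∉ stripInt →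
      1 - kern q0 ((q0 : ℂ) ^ 2 / z) w = kern q0 z (-w) := fun w hw hw' =>
    kern_neg hq0 hz0 fun h => hnot (h ▸ expMap_neg_mem_sigmaReg hq0 hw hw')
  have hw := add_branchPt_mem one_pos
  have h1 : ¬(q0 ≤ ‖z‖ ∧ z.im ≤ 0) := fun hc => by
    have := mul_nonpos_of_nonneg_of_nonpos (by nlinarith [hc.1] : 0 ≤ ‖z‖ ^ 2 - q0 ^ 2) hc.2
    linarith
  have h2 : ¬(q0 ≤ ‖(q0 : ℂ) ^ 2 / z‖ ∧ ((q0 : ℂ) ^ 2 / z).im ≤ 0) := fun hc => by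
    obtain ⟨h3, h4⟩ := hc
    rw [norm_sq_div, le_div_iff₀ hzn] at h3
    rw [im_sq_div, neg_nonpos] at h4
    have h5 : 0 ≤ z.im := by
      by_contra hneg
      push Not at hneg
      have : q0 ^ 2 * z.im / ‖z‖ ^ 2 < 0 :=
        div_neg_of_neg_of_pos (mul_neg_of_pos_of_neg (by positivity) hneg) (by positivity)
      linarith
    have h6 : ‖z‖ ≤ q0 := by nlinarith
    have := mul_nonpos_of_nonpos_of_nonneg (by nlinarith : ‖z‖ ^ 2 - q0 ^ 2 ≤ 0) h5
    linarith
  have hk' := (StripKernel.of_continuousOn hw continuousOn_const (differentiableOn_const (1 : ℂ))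
    tendsto_const_nhds).sub (stripKernel_kern_of_notMem hq0 h2 hw)
  have := hf.sigT_cauchy hq0 hκ (stripKernel_kern_of_notMem hq0 h1 hw) hk' (fun _ _ _ => rfl) hkk'
  refine ⟨this.1, ?_⟩
  convert this.2 using 2
  ring

theorem StripLog.tendsto_sigT_zero {f : ℂ → ℂ} (hf : StripLog f) {q0 : ℝ} (hq0 : 0 < q0) {κ : ℝ}
    (hκ : Glues f κ) :
    (∀ T, 0 ≤ T → SigTIntegrable q0 (fun ζ => glueLog q0 f κ ζ / (ζ - 0)) T) ∧
    Tendsto (sigT q0 fun ζ => glueLog q0 f κ ζ / (ζ - 0)) atTop (𝓝 (Real.pi * κ)) := by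
  have hq : (q0 : ℂ) ≠ 0 := by exact_mod_cast hq0.ne'
  have hkern : ∀ w, 1 = kern q0 0 w := fun w => by
    rw [kern, sub_zero, div_self (mul_ne_zero hq (Complex.exp_ne_zero w))]
  have := hf.sigT_cauchy hq0 hκ stripKernel_one stripKernel_one (z := 0)
    (fun w _ _ => hkern w) (fun w _ _ => hkern (-w))
  refine ⟨this.1, ?_⟩
  convert this.2 using 2
  linear_combination (Real.pi * κ : ℂ) * Complex.I_sq

theorem conj_mem_dPlus {q0 : ℝ} {z : ℂ} (hz : z ∈ DMinus q0) : conj z ∈ DPlus q0 := by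
  have h : (‖z‖ ^ 2 - q0 ^ 2) * z.im < 0 := hz
  show 0 < (‖conj z‖ ^ 2 - q0 ^ 2) * (conj z).im
  rw [RCLike.norm_conj, Complex.conj_im]
  linarith

/-- The Cauchy integral of the logarithm on `Σ` from those of its two parts. -/
theorem sigmaIntegral_jumpLog {f : ℂ → ℂ} {q0 : ℝ} (hq0 : 0 < q0) {κ : ℝ} {z a b : ℂ}
    (hi : SigmaIntegrable q0 fun ζ => jumpLog q0 f κ ζ / (ζ - z))
    (h₁ : (∀ T, 0 ≤ T → SigTIntegrable q0 (fun ζ => glueLog q0 f κ ζ / (ζ - z)) T) ∧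
      Tendsto (sigT q0 fun ζ => glueLog q0 f κ ζ / (ζ - z)) atTop (𝓝 a))
    (h₂ : (∀ T, 0 ≤ T → SigTIntegrable q0 (fun ζ => glueLog q0 f κ ζ / (ζ - conj z)) T) ∧
      Tendsto (sigT q0 fun ζ => glueLog q0 f κ ζ / (ζ - conj z)) atTop (𝓝 b)) :
    sigmaIntegral q0 (fun ζ => jumpLog q0 f κ ζ / (ζ - z)) = -(a + conj b) := by
  have e : (fun ζ => jumpLog q0 f κ ζ / (ζ - z)) = fun ζ => -(glueLog q0 f κ ζ / (ζ - z)
      + conj (glueLog q0 f κ (conj ζ) / (conj ζ - conj z))) := by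
    funext ζ
    rw [jumpLog, map_div₀, map_sub, Complex.conj_conj, Complex.conj_conj]
    ring
  refine tendsto_nhds_unique (tendsto_sigT hq0 hi) ?_
  have hb := (Complex.continuous_conj.tendsto b).comp h₂.2
  refine (h₁.2.add hb).neg.congr' ?_
  filter_upwards [eventually_ge_atTop 0] with T hT
  rw [e, sigT_neg, (h₁.1 T hT).sigT_add (h₂.1 T hT).conj,
    sigT_conj q0 fun ζ => glueLog q0 f κ ζ / (ζ - conj z)]
  rfl

theorem StripLog.sigmaIntegral_dMinus {f : ℂ → ℂ} (hf : StripLog f) {q0 : ℝ} (hq0 : 0 < q0) {κ : ℝ}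
    (hκ : Glues f κ) {z : ℂ} (hz : z ∈ DMinus q0)
    (hi : SigmaIntegrable q0 fun ζ => jumpLog q0 f κ ζ / (ζ - z)) :
    sigmaIntegral q0 (fun ζ => jumpLog q0 f κ ζ / (ζ - z))
      = 2 * Real.pi * Complex.I * glueLog q0 f κ z := by
  rw [sigmaIntegral_jumpLog hq0 hi (hf.tendsto_sigT_dMinus hq0 hκ hz)
    (hf.tendsto_sigT_dPlus hq0 hκ (conj_mem_dPlus hz))]
  simp

theorem StripLog.sigmaIntegral_dPlus {f : ℂ → ℂ} (hf : StripLog f) {q0 : ℝ} (hq0 : 0 < q0) {κ : ℝ}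
    (hκ : Glues f κ) {z : ℂ} (hz : z ∈ DPlus q0)
    (hi : SigmaIntegrable q0 fun ζ => jumpLog q0 f κ ζ / (ζ - z)) :
    sigmaIntegral q0 (fun ζ => jumpLog q0 f κ ζ / (ζ - z))
      = -(2 * Real.pi * Complex.I * conj (glueLog q0 f κ (conj z))) := by
  rw [sigmaIntegral_jumpLog hq0 hi (hf.tendsto_sigT_dPlus hq0 hκ hz)
    (hf.tendsto_sigT_dMinus hq0 hκ (conj_mem_dMinus hz))]
  simp only [map_neg, map_mul, map_ofNat, Complex.conj_ofReal, Complex.conj_I]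
  ring

theorem StripLog.sigmaIntegral_zero {f : ℂ → ℂ} (hf : StripLog f) {q0 : ℝ} (hq0 : 0 < q0) {κ : ℝ}
    (hκ : Glues f κ) :
    sigmaIntegral q0 (fun ζ => jumpLog q0 f κ ζ / ζ) = ((-(2 * Real.pi * κ) : ℝ) : ℂ) := by
  have h0 := hf.tendsto_sigT_zero hq0 hκ
  have h1 := sigmaIntegral_jumpLog (z := 0) hq0
    (by simpa only [sub_zero] using hf.sigmaIntegrable_jumpLog_div hq0 hκ) h0
    (by rw [map_zero]; exact h0)
  simp only [sub_zero] at h1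
  rw [h1]
  simp only [map_mul, Complex.conj_ofReal]
  push_cast
  ring

end IfoNLS

/-! ### The trace formula -/

namespace IfoNLS

theorem blaschkeFactor_inv (q0 : ℝ) (w z : ℂ) :
    blaschkeFactor q0 (conj w) z = (blaschkeFactor q0 w z)⁻¹ := by
  simp only [blaschkeFactor, Complex.conj_conj, inv_div]

theorem conj_blaschkeFactor (q0 : ℝ) (w z : ℂ) :
    conj (blaschkeFactor q0 w (conj z)) = blaschkeFactor q0 (conj w) z := by
  simp [blaschkeFactor]

/-- A Blaschke factor inherits the symmetry `z ↦ -q₀²/z*` of `s₁₁` up to a unimodular constant. -/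
theorem conj_blaschkeFactor_hatConj {q0 : ℝ} (hq0 : 0 < q0) {w z : ℂ} (hw : w ≠ 0) (hz : z ≠ 0) :
    conj (blaschkeFactor q0 w (hatConj q0 z)) = (conj w / w) ^ 2 * blaschkeFactor q0 w z := by
  have hq : (q0 : ℂ) ≠ 0 := by exact_mod_cast hq0.ne'
  have hw' : conj w ≠ 0 := (map_ne_zero _).2 hw
  simp only [blaschkeFactor, hatConj, map_mul, map_div₀, map_sub, map_add, map_neg, map_pow,
    Complex.conj_conj, Complex.conj_ofReal]
  generalize conj w = v at hw'
  have e1 : -((q0 : ℂ) ^ 2 / z) - v = -(v / z) * (z + (q0 : ℂ) ^ 2 / v) := by field_simp; ring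
  have e2 : -((q0 : ℂ) ^ 2 / z) + (q0 : ℂ) ^ 2 / w = (q0 : ℂ) ^ 2 / (w * z) * (z - w) := by
    field_simp; ring
  have e3 : -((q0 : ℂ) ^ 2 / z) - w = -(w / z) * (z + (q0 : ℂ) ^ 2 / w) := by field_simp; ring
  have e4 : -((q0 : ℂ) ^ 2 / z) + (q0 : ℂ) ^ 2 / v = (q0 : ℂ) ^ 2 / (v * z) * (z - v) := by
    field_simp; ring
  have key : ∀ a b a' b' P Q P' Q' : ℂ, a * P * (b * Q) / (a' * P' * (b' * Q'))
      = a * b / (a' * b') * (Q * P / (Q' * P')) := fun a b a' b' P Q P' Q' => by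
    rw [mul_mul_mul_comm a, mul_mul_mul_comm a', mul_div_mul_comm, mul_comm P, mul_comm P']
  rw [e1, e2, e3, e4, key, mul_comm (z - v)]
  congr 1
  · field_simp

theorem outerLower_subset_union {q0 : ℝ} (hq0 : 0 < q0) :
    outerLower q0 ⊆ (DMinus q0 ∪ SigmaSet q0) \ {-(Complex.I * (q0 : ℂ))} := by
  intro z hz
  refine ⟨?_, hz.2.2⟩
  rcases (outerLower_subset hq0 hz).2.2.2.lt_or_eq with h | h
  · exact Or.inl h
  · right
    rcases mul_eq_zero.1 h with h1 | h1
    · right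
      have := sq_eq_sq_iff_eq_or_eq_neg.1 (sub_eq_zero.1 h1)
      rcases this with h2 | h2
      · exact h2
      · linarith [norm_nonneg z]
    · exact Or.inl h1

theorem mem_outerLowerInt_or {q0 : ℝ} {z : ℂ} (hq0 : 0 < q0) (hz : z ∈ outerLower q0) :
    z ∈ outerLowerInt q0 ∨ z ∈ SigmaReg q0 := by
  have h := outerLower_subset hq0 hz
  have hreg : z ∈ SigmaSet q0 → z ∈ SigmaReg q0 := fun h1 => ⟨h1, by
    simp only [Set.mem_insert_iff, Set.mem_singleton_iff, not_or]
    exact ⟨h.1, h.2.1, h.2.2.1⟩⟩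
  rcases hz.1.lt_or_eq with h1 | h1
  · rcases hz.2.1.lt_or_eq with h2 | h2
    · exact Or.inl ⟨h1, h2⟩
    · exact Or.inr (hreg (Or.inl h2))
  · exact Or.inr (hreg (Or.inr h1.symm))

section Trace

variable {ε q0 : ℝ} {q : ℝ → ℝ → ℂ} {qp qm : ℂ} {t : ℝ}

theorem Potential.outerFn_s11 (h : Potential q0 q qp qm t) (ε : ℝ)
    (hbranch : ∃ c > 0, ∀ᶠ z in 𝓝[(DMinus q0 ∪ SigmaSet q0) \ {-(Complex.I * (q0 : ℂ))}]
      (-(Complex.I * (q0 : ℂ))), c ≤ ‖s11 ε q0 q qp qm t z‖) :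
    OuterFn q0 (s11 ε q0 q qp qm t) := by
  have hq0 := h.pos
  refine ⟨hq0, h.continuousOn_s11 ε, h.differentiableOn_s11 ε, h.tendsto_s11_atInfty ε, ?_, ?_, ?_,
    fun z hz him => ?_⟩
  · obtain ⟨C, hC⟩ := h.norm_s11_mul_abs_re_le ε
    refine ⟨|C| * (q0 + 1), ?_⟩
    have h1 : ∀ᶠ z : ℂ in 𝓝 (-(Complex.I * (q0 : ℂ))), ‖z‖ < q0 + 1 := by
      refine continuous_norm.continuousAt.eventually_lt continuousAt_const ?_
      rw [norm_neg, norm_mul, Complex.norm_I, one_mul, Complex.norm_real, Real.norm_eq_abs,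
        abs_of_pos hq0]
      linarith
    filter_upwards [nhdsWithin_le_nhds h1, self_mem_nhdsWithin] with z h2 hz
    refine (hC z hz).trans ?_
    calc C * ‖z‖ ≤ |C| * ‖z‖ := by gcongr; exact le_abs_self C
      _ ≤ |C| * (q0 + 1) := by gcongr
  · obtain ⟨c, hc, hcl⟩ := hbranch
    exact ⟨c, hc, hcl.filter_mono (nhdsWithin_mono _ (outerLower_subset_union hq0))⟩
  · obtain ⟨C, hC⟩ := h.norm_s11_sub_one_le ε
    refine Asymptotics.IsBigO.of_bound C ?_
    filter_upwards [eventually_ge_atTop (2 * q0)] with Y hY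
    have hY0 : 0 < Y := by linarith
    rw [norm_inv, Real.norm_eq_abs, abs_of_pos hY0, ← div_eq_mul_inv]
    exact hC Y hY
  · rcases mem_outerLowerInt_or hq0 hz with h1 | h1
    · exact absurd him h1.2.ne
    · exact h.norm_s11_le_one ε h1 him

/-- The factorization of `s₁₁` into a Blaschke product and an exponential on the closure of `D⁻`.
The constant `e^{iκ}` by which the exponents in the two components of `D⁻` differ comes from the
symmetry `z ↦ -q₀²/z*`. -/
theorem Potential.exists_trace (h : Potential q0 q qp qm t) (ε : ℝ)
    (hreg : ∀ ζ ∈ SigmaReg q0, s11 ε q0 q qp qm t ζ ≠ 0)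
    (hbranch : ∃ c > 0, ∀ᶠ z in 𝓝[(DMinus q0 ∪ SigmaSet q0) \ {-(Complex.I * (q0 : ℂ))}]
      (-(Complex.I * (q0 : ℂ))), c ≤ ‖s11 ε q0 q qp qm t z‖)
    {N : ℕ} {zn : Fin N → ℂ} (hinj : Function.Injective zn)
    (hzn : ∀ n, (zn n).im < 0 ∧ q0 < ‖zn n‖)
    (hzeros : ∀ z : ℂ, z.im < 0 → q0 < ‖z‖ → (s11 ε q0 q qp qm t z = 0 ↔ ∃ n, z = zn n)) :
    ∃ (m : Fin N → ℕ) (f : ℂ → ℂ) (κ : ℝ), StripLog f ∧ Glues f κ ∧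
      (∀ z ∈ closedDMinus q0, s11 ε q0 q qp qm t z
        = (∏ n, blaschkeFactor q0 (zn n) z ^ m n) * Complex.exp (glueLog q0 f κ z)) ∧
      Complex.exp (Complex.I * κ) = qm / qp * ∏ n, (conj (zn n) / zn n) ^ (2 * m n) ∧
      ∀ n k, (∀ i < k, iteratedDeriv i (s11 ε q0 q qp qm t) (zn n) = 0) →
        iteratedDeriv k (s11 ε q0 q qp qm t) (zn n) ≠ 0 → m n = k := by
  have hq0 := h.pos
  have hq : (q0 : ℂ) ≠ 0 := by exact_mod_cast hq0.ne'
  have hqp : qp ≠ 0 := norm_pos_iff.1 (h.norm_qp ▸ hq0)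
  have hqm : qm ≠ 0 := norm_pos_iff.1 (h.norm_qm ▸ hq0)
  have ha := h.outerFn_s11 ε hbranch
  set a := s11 ε q0 q qp qm t with hadef
  have hs : ∀ w ∈ Finset.univ.map ⟨zn, hinj⟩, w ∈ outerLowerInt q0 := by
    intro w hw
    obtain ⟨n, _, rfl⟩ := Finset.mem_map.1 hw
    exact ⟨(hzn n).2, (hzn n).1⟩
  have hz : ∀ z ∈ outerLower q0, a z = 0 ↔ z ∈ Finset.univ.map ⟨zn, hinj⟩ := by
    intro z hz
    rcases mem_outerLowerInt_or hq0 hz with h1 | h1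
    · rw [hzeros z h1.2 h1.1]
      simp [eq_comm]
    · refine ⟨fun h2 => absurd h2 (hreg z h1), fun h2 => ?_⟩
      have h3 := hs z h2
      rcases h1.1 with h4 | h4
      · exact absurd h4 h3.2.ne
      · exact absurd h4 h3.1.ne'
  obtain ⟨m, g, hg, hg0, hfac⟩ := OuterFn.exists_factorization _ ha hs hz
  obtain ⟨f, hf, hfe⟩ := hg.exists_stripLog hg0
  have hmult : ∀ n k, (∀ i < k, iteratedDeriv i a (zn n) = 0) → iteratedDeriv k a (zn n) ≠ 0 →
      m (zn n) = k := fun n k h0 hk =>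
    eq_of_factorization hq0 hs hg.diff hg0 hfac (Finset.mem_map.2 ⟨n, Finset.mem_univ n, rfl⟩) h0 hk
  simp only [Finset.prod_map, Function.Embedding.coeFn_mk] at hfac
  set B : ℂ → ℂ := fun z => ∏ n, blaschkeFactor q0 (zn n) z ^ m (zn n) with hB
  set c : ℂ := qm / qp * ∏ n, (conj (zn n) / zn n) ^ (2 * m (zn n)) with hc
  have hzn0 : ∀ n, zn n ≠ 0 := fun n => ne_zero_of_le_norm hq0 (hzn n).2.le
  have hBhat : ∀ z, z ≠ 0 →
      conj (B (hatConj q0 z)) = (∏ n, (conj (zn n) / zn n) ^ (2 * m (zn n))) * B z := by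
    intro z hz
    simp only [hB, map_prod, map_pow, ← Finset.prod_mul_distrib]
    refine Finset.prod_congr rfl fun n _ => ?_
    rw [conj_blaschkeFactor_hatConj hq0 (hzn0 n) hz, mul_pow, ← pow_mul]
  have hconjq : conj (qp / qm) = qm / qp := by
    have h1 : conj qp * qp = (q0 : ℂ) ^ 2 := by rw [Complex.conj_mul', h.norm_qp]
    have h2 : conj qm * qm = (q0 : ℂ) ^ 2 := by rw [Complex.conj_mul', h.norm_qm]
    have h3 : conj qm ≠ 0 := (map_ne_zero _).2 hqm
    rw [map_div₀, div_eq_div_iff h3 hqp, h1, ← h2, mul_comm]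
  have hinner : ∀ z ∈ closedDMinus q0, hatConj q0 z ∈ outerLower q0 →
      a z = B z * (c * conj (g (hatConj q0 z))) := by
    intro z hz hzh
    have h1 := h.s11_hatConj ε hz
    have h2 : a z = conj (qp / qm * a (hatConj q0 z)) := by
      rw [hadef, h1, ← mul_assoc, div_mul_div_comm, mul_comm qm, div_self (mul_ne_zero hqp hqm),
        one_mul, Complex.conj_conj]
    rw [h2, map_mul, hconjq, hfac _ hzh, map_mul, hBhat z hz.1, hc]
    ring
  have hnormc : ‖c‖ = 1 := by
    rw [hc, norm_mul, norm_div, h.norm_qp, h.norm_qm, div_self hq0.ne', one_mul, norm_prod]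
    refine Finset.prod_eq_one fun n _ => ?_
    rw [norm_pow, norm_div, RCLike.norm_conj, div_self (norm_ne_zero_iff.2 (hzn0 n)), one_pow]
  -- at `z = q₀` both representations are available, and they determine `κ`
  have hq0mem : (q0 : ℂ) ∈ outerLower q0 := by
    simpa using expMap_mem hq0 zero_mem_strip
  have hq0mem' : -(q0 : ℂ) ∈ outerLower q0 := by
    have := expMap_mem hq0 neg_I_mul_pi_mem_strip
    rwa [Complex.exp_neg, mul_comm Complex.I, Complex.exp_pi_mul_I, inv_neg, inv_one, mul_neg,
      mul_one] at this
  have hhat : hatConj q0 q0 = -(q0 : ℂ) := by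
    simp only [hatConj, Complex.conj_ofReal]; field_simp
  have hq0reg : (q0 : ℂ) ∈ SigmaReg q0 := ofReal_mem_sigmaReg hq0.ne'
  have hg1 : g q0 = c * conj (g (-q0)) := by
    have h1 := hinner q0 (sigmaReg_subset q0 hq0reg) (by rwa [hhat])
    have h2 := hfac q0 hq0mem
    have h3 := hreg q0 hq0reg
    rw [h2] at h3
    rw [h2, hhat] at h1
    exact mul_left_cancel₀ (left_ne_zero_of_mul h3) h1
  have hf1 : Complex.exp (f 0) = g q0 := by
    rw [hfe 0 zero_mem_strip, Complex.exp_zero, mul_one]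
  have hf2 : Complex.exp (f (-(Complex.I * Real.pi))) = g (-q0) := by
    rw [hfe _ neg_I_mul_pi_mem_strip, Complex.exp_neg, mul_comm Complex.I, Complex.exp_pi_mul_I,
      inv_neg, inv_one, mul_neg, mul_one]
  set κ : ℝ := (f 0).im + (f (-(Complex.I * Real.pi))).im with hκd
  have hκ : Glues f κ := by
    have h1 := congrArg norm hg1
    rw [norm_mul, hnormc, one_mul, RCLike.norm_conj, ← hf1, ← hf2, Complex.norm_exp,
      Complex.norm_exp] at h1
    have h2 := Real.exp_injective h1
    refine Complex.ext ?_ ?_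
    · simpa using h2
    · simp [hκd]
  have hexpκ : Complex.exp (Complex.I * κ) = c := by
    have h1 := congrArg Complex.exp hκ
    rw [Complex.exp_add, Complex.exp_conj, hf1, hf2, hg1] at h1
    exact (mul_right_cancel₀ ((map_ne_zero _).2 (hg0 _ hq0mem')) h1).symm
  refine ⟨fun n => m (zn n), f, κ, hf, hκ, fun z hz => ?_, hexpκ, hmult⟩
  by_cases hzo : z ∈ outerLower q0
  · rw [hfac z hzo, glueLog, if_pos hzo, hfe _ (stripCoord_mem hq0 hzo), exp_stripCoord hq0 hzo]
  · have hzh : hatConj q0 z ∈ outerLower q0 :=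
      (mem_outerLower_or hq0 hz).elim (fun h => absurd h hzo) fun h => h.2.2
    rw [hinner z hz hzh, glueLog_of_hatConj_mem hq0 hκ hzh, Complex.exp_add, hexpκ,
      Complex.exp_conj, hfe _ (stripCoord_mem hq0 hzh), exp_stripCoord hq0 hzh]

/-- On `Σ` the Blaschke product drops out of `1 + ρ ρ*`. -/
theorem Potential.onePlusRho_eq_of_trace (h : Potential q0 q qp qm t)
    (hreg : ∀ ζ ∈ SigmaReg q0, s11 ε q0 q qp qm t ζ ≠ 0) {N : ℕ} {zn : Fin N → ℂ} {m : Fin N → ℕ}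
    {Ψ : ℂ → ℂ} (htr : ∀ z ∈ closedDMinus q0, s11 ε q0 q qp qm t z
      = (∏ n, blaschkeFactor q0 (zn n) z ^ m n) * Complex.exp (Ψ z)) {ζ : ℂ}
    (hζ : ζ ∈ SigmaReg q0) :
    onePlusRho ε q0 q qp qm t ζ = (Complex.exp (Ψ ζ) * conj (Complex.exp (Ψ (conj ζ))))⁻¹ := by
  have h1 := htr ζ (sigmaReg_subset q0 hζ)
  have h2 := htr (conj ζ) (sigmaReg_subset q0 (conj_mem_sigmaReg hζ))
  have h3 := hreg ζ hζ
  rw [h1] at h3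
  rw [h.onePlusRho_eq ε hreg hζ, h1, h2, map_mul, map_prod]
  simp only [map_pow, conj_blaschkeFactor, blaschkeFactor_inv, inv_pow, Finset.prod_inv_distrib]
  have h4 := left_ne_zero_of_mul h3
  congr 1
  rw [mul_mul_mul_comm, mul_inv_cancel₀ h4, one_mul]

end Trace

theorem prod_blaschkeFactor_pow (q0 : ℝ) {N : ℕ} (zn : Fin N → ℂ) (z : ℂ) (k : ℕ) :
    ∏ n, blaschkeFactor q0 (zn n) z ^ k = blaschke q0 zn z ^ k := by
  rw [Finset.prod_pow]
  rfl

theorem conj_blaschke (q0 : ℝ) {N : ℕ} (zn : Fin N → ℂ) (z : ℂ) :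
    conj (blaschke q0 zn (conj z)) = blaschke q0 (fun n => conj (zn n)) z := by
  simp [blaschke]

theorem angle_eq_of_exp_eq {a b : ℝ}
    (h : Complex.exp (Complex.I * a) = Complex.exp (Complex.I * b)) :
    (a : Real.Angle) = (b : Real.Angle) := by
  obtain ⟨n, hn⟩ := Complex.exp_eq_exp_iff_exists_int.1 h
  rw [Real.Angle.angle_eq_iff_two_pi_dvd_sub]
  refine ⟨n, ?_⟩
  have h1 : ((a - b : ℝ) : ℂ) = ((2 * Real.pi * n : ℝ) : ℂ) := by
    push_cast
    refine mul_left_cancel₀ Complex.I_ne_zero ?_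
    linear_combination hn
  exact_mod_cast h1

theorem exp_I_mul_arg {z : ℂ} (hz : z ≠ 0) : Complex.exp (Complex.I * Complex.arg z) = z / ‖z‖ := by
  have h := Complex.norm_mul_exp_arg_mul_I z
  have hn : (‖z‖ : ℂ) ≠ 0 := by exact_mod_cast norm_ne_zero_iff.2 hz
  rw [eq_div_iff hn, mul_comm Complex.I, mul_comm, h]

theorem conj_div_self_eq_exp {z : ℂ} (hz : z ≠ 0) :
    conj z / z = Complex.exp (-(2 * (Complex.I * Complex.arg z))) := by
  have hn : (‖z‖ : ℂ) ≠ 0 := by exact_mod_cast norm_ne_zero_iff.2 hz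
  rw [Complex.exp_neg, two_mul, Complex.exp_add, exp_I_mul_arg hz]
  field_simp
  linear_combination Complex.conj_mul' z

/-- The theta condition for zeros of the same multiplicity. -/
theorem arg_eq_of_exp_eq {qp qm : ℂ} (hqp : qp ≠ 0) (hn : ‖qm‖ = ‖qp‖) {N : ℕ} {zn : Fin N → ℂ}
    (hzn : ∀ n, zn n ≠ 0) {k : ℕ} {κ : ℝ}
    (hκ : Complex.exp (Complex.I * κ) = qm / qp * ∏ n, (conj (zn n) / zn n) ^ (2 * k)) :
    (Complex.arg (qm / qp) : Real.Angle)
      = ((κ + 4 * k * ∑ n, Complex.arg (zn n) : ℝ) : Real.Angle) := by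
  have hqm : qm ≠ 0 := norm_ne_zero_iff.1 (hn ▸ norm_ne_zero_iff.2 hqp)
  refine angle_eq_of_exp_eq ?_
  have h1 : ‖qm / qp‖ = 1 := by rw [norm_div, hn, div_self (norm_ne_zero_iff.2 hqp)]
  have h2 : ∏ n, (conj (zn n) / zn n) ^ (2 * k)
      = Complex.exp (-(Complex.I * (4 * k * ∑ n, Complex.arg (zn n) : ℝ))) := by
    have e : -(Complex.I * ((4 * k * ∑ n, Complex.arg (zn n) : ℝ) : ℂ))
        = ∑ n, ((2 * k : ℕ) : ℂ) * -(2 * (Complex.I * Complex.arg (zn n))) := by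
      push_cast
      rw [← Finset.mul_sum, Finset.sum_neg_distrib, ← Finset.mul_sum, ← Finset.mul_sum]
      ring
    rw [e, Complex.exp_sum]
    refine Finset.prod_congr rfl fun n _ => ?_
    rw [conj_div_self_eq_exp (hzn n), ← Complex.exp_nat_mul]
  rw [exp_I_mul_arg (div_ne_zero hqm hqp), h1, Complex.ofReal_one, div_one, Complex.ofReal_add,
    mul_add, Complex.exp_add, hκ, h2, mul_assoc, ← Complex.exp_add, neg_add_cancel,
    Complex.exp_zero, mul_one]

end IfoNLS

theorem mainTheorem7 (ε q0 : ℝ) (hq0 : 0 < q0) (q : ℝ → ℝ → ℂ) (qp qm : ℂ)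
    (hqp : ‖qp‖ = q0) (hqm : ‖qm‖ = q0) (t : ℝ)
    -- the potential at time `t`: continuous, with limits `q_±`, attained integrably
    (hcont : Continuous (fun x => q x t))
    (hlimp : Filter.Tendsto (fun x => q x t) Filter.atTop (nhds qp))
    (hlimm : Filter.Tendsto (fun x => q x t) Filter.atBot (nhds qm))
    (hdecp : MeasureTheory.IntegrableOn
      (fun x : ℝ => ((1 + |x| : ℝ) : ℂ) * (q x t - qp)) (Set.Ici 0))
    (hdecm : MeasureTheory.IntegrableOn
      (fun x : ℝ => ((1 + |x| : ℝ) : ℂ) * (q x t - qm)) (Set.Iic 0))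
    -- no spectral singularities on `Σ`, the branch points `± i q₀` included
    (hreg : ∀ ζ ∈ IfoNLS.SigmaReg q0, IfoNLS.s11 ε q0 q qp qm t ζ ≠ 0)
    (hbranch : ∀ b ∈ ({Complex.I * (q0 : ℂ), -(Complex.I * (q0 : ℂ))} : Set ℂ),
      ∃ c > 0, ∀ᶠ z in nhdsWithin b ((IfoNLS.DMinus q0 ∪ IfoNLS.SigmaSet q0) \ {b}),
        c ≤ ‖IfoNLS.s11 ε q0 q qp qm t z‖)
    -- the zeros of `s₁₁` in the part of `D⁻` in the open lower half-plane
    (N : ℕ) (zn : Fin N → ℂ) (hinj : Function.Injective zn)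
    (hzn : ∀ n, (zn n).im < 0 ∧ q0 < ‖zn n‖)
    (hzeros : ∀ z : ℂ, z.im < 0 → q0 < ‖z‖ →
      (IfoNLS.s11 ε q0 q qp qm t z = 0 ↔ ∃ n, z = zn n)) :
    (∃ L, IfoNLS.IsLogOnSigma q0 (IfoNLS.onePlusRho ε q0 q qp qm t) L) ∧
    ∀ L, IfoNLS.IsLogOnSigma q0 (IfoNLS.onePlusRho ε q0 q qp qm t) L →
      -- the integrals over `Σ` converge, and the second one is real
      (∀ z ∈ IfoNLS.DMinus q0 ∪ IfoNLS.DPlus q0,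
        IfoNLS.SigmaIntegrable q0 (fun ζ => L ζ / (ζ - z))) ∧
      IfoNLS.SigmaIntegrable q0 (fun ζ => L ζ / ζ) ∧
      (IfoNLS.sigmaIntegral q0 (fun ζ => L ζ / ζ)).im = 0 ∧
      -- simple zeros
      ((∀ n, deriv (IfoNLS.s11 ε q0 q qp qm t) (zn n) ≠ 0) →
        (∀ z ∈ IfoNLS.DMinus q0, IfoNLS.s11 ε q0 q qp qm t z =
          Complex.exp (1 / (2 * Real.pi * Complex.I)
            * IfoNLS.sigmaIntegral q0 (fun ζ => L ζ / (ζ - z)))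
            * IfoNLS.blaschke q0 zn z) ∧
        (∀ z ∈ IfoNLS.DPlus q0, IfoNLS.s22 ε q0 q qp qm t z =
          Complex.exp (-(1 / (2 * Real.pi * Complex.I)
            * IfoNLS.sigmaIntegral q0 (fun ζ => L ζ / (ζ - z))))
            * IfoNLS.blaschke q0 (fun n => starRingEnd ℂ (zn n)) z) ∧
        (Complex.arg (qm / qp) : Real.Angle) =
          ((-(1 / (2 * Real.pi)) * (IfoNLS.sigmaIntegral q0 (fun ζ => L ζ / ζ)).re
            + 4 * ∑ n, Complex.arg (zn n) : ℝ) : Real.Angle)) ∧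
      -- double zeros
      ((∀ n, deriv (IfoNLS.s11 ε q0 q qp qm t) (zn n) = 0 ∧
          deriv (deriv (IfoNLS.s11 ε q0 q qp qm t)) (zn n) ≠ 0) →
        (∀ z ∈ IfoNLS.DMinus q0, IfoNLS.s11 ε q0 q qp qm t z =
          Complex.exp (1 / (2 * Real.pi * Complex.I)
            * IfoNLS.sigmaIntegral q0 (fun ζ => L ζ / (ζ - z)))
            * IfoNLS.blaschke q0 zn z ^ 2) ∧
        (∀ z ∈ IfoNLS.DPlus q0, IfoNLS.s22 ε q0 q qp qm t z =
          Complex.exp (-(1 / (2 * Real.pi * Complex.I)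
            * IfoNLS.sigmaIntegral q0 (fun ζ => L ζ / (ζ - z))))
            * IfoNLS.blaschke q0 (fun n => starRingEnd ℂ (zn n)) z ^ 2) ∧
        (Complex.arg (qm / qp) : Real.Angle) =
          ((-(1 / (2 * Real.pi)) * (IfoNLS.sigmaIntegral q0 (fun ζ => L ζ / ζ)).re
            + 8 * ∑ n, Complex.arg (zn n) : ℝ) : Real.Angle)) := by
  have h : IfoNLS.Potential q0 q qp qm t :=
    ⟨hq0, hqp, hqm, hcont, hlimp, hlimm, hdecp, hdecm⟩
  have hqp0 : qp ≠ 0 := norm_pos_iff.1 (hqp ▸ hq0)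
  obtain ⟨m, f, κ, hf, hκ, htr, hexp, hm⟩ :=
    h.exists_trace ε hreg (hbranch _ (by simp)) hinj hzn hzeros
  have hL₀ : IfoNLS.IsLogOnSigma q0 (IfoNLS.onePlusRho ε q0 q qp qm t)
      (IfoNLS.jumpLog q0 f κ) :=
    IfoNLS.isLogOnSigma_jumpLog hq0 hf.cont hκ fun ζ hζ => h.onePlusRho_eq_of_trace hreg htr hζ
  refine ⟨⟨_, hL₀⟩, fun L hL => ?_⟩
  have heq := hL₀.eqOn hq0 hL
  have hdiv : ∀ v : ℂ, Set.EqOn (fun ζ => IfoNLS.jumpLog q0 f κ ζ / (ζ - v))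
      (fun ζ => L ζ / (ζ - v)) (IfoNLS.SigmaReg q0) := fun v ζ hζ => by
    simp only [heq hζ]
  have hdiv0 : Set.EqOn (fun ζ => IfoNLS.jumpLog q0 f κ ζ / ζ) (fun ζ => L ζ / ζ)
      (IfoNLS.SigmaReg q0) := fun ζ hζ => by simp only [heq hζ]
  have hi0 := hf.sigmaIntegrable_jumpLog_div hq0 hκ
  have hoff : ∀ z ∈ IfoNLS.DMinus q0 ∪ IfoNLS.DPlus q0, z.im ≠ 0 ∧ ‖z‖ ≠ q0 := by
    intro z hz
    have hne : (‖z‖ ^ 2 - q0 ^ 2) * z.im ≠ 0 := hz.elim (fun h => ne_of_lt h) fun h => ne_of_gt h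
    exact ⟨right_ne_zero_of_mul hne, fun e => left_ne_zero_of_mul hne (by rw [e, sub_self])⟩
  have hi : ∀ z ∈ IfoNLS.DMinus q0 ∪ IfoNLS.DPlus q0,
      IfoNLS.SigmaIntegrable q0 fun ζ => IfoNLS.jumpLog q0 f κ ζ / (ζ - z) := fun z hz =>
    hi0.cauchy hq0 (hoff z hz).1 (hoff z hz).2
  have hpi : (2 * Real.pi * Complex.I : ℂ) ≠ 0 := by
    simp [Real.pi_ne_zero]
  have hminus : ∀ z ∈ IfoNLS.DMinus q0, 1 / (2 * Real.pi * Complex.I)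
      * IfoNLS.sigmaIntegral q0 (fun ζ => L ζ / (ζ - z)) = IfoNLS.glueLog q0 f κ z := by
    intro z hz
    rw [← IfoNLS.sigmaIntegral_congr hq0 (hdiv z),
      hf.sigmaIntegral_dMinus hq0 hκ hz (hi z (Or.inl hz)), one_div, inv_mul_cancel_left₀ hpi]
  have hplus : ∀ z ∈ IfoNLS.DPlus q0, -(1 / (2 * Real.pi * Complex.I)
      * IfoNLS.sigmaIntegral q0 (fun ζ => L ζ / (ζ - z)))
        = conj (IfoNLS.glueLog q0 f κ (conj z)) := by
    intro z hz
    rw [← IfoNLS.sigmaIntegral_congr hq0 (hdiv z),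
      hf.sigmaIntegral_dPlus hq0 hκ hz (hi z (Or.inr hz)), one_div, mul_neg, neg_neg,
      inv_mul_cancel_left₀ hpi]
  have hzero : IfoNLS.sigmaIntegral q0 (fun ζ => L ζ / ζ) = ((-(2 * Real.pi * κ) : ℝ) : ℂ) := by
    rw [← IfoNLS.sigmaIntegral_congr hq0 hdiv0, hf.sigmaIntegral_zero hq0 hκ]
  have hκint : κ = -(1 / (2 * Real.pi)) * (IfoNLS.sigmaIntegral q0 (fun ζ => L ζ / ζ)).re := by
    rw [hzero, Complex.ofReal_re]
    field_simp
  -- the three formulas for zeros of a common multiplicity `k`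
  have main : ∀ k : ℕ, (∀ n, m n = k) →
      (∀ z ∈ IfoNLS.DMinus q0, IfoNLS.s11 ε q0 q qp qm t z =
        Complex.exp (1 / (2 * Real.pi * Complex.I)
          * IfoNLS.sigmaIntegral q0 (fun ζ => L ζ / (ζ - z))) * IfoNLS.blaschke q0 zn z ^ k) ∧
      (∀ z ∈ IfoNLS.DPlus q0, IfoNLS.s22 ε q0 q qp qm t z =
        Complex.exp (-(1 / (2 * Real.pi * Complex.I)
          * IfoNLS.sigmaIntegral q0 (fun ζ => L ζ / (ζ - z))))
          * IfoNLS.blaschke q0 (fun n => starRingEnd ℂ (zn n)) z ^ k) ∧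
      (Complex.arg (qm / qp) : Real.Angle) =
        ((-(1 / (2 * Real.pi)) * (IfoNLS.sigmaIntegral q0 (fun ζ => L ζ / ζ)).re
          + 4 * k * ∑ n, Complex.arg (zn n) : ℝ) : Real.Angle) := by
    intro k hk
    have htr' : ∀ z ∈ IfoNLS.DMinus q0, IfoNLS.s11 ε q0 q qp qm t z
        = Complex.exp (IfoNLS.glueLog q0 f κ z) * IfoNLS.blaschke q0 zn z ^ k := fun z hz => by
      rw [htr z (IfoNLS.dMinus_subset hz), mul_comm]
      simp only [hk, IfoNLS.prod_blaschkeFactor_pow]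
    refine ⟨fun z hz => ?_, fun z hz => ?_, ?_⟩
    · rw [hminus z hz, htr' z hz]
    · have hz' := IfoNLS.conj_mem_dMinus hz
      have h22 := h.s22_conj ε (IfoNLS.dMinus_subset hz')
      rw [Complex.conj_conj] at h22
      rw [hplus z hz, h22, htr' _ hz', map_mul, map_pow, IfoNLS.conj_blaschke,
        ← Complex.exp_conj]
    · rw [← hκint]
      refine IfoNLS.arg_eq_of_exp_eq hqp0 (hqm.trans hqp.symm) (fun n e => ?_)
        (by simpa only [hk] using hexp)
      have := (hzn n).1
      rw [e] at this
      exact lt_irrefl _ this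
  refine ⟨fun z hz => (hi z hz).congr hq0 (hdiv z), hi0.congr hq0 hdiv0, ?_, fun hs => ?_,
    fun hd => ?_⟩
  · rw [hzero, Complex.ofReal_im]
  · have hk : ∀ n, m n = 1 := fun n => hm n 1
      (fun i hi1 => by
        rw [Nat.lt_one_iff.1 hi1, iteratedDeriv_zero]
        exact (hzeros _ (hzn n).1 (hzn n).2).2 ⟨n, rfl⟩)
      (by rw [iteratedDeriv_one]; exact hs n)
    have := main 1 hk
    simp only [pow_one, Nat.cast_one, mul_one] at this
    exact this
  · have hk : ∀ n, m n = 2 := fun n => hm n 2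
      (fun i hi2 => by
        have hi2' : i = 0 ∨ i = 1 := by omega
        rcases hi2' with rfl | rfl
        · rw [iteratedDeriv_zero]
          exact (hzeros _ (hzn n).1 (hzn n).2).2 ⟨n, rfl⟩
        · rw [iteratedDeriv_one]
          exact (hd n).1)
      (by rw [iteratedDeriv_succ, iteratedDeriv_one]; exact (hd n).2)
    have := main 2 hk
    norm_num at this ⊢
    exact this
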